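/- Let $\Bbbk$ be a field of characteristic $0$, complete for a non-trivial non-archimedean absolute value whose restriction to $\mathbb Q$ is trivial. Let $B$ be an admissible open neighbourhood of $b=0$ in the $\Bbbk$-analytic affine space $\mathbb A^{n}$ with coordinates $t=(t_1,\dots,t_n)$, and let $\mathbb D_u$ be the germ at $0$ of the closed unit disc with coordinate $u$ (so an object over $B\times\mathbb D_u$ lives on some admissible open neighbourhood of $B\times\{0\}$ in $B\times\{|u|\le 1\}$, and equality over $B\times\mathbb D_u$ means equality on such a neighbourhood). An F-bundle $(\mathcal H,\nabla)$ over $B$ is a vector bundle $\mathcal H$ on $B\times\mathbb D_u$ with a meromorphic flat connection $\nabla$ with poles along $u=0$ such that $\nabla_{u^2\partial_u}$ and $\nabla_{u\partial_{t_j}}$ ($1\le j\le n$) are regular. A framing of it over an admissible open $U\subseteq B$ is a flat connection $\nabla^{\mathrm{fr}}$ without poles on $\mathcal H|_{U\times\mathbb D_u}$ such that, around each point of $U$, there are $\nabla^{\mathrm{fr}}$-flat frames of $\mathcal H$ in which $$\nabla_{\partial_u}=\partial_u+u^{-2}\mathbf K(t)+u^{-1}\mathbf G(t),\qquad \nabla_{\partial_{t_j}}=\partial_{t_j}+u^{-1}\mathbf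 A_j(t)\quad(1\le j\le n),$$ where $\mathbf K,\mathbf G,\mathbf A_j$ are matrices of analytic functions of $t$ alone. A framing at $b$ is a framing of the F-bundle $(\mathcal H,\nabla)|_{b}$ over the point $b$. Theorem. Let $(\mathcal H,\nabla)$ be an F-bundle over $B$ and let $\nabla^{\mathrm{fr}}_b$ be a framing of $(\mathcal H,\nabla)$ at $b$. Then there are an admissible open neighbourhood $U\subseteq B$ of $b$ and a framing $\nabla^{\mathrm{fr}}$ of $(\mathcal H,\nabla)$ over $U$ with $\nabla^{\mathrm{fr}}|_{b\times\mathbb D_u}=\nabla^{\mathrm{fr}}_b$, such that the following hold. 1. (Uniqueness.) Every framing over $U$ which restricts to $\nabla^{\mathrm{fr}}_b$ is equal to $\nabla^{\mathrm{fr}}$. Moreover, if $V\subseteq B$ is any admissible open neighbourhood of $b$, every framing over $V$ which restricts to $\nabla^{\mathrm{fr}}_b$ agrees with $\nabla^{\mathrm{fr}}$ over some admissible open neighbourhood of $b$ in $U\cap V$. 2. (Explicit form.) Let $F$ be a local frame of $\mathcal H$ near $(b,0)$ whose restriction to $b\times\mathbb D_u$ is $\nabla^{\mathrm{fr}}_b$-flat,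 and write $\nabla_{\partial_{t_j}}=\partial_{t_j}+u^{-1}T^j$ in the frame $F$, with $T^j=\sum_{\ell\in\mathbb N^n,\,k\ge 0}T^j_{\ell,k}t^\ell u^k$ near $(b,0)$. Define matrices $P_{\ell,k}$ and $M^j_\ell$ over $\Bbbk$ by $P_{0,k}=\delta_{k,0}\,\mathrm{id}$, $$\sum_{\ell'+\ell''=\ell}P_{\ell',0}M^j_{\ell''}=\sum_{\ell'+\ell''=\ell}T^j_{\ell',0}P_{\ell'',0},$$ $$(\ell_j+1)P_{\ell+e_j,k}=-\sum_{\substack{\ell'+\ell''=\ell\\ k'+k''=k+1}}T^j_{\ell',k'}P_{\ell'',k''}+\sum_{\ell'+\ell''=\ell}P_{\ell',k+1}M^j_{\ell''}$$ for all $1\le j\le n$, $\ell\in\mathbb N^n$, $k\ge0$. These equations have a solution, which is unique by induction on $|\ell|$; the series $P(t,u)=\sum_{\ell,k}P_{\ell,k}t^\ell u^k$ converges on some polydisc around $(b,0)$, and there $P$ is invertible and $FP$ is a $\nabla^{\mathrm{fr}}$-flat frame. -/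

import Mathlib

/-!
Rigid analytic geometry inside affine spaces over a complete non-archimedean field `k`.

`L` is an algebraic closure of `k` with the norm that extends the one of `k`.  The closed points of
the affine space `A^σ` are the Galois orbits in `σ → L`; subsets and functions below live on
`σ → L`, and those which are built from polynomials over `k` are automatically compatible with the
Galois action.
-/

namespace RigidAn

universe w

/-! ### Rational subsets, analytic functions, admissible opens -/

section Geometry

variable (k : Type*) [NontriviallyNormedField k]
variable {L : Type*} [NontriviallyNormedField L] [NormedAlgebra k L]

/-- The closed polydisc `‖xᵢ‖ ≤ ‖c‖`. -/
def polydisc {σ : Type*} (c : k) : Set (σ → L) := {x | ∀ i, ‖x i‖ ≤ ‖c‖}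

/-- `R` is a rational subdomain of a closed polydisc of `A^σ`: it is cut out of a polydisc of radius
`‖c‖`, `c ≠ 0`, by the inequalities `|f| ≤ |f₀|`, where `f` runs through a finite set of
polynomials together with a nonzero constant `δ` (so that these functions generate the unit ideal;
every rational subdomain can be written in this way, since `|f₀|` is bounded below on it). -/
def IsRational {σ : Type*} (R : Set (σ → L)) : Prop :=
  ∃ (c δ : k) (f₀ : MvPolynomial σ k) (F : Finset (MvPolynomial σ k)), c ≠ 0 ∧ δ ≠ 0 ∧
    R = {x | x ∈ polydisc k c ∧ ‖δ‖ ≤ ‖MvPolynomial.aeval x f₀‖ ∧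
      ∀ f ∈ F, ‖MvPolynomial.aeval x f‖ ≤ ‖MvPolynomial.aeval x f₀‖}

/-- `f` is a uniform limit on `R` of rational functions over `k` without poles on `R`.  For a rational
subdomain `R` these functions form the affinoid algebra of `R`. -/
def IsUniformLimit {σ : Type*} (R : Set (σ → L)) (f : (σ → L) → L) : Prop :=
  ∀ ε : ℝ, 0 < ε → ∃ p q : MvPolynomial σ k, ∀ x ∈ R, MvPolynomial.aeval x q ≠ 0 ∧
    ‖f x - MvPolynomial.aeval x p / MvPolynomial.aeval x q‖ ≤ ε

/-- `f` is a (rigid) analytic function on the admissible open subset `S`: its restriction to each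
rational subdomain contained in `S` belongs to the affinoid algebra of that subdomain. The values
of `f` outside `S` are irrelevant. -/
def IsAnalytic {σ : Type*} (S : Set (σ → L)) (f : (σ → L) → L) : Prop :=
  ∀ R : Set (σ → L), IsRational k R → R ⊆ S → IsUniformLimit k R f

/-- Matrices of analytic functions. -/
def IsAnalyticMat {σ m n : Type*} (S : Set (σ → L)) (f : (σ → L) → Matrix m n L) : Prop :=
  ∀ a b, IsAnalytic k S (fun x => f x a b)

/-- `R` is an admissible covering of `W` by rational subdomains.  The last clause runs through all
morphisms from affinoid spaces to `A^σ` with image in `W`; the affinoid space is the zero set of a set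
`I` of analytic functions on the closed unit polydisc of dimension `m`.  Its pulled back covering has
a finite refinement by affinoid subdomains if and only if the image is covered by finitely many of the
`R i`. -/
structure IsAdmissibleCover {σ ι : Type*} (W : Set (σ → L)) (R : ι → Set (σ → L)) : Prop where
  rational : ∀ i, IsRational k (R i)
  iUnion_eq : ⋃ i, R i = W
  finite : ∀ (m : ℕ) (I : Set ((Fin m → L) → L)) (φ : σ → (Fin m → L) → L),
    (∀ g ∈ I, IsAnalytic k (polydisc k 1) g) → (∀ i, IsAnalytic k (polydisc k 1) (φ i)) →
    (∀ z ∈ polydisc k 1, (∀ g ∈ I, g z = 0) → (fun i => φ i z) ∈ W) →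
    ∃ s : Finset ι, ∀ z ∈ polydisc k 1, (∀ g ∈ I, g z = 0) → ∃ j ∈ s, (fun i => φ i z) ∈ R j

/-- Admissible open subsets of the analytic affine space `A^σ`. -/
def IsAdmissibleOpen {σ : Type*} (W : Set (σ → L)) : Prop :=
  ∃ 𝒞 : Set (Set (σ → L)), IsAdmissibleCover k W (fun R : 𝒞 => (R : Set (σ → L)))

/-- Partial derivative in the direction `c` (entrywise). Analytic functions have all partial
derivatives at the points of their domain. -/
noncomputable def partialD {σ m n : Type*} [DecidableEq σ] (c : σ)
    (f : (σ → L) → Matrix m n L) (x : σ → L) : Matrix m n L :=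
  Matrix.of fun a b => deriv (fun s => f (Function.update x c s) a b) (x c)

/-- The `(c, d)` component of the curvature of `d + ∑ Ω_c dx_c`. -/
noncomputable def curvature {σ m : Type*} [DecidableEq σ] [Fintype m]
    (Ω : σ → (σ → L) → Matrix m m L) (c d : σ) (x : σ → L) : Matrix m m L :=
  partialD c (Ω d) x - partialD d (Ω c) x + (Ω c x * Ω d x - Ω d x * Ω c x)

/-! ### Vector bundles, F-bundles and framings -/

/-- A vector bundle on the admissible open `W`, given by an admissible covering and transition
matrices: `g i j` sends coordinates in the `j`-th frame to coordinates in the `i`-th frame. -/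
structure VectorBundle {σ : Type*} (W : Set (σ → L)) where
  ι : Type w
  chart : ι → Set (σ → L)
  cover : IsAdmissibleCover k W chart
  rank : ι → ℕ
  g : ∀ i j, (σ → L) → Matrix (Fin (rank i)) (Fin (rank j)) L
  analytic_g : ∀ i j, IsAnalyticMat k (chart i ∩ chart j) (g i j)
  g_self : ∀ i, ∀ x ∈ chart i, g i i x = 1
  g_mul : ∀ i j l, ∀ x ∈ chart i ∩ chart j ∩ chart l, g i j x * g j l x = g i l x

/-- Coordinates on `B × 𝔻_u`: `some i` is the `i`-th coordinate of the base, `none` is `u`.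
This is the point `(t, u)`. -/
def point {σ : Type*} (t : σ → L) (u : L) : Option σ → L := fun c => c.elim u t

/-- The projection `(t, u) ↦ t`. -/
def base {σ : Type*} (y : Option σ → L) : σ → L := fun i => y (some i)

/-- `u² ` in the direction `∂_u` and `u` in the direction `∂_{t_i}`. -/
def weight {σ : Type*} (c : Option σ) (y : Option σ → L) : L :=
  c.elim (y none ^ 2) (fun _ => y none)

/-- `N` is an admissible open neighbourhood of `U × {0}` in `U × (closed unit disc)`, i.e. it
represents `U × 𝔻_u`, where `𝔻_u` is the germ at `0` of the closed unit disc. -/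
structure IsGermNhd {σ : Type*} (U : Set (σ → L)) (N : Set (Option σ → L)) : Prop where
  admissible : IsAdmissibleOpen k N
  zero_mem : ∀ t ∈ U, point t 0 ∈ N
  subset : ∀ y ∈ N, base y ∈ U ∧ ‖y none‖ ≤ 1

/-- An F-bundle over `B`: a vector bundle over `B × 𝔻_u` with a meromorphic flat connection `∇` with
poles along `u = 0` such that `∇_{u²∂_u}` and `∇_{u∂_{t_j}}` are regular.  In the `i`-th frame
`∇_{u²∂_u} = u²∂_u + A i none` and `∇_{u∂_{t_j}} = u∂_{t_j} + A i (some j)`. -/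
structure FBundle {σ : Type*} [DecidableEq σ] (B : Set (σ → L)) where
  dom : Set (Option σ → L)
  isGermNhd : IsGermNhd k B dom
  bundle : VectorBundle.{w} k dom
  A : ∀ i, Option σ → (Option σ → L) →
    Matrix (Fin (bundle.rank i)) (Fin (bundle.rank i)) L
  analytic_A : ∀ i c, IsAnalyticMat k (bundle.chart i) (A i c)
  gauge : ∀ i j c, ∀ y ∈ bundle.chart i ∩ bundle.chart j,
    bundle.g i j y * A j c y = A i c y * bundle.g i j y + weight c y • partialD c (bundle.g i j) y
  flat : ∀ i c d, ∀ y ∈ bundle.chart i, y none ≠ 0 →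
    curvature (fun e z => (weight e z)⁻¹ • A i e z) c d y = 0

/-- A framing over `U ⊆ B` of an F-bundle over `B`: a flat connection without poles, equal to
`∇^fr_{∂_c} = ∂_c + Γ i c` in the `i`-th frame, such that around each point of `U` there are flat
frames in which `∇_{∂_u} = ∂_u + u⁻² K(t) + u⁻¹ G(t)` and `∇_{∂_{t_j}} = ∂_{t_j} + u⁻¹ a_j(t)`. -/
structure Framing {σ : Type*} [DecidableEq σ] {B : Set (σ → L)} (E : FBundle k B)
    (U : Set (σ → L)) where
  dom : Set (Option σ → L)
  isGermNhd : IsGermNhd k U dom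
  subset : dom ⊆ E.dom
  Γ : ∀ i, Option σ → (Option σ → L) →
    Matrix (Fin (E.bundle.rank i)) (Fin (E.bundle.rank i)) L
  analytic_Γ : ∀ i c, IsAnalyticMat k (E.bundle.chart i ∩ dom) (Γ i c)
  gauge : ∀ i j c, ∀ y ∈ E.bundle.chart i ∩ E.bundle.chart j ∩ dom,
    E.bundle.g i j y * Γ j c y = Γ i c y * E.bundle.g i j y + partialD c (E.bundle.g i j) y
  flat : ∀ i c d, ∀ y ∈ E.bundle.chart i ∩ dom, curvature (Γ i) c d y = 0
  framed : ∀ x ∈ U, ∃ (i : E.bundle.ι) (V : Set (σ → L)) (S : Set (Option σ → L))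
    (P : (Option σ → L) → Matrix (Fin (E.bundle.rank i)) (Fin (E.bundle.rank i)) L)
    (K G : (σ → L) → Matrix (Fin (E.bundle.rank i)) (Fin (E.bundle.rank i)) L)
    (a : σ → (σ → L) → Matrix (Fin (E.bundle.rank i)) (Fin (E.bundle.rank i)) L),
    IsAdmissibleOpen k V ∧ x ∈ V ∧ V ⊆ U ∧
    IsGermNhd k V S ∧ S ⊆ E.bundle.chart i ∩ dom ∧
    IsAnalyticMat k S P ∧ IsAnalyticMat k V K ∧ IsAnalyticMat k V G ∧
    (∀ j, IsAnalyticMat k V (a j)) ∧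
    ∀ y ∈ S, (P y).det ≠ 0 ∧
      (∀ c, partialD c P y + Γ i c y * P y = 0) ∧
      E.A i none y * P y + weight none y • partialD none P y
        = P y * (K (base y) + y none • G (base y)) ∧
      ∀ j, E.A i (some j) y * P y + weight (some j) y • partialD (some j) P y
        = P y * a j (base y)

/-- Two framings, over `U₁` and `U₂`, coincide over `U`, i.e. on `U × 𝔻_u`. -/
def Framing.AgreeOn {k} [NontriviallyNormedField k] [NormedAlgebra k L]
    {σ : Type*} [DecidableEq σ] {B : Set (σ → L)} {E : FBundle k B}
    {U₁ U₂ : Set (σ → L)} (Φ₁ : Framing k E U₁) (Φ₂ : Framing k E U₂) (U : Set (σ → L)) : Prop :=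
  ∃ N : Set (Option σ → L), IsGermNhd k U N ∧ N ⊆ Φ₁.dom ∩ Φ₂.dom ∧
    ∀ i c, ∀ y ∈ N ∩ E.bundle.chart i, Φ₁.Γ i c y = Φ₂.Γ i c y

end Geometry

/-! ### Restriction to the origin -/

section Restriction

variable {k : Type*} [NontriviallyNormedField k]
variable {L : Type*} [NontriviallyNormedField L] [NormedAlgebra k L]
variable {σ : Type*}

/-- The inclusion of `b × 𝔻_u` in `B × 𝔻_u` for `b = 0`, where the point `b` is identified with the
affine space of dimension `0`. -/
def axis (σ : Type*) (y : Option (Fin 0) → L) : Option σ → L := point 0 (y none)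

/-- Restriction of polynomials to the `u`-axis. -/
noncomputable def axisPoly (σ k : Type*) [NontriviallyNormedField k] :
    MvPolynomial (Option σ) k →ₐ[k] MvPolynomial (Option (Fin 0)) k :=
  MvPolynomial.aeval (fun c : Option σ => c.elim (MvPolynomial.X none) (fun _ => 0))

theorem aeval_axisPoly (y : Option (Fin 0) → L) (p : MvPolynomial (Option σ) k) :
    MvPolynomial.aeval y (axisPoly σ k p) = MvPolynomial.aeval (axis σ y) p := by
  rw [axisPoly, ← AlgHom.comp_apply, MvPolynomial.comp_aeval]
  congr 2
  funext c
  cases c <;> simp [axis, point]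

theorem IsRational.preimage_axis {R : Set (Option σ → L)} (h : IsRational k R) :
    IsRational k (axis σ ⁻¹' R) := by
  classical
  obtain ⟨c, δ, f₀, F, hc, hδ, rfl⟩ := h
  refine ⟨c, δ, axisPoly σ k f₀, F.image (axisPoly σ k), hc, hδ, ?_⟩
  ext y
  have hb : axis σ y ∈ polydisc k c ↔ y ∈ polydisc k c := by
    constructor
    · intro h i
      have := h none
      match i with
      | none => simpa [axis, point] using this
    · intro h i
      cases i with
      | none => simpa [axis, point] using h none
      | some i => simp [axis, point]
  simp only [Set.mem_preimage, Set.mem_ofPred_eq, hb, aeval_axisPoly, Finset.mem_image,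
    forall_exists_index, and_imp, forall_apply_eq_imp_iff₂]

theorem IsRational.inter {σ : Type*} {R R' : Set (σ → L)} (h : IsRational k R)
    (h' : IsRational k R') : IsRational k (R ∩ R') := by
  classical
  wlog hcc : ∃ (c δ c' δ' : k) (f₀ g₀ : MvPolynomial σ k) (F G : Finset (MvPolynomial σ k)),
      c ≠ 0 ∧ δ ≠ 0 ∧ c' ≠ 0 ∧ δ' ≠ 0 ∧ ‖c‖ ≤ ‖c'‖ ∧
      R = {x | x ∈ polydisc k c ∧ ‖δ‖ ≤ ‖MvPolynomial.aeval x f₀‖ ∧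
        ∀ f ∈ F, ‖MvPolynomial.aeval x f‖ ≤ ‖MvPolynomial.aeval x f₀‖} ∧
      R' = {x | x ∈ polydisc k c' ∧ ‖δ'‖ ≤ ‖MvPolynomial.aeval x g₀‖ ∧
        ∀ f ∈ G, ‖MvPolynomial.aeval x f‖ ≤ ‖MvPolynomial.aeval x g₀‖}
  · rw [Set.inter_comm]
    refine this h' h ?_
    obtain ⟨c, δ, f₀, F, hc, hδ, e⟩ := h
    obtain ⟨c', δ', g₀, G, hc', hδ', e'⟩ := h'
    rcases le_total ‖c‖ ‖c'‖ with hle | hle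
    · exact absurd ⟨c, δ, c', δ', f₀, g₀, F, G, hc, hδ, hc', hδ', hle, e, e'⟩ hcc
    · exact ⟨c', δ', c, δ, g₀, f₀, G, F, hc', hδ', hc, hδ, hle, e', e⟩
  obtain ⟨c, δ, c', δ', f₀, g₀, F, G, hc, hδ, hc', hδ', hle, rfl, rfl⟩ := hcc
  refine ⟨c, δ * δ', f₀ * g₀, (insert (MvPolynomial.C δ) F).image (· * g₀) ∪
    (insert (MvPolynomial.C δ') G).image (f₀ * ·), hc, mul_ne_zero hδ hδ', ?_⟩
  ext x
  simp only [Set.mem_inter_iff, Set.mem_ofPred_eq, Finset.mem_union, Finset.mem_image, Finset.mem_insert,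
    map_mul, norm_mul]
  constructor
  · rintro ⟨⟨h1, h2, h3⟩, -, h5, h6⟩
    refine ⟨h1, by gcongr, ?_⟩
    rintro _ (⟨f, rfl | hf, rfl⟩ | ⟨f, rfl | hf, rfl⟩)
    · simp only [map_mul, norm_mul, MvPolynomial.algHom_C, norm_algebraMap']
      gcongr
    · simp only [map_mul, norm_mul]
      gcongr
      exact h3 f hf
    · simp only [map_mul, norm_mul, MvPolynomial.algHom_C, norm_algebraMap']
      gcongr
    · simp only [map_mul, norm_mul]
      gcongr
      exact h6 f hf
  · rintro ⟨h1, h2, h3⟩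
    have hpos : 0 < ‖MvPolynomial.aeval x f₀‖ * ‖MvPolynomial.aeval x g₀‖ :=
      lt_of_lt_of_le (mul_pos (norm_pos_iff.2 hδ) (norm_pos_iff.2 hδ')) h2
    have hf0 : 0 < ‖MvPolynomial.aeval x f₀‖ := by
      by_contra hneg
      rw [le_antisymm (not_lt.1 hneg) (norm_nonneg _)] at hpos
      simp at hpos
    have hg0 : 0 < ‖MvPolynomial.aeval x g₀‖ := by
      by_contra hneg
      rw [le_antisymm (not_lt.1 hneg) (norm_nonneg _)] at hpos
      simp at hpos
    have hF : ∀ f, (f = MvPolynomial.C δ ∨ f ∈ F) →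
        ‖MvPolynomial.aeval x f‖ ≤ ‖MvPolynomial.aeval x f₀‖ := by
      intro f hf
      have := h3 _ (Or.inl ⟨f, hf, rfl⟩)
      simp only [map_mul, norm_mul] at this
      exact le_of_mul_le_mul_right this hg0
    have hG : ∀ f, (f = MvPolynomial.C δ' ∨ f ∈ G) →
        ‖MvPolynomial.aeval x f‖ ≤ ‖MvPolynomial.aeval x g₀‖ := by
      intro f hf
      have := h3 _ (Or.inr ⟨f, hf, rfl⟩)
      simp only [map_mul, norm_mul] at this
      exact le_of_mul_le_mul_left this hf0
    refine ⟨⟨h1, ?_, fun f hf => hF f (Or.inr hf)⟩, fun i => (h1 i).trans hle, ?_,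
      fun f hf => hG f (Or.inr hf)⟩
    · simpa using hF _ (Or.inl rfl)
    · simpa using hG _ (Or.inl rfl)

theorem IsAnalytic.preimage_axis {R : Set (Option σ → L)} (hR : IsRational k R)
    {f : (Option σ → L) → L} (h : IsAnalytic k R f) :
    IsAnalytic k (axis σ ⁻¹' R) (fun y => f (axis σ y)) := by
  intro R' _ hsub ε hε
  obtain ⟨p, q, hpq⟩ := h R hR subset_rfl ε hε
  refine ⟨axisPoly σ k p, axisPoly σ k q, fun y hy => ?_⟩
  rw [aeval_axisPoly, aeval_axisPoly]
  exact hpq _ (hsub hy)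

theorem IsAdmissibleCover.preimage_axis {ι : Type*} {W : Set (Option σ → L)} {R : ι → Set (Option σ → L)}
    (h : IsAdmissibleCover k W R) :
    IsAdmissibleCover k (axis σ ⁻¹' W) (fun i => axis σ ⁻¹' R i) where
  rational i := (h.rational i).preimage_axis
  iUnion_eq := by rw [← Set.preimage_iUnion, h.iUnion_eq]
  finite := by
    intro m I φ hI hφ hW
    have key : ∀ z, (fun c : Option σ => (c.elim (φ none) (fun _ _ => 0) : (Fin m → L) → L) z)
        = axis σ (fun i => φ i z) := by
      intro z
      funext c
      cases c <;> rfl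
    obtain ⟨s, hs⟩ := h.finite m I (fun c => c.elim (φ none) (fun _ _ => 0)) hI
      (by
        intro c
        cases c with
        | none => exact hφ none
        | some c =>
          intro R _ _ ε hε
          exact ⟨0, 1, fun x _ => by simp [hε.le]⟩)
      (by
        intro z hz hz'
        rw [key]
        exact hW z hz hz')
    refine ⟨s, fun z hz hz' => ?_⟩
    obtain ⟨j, hj, hjz⟩ := hs z hz hz'
    rw [key] at hjz
    exact ⟨j, hj, hjz⟩

theorem IsAdmissibleOpen.preimage_axis {W : Set (Option σ → L)} (h : IsAdmissibleOpen k W) :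
    IsAdmissibleOpen k (axis σ ⁻¹' W) := by
  obtain ⟨𝒞, h𝒞⟩ := h
  have h' := h𝒞.preimage_axis
  refine ⟨(fun R : Set (Option σ → L) => axis σ ⁻¹' R) '' 𝒞, ?_, ?_, ?_⟩
  · rintro ⟨_, R, hR, rfl⟩
    exact h'.rational ⟨R, hR⟩
  · rw [← h'.iUnion_eq]
    ext y
    simp
  · intro m I φ hI hφ hW
    classical
    obtain ⟨s, hs⟩ := h'.finite m I φ hI hφ hW
    refine ⟨s.image (fun R : 𝒞 => ⟨axis σ ⁻¹' (R : Set (Option σ → L)), R, R.2, rfl⟩),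
      fun z hz hz' => ?_⟩
    obtain ⟨j, hj, hjz⟩ := hs z hz hz'
    exact ⟨_, Finset.mem_image_of_mem _ hj, hjz⟩

theorem axis_update [DecidableEq σ] (y : Option (Fin 0) → L) (s : L) :
    axis σ (Function.update y none s) = Function.update (axis σ y) none s := by
  funext c
  cases c <;> simp [axis, point]

theorem partialD_axis [DecidableEq σ] {m n : Type*} (f : (Option σ → L) → Matrix m n L)
    (y : Option (Fin 0) → L) :
    partialD none (fun z => f (axis σ z)) y = partialD none f (axis σ y) := by
  ext a b
  simp only [partialD, Matrix.of_apply, axis_update]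
  rfl

/-- The restriction of a vector bundle to the `u`-axis. -/
def VectorBundle.restrictAxis {W : Set (Option σ → L)} (E : VectorBundle k W) :
    VectorBundle k (axis σ ⁻¹' W) where
  ι := E.ι
  chart i := axis σ ⁻¹' E.chart i
  cover := E.cover.preimage_axis
  rank := E.rank
  g i j y := E.g i j (axis σ y)
  analytic_g i j a b :=
    (E.analytic_g i j a b).preimage_axis ((E.cover.rational i).inter (E.cover.rational j))
  g_self i _ hy := E.g_self i _ hy
  g_mul i j l _ hy := E.g_mul i j l _ hy

/-- The restriction `(ℋ, ∇)|_b` of an F-bundle to the point `b = 0` of its base, an F-bundle over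
the point `A^0`. -/
def FBundle.restrictZero [DecidableEq σ] {B : Set (σ → L)} (E : FBundle k B) (hB : (0 : σ → L) ∈ B) :
    FBundle k (Set.univ : Set (Fin 0 → L)) where
  dom := axis σ ⁻¹' E.dom
  isGermNhd :=
    { admissible := E.isGermNhd.admissible.preimage_axis
      zero_mem := fun _ _ => E.isGermNhd.zero_mem 0 hB
      subset := fun y hy => ⟨Set.mem_univ _, (E.isGermNhd.subset _ hy).2⟩ }
  bundle := E.bundle.restrictAxis
  A i c y := E.A i (c.elim none (fun j => j.elim0)) (axis σ y)
  analytic_A i c a b := (E.analytic_A i _ a b).preimage_axis (E.bundle.cover.rational i)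
  gauge := by
    rintro i j (_ | c) y hy
    · have := E.gauge i j none _ hy
      erw [partialD_axis (E.bundle.g i j) y]
      exact this
    · exact c.elim0
  flat := by
    rintro i (_ | c) (_ | d) y hy hu
    · simp only [curvature, sub_self, add_zero]
    · exact d.elim0
    · exact c.elim0
    · exact c.elim0

/-- The matrix of a framing `∇_b^fr = d + (matrixAtZero i) du` of `(ℋ, ∇)|_b` in the restriction to
`b × 𝔻_u` of the `i`-th frame of `ℋ`. -/
def Framing.matrixAtZero [DecidableEq σ] {B : Set (σ → L)} {E : FBundle k B}
    {hB : (0 : σ → L) ∈ B} (φ : Framing k (E.restrictZero hB) Set.univ) (i : E.bundle.ι)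
    (y : Option (Fin 0) → L) : Matrix (Fin (E.bundle.rank i)) (Fin (E.bundle.rank i)) L :=
  φ.Γ i none y

/-- The restriction to `b = 0` of the framing `Φ` over `U` is the framing `φ` of `(ℋ, ∇)|_b`. -/
def Framing.Extends [DecidableEq σ] {B : Set (σ → L)} {E : FBundle k B} {hB : (0 : σ → L) ∈ B}
    {U : Set (σ → L)} (Φ : Framing k E U) (φ : Framing k (E.restrictZero hB) Set.univ) : Prop :=
  ∃ N : Set (Option (Fin 0) → L), IsGermNhd k Set.univ N ∧ N ⊆ φ.dom ∩ axis σ ⁻¹' Φ.dom ∧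
    ∀ i : E.bundle.ι, ∀ y ∈ N ∩ axis σ ⁻¹' E.bundle.chart i,
      Φ.Γ i none (axis σ y) = φ.matrixAtZero i y

end Restriction

/-! ### The explicit gauge transformation -/

section Explicit

variable {k : Type*} [NontriviallyNormedField k]
variable {L : Type*} [NontriviallyNormedField L] [NormedAlgebra k L]
variable {n r : ℕ}

/-- The power series `∑ X_{ℓ,q} t^ℓ u^q`, with coefficients in `r × r` matrices over `k`, converges
at the point `y = (t, u)` to the matrix `x`. -/
def SeriesHasSum (X : (Fin n →₀ ℕ) → ℕ → Matrix (Fin r) (Fin r) k) (y : Option (Fin n) → L)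
    (x : Matrix (Fin r) (Fin r) L) : Prop :=
  ∀ a b, HasSum (fun p : (Fin n →₀ ℕ) × ℕ =>
    algebraMap k L (X p.1 p.2 a b) * ((p.1.prod fun j e => y (some j) ^ e) * y none ^ p.2)) (x a b)

/-- The recursion for the coefficients `P ℓ q` (of `t^ℓ u^q`) of the gauge transformation `P`, given
the coefficients `T j ℓ q` of connection matrices `u⁻¹ T^j` in the directions `∂_{t_j}`: one has
`P(0, u) = 1` and `u ∂_{t_j} P = - T^j P + P M^j`, where `M^j(t) = P(t,0)⁻¹ T^j(t,0) P(t,0)`.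
It determines `P` and `M` by induction on the degree in `t`. -/
structure IsGaugeRecursion (T : Fin n → (Fin n →₀ ℕ) → ℕ → Matrix (Fin r) (Fin r) k)
    (P : (Fin n →₀ ℕ) → ℕ → Matrix (Fin r) (Fin r) k)
    (M : Fin n → (Fin n →₀ ℕ) → Matrix (Fin r) (Fin r) k) : Prop where
  init : ∀ q, P 0 q = if q = 0 then 1 else 0
  residue : ∀ j ℓ, ∑ p ∈ Finset.HasAntidiagonal.antidiagonal ℓ, P p.1 0 * M j p.2
    = ∑ p ∈ Finset.HasAntidiagonal.antidiagonal ℓ, T j p.1 0 * P p.2 0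
  step : ∀ j ℓ q, ((ℓ j + 1 : ℕ) : k) • P (ℓ + Finsupp.single j 1) q
    = - (∑ p ∈ Finset.HasAntidiagonal.antidiagonal ℓ, ∑ s ∈ Finset.HasAntidiagonal.antidiagonal (q + 1), T j p.1 s.1 * P p.2 s.2)
      + ∑ p ∈ Finset.HasAntidiagonal.antidiagonal ℓ, P p.1 (q + 1) * M j p.2

/-- The framing `Φ`, which extends `φ`, is given explicitly by the recursion: for each local frame
`F` of `ℋ` near `(b, 0)` whose restriction to `b × 𝔻_u` is `φ`-flat, let `u⁻¹ T^j` be the connection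
matrices of `∇` in the frame `F`. Then, on a polydisc around `(b, 0)`, the power series `P` produced
by the recursion converges and `F * P` is a flat frame for `Φ`. -/
def Framing.IsExplicit {B : Set (Fin n → L)} {E : FBundle k B} {hB : (0 : Fin n → L) ∈ B}
    {U : Set (Fin n → L)} (Φ : Framing k E U) (φ : Framing k (E.restrictZero hB) Set.univ) : Prop :=
  ∀ (i : E.bundle.ι) (S : Set (Option (Fin n) → L))
    (F : (Option (Fin n) → L) → Matrix (Fin (E.bundle.rank i)) (Fin (E.bundle.rank i)) L),
    IsAdmissibleOpen k S → 0 ∈ S → S ⊆ E.bundle.chart i → IsAnalyticMat k S F →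
    (∀ y ∈ S, (F y).det ≠ 0) →
    (∀ y ∈ φ.dom ∩ axis (Fin n) ⁻¹' S,
      partialD none (fun z => F (axis (Fin n) z)) y + 
        φ.matrixAtZero i y * F (axis (Fin n) y) = 0) →
    ∃ (c : k) (T : Fin n → (Fin n →₀ ℕ) → ℕ →
        Matrix (Fin (E.bundle.rank i)) (Fin (E.bundle.rank i)) k)
      (P : (Fin n →₀ ℕ) → ℕ → Matrix (Fin (E.bundle.rank i)) (Fin (E.bundle.rank i)) k)
      (M : Fin n → (Fin n →₀ ℕ) → Matrix (Fin (E.bundle.rank i)) (Fin (E.bundle.rank i)) k)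
      (Q : (Option (Fin n) → L) → Matrix (Fin (E.bundle.rank i)) (Fin (E.bundle.rank i)) L),
      c ≠ 0 ∧ polydisc k c ⊆ S ∩ Φ.dom ∧ IsGaugeRecursion T P M ∧
      ∀ y ∈ polydisc k c,
        (∀ j, SeriesHasSum (T j) y
          ((F y)⁻¹ * (E.A i (some j) y * F y + weight (some j) y • partialD (some j) F y))) ∧
        SeriesHasSum P y (Q y) ∧ (Q y).det ≠ 0 ∧
        ∀ e, partialD e (fun z => F z * Q z) y + Φ.Γ i e y * (F y * Q y) = 0

end Explicit

end RigidAn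

set_option linter.unusedSectionVars false

namespace RigidAn

/-! Existence. The framing at b gives a flat frame along the axis t = 0, which is first extended
constantly in t. Let u∂_{t_j} + A_j be the connection in this frame. A gauge transformation P, equal
to 1 on the axis, is sought after which the matrices in the t-directions no longer depend on u.
Contracting with the Euler field E = ∑ t_j ∂_{t_j} and putting T = ∑ t_j A_j gives the single
equation u E P = -T P + P M, with M free of u. Its coefficient at u^0 determines M, its coefficient
at u^{q+1} determines P at u^q. As T and M vanish at t = 0 and E multiplies the part of t-degree N
by N, this is a triangular recursion on the t-degree (`exists_isRadialSolution`). Nonzero integers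
have norm one, so dividing by N costs nothing, and a suitable weighted bound reproduces itself
(`IsRadialSolution.cauchyBound`). The radial equation makes only the contraction of the new
connection with E free of u. Flatness, itself contracted with E, gives by induction on the t-degree
that every t-component is free of u and that the u-component, which is linear in u on the axis, is
linear in u everywhere (`IsFormallyFlat.indep`, `IsFormallyFlat.none_eq_zero`). This is
`exists_formal_framing`.

Uniqueness. The matrix W comparing two such frames satisfies u ∂_{t_j} W + N_j W = W a_j with N_j
and a_j free of u, and is constant on the axis. Comparing powers of u shows that W is constant
(`eq_const_of_compare`), so both frames are flat for the same connection near 0. On all of U the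
agreement follows from an identity theorem on a thin bidisc around U × {0}. The recursion of the
explicit form is the gauge equation in the separate directions t_j, read coefficientwise.

Analytic foundations. Functions are uniform limits of rational functions on sets of points over the
algebraic closure L, which need not be complete. Three facts make this workable. A polynomial
without zeros on a rational subset is bounded below there (`IsRational.exists_le_norm_aeval`), by a
Nullstellensatz for the unit polydisc; hence products of such functions are again of this kind.
Limits at a point x exist because all approximants take values in k(x), which is finite over k and
so complete. Finally, functions on a polydisc have unique power series over k
(`IsUniformLimit.exists_expansion`, `HasSer.unique`), so that statements about germs become formal;
here the Gauss norm is controlled by values at multiples of integer points, whose differences are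
units. -/

/-- The nonzero natural numbers have norm one. -/
class NormNatOne (K : Type*) [NormedField K] : Prop where
  norm_natCast : ∀ n : ℕ, n ≠ 0 → ‖(n : K)‖ = 1

/-! ### The Gauss norm is a supremum over integer multiples of a scalar. -/

section Gauss

variable {K : Type*} [NormedField K] [NormNatOne K]

theorem NormNatOne.charZero : CharZero K := by
  refine charZero_of_inj_zero fun n hn => ?_
  by_contra h
  have := NormNatOne.norm_natCast (K := K) n h
  simp [hn] at this

theorem NormNatOne.norm_natCast_le (n : ℕ) : ‖(n : K)‖ ≤ 1 := by
  rcases eq_or_ne n 0 with rfl | h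
  · simp
  · exact (NormNatOne.norm_natCast n h).le

theorem NormNatOne.isUltrametricDist : IsUltrametricDist K :=
  IsUltrametricDist.isUltrametricDist_of_forall_norm_natCast_le_one NormNatOne.norm_natCast_le

theorem NormNatOne.norm_natCast_sub {m n : ℕ} (h : m ≠ n) : ‖(m : K) - n‖ = 1 := by
  rcases lt_or_gt_of_ne h with h | h
  · rw [norm_sub_rev, ← Nat.cast_sub h.le]
    exact NormNatOne.norm_natCast _ (by omega)
  · rw [← Nat.cast_sub h.le]
    exact NormNatOne.norm_natCast _ (by omega)

variable [IsUltrametricDist K]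

omit [NormNatOne K] in
theorem norm_coeff_mul_le_one {p q : Polynomial K} (hp : ∀ i, ‖p.coeff i‖ ≤ 1)
    (hq : ∀ i, ‖q.coeff i‖ ≤ 1) (i : ℕ) : ‖(p * q).coeff i‖ ≤ 1 := by
  rw [Polynomial.coeff_mul]
  refine IsUltrametricDist.norm_sum_le_of_forall_le_of_nonneg zero_le_one fun x _ => ?_
  rw [norm_mul]
  exact mul_le_one₀ (hp _) (norm_nonneg _) (hq _)

/-- The denominators of the basis polynomials are differences of distinct natural numbers, which
have norm one. -/
theorem norm_coeff_lagrange_basis_le (s : Finset ℕ) (j i : ℕ) :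
    ‖(Lagrange.basis s (fun n : ℕ => (n : K)) j).coeff i‖ ≤ 1 := by
  classical
  unfold Lagrange.basis
  have key : ∀ t : Finset ℕ, t ⊆ s.erase j → ∀ i,
      ‖(∏ a ∈ t, Lagrange.basisDivisor (j : K) (a : K)).coeff i‖ ≤ 1 := by
    intro t
    induction t using Finset.induction_on with
    | empty =>
      intro _ i
      simp only [Finset.prod_empty, Polynomial.coeff_one]
      split_ifs <;> simp
    | insert a t ha ih =>
      intro hsub
      rw [Finset.prod_insert ha]
      refine norm_coeff_mul_le_one (fun i => ?_) (ih fun x hx => hsub (Finset.mem_insert_of_mem hx))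
      have haj : a ≠ j := (Finset.mem_erase.1 (hsub (Finset.mem_insert_self a t))).1
      rw [Lagrange.basisDivisor, Polynomial.coeff_C_mul, norm_mul, norm_inv,
        NormNatOne.norm_natCast_sub haj.symm, inv_one, one_mul, Polynomial.coeff_sub,
        Polynomial.coeff_X, Polynomial.coeff_C]
      rw [sub_eq_add_neg]
      refine (IsUltrametricDist.norm_add_le_max _ _).trans (max_le ?_ ?_)
      · split_ifs <;> simp
      · rw [norm_neg]
        split_ifs
        · exact NormNatOne.norm_natCast_le _
        · simp
  exact key _ le_rfl i

/-- Interpolating p(cX) at 0, 1, …, deg p writes its coefficients as integral combinations of values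
of p on the disc. Residue characteristic zero supplies enough nodes with unit differences. -/
theorem Polynomial.norm_coeff_le_of_forall_norm_eval_le (p : Polynomial K) (c : K) {C : ℝ}
    (h : ∀ s : K, ‖s‖ ≤ ‖c‖ → ‖p.eval s‖ ≤ C) (i : ℕ) : ‖p.coeff i‖ * ‖c‖ ^ i ≤ C := by
  have hC : 0 ≤ C := (norm_nonneg _).trans (h 0 (by simp))
  have := NormNatOne.charZero (K := K)
  set q : Polynomial K := p.comp (Polynomial.C c * Polynomial.X) with hq
  have hcoef : q.coeff i = p.coeff i * c ^ i := by
    rw [hq, Polynomial.comp_C_mul_X_coeff]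
  have hinj : Set.InjOn (fun n : ℕ => (n : K)) (Finset.range (q.natDegree + 1)) :=
    fun a _ b _ hab => Nat.cast_injective hab
  have hint := Lagrange.eq_interpolate (f := q) hinj (by
    rw [Finset.card_range]
    exact Polynomial.degree_le_natDegree.trans_lt (by exact_mod_cast Nat.lt_succ_self _))
  rw [← norm_pow, ← norm_mul, ← hcoef, hint, Lagrange.interpolate_apply, Polynomial.finsetSum_coeff]
  refine IsUltrametricDist.norm_sum_le_of_forall_le_of_nonneg hC fun j _ => ?_
  rw [Polynomial.coeff_C_mul, norm_mul]
  refine (mul_le_of_le_one_right (norm_nonneg _) (norm_coeff_lagrange_basis_le _ _ _)).trans ?_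
  rw [hq, Polynomial.eval_comp]
  apply h
  simp only [Polynomial.eval_mul, Polynomial.eval_C, Polynomial.eval_X, norm_mul]
  exact mul_le_of_le_one_right (norm_nonneg _) (NormNatOne.norm_natCast_le _)

theorem norm_coeff_le_of_forall_norm_eval_le_fin {n : ℕ} (p : MvPolynomial (Fin n) K) (c : K) {C : ℝ}
    (h : ∀ x : Fin n → K, (∀ i, ‖x i‖ ≤ ‖c‖) → ‖MvPolynomial.eval x p‖ ≤ C) (ℓ : Fin n →₀ ℕ) :
    ‖p.coeff ℓ‖ * ‖c‖ ^ ℓ.degree ≤ C := by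
  induction n generalizing C with
  | zero =>
    have h0 := h 0 (fun i => i.elim0)
    obtain rfl : ℓ = 0 := Subsingleton.elim _ _
    rw [MvPolynomial.eq_C_of_isEmpty p, MvPolynomial.eval_C] at h0
    simpa using h0
  | succ n ih =>
    have key : ∀ y : Fin n → K, (∀ i, ‖y i‖ ≤ ‖c‖) →
        ‖MvPolynomial.eval y ((MvPolynomial.finSuccEquiv K n p).coeff (ℓ 0))‖ * ‖c‖ ^ (ℓ 0) ≤ C := by
      intro y hy
      have := Polynomial.norm_coeff_le_of_forall_norm_eval_le
        (Polynomial.map (MvPolynomial.eval y) (MvPolynomial.finSuccEquiv K n p)) c (C := C) ?_ (ℓ 0)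
      · rwa [Polynomial.coeff_map] at this
      · intro s hs
        rw [← MvPolynomial.eval_eq_eval_mv_eval']
        exact h _ (fun i => by refine Fin.cases ?_ (fun i => ?_) i <;> simp [hs, hy])
    -- The scalar `c ^ (ℓ 0)` absorbs the factor contributed by the first variable, so that the
    -- induction hypothesis applies with the same C.
    have key2 := ih (MvPolynomial.C (c ^ (ℓ 0)) * (MvPolynomial.finSuccEquiv K n p).coeff (ℓ 0))
      (C := C) (fun x hx => by
        rw [map_mul, MvPolynomial.eval_C, norm_mul, norm_pow, mul_comm]
        exact key x hx) ℓ.tail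
    rw [MvPolynomial.coeff_C_mul, MvPolynomial.finSuccEquiv_coeff_coeff, Finsupp.cons_tail,
      norm_mul, norm_pow, mul_comm (‖c‖ ^ _), mul_assoc, ← pow_add] at key2
    convert key2 using 3
    conv_lhs => rw [← Finsupp.cons_tail ℓ]
    rw [Finsupp.degree_eq_sum, Finsupp.degree_eq_sum, Fin.sum_univ_succ]
    rfl

/-- The Gauss norm of a polynomial is bounded by its supremum on the rational points of the closed
polydisc. -/
theorem norm_coeff_le_of_forall_norm_eval_le {σ : Type*} [Finite σ] (p : MvPolynomial σ K) (c : K)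
    {C : ℝ} (h : ∀ x : σ → K, (∀ i, ‖x i‖ ≤ ‖c‖) → ‖MvPolynomial.eval x p‖ ≤ C) (ℓ : σ →₀ ℕ) :
    ‖p.coeff ℓ‖ * ‖c‖ ^ ℓ.degree ≤ C := by
  obtain ⟨n, ⟨e⟩⟩ := Finite.exists_equiv_fin σ
  have := norm_coeff_le_of_forall_norm_eval_le_fin (MvPolynomial.rename e p) c (C := C) (fun x hx => by
    rw [MvPolynomial.eval_rename]
    exact h _ fun i => hx _) (ℓ.mapDomain e)
  rwa [MvPolynomial.coeff_rename_mapDomain _ e.injective, Finsupp.degree_mapDomain] at this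

end Gauss

/-! ### Rational functions without poles on a disc. -/

section Lines

variable {L : Type*} [NormedField L] [IsUltrametricDist L] [IsAlgClosed L]

/-- Every root a has norm greater than r, so ‖s - a‖ = ‖a‖ on the disc and the product over the
roots has constant norm. -/
theorem norm_eval_eq_of_forall_ne_zero (q : Polynomial L) {r : ℝ}
    (h : ∀ s : L, ‖s‖ ≤ r → q.eval s ≠ 0) {s : L} (hs : ‖s‖ ≤ r) : ‖q.eval s‖ = ‖q.eval 0‖ := by
  have hprod : ∀ s : L, ‖(Multiset.map (fun a => s - a) q.roots).prod‖ =
      (Multiset.map (fun a => ‖s - a‖) q.roots).prod := fun s => by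
    refine (map_multiset_prod (normHom : L →*₀ ℝ) _).trans ?_
    rw [Multiset.map_map]
    rfl
  rw [(IsAlgClosed.splits q).eval_eq_prod_roots, (IsAlgClosed.splits q).eval_eq_prod_roots,
    norm_mul, norm_mul, hprod, hprod]
  congr 2
  refine Multiset.map_congr rfl fun a ha => ?_
  have hra : r < ‖a‖ := by
    by_contra hle
    exact h a (not_lt.1 hle) (Polynomial.isRoot_of_mem_roots ha)
  rw [zero_sub, norm_neg, sub_eq_add_neg, IsUltrametricDist.norm_add_eq_max_of_norm_ne_norm
    (by rw [norm_neg]; exact (hs.trans_lt hra).ne), norm_neg]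
  exact max_eq_right (hs.trans hra.le)

variable [NormNatOne L]

/-- Lipschitz estimate for a rational function without poles on a disc. -/
theorem norm_ratio_sub_le (p q : Polynomial L) (c : L) (hc : c ≠ 0) {C : ℝ}
    (hq : ∀ s : L, ‖s‖ ≤ ‖c‖ → q.eval s ≠ 0)
    (h : ∀ s : L, ‖s‖ ≤ ‖c‖ → ‖p.eval s / q.eval s‖ ≤ C) {s : L} (hs : ‖s‖ ≤ ‖c‖) :
    ‖p.eval s / q.eval s - p.eval 0 / q.eval 0‖ ≤ C * ‖s‖ / ‖c‖ := by
  have h0 : ‖(0 : L)‖ ≤ ‖c‖ := by simp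
  have hcpos : 0 < ‖c‖ := norm_pos_iff.2 hc
  have hq0 : 0 < ‖q.eval 0‖ := norm_pos_iff.2 (hq 0 h0)
  have hC : 0 ≤ C := (norm_nonneg _).trans (h 0 h0)
  -- N is the numerator of the difference. It has no constant term, and each remaining monomial
  -- gains a factor ‖s‖/‖c‖ over its Gauss bound.
  set N : Polynomial L := p * Polynomial.C (q.eval 0) - Polynomial.C (p.eval 0) * q with hN
  have hp : ∀ s : L, ‖s‖ ≤ ‖c‖ → ‖p.eval s‖ ≤ C * ‖q.eval 0‖ := by
    intro s hs
    have := h s hs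
    rwa [norm_div, norm_eval_eq_of_forall_ne_zero q hq hs, div_le_iff₀ hq0] at this
  have hNb : ∀ s : L, ‖s‖ ≤ ‖c‖ → ‖N.eval s‖ ≤ C * ‖q.eval 0‖ ^ 2 := by
    intro s hs
    simp only [hN, Polynomial.eval_sub, Polynomial.eval_mul, Polynomial.eval_C]
    rw [sub_eq_add_neg]
    refine (IsUltrametricDist.norm_add_le_max _ _).trans (max_le ?_ ?_)
    · rw [norm_mul, pow_two, ← mul_assoc]
      gcongr
      exact hp s hs
    · rw [norm_neg, norm_mul, pow_two, ← mul_assoc, norm_eval_eq_of_forall_ne_zero q hq hs]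
      gcongr
      exact hp 0 h0
  have hcoef := Polynomial.norm_coeff_le_of_forall_norm_eval_le N c hNb
  have hN0 : N.coeff 0 = 0 := by
    rw [Polynomial.coeff_zero_eq_eval_zero]
    simp only [hN, Polynomial.eval_sub, Polynomial.eval_mul, Polynomial.eval_C]
    ring
  have hNs : ‖N.eval s‖ ≤ C * ‖q.eval 0‖ ^ 2 * (‖s‖ / ‖c‖) := by
    rw [Polynomial.eval_eq_sum_range]
    refine IsUltrametricDist.norm_sum_le_of_forall_le_of_nonneg (by positivity) fun i _ => ?_
    rcases i with _ | i
    · rw [hN0, zero_mul, norm_zero]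
      positivity
    · rw [norm_mul, norm_pow]
      have hsc : ‖s‖ / ‖c‖ ≤ 1 := (div_le_one hcpos).2 hs
      have : ‖s‖ ^ (i + 1) = ‖c‖ ^ (i + 1) * (‖s‖ / ‖c‖) ^ (i + 1) := by
        rw [← mul_pow, mul_div_cancel₀ _ hcpos.ne']
      rw [this, ← mul_assoc]
      refine mul_le_mul (hcoef _) ?_ (by positivity) (by positivity)
      calc (‖s‖ / ‖c‖) ^ (i + 1) ≤ (‖s‖ / ‖c‖) ^ 1 :=
            pow_le_pow_of_le_one (by positivity) hsc (by omega)
        _ = _ := pow_one _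
  have hdiff : p.eval s / q.eval s - p.eval 0 / q.eval 0 = N.eval s / (q.eval s * q.eval 0) := by
    rw [div_sub_div _ _ (hq s hs) (hq 0 h0)]
    congr 1
    simp only [hN, Polynomial.eval_sub, Polynomial.eval_mul, Polynomial.eval_C]
    ring
  rw [hdiff, norm_div, norm_mul, norm_eval_eq_of_forall_ne_zero q hq hs, div_le_iff₀ (by positivity)]
  refine hNs.trans (le_of_eq ?_)
  ring

end Lines

/-! ### Polydiscs, rational subsets and their topology. -/

section Rational

variable {k : Type*} [NontriviallyNormedField k]
variable {L : Type*} [NontriviallyNormedField L] [NormedAlgebra k L]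
variable {σ : Type*}

theorem polydisc_mono {c c' : k} (h : ‖c‖ ≤ ‖c'‖) :
    (polydisc k c : Set (σ → L)) ⊆ polydisc k c' := fun _ hx i => (hx i).trans h

theorem zero_mem_polydisc (c : k) : (0 : σ → L) ∈ polydisc k c := fun i => by simp

theorem isRational_polydisc {c : k} (hc : c ≠ 0) : IsRational k (polydisc k c : Set (σ → L)) :=
  ⟨c, 1, 1, ∅, hc, one_ne_zero, by ext x; simp⟩

/-- The polydisc `‖tᵢ‖ ≤ ‖c‖`, `‖u‖ ≤ ‖d‖`. -/
def bidisc (k : Type*) [NontriviallyNormedField k] {L : Type*} [NontriviallyNormedField L] {σ : Type*}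
    (c d : k) : Set (Option σ → L) := {y | y ∈ polydisc k c ∧ ‖y none‖ ≤ ‖d‖}

theorem isRational_bidisc {c d : k} (hc : c ≠ 0) (hd : d ≠ 0) :
    IsRational k (bidisc k c d : Set (Option σ → L)) := by
  -- With the constant d as denominator, the inequality for the function u reads ‖u‖ ≤ ‖d‖.
  refine ⟨c, d, MvPolynomial.C d, {MvPolynomial.X none}, hc, hd, ?_⟩
  ext x
  simp [bidisc, MvPolynomial.algHom_C, norm_algebraMap']

theorem exists_ne_zero_norm_le (k : Type*) [NontriviallyNormedField k] {ε : ℝ} (hε : 0 < ε) :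
    ∃ c : k, c ≠ 0 ∧ ‖c‖ ≤ ε := by
  obtain ⟨c, h, h'⟩ := NormedField.exists_norm_lt k hε
  exact ⟨c, norm_pos_iff.1 h, h'.le⟩

theorem IsRational.isAdmissibleOpen {R : Set (σ → L)} (hR : IsRational k R) :
    IsAdmissibleOpen k R := by
  refine ⟨{R}, ?_, ?_, ?_⟩
  · rintro ⟨_, rfl⟩
    exact hR
  · simp
  · intro m I φ _ _ h
    exact ⟨{⟨R, rfl⟩}, fun z hz hz' => ⟨⟨R, rfl⟩, by simp, h z hz hz'⟩⟩

theorem IsAdmissibleOpen.exists_isRational {W : Set (σ → L)} (hW : IsAdmissibleOpen k W) {x : σ → L}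
    (hx : x ∈ W) : ∃ R, IsRational k R ∧ x ∈ R ∧ R ⊆ W := by
  obtain ⟨𝒞, h⟩ := hW
  rw [← h.iUnion_eq] at hx
  obtain ⟨i, hi⟩ := Set.mem_iUnion.1 hx
  exact ⟨i, h.rational i, hi, h.iUnion_eq ▸ Set.subset_iUnion (fun R : 𝒞 => (R : Set (σ → L))) i⟩

theorem isGermNhd_polydisc [Finite σ] {c : k} (hc : c ≠ 0) (hc1 : ‖c‖ ≤ 1) :
    IsGermNhd k (polydisc k c : Set (σ → L)) (polydisc k c) where
  admissible := (isRational_polydisc hc).isAdmissibleOpen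
  zero_mem t ht i := by
    cases i with
    | none => simp [point]
    | some i => exact ht i
  subset y hy := ⟨fun i => hy (some i), (hy none).trans hc1⟩

theorem isGermNhd_bidisc [Finite σ] {c d : k} (hc : c ≠ 0) (hd : d ≠ 0) (hd1 : ‖d‖ ≤ 1) :
    IsGermNhd k (polydisc k c : Set (σ → L)) (bidisc k c d) where
  admissible := (isRational_bidisc hc hd).isAdmissibleOpen
  zero_mem t ht := ⟨fun i => by
    cases i with
    | none => simp [point]
    | some i => exact ht i, by simp [point]⟩
  subset y hy := ⟨fun i => hy.1 (some i), hy.2.trans hd1⟩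

variable [IsUltrametricDist L]

theorem add_mem_polydisc {c : k} {x h : σ → L} (hx : x ∈ polydisc k c) (hh : h ∈ polydisc k c) :
    x + h ∈ polydisc k c := fun i =>
  (IsUltrametricDist.norm_add_le_max _ _).trans (max_le (hx i) (hh i))

/-- Polynomials are bounded and Lipschitz on polydiscs. -/
theorem exists_norm_aeval_le (p : MvPolynomial σ k) (c : k) : ∃ C : ℝ, 0 < C ∧
    ∀ x ∈ (polydisc k c : Set (σ → L)), ‖MvPolynomial.aeval x p‖ ≤ C ∧
      ∀ h ∈ (polydisc k c : Set (σ → L)), ∀ t : ℝ, (∀ i, ‖h i‖ ≤ t) → 0 ≤ t →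
        ‖MvPolynomial.aeval (x + h) p - MvPolynomial.aeval x p‖ ≤ C * t := by
  induction p using MvPolynomial.induction_on with
  | C a =>
    refine ⟨‖a‖ + 1, by positivity, fun x _ => ⟨?_, fun h _ t _ ht => ?_⟩⟩
    · rw [MvPolynomial.algHom_C, norm_algebraMap']
      linarith
    · rw [MvPolynomial.algHom_C, MvPolynomial.algHom_C, sub_self, norm_zero]
      positivity
  | add p q hp hq =>
    obtain ⟨C, hC, hp⟩ := hp
    obtain ⟨C', hC', hq⟩ := hq
    refine ⟨max C C', lt_max_of_lt_left hC, fun x hx => ⟨?_, fun h hh t ht ht0 => ?_⟩⟩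
    · rw [map_add]
      exact (IsUltrametricDist.norm_add_le_max _ _).trans (max_le_max (hp x hx).1 (hq x hx).1)
    · rw [map_add, map_add, add_sub_add_comm]
      refine (IsUltrametricDist.norm_add_le_max _ _).trans (max_le ?_ ?_)
      · exact ((hp x hx).2 h hh t ht ht0).trans (by gcongr; exact le_max_left _ _)
      · exact ((hq x hx).2 h hh t ht ht0).trans (by gcongr; exact le_max_right _ _)
  | mul_X p i hp =>
    obtain ⟨C, hC, hp⟩ := hp
    refine ⟨C * (‖c‖ + 1), by positivity, fun x hx => ⟨?_, fun h hh t ht ht0 => ?_⟩⟩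
    · rw [map_mul, MvPolynomial.aeval_X, norm_mul]
      gcongr
      · exact (hp x hx).1
      · linarith [hx i]
    · have e : MvPolynomial.aeval (x + h) (p * MvPolynomial.X i)
          - MvPolynomial.aeval x (p * MvPolynomial.X i)
          = (MvPolynomial.aeval (x + h) p - MvPolynomial.aeval x p) * x i
            + MvPolynomial.aeval (x + h) p * h i := by
        simp only [map_mul, MvPolynomial.aeval_X, Pi.add_apply]
        ring
      rw [e]
      refine (IsUltrametricDist.norm_add_le_max _ _).trans (max_le ?_ ?_)
      · rw [norm_mul, mul_right_comm]
        gcongr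
        · exact (hp x hx).2 h hh t ht ht0
        · linarith [hx i]
      · rw [norm_mul]
        have h1 := (hp _ (add_mem_polydisc hx hh)).1
        calc _ ≤ C * t := by gcongr; exact ht i
          _ ≤ C * (‖c‖ + 1) * t := by
            gcongr
            nlinarith [norm_nonneg c]

/-- A rational subset contains with each of its points a polydisc of fixed radius. -/
theorem IsRational.exists_add_mem {R : Set (σ → L)} (hR : IsRational k R) :
    ∃ ρ : k, ρ ≠ 0 ∧ ∀ x ∈ R, ∀ h ∈ (polydisc k ρ : Set (σ → L)), x + h ∈ R := by
  classical
  obtain ⟨c, δ, f₀, F, hc, hδ, rfl⟩ := hR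
  have hδ' : 0 < ‖δ‖ := norm_pos_iff.2 hδ
  have key : ∀ G : Finset (MvPolynomial σ k), ∃ C : ℝ, 0 < C ∧ ∀ f ∈ G,
      ∀ x ∈ (polydisc k c : Set (σ → L)), ∀ h ∈ (polydisc k c : Set (σ → L)), ∀ t : ℝ,
        (∀ i, ‖h i‖ ≤ t) → 0 ≤ t →
          ‖MvPolynomial.aeval (x + h) f - MvPolynomial.aeval x f‖ ≤ C * t := by
    intro G
    induction G using Finset.induction_on with
    | empty => exact ⟨1, one_pos, by simp⟩
    | insert f G _ ih =>
      obtain ⟨C, hC, h⟩ := ih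
      obtain ⟨C', hC', h'⟩ := exists_norm_aeval_le (L := L) f c
      refine ⟨max C C', lt_max_of_lt_left hC, fun g hg x hx y hy t ht ht0 => ?_⟩
      rcases Finset.mem_insert.1 hg with rfl | hg
      · exact ((h' x hx).2 y hy t ht ht0).trans (by gcongr; exact le_max_right _ _)
      · exact (h g hg x hx y hy t ht ht0).trans (by gcongr; exact le_max_left _ _)
  obtain ⟨C, hC, hlip⟩ := key (insert f₀ F)
  -- On a polydisc of radius ‖ρ‖ every defining polynomial varies by less than ‖δ‖ ≤ ‖f₀‖, so ‖f₀‖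
  -- is unchanged and all inequalities persist.
  obtain ⟨ρ, hρ, hρle⟩ := exists_ne_zero_norm_le k (ε := min ‖c‖ (‖δ‖ / (2 * C)))
    (lt_min (norm_pos_iff.2 hc) (by positivity))
  have hCρ : C * ‖ρ‖ < ‖δ‖ := by
    have := hρle.trans (min_le_right _ _)
    rw [le_div_iff₀ (by positivity)] at this
    have : 0 < C * ‖ρ‖ := mul_pos hC (norm_pos_iff.2 hρ)
    linarith
  refine ⟨ρ, hρ, fun x hx h hh => ?_⟩
  obtain ⟨hx1, hx2, hx3⟩ := hx
  have hhc : h ∈ (polydisc k c : Set (σ → L)) := polydisc_mono (hρle.trans (min_le_left _ _)) hh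
  have hdiff : ∀ f ∈ insert f₀ F, ‖MvPolynomial.aeval (x + h) f - MvPolynomial.aeval x f‖
      < ‖MvPolynomial.aeval x f₀‖ := fun f hf =>
    (hlip f hf x hx1 h hhc ‖ρ‖ hh (norm_nonneg _)).trans_lt (hCρ.trans_le hx2)
  have h0 : ‖MvPolynomial.aeval (x + h) f₀‖ = ‖MvPolynomial.aeval x f₀‖ := by
    have := hdiff f₀ (Finset.mem_insert_self _ _)
    rw [← sub_add_cancel (MvPolynomial.aeval (x + h) f₀) (MvPolynomial.aeval x f₀),
      IsUltrametricDist.norm_add_eq_max_of_norm_ne_norm this.ne, max_eq_right this.le]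
  refine ⟨add_mem_polydisc hx1 hhc, by rw [h0]; exact hx2, fun f hf => ?_⟩
  rw [h0, ← sub_add_cancel (MvPolynomial.aeval (x + h) f) (MvPolynomial.aeval x f)]
  exact (IsUltrametricDist.norm_add_le_max _ _).trans
    (max_le (hdiff f (Finset.mem_insert_of_mem hf)).le (hx3 f hf))

/-- This links rigid geometry with the topology of `σ → L`; later, statements about germs are
expressed through `𝓝 0`. -/
theorem IsRational.mem_nhds [Finite σ] {R : Set (σ → L)} (hR : IsRational k R) {x : σ → L}
    (hx : x ∈ R) : R ∈ nhds x := by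
  have := Fintype.ofFinite σ
  obtain ⟨ρ, hρ, h⟩ := hR.exists_add_mem
  refine Filter.mem_of_superset (Metric.closedBall_mem_nhds x (norm_pos_iff.2 hρ)) fun y hy => ?_
  have := h x hx (y - x) fun i => by
    rw [mem_closedBall_iff_norm] at hy
    exact (norm_le_pi_norm (y - x) i).trans hy
  simpa using this

omit [IsUltrametricDist L] in
theorem exists_polydisc_subset (k : Type*) [NontriviallyNormedField k] [Finite σ] {N : Set (σ → L)}
    (hN : N ∈ nhds 0) {ε : ℝ} (hε : 0 < ε) :
    ∃ c : k, c ≠ 0 ∧ ‖c‖ ≤ ε ∧ (polydisc k c : Set (σ → L)) ⊆ N := by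
  have := Fintype.ofFinite σ
  obtain ⟨r, hr, h⟩ := Metric.nhds_basis_closedBall.mem_iff.1 hN
  obtain ⟨c, hc, hcr⟩ := exists_ne_zero_norm_le k (ε := min r ε) (lt_min hr hε)
  refine ⟨c, hc, hcr.trans (min_le_right _ _), fun x hx => h ?_⟩
  rw [mem_closedBall_zero_iff, pi_norm_le_iff_of_nonneg hr.le]
  exact fun i => (hx i).trans (hcr.trans (min_le_left _ _))

theorem polydisc_mem_nhds [Finite σ] {c : k} (hc : c ≠ 0) :
    (polydisc k c : Set (σ → L)) ∈ nhds 0 :=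
  (isRational_polydisc hc).mem_nhds (zero_mem_polydisc c)

theorem IsAdmissibleOpen.mem_nhds [Finite σ] {W : Set (σ → L)} (hW : IsAdmissibleOpen k W) {x : σ → L}
    (hx : x ∈ W) : W ∈ nhds x := by
  obtain ⟨R, hR, hxR, hRW⟩ := hW.exists_isRational hx
  exact Filter.mem_of_superset (hR.mem_nhds hxR) hRW

end Rational

/-! ### The Tate algebra as a completion of the polynomial ring -/

noncomputable section Tate

variable {k : Type*} [NormedField k] {m : ℕ}

/-- The Gauss norm of a polynomial. -/
def gaussNorm (p : MvPolynomial (Fin m) k) : NNReal := p.support.sup fun ℓ => ‖p.coeff ℓ‖₊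

theorem norm_coeff_le_gaussNorm (p : MvPolynomial (Fin m) k) (ℓ : Fin m →₀ ℕ) :
    ‖p.coeff ℓ‖ ≤ gaussNorm p := by
  by_cases h : ℓ ∈ p.support
  · exact_mod_cast Finset.le_sup (f := fun ℓ => ‖p.coeff ℓ‖₊) h
  · rw [MvPolynomial.notMem_support_iff.1 h]
    simp

theorem gaussNorm_le {p : MvPolynomial (Fin m) k} {C : ℝ} (hC : 0 ≤ C)
    (h : ∀ ℓ, ‖p.coeff ℓ‖ ≤ C) : (gaussNorm p : ℝ) ≤ C := by
  lift C to NNReal using hC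
  exact NNReal.coe_le_coe.2 (Finset.sup_le fun ℓ _ => h ℓ)

theorem exists_norm_coeff_eq_gaussNorm (p : MvPolynomial (Fin m) k) :
    ∃ ℓ, ‖p.coeff ℓ‖ = gaussNorm p := by
  rcases p.support.eq_empty_or_nonempty with h | h
  · refine ⟨0, ?_⟩
    rw [MvPolynomial.support_eq_empty.1 h]
    simp [gaussNorm]
  · obtain ⟨ℓ, _, hℓ⟩ := Finset.exists_mem_eq_sup p.support h fun ℓ => ‖p.coeff ℓ‖₊
    exact ⟨ℓ, by rw [gaussNorm, hℓ]; rfl⟩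

variable [IsUltrametricDist k]

theorem gaussNorm_add_le_max (p q : MvPolynomial (Fin m) k) :
    (gaussNorm (p + q) : ℝ) ≤ max (gaussNorm p : ℝ) (gaussNorm q) :=
  gaussNorm_le (le_max_of_le_left (NNReal.coe_nonneg _)) fun ℓ => by
    rw [MvPolynomial.coeff_add]
    exact (IsUltrametricDist.norm_add_le_max _ _).trans
      (max_le_max (norm_coeff_le_gaussNorm _ _) (norm_coeff_le_gaussNorm _ _))

variable (k m) in
/-- The Gauss norm as a ring norm. -/
def gaussRingNorm : RingNorm (MvPolynomial (Fin m) k) where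
  toFun p := gaussNorm p
  map_zero' := by simp [gaussNorm]
  add_le' p q := (gaussNorm_add_le_max p q).trans
    (max_le_add_of_nonneg (NNReal.coe_nonneg _) (NNReal.coe_nonneg _))
  neg' p := by
    refine le_antisymm ?_ ?_
    · refine gaussNorm_le (NNReal.coe_nonneg _) fun ℓ => ?_
      have := norm_coeff_le_gaussNorm p ℓ
      rw [← norm_neg] at this
      exact this
    · refine gaussNorm_le (NNReal.coe_nonneg _) fun ℓ => ?_
      have := norm_coeff_le_gaussNorm (-p : MvPolynomial (Fin m) k) ℓ
      rw [MvPolynomial.coeff_neg, norm_neg] at this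
      exact this
  mul_le' p q := gaussNorm_le (by positivity) fun ℓ => by
    rw [MvPolynomial.coeff_mul]
    refine IsUltrametricDist.norm_sum_le_of_forall_le_of_nonneg (by positivity) fun x _ => ?_
    rw [norm_mul]
    exact mul_le_mul (norm_coeff_le_gaussNorm _ _) (norm_coeff_le_gaussNorm _ _) (norm_nonneg _)
      (NNReal.coe_nonneg _)
  eq_zero_of_map_eq_zero' p hp := by
    refine MvPolynomial.ext _ _ fun ℓ => ?_
    rw [MvPolynomial.coeff_zero, ← norm_le_zero_iff]
    exact (norm_coeff_le_gaussNorm p ℓ).trans hp.le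

instance : NormedCommRing (MvPolynomial (Fin m) k) where
  __ := (gaussRingNorm k m).toNormedRing
  mul_comm := mul_comm

instance : UniformSpace (MvPolynomial (Fin m) k) := PseudoMetricSpace.toUniformSpace

instance : TopologicalSpace (MvPolynomial (Fin m) k) := UniformSpace.toTopologicalSpace

theorem MvPolynomial.norm_def (p : MvPolynomial (Fin m) k) : ‖p‖ = gaussNorm (p : MvPolynomial (Fin m) k) := rfl

instance : NormedAlgebra k (MvPolynomial (Fin m) k) where
  norm_smul_le c p := gaussNorm_le (by positivity) fun ℓ => by
    rw [MvPolynomial.coeff_smul, norm_smul]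
    gcongr
    exact norm_coeff_le_gaussNorm p ℓ

instance : NormOneClass (MvPolynomial (Fin m) k) where
  norm_one := by
    refine le_antisymm (gaussNorm_le zero_le_one fun ℓ => ?_) ?_
    · rw [MvPolynomial.coeff_one]
      split_ifs <;> simp
    · have := norm_coeff_le_gaussNorm (1 : MvPolynomial (Fin m) k) 0
      rwa [MvPolynomial.coeff_one, if_pos rfl, norm_one] at this

instance : IsUltrametricDist (MvPolynomial (Fin m) k) :=
  IsUltrametricDist.isUltrametricDist_of_forall_norm_add_le_max_norm gaussNorm_add_le_max

instance {A : Type*} [SeminormedAddCommGroup A] [IsUltrametricDist A] :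
    IsUltrametricDist (UniformSpace.Completion A) :=
  IsUltrametricDist.isUltrametricDist_of_forall_norm_add_le_max_norm fun x y => by
    induction x, y using UniformSpace.Completion.induction_on₂ with
    | hp => exact isClosed_le (by fun_prop) (by fun_prop)
    | ih a b =>
      rw [← UniformSpace.Completion.coe_add, UniformSpace.Completion.norm_coe,
        UniformSpace.Completion.norm_coe, UniformSpace.Completion.norm_coe]
      exact IsUltrametricDist.norm_add_le_max a b

variable (k m) in
/-- The Tate algebra in `m` variables. -/
abbrev TateAlg := UniformSpace.Completion (MvPolynomial (Fin m) k)

theorem exists_norm_sub_coe_lt (t : TateAlg k m) {ε : ℝ} (hε : 0 < ε) :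
    ∃ p : MvPolynomial (Fin m) k, ‖t - (p : TateAlg k m)‖ < ε := by
  obtain ⟨p, hp⟩ := Metric.denseRange_iff.1 UniformSpace.Completion.denseRange_coe t ε hε
  exact ⟨p, by rwa [dist_eq_norm] at hp⟩

theorem MvPolynomial.norm_X_le (i : Fin m) : ‖(MvPolynomial.X i : MvPolynomial (Fin m) k)‖ ≤ 1 :=
  gaussNorm_le zero_le_one fun ℓ => by
    classical
    rw [MvPolynomial.coeff_X]
    split_ifs <;> simp

/-- Evaluation of polynomials at elements of norm at most one of an ultrametric algebra does not
increase the norm. -/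
theorem norm_aeval_le {A : Type*} [NormedCommRing A] [NormedAlgebra k A] [IsUltrametricDist A]
    (h1 : ‖(1 : A)‖ ≤ 1) {y : Fin m → A} (hy : ∀ j, ‖y j‖ ≤ 1) (p : MvPolynomial (Fin m) k) :
    ‖MvPolynomial.aeval y p‖ ≤ gaussNorm p := by
  have hpow : ∀ (a : A) (d : ℕ), ‖a‖ ≤ 1 → ‖a ^ d‖ ≤ 1 := fun a d ha => by
    induction d with
    | zero => simpa using h1
    | succ d ih =>
      rw [pow_succ]
      exact (norm_mul_le _ _).trans (mul_le_one₀ ih (norm_nonneg _) ha)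
  have hprod : ∀ (s : Finset (Fin m)) (d : Fin m →₀ ℕ), ‖∏ i ∈ s, y i ^ d i‖ ≤ 1 := fun s d => by
    induction s using Finset.cons_induction with
    | empty => simpa using h1
    | cons a s ha ih =>
      rw [Finset.prod_cons]
      exact (norm_mul_le _ _).trans (mul_le_one₀ (hpow _ _ (hy _)) (norm_nonneg _) ih)
  rw [MvPolynomial.aeval_def, MvPolynomial.eval₂_eq']
  refine IsUltrametricDist.norm_sum_le_of_forall_le_of_nonneg (NNReal.coe_nonneg _) fun d _ => ?_
  rw [← Algebra.smul_def]
  refine (norm_smul_le _ _).trans ?_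
  exact (mul_le_of_le_one_right (norm_nonneg _) (hprod _ _)).trans (norm_coeff_le_gaussNorm _ _)

/-- A bounded homomorphism from a complete group which hits every element up to a fixed relative
error is surjective. -/
theorem surjective_of_approx {G H : Type*} [NormedAddCommGroup G] [CompleteSpace G]
    [NormedAddCommGroup H] (f : G →+ H) {C C' ε : ℝ} (hε : 0 ≤ ε) (hε1 : ε < 1)
    (hf : ∀ g, ‖f g‖ ≤ C * ‖g‖) (h : ∀ b, ∃ g, ‖g‖ ≤ C' * ‖b‖ ∧ ‖b - f g‖ ≤ ε * ‖b‖) :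
    Function.Surjective f := by
  intro b
  choose g hg hg' using h
  let r : ℕ → H := fun n => Nat.rec b (fun _ x => x - f (g x)) n
  have hr : ∀ n, r (n + 1) = r n - f (g (r n)) := fun n => rfl
  have hrn : ∀ n, ‖r n‖ ≤ ε ^ n * ‖b‖ := fun n => by
    induction n with
    | zero => simp [r]
    | succ n ih =>
      rw [hr, pow_succ, mul_assoc, mul_comm, mul_assoc]
      exact (hg' _).trans (by rw [mul_comm ‖b‖]; gcongr)
  have hC' : ∀ n, ‖g (r n)‖ ≤ |C'| * ‖b‖ * ε ^ n := fun n => by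
    refine (hg _).trans ((mul_le_mul_of_nonneg_right (le_abs_self C') (norm_nonneg _)).trans ?_)
    rw [mul_assoc, mul_comm ‖b‖]
    gcongr
    exact hrn n
  have hs : Summable fun n => g (r n) :=
    Summable.of_norm_bounded ((summable_geometric_of_lt_one hε hε1).mul_left _) hC'
  have hcont : Continuous f := AddMonoidHomClass.continuous_of_bound f C hf
  have hsum := (hs.hasSum.map f hcont).tendsto_sum_nat
  have hpart : ∀ n, ∑ i ∈ Finset.range n, (f ∘ fun n => g (r n)) i = b - r n := fun n => by
    induction n with
    | zero => simp [r]
    | succ n ih =>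
      rw [Finset.sum_range_succ, ih, hr, Function.comp_apply]
      abel
  have hr0 : Filter.Tendsto r Filter.atTop (nhds 0) := by
    refine squeeze_zero_norm hrn ?_
    simpa using (tendsto_pow_atTop_nhds_zero_of_lt_one hε hε1).mul_const ‖b‖
  simp_rw [hpart] at hsum
  have h2 := hr0.const_sub b
  rw [sub_zero] at h2
  exact ⟨_, tendsto_nhds_unique hsum h2⟩

end Tate

/-! ### Reduction of a quotient of the polynomial ring and Noether normalization. -/

noncomputable section TateQuotient

variable {k : Type*} [NormedField k] [IsUltrametricDist k] {m : ℕ}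

/-- The ring of integers of `k`. -/
abbrev intRing (k : Type*) [NormedField k] [IsUltrametricDist k] : ValuationSubring k :=
  (NormedField.valuation (K := k)).valuationSubring

theorem mem_intRing {x : k} : x ∈ intRing k ↔ ‖x‖ ≤ 1 := by
  rw [Valuation.mem_valuationSubring_iff]
  rfl

theorem intRing_isUnit {x : intRing k} (h : ‖(x : k)‖ = 1) : IsUnit x := by
  have hx : (x : k) ≠ 0 := by
    rw [← norm_pos_iff, h]
    exact one_pos
  refine IsUnit.of_mul_eq_one ⟨(x : k)⁻¹, mem_intRing.2 (by rw [norm_inv, h, inv_one])⟩ ?_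
  ext
  simp [hx]

theorem norm_lt_one_of_mem_maximalIdeal {x : intRing k}
    (h : x ∈ IsLocalRing.maximalIdeal (intRing k)) : ‖(x : k)‖ < 1 := by
  refine lt_of_le_of_ne (mem_intRing.1 x.2) fun h1 => ?_
  exact (IsLocalRing.mem_maximalIdeal x).1 h (intRing_isUnit h1)

/-- Polynomials with integral coefficients. -/
def intPoly (p : MvPolynomial (Fin m) (intRing k)) : MvPolynomial (Fin m) k :=
  MvPolynomial.map (algebraMap (intRing k) k) p

theorem norm_intPoly_le (p : MvPolynomial (Fin m) (intRing k)) : ‖intPoly p‖ ≤ 1 :=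
  gaussNorm_le zero_le_one fun ℓ => by
    rw [intPoly, MvPolynomial.coeff_map]
    exact mem_intRing.1 (p.coeff ℓ).2

theorem exists_intPoly_eq (p : MvPolynomial (Fin m) k) (hp : ‖p‖ ≤ 1) : ∃ q, intPoly q = p := by
  refine MvPolynomial.mem_range_map_iff_coeffs_subset.2 fun c hc => ?_
  obtain ⟨ℓ, _, rfl⟩ := MvPolynomial.mem_coeffs_iff.1 hc
  exact ⟨⟨p.coeff ℓ, mem_intRing.2 ((norm_coeff_le_gaussNorm p ℓ).trans hp)⟩, rfl⟩

/-- Every polynomial is a scalar, of the same norm, times an integral polynomial; the reduction of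
the latter is nonzero if the polynomial is nonzero. -/
theorem exists_smul_intPoly_eq (p : MvPolynomial (Fin m) k) :
    ∃ (a : k) (q : MvPolynomial (Fin m) (intRing k)), ‖a‖ = ‖p‖ ∧ p = a • intPoly q ∧
      (p ≠ 0 → MvPolynomial.map (IsLocalRing.residue (intRing k)) q ≠ 0) := by
  by_cases hp : p = 0
  · exact ⟨0, 0, by simp [hp], by simp [hp], fun h => absurd hp h⟩
  obtain ⟨ℓ, hℓ⟩ := exists_norm_coeff_eq_gaussNorm p
  have ha : p.coeff ℓ ≠ 0 := by
    rw [← norm_pos_iff, hℓ, ← MvPolynomial.norm_def]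
    exact norm_pos_iff.2 hp
  obtain ⟨q, hq⟩ := exists_intPoly_eq ((p.coeff ℓ)⁻¹ • p) (by
    refine (norm_smul_le _ _).trans ?_
    rw [norm_inv, hℓ, MvPolynomial.norm_def, inv_mul_cancel₀]
    rw [← hℓ]
    exact norm_ne_zero_iff.2 ha)
  refine ⟨p.coeff ℓ, q, hℓ, ?_, fun _ h0 => ?_⟩
  · rw [hq, smul_inv_smul₀ ha]
  · have h1 : ((q.coeff ℓ : intRing k) : k) = 1 := by
      have := congrArg (MvPolynomial.coeff ℓ) hq
      rw [intPoly, MvPolynomial.coeff_map, MvPolynomial.coeff_smul, smul_eq_mul,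
        inv_mul_cancel₀ ha] at this
      exact this
    have h2 := congrArg (MvPolynomial.coeff ℓ) h0
    rw [MvPolynomial.coeff_map, MvPolynomial.coeff_zero,
      show q.coeff ℓ = 1 from Subtype.ext h1, map_one] at h2
    exact one_ne_zero h2

section Reduction

variable {A : Type*} [NormedCommRing A] [NormedAlgebra k A] [IsUltrametricDist A]
  (π : MvPolynomial (Fin m) k →ₐ[k] A) (hπ : ∀ p, ‖π p‖ ≤ ‖p‖)

/-- The integral polynomials whose image has norm less than one. -/
def smallIdeal : Ideal (MvPolynomial (Fin m) (intRing k)) where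
  carrier := {p | ‖π (intPoly p)‖ < 1}
  add_mem' {p q} hp hq := by
    have : π (intPoly (p + q)) = π (intPoly p) + π (intPoly q) := by simp [intPoly]
    exact (this ▸ IsUltrametricDist.norm_add_le_max _ _ : _ ≤ _).trans_lt (max_lt hp hq)
  zero_mem' := by simp [intPoly]
  smul_mem' p q hq := by
    have : π (intPoly (p • q)) = π (intPoly p) * π (intPoly q) := by simp [intPoly]
    rw [Set.mem_ofPred_eq, this]
    exact (norm_mul_le _ _).trans_lt
      (mul_lt_one_of_nonneg_of_lt_one_right ((hπ _).trans (norm_intPoly_le _)) (norm_nonneg _) hq)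

include hπ in
/-- Finitely many elements of `A` which span it, up to a fixed error less than one, over integral
polynomials in elements `y j`; moreover these elements are independent modulo the maximal ideal. -/
theorem exists_noether_normalization (h1 : ‖(1 : A)‖ = 1) :
    ∃ (s N : ℕ) (y : Fin s → MvPolynomial (Fin m) (intRing k))
      (e : Fin N → MvPolynomial (Fin m) (intRing k)),
      (∀ p : MvPolynomial (Fin m) (intRing k),
        ∃ w : Fin N → MvPolynomial (Fin s) (intRing k),
          ‖π (intPoly (p - ∑ l, MvPolynomial.aeval y (w l) * e l))‖ < 1) ∧
      ∀ w : MvPolynomial (Fin s) (intRing k), ‖π (intPoly (MvPolynomial.aeval y w))‖ < 1 →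
        MvPolynomial.map (IsLocalRing.residue (intRing k)) w = 0 := by
  let J := smallIdeal π hπ
  -- The maximal ideal of the integers dies in B (`hJ`), so B is a finitely generated algebra over
  -- the residue field, and classical Noether normalization applies to it; y and e are lifts of its
  -- output.
  let B := MvPolynomial (Fin m) (intRing k) ⧸ J
  let _ : CommRing B := Ideal.Quotient.commRing J
  let κ := IsLocalRing.ResidueField (intRing k)
  have hJ : ∀ x ∈ IsLocalRing.maximalIdeal (intRing k),
      ((Ideal.Quotient.mk J).comp MvPolynomial.C) x = 0 := fun x hx => by
    rw [RingHom.comp_apply, Ideal.Quotient.eq_zero_iff_mem]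
    change ‖π (intPoly _)‖ < 1
    refine (hπ _).trans_lt ?_
    rw [intPoly, MvPolynomial.map_C]
    refine lt_of_le_of_lt (gaussNorm_le (norm_nonneg (x : k)) fun ℓ => ?_)
      (norm_lt_one_of_mem_maximalIdeal hx)
    rw [MvPolynomial.coeff_C]
    split_ifs
    · exact le_rfl
    · simp
  let φ : κ →+* B := Ideal.Quotient.lift _ _ hJ
  let _ : Algebra κ B := φ.toAlgebra
  have : IsScalarTower (intRing k) κ B := IsScalarTower.of_algebraMap_eq fun x => rfl
  have : Algebra.FiniteType κ B :=
    Algebra.FiniteType.of_restrictScalars_finiteType (intRing k) κ B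
  have : Nontrivial B := Ideal.Quotient.nontrivial_iff.2 fun h => by
    have h0 : (1 : MvPolynomial (Fin m) (intRing k)) ∈ J := h ▸ Submodule.mem_top
    have h0' : ‖π (intPoly 1)‖ < 1 := h0
    rw [intPoly, map_one, map_one, h1] at h0'
    exact lt_irrefl _ h0'
  obtain ⟨s, g, ginj, gfin⟩ := exists_finite_inj_algHom_of_fg κ B
  let _ : Algebra (MvPolynomial (Fin s) κ) B := g.toRingHom.toAlgebra
  have : Module.Finite (MvPolynomial (Fin s) κ) B := gfin
  obtain ⟨N, e, he⟩ := Module.Finite.exists_fin (R := MvPolynomial (Fin s) κ) (M := B)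
  choose y hy using fun j : Fin s => Ideal.Quotient.mk_surjective (I := J) (g (MvPolynomial.X j))
  choose e' he' using fun l : Fin N => Ideal.Quotient.mk_surjective (I := J) (e l)
  have hmk : ∀ w : MvPolynomial (Fin s) (intRing k),
      Ideal.Quotient.mk J (MvPolynomial.aeval y w) =
        g (MvPolynomial.map (IsLocalRing.residue (intRing k)) w) := by
    have : ((Ideal.Quotient.mk J).comp (MvPolynomial.aeval y).toRingHom) =
        g.toRingHom.comp (MvPolynomial.map (IsLocalRing.residue (intRing k))) := by
      refine MvPolynomial.ringHom_ext (fun a => ?_) fun j => ?_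
      · simp only [RingHom.comp_apply, AlgHom.toRingHom_eq_coe, RingHom.coe_coe,
          MvPolynomial.algHom_C, MvPolynomial.map_C]
        rfl
      · simp [hy]
    intro w
    exact RingHom.congr_fun this w
  refine ⟨s, N, y, e', fun p => ?_, fun w hw => ?_⟩
  · have hp : Ideal.Quotient.mk J p ∈ Submodule.span (MvPolynomial (Fin s) κ) (Set.range e) :=
      he ▸ Submodule.mem_top
    obtain ⟨c, hc⟩ := (Submodule.mem_span_range_iff_exists_fun _).1 hp
    choose w hw using fun l => MvPolynomial.map_surjective (IsLocalRing.residue (intRing k))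
      IsLocalRing.residue_surjective (c l)
    refine ⟨w, ?_⟩
    change p - ∑ l, MvPolynomial.aeval y (w l) * e' l ∈ J
    rw [← Ideal.Quotient.eq_zero_iff_mem, map_sub, map_sum, ← hc, sub_eq_zero]
    refine Finset.sum_congr rfl fun l _ => ?_
    rw [map_mul, hmk, hw, he']
    rfl
  · have : Ideal.Quotient.mk J (MvPolynomial.aeval y w) = 0 := Ideal.Quotient.eq_zero_iff_mem.2 hw
    rw [hmk] at this
    exact (map_eq_zero_iff g ginj).1 this

include hπ in
/-- The spanning relation holds with a uniform error. -/
theorem exists_uniform_error {s N : ℕ}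
    {y : Fin s → MvPolynomial (Fin m) (intRing k)} {e : Fin N → MvPolynomial (Fin m) (intRing k)}
    (h : ∀ p : MvPolynomial (Fin m) (intRing k), ∃ w : Fin N → MvPolynomial (Fin s) (intRing k),
      ‖π (intPoly (p - ∑ l, MvPolynomial.aeval y (w l) * e l))‖ < 1) :
    ∃ ε : ℝ, 0 ≤ ε ∧ ε < 1 ∧ ∀ p : MvPolynomial (Fin m) (intRing k),
      ∃ w : Fin N → MvPolynomial (Fin s) (intRing k),
        ‖π (intPoly (p - ∑ l, MvPolynomial.aeval y (w l) * e l))‖ ≤ ε := by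
  choose w hw using h
  classical
  -- Only finitely many errors matter: that of 1 and those of the products X_j e_l. Every polynomial
  -- is built from 1 by scalars, sums and multiplication by variables, none of which enlarges the
  -- worst of these errors.
  let S : Finset (MvPolynomial (Fin m) (intRing k)) := insert 1 (Finset.univ.image fun x : Fin m × Fin N => MvPolynomial.X x.1 * e x.2)
  have h1S : (1 : MvPolynomial (Fin m) (intRing k)) ∈ S := Finset.mem_insert_self _ _
  have hXS : ∀ j l, MvPolynomial.X j * e l ∈ S := fun j l =>
    Finset.mem_insert_of_mem (Finset.mem_image.2 ⟨(j, l), Finset.mem_univ _, rfl⟩)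
  let err : MvPolynomial (Fin m) (intRing k) → ℝ := fun p =>
    ‖π (intPoly (p - ∑ l, MvPolynomial.aeval y (w p l) * e l))‖
  obtain ⟨p₀, _, hp₀⟩ := S.exists_max_image err ⟨1, h1S⟩
  refine ⟨err p₀, norm_nonneg _, hw _, ?_⟩
  have hmul : ∀ p q : MvPolynomial (Fin m) (intRing k), ‖π (intPoly q)‖ ≤ err p₀ →
      ‖π (intPoly (p * q))‖ ≤ err p₀ := fun p q hq => by
    have : π (intPoly (p * q)) = π (intPoly p) * π (intPoly q) := by simp [intPoly]
    rw [this]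
    exact (norm_mul_le _ _).trans ((mul_le_of_le_one_left (norm_nonneg _)
      ((hπ _).trans (norm_intPoly_le _))).trans hq)
  have hadd : ∀ p q : MvPolynomial (Fin m) (intRing k), ‖π (intPoly p)‖ ≤ err p₀ →
      ‖π (intPoly q)‖ ≤ err p₀ → ‖π (intPoly (p + q))‖ ≤ err p₀ := fun p q hp hq => by
    have : π (intPoly (p + q)) = π (intPoly p) + π (intPoly q) := by simp [intPoly]
    rw [this]
    exact (IsUltrametricDist.norm_add_le_max _ _).trans (max_le hp hq)
  have hsum : ∀ f : Fin N → MvPolynomial (Fin m) (intRing k), (∀ l, ‖π (intPoly (f l))‖ ≤ err p₀) →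
      ‖π (intPoly (∑ l, f l))‖ ≤ err p₀ := fun f hf =>
    Finset.sum_induction f (fun p => ‖π (intPoly p)‖ ≤ err p₀) hadd
      (by simp [intPoly]; exact norm_nonneg _) fun l _ => hf l
  intro p
  induction p using MvPolynomial.induction_on with
  | C a =>
    refine ⟨fun l => MvPolynomial.C a * w 1 l, ?_⟩
    convert hmul (MvPolynomial.C a) _ (hp₀ 1 h1S) using 4
    rw [mul_sub, mul_one, Finset.mul_sum]
    congr 1
    refine Finset.sum_congr rfl fun l _ => ?_
    rw [map_mul, MvPolynomial.algHom_C, mul_assoc]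
    rfl
  | add p q hp hq =>
    obtain ⟨u, hu⟩ := hp
    obtain ⟨v, hv⟩ := hq
    refine ⟨fun l => u l + v l, ?_⟩
    convert hadd _ _ hu hv using 4
    simp only [map_add, add_mul, Finset.sum_add_distrib]
    ring
  | mul_X p j hp =>
    obtain ⟨u, hu⟩ := hp
    -- First p is expanded over the e i, then each X_j e i is expanded again over the e l.
    refine ⟨fun l => ∑ i, u i * w (MvPolynomial.X j * e i) l, ?_⟩
    have h3 := hadd _ _ (hmul (MvPolynomial.X j) _ hu)
      (hsum (fun i => MvPolynomial.aeval y (u i) * (MvPolynomial.X j * e i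
        - ∑ l, MvPolynomial.aeval y (w (MvPolynomial.X j * e i) l) * e l))
        fun i => hmul _ _ (hp₀ _ (hXS j i)))
    convert h3 using 4
    simp only [map_sum, map_mul, mul_sub, Finset.sum_sub_distrib, Finset.mul_sum, Finset.sum_mul]
    rw [Finset.sum_comm, mul_comm p, ← sub_eq_zero]
    have e1 : ∀ i, MvPolynomial.X j * (MvPolynomial.aeval y (u i) * e i) =
        MvPolynomial.aeval y (u i) * (MvPolynomial.X j * e i) := fun i => by ring
    simp only [e1, mul_assoc]
    ring

end Reduction
end TateQuotient
-- A topologically finitely generated Banach field is finite over the base.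
noncomputable section TateField

variable {k : Type*} [NormedField k] [IsUltrametricDist k]

section Extension

variable {m : ℕ} {A : Type*} [NormedCommRing A] [CompleteSpace A]

/-- The extension of a contracting homomorphism to the Tate algebra. -/
def tateLift (f : MvPolynomial (Fin m) k →+* A) (hf : ∀ p, ‖f p‖ ≤ ‖p‖) : TateAlg k m →+* A :=
  UniformSpace.Completion.extensionHom f
    (AddMonoidHomClass.continuous_of_bound f 1 fun p => by rw [one_mul]; exact hf p)

theorem tateLift_coe (f : MvPolynomial (Fin m) k →+* A) (hf : ∀ p, ‖f p‖ ≤ ‖p‖)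
    (p : MvPolynomial (Fin m) k) : tateLift f hf (p : TateAlg k m) = f p :=
  UniformSpace.Completion.extensionHom_coe _ _ _

theorem norm_tateLift_le (f : MvPolynomial (Fin m) k →+* A) (hf : ∀ p, ‖f p‖ ≤ ‖p‖)
    (t : TateAlg k m) : ‖tateLift f hf t‖ ≤ ‖t‖ := by
  induction t using UniformSpace.Completion.induction_on with
  | hp =>
    refine isClosed_le (Continuous.norm ?_) continuous_norm
    exact UniformSpace.Completion.continuous_extension
  | ih p =>
    rw [tateLift_coe, UniformSpace.Completion.norm_coe]
    exact hf p

end Extension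

theorem norm_eq_norm_of_norm_sub_lt {A : Type*} [SeminormedAddCommGroup A] [IsUltrametricDist A]
    {x y : A} (h : ‖x - y‖ < ‖x‖) : ‖y‖ = ‖x‖ := by
  have : ‖-(x - y)‖ ≠ ‖x‖ := by rw [norm_neg]; exact h.ne
  rw [show y = -(x - y) + x by abel, IsUltrametricDist.norm_add_eq_max_of_norm_ne_norm this, norm_neg,
    max_eq_right h.le]

/-- The Tate algebra in a positive number of variables is not a field. -/
theorem not_isField_tateAlg [CompleteSpace k] (s : ℕ) : ¬ IsField (TateAlg k (s + 1)) := by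
  intro h
  have hev : ∀ p : MvPolynomial (Fin (s + 1)) k, ‖MvPolynomial.eval 0 p‖ ≤ ‖p‖ := fun p => by
    rw [show MvPolynomial.eval 0 p = p.coeff 0 by
      rw [← MvPolynomial.constantCoeff_eq, ← MvPolynomial.eval_zero']; rfl]
    exact norm_coeff_le_gaussNorm p 0
  have hX : ((MvPolynomial.X 0 : MvPolynomial (Fin (s + 1)) k) : TateAlg k (s + 1)) ≠ 0 := by
    rw [← norm_pos_iff, UniformSpace.Completion.norm_coe, norm_pos_iff]
    exact MvPolynomial.X_ne_zero 0
  -- Evaluation at the origin would send the unit X_0 to zero.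
  obtain ⟨c, hc⟩ := h.mul_inv_cancel hX
  have := congrArg (tateLift (MvPolynomial.eval (0 : Fin (s + 1) → k)) hev) hc
  rw [map_mul, map_one, tateLift_coe, MvPolynomial.eval_X, Pi.zero_apply, zero_mul] at this
  exact zero_ne_one this

instance {m : ℕ} : NormOneClass (TateAlg k m) where
  norm_one := by
    rw [← UniformSpace.Completion.coe_one, UniformSpace.Completion.norm_coe, norm_one]

/-- Constants are dense, and they form a closed subset because k is complete and embeds
isometrically. -/
theorem exists_algebraMap_eq_tateAlg_zero [CompleteSpace k] (t : TateAlg k 0) :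
    ∃ a : k, algebraMap k (TateAlg k 0) a = t := by
  have hiso : Isometry (algebraMap k (TateAlg k 0)) := algebraMap_isometry k _
  induction t using UniformSpace.Completion.induction_on with
  | hp => exact hiso.isClosedEmbedding.isClosed_range
  | ih p =>
    refine ⟨p.coeff 0, ?_⟩
    rw [MvPolynomial.eq_C_of_isEmpty p, MvPolynomial.coeff_C, if_pos rfl]
    rfl

variable {m : ℕ} {A : Type*} [NormedCommRing A] [NormedAlgebra k A] [IsUltrametricDist A]
  [CompleteSpace A]

/-- A Banach `k`-algebra which is topologically generated by finitely many elements and is a field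
has finite dimension over `k`. -/
theorem finite_of_isField [CompleteSpace k] (hA : IsField A) (h1 : ‖(1 : A)‖ = 1)
    (π : MvPolynomial (Fin m) k →ₐ[k] A) (hπ : ∀ p, ‖π p‖ ≤ ‖p‖)
    (hdense : ∀ b : A, b ≠ 0 → ∀ δ : ℝ, 0 < δ → ∃ p, ‖p‖ ≤ (1 + δ) * ‖b‖ ∧ ‖b - π p‖ ≤ δ * ‖b‖) :
    Module.Finite k A := by
  obtain ⟨s, N, y, e, hspan, hind⟩ := exists_noether_normalization π hπ h1
  obtain ⟨ε, hε, hε1, happ⟩ := exists_uniform_error π hπ hspan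
  clear hspan
  have hyle : ∀ j, ‖π (intPoly (y j))‖ ≤ 1 := fun j => (hπ _).trans (norm_intPoly_le _)
  have hele : ∀ j, ‖π (intPoly (e j))‖ ≤ 1 := fun j => (hπ _).trans (norm_intPoly_le _)
  let θ₀ : MvPolynomial (Fin s) k →ₐ[k] A := MvPolynomial.aeval fun j => π (intPoly (y j))
  have hθ₀ : ∀ w, ‖θ₀ w‖ ≤ ‖w‖ := norm_aeval_le h1.le hyle
  have hθ₀int : ∀ w : MvPolynomial (Fin s) (intRing k),
      θ₀ (intPoly w) = π (intPoly (MvPolynomial.aeval y w)) := by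
    have : (θ₀ : MvPolynomial (Fin s) k →+* A).comp (MvPolynomial.map (algebraMap (intRing k) k)) =
        ((π : MvPolynomial (Fin m) k →+* A).comp
          (MvPolynomial.map (algebraMap (intRing k) k))).comp
            (MvPolynomial.aeval y).toRingHom := by
      refine MvPolynomial.ringHom_ext (fun a => ?_) fun j => ?_
      · simp [θ₀, MvPolynomial.algHom_C]
      · simp [θ₀, intPoly]
    intro w
    exact RingHom.congr_fun this w
  let θ : TateAlg k s →+* A := tateLift (θ₀ : MvPolynomial (Fin s) k →+* A) hθ₀
  have hθ : ∀ t, ‖θ t‖ ≤ ‖t‖ := norm_tateLift_le _ _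
  have hθcoe : ∀ p : MvPolynomial (Fin s) k, θ (p : TateAlg k s) = θ₀ p := tateLift_coe _ _
  -- A nonzero f in the kernel would be approximated by a polynomial p of the same norm with ‖θ₀ p‖
  -- < ‖p‖. Scaled to an integral polynomial, p has nonzero reduction, against `hind`.
  have hinj : Function.Injective θ := by
    rw [injective_iff_map_eq_zero]
    intro f hf
    by_contra hf0
    obtain ⟨p, hp⟩ := exists_norm_sub_coe_lt f (norm_pos_iff.2 hf0)
    have hpn : ‖p‖ = ‖f‖ := by
      rw [← UniformSpace.Completion.norm_coe]
      exact norm_eq_norm_of_norm_sub_lt hp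
    have hp0 : p ≠ 0 := by
      rw [← norm_pos_iff, hpn]
      exact norm_pos_iff.2 hf0
    obtain ⟨a, q, ha, hq, hq0⟩ := exists_smul_intPoly_eq p
    refine hq0 hp0 (hind q ?_)
    have hlt : ‖θ₀ p‖ < ‖p‖ := by
      rw [← hθcoe, show (p : TateAlg k s) = f - (f - p) by abel, map_sub, hf, zero_sub, norm_neg]
      exact (hθ _).trans_lt (hp.trans_eq hpn.symm)
    rw [← hθ₀int]
    have ha0 : 0 < ‖a‖ := by rw [ha]; exact norm_pos_iff.2 hp0
    rw [← ha, hq, map_smul, norm_smul] at hlt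
    exact lt_of_mul_lt_mul_left (by rwa [mul_one]) ha0.le
  let f : (Fin N → TateAlg k s) →+ A :=
    { toFun := fun W => ∑ l, θ (W l) * π (intPoly (e l))
      map_zero' := by simp
      map_add' := fun W W' => by simp [add_mul, Finset.sum_add_distrib] }
  have hfa : ∀ W, f W = ∑ l, θ (W l) * π (intPoly (e l)) := fun _ => rfl
  have hf : ∀ W, ‖f W‖ ≤ 1 * ‖W‖ := fun W => by
    rw [one_mul, hfa]
    refine IsUltrametricDist.norm_sum_le_of_forall_le_of_nonneg (norm_nonneg _) fun l _ => ?_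
    refine (norm_mul_le _ _).trans ((mul_le_of_le_one_right (norm_nonneg _) (hele l)).trans ?_)
    exact (hθ _).trans (norm_le_pi_norm W l)
  -- An element b is approximated by π p, and p, scaled to be integral, is expanded over the e l
  -- with error ε. With the tolerance (1 - ε)/2 in `hdense` the total relative error stays below (1
  -- + ε)/2, because (1 - ε)² ≥ 0.
  have hsurj : Function.Surjective f := by
    refine surjective_of_approx f (C := 1) (C' := 2) (ε := (1 + ε) / 2) (by linarith) (by linarith) hf
      fun b => ?_
    rcases eq_or_ne b 0 with rfl | hb
    · exact ⟨0, by simp, by simp⟩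
    have hbpos : 0 < ‖b‖ := norm_pos_iff.2 hb
    obtain ⟨p, hp, hbp⟩ := hdense b hb ((1 - ε) / 2) (by linarith)
    obtain ⟨a, q, ha, hq, _⟩ := exists_smul_intPoly_eq p
    obtain ⟨w, hw⟩ := happ q
    refine ⟨fun l => ((a • intPoly (w l) : MvPolynomial (Fin s) k) : TateAlg k s), ?_, ?_⟩
    · rw [pi_norm_le_iff_of_nonneg (by positivity)]
      intro l
      rw [UniformSpace.Completion.norm_coe]
      refine (norm_smul_le _ _).trans ((mul_le_of_le_one_right (norm_nonneg _)
        (norm_intPoly_le _)).trans ?_)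
      rw [ha]
      refine hp.trans ?_
      gcongr
      linarith
    · have hfe : b - f (fun l => ((a • intPoly (w l) : MvPolynomial (Fin s) k) : TateAlg k s)) =
          (b - π p) + a • π (intPoly (q - ∑ l, MvPolynomial.aeval y (w l) * e l)) := by
        have h2 : f (fun l => ((a • intPoly (w l) : MvPolynomial (Fin s) k) : TateAlg k s)) =
            a • ∑ l, π (intPoly (MvPolynomial.aeval y (w l))) * π (intPoly (e l)) := by
          rw [hfa, Finset.smul_sum]
          refine Finset.sum_congr rfl fun l _ => ?_
          rw [hθcoe, map_smul, hθ₀int, smul_mul_assoc]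
        rw [h2, hq, map_smul]
        simp only [intPoly, map_sub, map_sum, map_mul, smul_sub]
        abel
      rw [hfe]
      refine (IsUltrametricDist.norm_add_le_max _ _).trans (max_le ?_ ?_)
      · refine hbp.trans ?_
        gcongr
        linarith
      · refine (norm_smul_le _ _).trans ?_
        rw [ha]
        calc ‖p‖ * _ ≤ ((1 + (1 - ε) / 2) * ‖b‖) * ε := by gcongr
          _ = ((1 + (1 - ε) / 2) * ε) * ‖b‖ := by ring
          _ ≤ (1 + ε) / 2 * ‖b‖ := by
            gcongr
            nlinarith [sq_nonneg (1 - ε)]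
  let _ : Algebra (TateAlg k s) A := θ.toAlgebra
  have hfin : Module.Finite (TateAlg k s) A := by
    let g : (Fin N → TateAlg k s) →ₗ[TateAlg k s] A :=
      { toFun := f
        map_add' := f.map_add
        map_smul' := fun t W => by
          change ∑ l, θ (t * W l) * _ = θ t * ∑ l, θ (W l) * _
          rw [Finset.mul_sum]
          exact Finset.sum_congr rfl fun l _ => by rw [map_mul, mul_assoc] }
    exact Module.Finite.of_surjective g hsurj
  -- A is a field, integral over the injected Tate algebra, so the latter is a field too. This
  -- forces s = 0, and A is spanned over k by the images of the e l.
  have hfield : IsField (TateAlg k s) := isField_of_isIntegral_of_isField (S := A) hinj hA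
  obtain rfl : s = 0 := by
    rcases s with _ | s
    · rfl
    · exact absurd hfield (not_isField_tateAlg s)
  let g : (Fin N → k) →ₗ[k] A :=
    { toFun := fun c => ∑ l, c l • π (intPoly (e l))
      map_add' := fun c d => by simp [add_smul, Finset.sum_add_distrib]
      map_smul' := fun c d => by simp [Finset.smul_sum, mul_smul] }
  refine Module.Finite.of_surjective g fun b => ?_
  obtain ⟨W, hW⟩ := hsurj b
  choose c hc using fun l => exists_algebraMap_eq_tateAlg_zero (W l)
  refine ⟨c, ?_⟩
  rw [← hW, hfa]
  change ∑ l, c l • π (intPoly (e l)) = _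
  refine Finset.sum_congr rfl fun l _ => ?_
  rw [← hc l, show algebraMap k (TateAlg k 0) (c l) =
    ((algebraMap k (MvPolynomial (Fin 0) k) (c l) : MvPolynomial (Fin 0) k) : TateAlg k 0) from rfl,
    hθcoe, AlgHom.commutes, Algebra.smul_def]

end TateField

/-! ### The Nullstellensatz for the closed unit polydisc. -/

noncomputable section TatePoints

variable {k : Type*} [NontriviallyNormedField k] [IsUltrametricDist k] [CompleteSpace k] {m : ℕ}
variable {L : Type*} [NontriviallyNormedField L] [NormedAlgebra k L] [IsAlgClosed L]

instance {A : Type*} [NormedCommRing A] [IsUltrametricDist A] (I : Ideal A) :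
    IsUltrametricDist (A ⧸ I) :=
  IsUltrametricDist.isUltrametricDist_of_forall_norm_add_le_max_norm fun x y => by
    refine le_of_forall_pos_le_add fun ε hε => ?_
    obtain ⟨a, rfl, ha⟩ := Ideal.Quotient.norm_mk_lt x hε
    obtain ⟨b, rfl, hb⟩ := Ideal.Quotient.norm_mk_lt y hε
    rw [← map_add, ← max_add_add_right]
    exact (Ideal.Quotient.norm_mk_le _ _).trans
      ((IsUltrametricDist.norm_add_le_max _ _).trans (max_le_max ha.le hb.le))

/-- The closure of an ideal of the polynomial ring in the Tate algebra. -/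
def tateClosure (I : Ideal (MvPolynomial (Fin m) k)) : Ideal (TateAlg k m) where
  carrier := {t | ∀ ε : ℝ, 0 < ε → ∃ g ∈ I, ‖t - (g : TateAlg k m)‖ < ε}
  zero_mem' ε hε := ⟨0, I.zero_mem, by simpa using hε⟩
  add_mem' {a b} ha hb ε hε := by
    obtain ⟨g, hg, h⟩ := ha ε hε
    obtain ⟨g', hg', h'⟩ := hb ε hε
    refine ⟨g + g', I.add_mem hg hg', ?_⟩
    rw [UniformSpace.Completion.coe_add, add_sub_add_comm]
    exact (IsUltrametricDist.norm_add_le_max _ _).trans_lt (max_lt h h')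
  smul_mem' t a ha ε hε := by
    obtain ⟨g, hg, h⟩ := ha (ε / (‖t‖ + 1)) (by positivity)
    obtain ⟨p, hp⟩ := exists_norm_sub_coe_lt t (ε := ε / (‖g‖ + 1)) (by positivity)
    refine ⟨p * g, I.mul_mem_left p hg, ?_⟩
    rw [UniformSpace.Completion.coe_mul, smul_eq_mul,
      show t * a - (p : TateAlg k m) * g = t * (a - g) + (t - p) * g by ring]
    refine (IsUltrametricDist.norm_add_le_max _ _).trans_lt (max_lt ?_ ?_)
    · refine (norm_mul_le _ _).trans_lt ?_
      rw [lt_div_iff₀ (by positivity)] at h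
      nlinarith [norm_nonneg t, norm_nonneg (a - (g : TateAlg k m))]
    · refine (norm_mul_le _ _).trans_lt ?_
      rw [UniformSpace.Completion.norm_coe]
      rw [lt_div_iff₀ (by positivity)] at hp
      nlinarith [norm_nonneg g, norm_nonneg (t - (p : TateAlg k m))]

/-- A finite-dimensional normed domain over `k` has a point in `L` which does not increase the unit
ball. -/
theorem exists_algHom_norm_le_one (k : Type*) [NontriviallyNormedField k] [CompleteSpace k]
    [NormedAlgebra k L] {A : Type*} [NormedCommRing A] [NormedAlgebra k A] [IsDomain A]
    [Module.Finite k A] (h1 : ‖(1 : A)‖ ≤ 1) : ∃ ψ : A →ₐ[k] L, ∀ a, ‖a‖ ≤ 1 → ‖ψ a‖ ≤ 1 := by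
  let ψ : A →ₐ[k] L := IsAlgClosed.lift
  have hψ : ∃ C : ℝ, 0 ≤ C ∧ ∀ a, ‖ψ a‖ ≤ C * ‖a‖ :=
    ⟨_, norm_nonneg _, fun a => (LinearMap.toContinuousLinearMap ψ.toLinearMap).le_opNorm a⟩
  obtain ⟨C, hC0, hC⟩ := hψ
  refine ⟨ψ, fun a ha => ?_⟩
  -- The map ψ is bounded. If ‖ψ a‖ > 1 for some a in the unit ball, the powers of ψ a would be
  -- unbounded while those of a remain in the unit ball.
  by_contra hlt
  obtain ⟨d, hd⟩ := pow_unbounded_of_one_lt C (not_le.1 hlt)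
  have hpow : ‖a ^ d‖ ≤ 1 := by
    clear hd
    induction d with
    | zero => simpa using h1
    | succ d ih =>
      rw [pow_succ]
      exact (norm_mul_le _ _).trans (mul_le_one₀ ih (norm_nonneg _) ha)
  rw [← norm_pow, ← map_pow] at hd
  nlinarith [hC (a ^ d)]

/-- A form of the Nullstellensatz for the closed unit polydisc: polynomials without common zero
generate the unit ideal up to an error of Gauss norm less than one. -/
theorem exists_norm_one_sub_lt (I : Ideal (MvPolynomial (Fin m) k))
    (h : ∀ x : Fin m → L, (∀ i, ‖x i‖ ≤ 1) → ∃ p ∈ I, MvPolynomial.aeval x p ≠ 0) :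
    ∃ g ∈ I, ‖1 - g‖ < 1 := by
  by_contra hne
  push Not at hne
  have hJ : tateClosure I ≠ ⊤ := fun htop => by
    have h1 : (1 : TateAlg k m) ∈ tateClosure I := htop ▸ Submodule.mem_top
    obtain ⟨g, hg, hlt⟩ := h1 1 one_pos
    rw [← UniformSpace.Completion.coe_one, ← UniformSpace.Completion.coe_sub,
      UniformSpace.Completion.norm_coe] at hlt
    exact (hne g hg).not_gt hlt
  -- The residue field of M is finite over k by `finite_of_isField`, so it embeds in L. The images
  -- of the variables form a point of the unit polydisc at which all of I vanishes, against `h`.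
  obtain ⟨M, hM, hJM⟩ := Ideal.exists_le_maximal _ hJ
  have hone : ‖(1 : TateAlg k m ⧸ M)‖ = 1 := by
    refine le_antisymm ?_ ?_
    · calc ‖(1 : TateAlg k m ⧸ M)‖ = ‖Ideal.Quotient.mk M 1‖ := by rw [map_one]
        _ ≤ ‖(1 : TateAlg k m)‖ := Ideal.Quotient.norm_mk_le M 1
        _ = 1 := norm_one
    · have h1 := norm_mul_le (1 : TateAlg k m ⧸ M) 1
      rw [one_mul] at h1
      have h2 : 0 < ‖(1 : TateAlg k m ⧸ M)‖ := norm_pos_iff.2 one_ne_zero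
      nlinarith
  let coeAlg : MvPolynomial (Fin m) k →ₐ[k] TateAlg k m :=
    { UniformSpace.Completion.coeRingHom with commutes' := fun _ => rfl }
  have hcoe : ∀ p, coeAlg p = (p : TateAlg k m) := fun _ => rfl
  let π : MvPolynomial (Fin m) k →ₐ[k] TateAlg k m ⧸ M := (Ideal.Quotient.mkₐ k M).comp coeAlg
  have hπmk : ∀ p : MvPolynomial (Fin m) k, π p = Ideal.Quotient.mk M (p : TateAlg k m) :=
    fun _ => rfl
  have hπ : ∀ p, ‖π p‖ ≤ ‖p‖ := fun p => by
    rw [hπmk, ← UniformSpace.Completion.norm_coe p]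
    exact Ideal.Quotient.norm_mk_le _ _
  have hfield : IsField (TateAlg k m ⧸ M) := (Ideal.Quotient.maximal_ideal_iff_isField_quotient M).1 hM
  have hfin : Module.Finite k (TateAlg k m ⧸ M) := by
    refine finite_of_isField hfield hone π hπ fun b hb δ hδ => ?_
    have hbpos : 0 < ‖b‖ := norm_pos_iff.2 hb
    obtain ⟨t, rfl, ht⟩ := Ideal.Quotient.norm_mk_lt b (ε := δ * ‖b‖) (by positivity)
    obtain ⟨p, hp⟩ := exists_norm_sub_coe_lt t (ε := δ * ‖Ideal.Quotient.mk M t‖) (by positivity)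
    refine ⟨p, ?_, ?_⟩
    · rw [← UniformSpace.Completion.norm_coe p, show (p : TateAlg k m) = t + -(t - p) by abel]
      refine (IsUltrametricDist.norm_add_le_max _ _).trans (max_le (ht.le.trans (by linarith)) ?_)
      rw [norm_neg]
      exact hp.le.trans (by linarith)
    · rw [hπmk, ← map_sub]
      exact (Ideal.Quotient.norm_mk_le _ _).trans hp.le
  have hdom : IsDomain (TateAlg k m ⧸ M) := hfield.isDomain
  obtain ⟨ψ, hψ⟩ := exists_algHom_norm_le_one (L := L) k hone.le
  have hz : ∀ i, ‖ψ (π (MvPolynomial.X i))‖ ≤ 1 := fun i =>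
    hψ _ ((hπ _).trans (MvPolynomial.norm_X_le i))
  obtain ⟨p, hpI, hp⟩ := h (fun i => ψ (π (MvPolynomial.X i))) hz
  apply hp
  have : MvPolynomial.aeval (fun i => ψ (π (MvPolynomial.X i))) = ψ.comp π := by
    refine MvPolynomial.algHom_ext fun i => ?_
    simp
  rw [this, AlgHom.comp_apply, hπmk, Ideal.Quotient.eq_zero_iff_mem.2, map_zero]
  exact hJM fun ε hε => ⟨p, hpI, by simpa using hε⟩

end TatePoints

/-! ### Lower bounds for polynomials without zeros on a rational subset. -/

section MinimumModulus

variable {k : Type*} [NontriviallyNormedField k] [IsUltrametricDist k] [CompleteSpace k]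
variable {L : Type*} [NontriviallyNormedField L] [NormedAlgebra k L] [IsUltrametricDist L]
  [IsAlgClosed L]
variable {σ : Type*} [Finite σ]

/-- A polynomial without zeros on a rational subset is bounded below there. -/
theorem IsRational.exists_le_norm_aeval {R : Set (σ → L)} (hR : IsRational k R) (q : MvPolynomial σ k)
    (hq : ∀ x ∈ R, MvPolynomial.aeval x q ≠ 0) :
    ∃ η : ℝ, 0 < η ∧ ∀ x ∈ R, η ≤ ‖MvPolynomial.aeval x q‖ := by
  classical
  obtain ⟨c, δ, f₀, F, hc, hδ, rfl⟩ := hR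
  have hδ' : 0 < ‖δ‖ := norm_pos_iff.2 hδ
  -- The rational subset is realised as a zero locus in a unit polydisc: each f in F, and the
  -- constant δ (index `none`), gets a new variable w_f subject to f = f₀ w_f, while the old
  -- variables are scaled by c.
  obtain ⟨m, ⟨e⟩⟩ := Finite.exists_equiv_fin (σ ⊕ Option F)
  let S : MvPolynomial σ k →ₐ[k] MvPolynomial (Fin m) k :=
    MvPolynomial.aeval fun i => MvPolynomial.C c * MvPolynomial.X (e (Sum.inl i))
  have hS : ∀ (z : Fin m → L) (f : MvPolynomial σ k), MvPolynomial.aeval z (S f) =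
      MvPolynomial.aeval (fun i => algebraMap k L c * z (e (Sum.inl i))) f := by
    intro z f
    rw [← AlgHom.comp_apply, MvPolynomial.comp_aeval]
    simp [MvPolynomial.algHom_C]
  let num : Option F → MvPolynomial σ k := fun f => f.elim (MvPolynomial.C δ) Subtype.val
  let rel : Option F → MvPolynomial (Fin m) k := fun f =>
    S (num f) - S f₀ * MvPolynomial.X (e (Sum.inr f))
  obtain ⟨g, hg, hg1⟩ := exists_norm_one_sub_lt (L := L)
    (Ideal.span (Set.range rel) ⊔ Ideal.span {S q}) (by
      intro z hz
      by_contra hcon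
      push Not at hcon
      have hrel : ∀ f, MvPolynomial.aeval z (S (num f)) =
          MvPolynomial.aeval z (S f₀) * z (e (Sum.inr f)) := fun f => by
        have := hcon (rel f) (Ideal.mem_sup_left (Ideal.subset_span ⟨f, rfl⟩))
        rw [map_sub, map_mul, MvPolynomial.aeval_X, sub_eq_zero] at this
        exact this
      have hle : ∀ f, ‖MvPolynomial.aeval (fun i => algebraMap k L c * z (e (Sum.inl i))) (num f)‖ ≤
          ‖MvPolynomial.aeval (fun i => algebraMap k L c * z (e (Sum.inl i))) f₀‖ := fun f => by
        rw [← hS, hrel, norm_mul, hS]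
        exact mul_le_of_le_one_right (norm_nonneg _) (hz _)
      refine hq (fun i => algebraMap k L c * z (e (Sum.inl i))) ⟨fun i => ?_, ?_, fun f hf => ?_⟩ ?_
      · rw [norm_mul, norm_algebraMap']
        exact mul_le_of_le_one_right (norm_nonneg _) (hz _)
      · simpa [num, MvPolynomial.algHom_C, norm_algebraMap'] using hle none
      · exact hle (some ⟨f, hf⟩)
      · rw [← hS]
        exact hcon _ (Ideal.mem_sup_right (Ideal.mem_span_singleton_self _)))
  obtain ⟨g₀, hg₀, g₁, hg₁, rfl⟩ := Submodule.mem_sup.1 hg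
  obtain ⟨b, rfl⟩ := Ideal.mem_span_singleton'.1 hg₁
  -- At the point z lying over x the relations vanish, so b·q is within less than one of 1 and has
  -- norm one there. Hence ‖q(x)‖ is at least the inverse of any positive bound for b; the summand 1
  -- keeps that bound positive.
  refine ⟨(‖b‖ + 1)⁻¹, by positivity, fun x hx => ?_⟩
  obtain ⟨hx1, hx2, hx3⟩ := hx
  have hf0 : MvPolynomial.aeval x f₀ ≠ 0 := norm_pos_iff.1 (hδ'.trans_le hx2)
  let z : Fin m → L := fun j => Sum.elim (fun i => (algebraMap k L c)⁻¹ * x i)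
    (fun f => MvPolynomial.aeval x (num f) / MvPolynomial.aeval x f₀) (e.symm j)
  have hcL : algebraMap k L c ≠ 0 := by simpa using hc
  have hSz : ∀ f, MvPolynomial.aeval z (S f) = MvPolynomial.aeval x f := fun f => by
    rw [hS]
    congr 2
    funext i
    simp [z, hcL]
  have hz : ∀ j, ‖z j‖ ≤ 1 := fun j => by
    obtain ⟨j, rfl⟩ := e.surjective j
    simp only [z, Equiv.symm_apply_apply]
    rcases j with i | f
    · rw [Sum.elim_inl, norm_mul, norm_inv, norm_algebraMap',
        inv_mul_le_iff₀ (norm_pos_iff.2 hc), mul_one]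
      exact hx1 i
    · rw [Sum.elim_inr, norm_div, div_le_one (norm_pos_iff.2 hf0)]
      rcases f with _ | f
      · simpa [num, MvPolynomial.algHom_C, norm_algebraMap'] using hx2
      · exact hx3 _ f.2
  have hzg₀ : MvPolynomial.aeval z g₀ = 0 := by
    have hker : Ideal.span (Set.range rel) ≤ RingHom.ker (MvPolynomial.aeval z) := by
      rw [Ideal.span_le]
      rintro _ ⟨f, rfl⟩
      rw [SetLike.mem_coe, RingHom.mem_ker]
      simp only [rel, map_sub, map_mul, hSz, MvPolynomial.aeval_X]
      simp [z, mul_div_cancel₀, hf0]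
    exact hker hg₀
  have hlt := (norm_aeval_le (A := L) norm_one.le hz (1 - (g₀ + b * S q))).trans_lt hg1
  rw [map_sub, map_one, map_add, hzg₀, zero_add, map_mul, hSz] at hlt
  have h1 : ‖MvPolynomial.aeval z b * MvPolynomial.aeval x q‖ = 1 := by
    have := norm_eq_norm_of_norm_sub_lt (x := (1 : L)) (by rwa [norm_one])
    rwa [norm_one] at this
  rw [norm_mul] at h1
  have hb : ‖MvPolynomial.aeval z b‖ ≤ ‖b‖ := norm_aeval_le (A := L) norm_one.le hz b
  rw [inv_le_iff_one_le_mul₀ (by positivity), ← h1]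
  nlinarith [norm_nonneg (MvPolynomial.aeval x q)]

end MinimumModulus

/-! ### The algebra of uniform limits of rational functions. -/

section UniformLimits

variable {k : Type*} [NontriviallyNormedField k]
variable {L : Type*} [NontriviallyNormedField L] [NormedAlgebra k L]
variable {σ τ : Type*}

theorem IsUniformLimit.mono {R R' : Set (σ → L)} {f : (σ → L) → L} (h : IsUniformLimit k R f)
    (hR : R' ⊆ R) : IsUniformLimit k R' f := fun ε hε => by
  obtain ⟨p, q, hpq⟩ := h ε hε
  exact ⟨p, q, fun x hx => hpq x (hR hx)⟩

theorem IsUniformLimit.isAnalytic {R : Set (σ → L)} {f : (σ → L) → L} (h : IsUniformLimit k R f) :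
    IsAnalytic k R f := fun _ _ hsub => h.mono hsub

theorem IsUniformLimit.congr {R : Set (σ → L)} {f g : (σ → L) → L} (h : IsUniformLimit k R f)
    (hfg : ∀ x ∈ R, f x = g x) : IsUniformLimit k R g := fun ε hε => by
  obtain ⟨p, q, hpq⟩ := h ε hε
  exact ⟨p, q, fun x hx => hfg x hx ▸ hpq x hx⟩

theorem isUniformLimit_aeval (R : Set (σ → L)) (p : MvPolynomial σ k) :
    IsUniformLimit k R fun x => MvPolynomial.aeval x p := fun ε hε =>
  ⟨p, 1, fun x _ => by simp [hε.le]⟩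

theorem isUniformLimit_algebraMap (R : Set (σ → L)) (a : k) :
    IsUniformLimit k R fun _ => algebraMap k L a :=
  (isUniformLimit_aeval R (MvPolynomial.C a)).congr fun x _ => by rw [MvPolynomial.algHom_C]

theorem isUniformLimit_coord (R : Set (σ → L)) (c : σ) : IsUniformLimit k R fun x => x c :=
  (isUniformLimit_aeval R (MvPolynomial.X c)).congr fun x _ => by rw [MvPolynomial.aeval_X]

theorem isUniformLimit_zero (R : Set (σ → L)) : IsUniformLimit k R fun _ => 0 :=
  (isUniformLimit_algebraMap R 0).congr fun _ _ => map_zero _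

/-- Composition with a polynomial map. -/
theorem IsUniformLimit.comp_polynomial {R : Set (σ → L)} {f : (σ → L) → L}
    (h : IsUniformLimit k R f) (μ : σ → MvPolynomial τ k) {R' : Set (τ → L)}
    (hμ : ∀ x ∈ R', (fun i => MvPolynomial.aeval x (μ i)) ∈ R) :
    IsUniformLimit k R' fun x => f fun i => MvPolynomial.aeval x (μ i) := fun ε hε => by
  obtain ⟨p, q, hpq⟩ := h ε hε
  refine ⟨MvPolynomial.aeval μ p, MvPolynomial.aeval μ q, fun x hx => ?_⟩
  have key : ∀ p : MvPolynomial σ k, MvPolynomial.aeval x (MvPolynomial.aeval μ p) =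
      MvPolynomial.aeval (fun i => MvPolynomial.aeval x (μ i)) p := fun p => by
    rw [← AlgHom.comp_apply, MvPolynomial.comp_aeval]
  rw [key, key]
  exact hpq _ (hμ x hx)

theorem IsUniformLimit.neg {R : Set (σ → L)} {f : (σ → L) → L} (h : IsUniformLimit k R f) :
    IsUniformLimit k R fun x => - f x := fun ε hε => by
  obtain ⟨p, q, hpq⟩ := h ε hε
  refine ⟨-p, q, fun x hx => ⟨(hpq x hx).1, ?_⟩⟩
  rw [map_neg, neg_div, ← neg_sub_neg, neg_neg, neg_neg, norm_sub_rev]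
  exact (hpq x hx).2

variable [IsUltrametricDist L]

theorem IsUniformLimit.add {R : Set (σ → L)} {f g : (σ → L) → L} (hf : IsUniformLimit k R f)
    (hg : IsUniformLimit k R g) : IsUniformLimit k R fun x => f x + g x := fun ε hε => by
  obtain ⟨p, q, hpq⟩ := hf ε hε
  obtain ⟨p', q', hpq'⟩ := hg ε hε
  refine ⟨p * q' + q * p', q * q', fun x hx => ?_⟩
  obtain ⟨h1, h2⟩ := hpq x hx
  obtain ⟨h1', h2'⟩ := hpq' x hx
  refine ⟨by rw [map_mul]; exact mul_ne_zero h1 h1', ?_⟩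
  rw [map_add, map_mul, map_mul, map_mul, ← div_add_div _ _ h1 h1', add_sub_add_comm]
  exact (IsUltrametricDist.norm_add_le_max _ _).trans (max_le h2 h2')

theorem IsUniformLimit.sub {R : Set (σ → L)} {f g : (σ → L) → L} (hf : IsUniformLimit k R f)
    (hg : IsUniformLimit k R g) : IsUniformLimit k R fun x => f x - g x := by
  simpa [sub_eq_add_neg] using hf.add hg.neg

theorem IsUniformLimit.sum {ι : Type*} {R : Set (σ → L)} {f : ι → (σ → L) → L} (s : Finset ι)
    (hf : ∀ i ∈ s, IsUniformLimit k R (f i)) : IsUniformLimit k R fun x => ∑ i ∈ s, f i x := by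
  classical
  induction s using Finset.induction_on with
  | empty => simpa using isUniformLimit_zero R
  | insert i s hi ih =>
    simp only [Finset.sum_insert hi]
    exact (hf i (Finset.mem_insert_self _ _)).add (ih fun j hj => hf j (Finset.mem_insert_of_mem hj))

variable [IsUltrametricDist k] [CompleteSpace k] [IsAlgClosed L] [Finite σ]

theorem IsRational.exists_norm_ratio_le {R : Set (σ → L)} (hR : IsRational k R)
    (p q : MvPolynomial σ k) (hq : ∀ x ∈ R, MvPolynomial.aeval x q ≠ 0) :
    ∃ C : ℝ, 0 < C ∧ ∀ x ∈ R, ‖MvPolynomial.aeval x p / MvPolynomial.aeval x q‖ ≤ C := by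
  obtain ⟨η, hη, h⟩ := hR.exists_le_norm_aeval q hq
  obtain ⟨c, δ, f₀, F, hc, hδ, rfl⟩ := hR
  obtain ⟨C, hC, hp⟩ := exists_norm_aeval_le (L := L) p c
  refine ⟨C / η, by positivity, fun x hx => ?_⟩
  rw [norm_div]
  gcongr
  · exact (hp x hx.1).1
  · exact h x hx

theorem IsUniformLimit.exists_norm_le {R : Set (σ → L)} (hR : IsRational k R) {f : (σ → L) → L}
    (hf : IsUniformLimit k R f) : ∃ C : ℝ, 0 < C ∧ ∀ x ∈ R, ‖f x‖ ≤ C := by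
  obtain ⟨p, q, hpq⟩ := hf 1 one_pos
  obtain ⟨C, hC, h⟩ := hR.exists_norm_ratio_le p q fun x hx => (hpq x hx).1
  refine ⟨max 1 C, by positivity, fun x hx => ?_⟩
  rw [← sub_add_cancel (f x) (MvPolynomial.aeval x p / MvPolynomial.aeval x q)]
  exact (IsUltrametricDist.norm_add_le_max _ _).trans (max_le_max (hpq x hx).2 (h x hx))

/-- Uniform limits multiply only when the factors are bounded, and that rests on the minimum modulus
estimate for the denominators. -/
theorem IsUniformLimit.mul {R : Set (σ → L)} (hR : IsRational k R) {f g : (σ → L) → L}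
    (hf : IsUniformLimit k R f) (hg : IsUniformLimit k R g) :
    IsUniformLimit k R fun x => f x * g x := fun ε hε => by
  obtain ⟨C, hC, hfC⟩ := hf.exists_norm_le hR
  obtain ⟨C', hC', hgC⟩ := hg.exists_norm_le hR
  -- Accuracy at most C makes the approximant of f inherit its bound C.
  obtain ⟨p, q, hpq⟩ := hf (min C (ε / max C' C)) (by positivity)
  obtain ⟨p', q', hpq'⟩ := hg (ε / max C' C) (by positivity)
  refine ⟨p * p', q * q', fun x hx => ?_⟩
  obtain ⟨h1, h2⟩ := hpq x hx
  obtain ⟨h1', h2'⟩ := hpq' x hx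
  refine ⟨by rw [map_mul]; exact mul_ne_zero h1 h1', ?_⟩
  rw [map_mul, map_mul, mul_div_mul_comm]
  set a := MvPolynomial.aeval x p / MvPolynomial.aeval x q
  set b := MvPolynomial.aeval x p' / MvPolynomial.aeval x q'
  have ha : ‖a‖ ≤ C := by
    rw [show a = -(f x - a) + f x by ring]
    refine (IsUltrametricDist.norm_add_le_max _ _).trans (max_le ?_ (hfC x hx))
    rw [norm_neg]
    exact h2.trans (min_le_left _ _)
  rw [show f x * g x - a * b = (f x - a) * g x + a * (g x - b) by ring]
  refine (IsUltrametricDist.norm_add_le_max _ _).trans (max_le ?_ ?_)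
  · rw [norm_mul]
    calc _ ≤ ε / max C' C * max C' C := by
          gcongr
          · exact h2.trans (min_le_right _ _)
          · exact (hgC x hx).trans (le_max_left _ _)
      _ = ε := div_mul_cancel₀ _ (by positivity)
  · rw [norm_mul]
    calc _ ≤ max C' C * (ε / max C' C) := by
          gcongr
          exact ha.trans (le_max_right _ _)
      _ = ε := mul_div_cancel₀ _ (by positivity)

end UniformLimits

/-! ### Matrices of such functions. -/

section MatrixLimits

variable {k : Type*} [NontriviallyNormedField k]
variable {L : Type*} [NontriviallyNormedField L] [NormedAlgebra k L]
variable {σ : Type*} {l m n : Type*}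

/-- Matrices of elements of the affinoid algebra of `R`. -/
def IsUniformLimitMat (k : Type*) [NontriviallyNormedField k] {L : Type*} [NontriviallyNormedField L]
    [NormedAlgebra k L] {σ m n : Type*} (R : Set (σ → L)) (f : (σ → L) → Matrix m n L) : Prop :=
  ∀ a b, IsUniformLimit k R fun x => f x a b

theorem IsAnalyticMat.isUniformLimitMat {S R : Set (σ → L)} {f : (σ → L) → Matrix m n L}
    (h : IsAnalyticMat k S f) (hR : IsRational k R) (hRS : R ⊆ S) : IsUniformLimitMat k R f :=
  fun a b => h a b R hR hRS

theorem IsUniformLimitMat.isAnalyticMat {R : Set (σ → L)} {f : (σ → L) → Matrix m n L}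
    (h : IsUniformLimitMat k R f) : IsAnalyticMat k R f := fun a b => (h a b).isAnalytic

theorem IsUniformLimitMat.mono {R R' : Set (σ → L)} {f : (σ → L) → Matrix m n L}
    (h : IsUniformLimitMat k R f) (hR : R' ⊆ R) : IsUniformLimitMat k R' f :=
  fun a b => (h a b).mono hR

theorem IsUniformLimitMat.neg {R : Set (σ → L)} {f : (σ → L) → Matrix m n L}
    (h : IsUniformLimitMat k R f) : IsUniformLimitMat k R fun x => -f x := fun a b => (h a b).neg

variable [IsUltrametricDist L]

theorem IsUniformLimitMat.add {R : Set (σ → L)} {f g : (σ → L) → Matrix m n L}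
    (hf : IsUniformLimitMat k R f) (hg : IsUniformLimitMat k R g) :
    IsUniformLimitMat k R fun x => f x + g x := fun a b => (hf a b).add (hg a b)

variable [IsUltrametricDist k] [CompleteSpace k] [IsAlgClosed L] [Finite σ] [Fintype m]

theorem IsUniformLimitMat.mul {R : Set (σ → L)} (hR : IsRational k R) {f : (σ → L) → Matrix l m L}
    {g : (σ → L) → Matrix m n L} (hf : IsUniformLimitMat k R f) (hg : IsUniformLimitMat k R g) :
    IsUniformLimitMat k R fun x => f x * g x := fun a b => by
  simp only [Matrix.mul_apply]
  exact IsUniformLimit.sum _ fun i _ => (hf a i).mul hR (hg i b)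

theorem IsUniformLimitMat.smul {R : Set (σ → L)} (hR : IsRational k R) {f : (σ → L) → L}
    {g : (σ → L) → Matrix l n L} (hf : IsUniformLimit k R f) (hg : IsUniformLimitMat k R g) :
    IsUniformLimitMat k R fun x => f x • g x := fun a b => hf.mul hR (hg a b)

end MatrixLimits

open Filter Topology

/-! ### Partial derivatives of rational functions and of limits. -/

section Derivatives

variable {k : Type*} [NontriviallyNormedField k]
variable {L : Type*} [NontriviallyNormedField L] [NormedAlgebra k L]
variable {σ : Type*} [DecidableEq σ]

/-- The partial derivative of a function of several variables. -/
noncomputable def pd (c : σ) (f : (σ → L) → L) (x : σ → L) : L :=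
  deriv (fun s => f (Function.update x c s)) (x c)

/-- The restriction of `f` to the line through `x` in the direction `c` is differentiable. -/
def PDiff (c : σ) (f : (σ → L) → L) (x : σ → L) : Prop :=
  DifferentiableAt L (fun s => f (Function.update x c s)) (x c)

theorem partialD_apply {m n : Type*} (c : σ) (F : (σ → L) → Matrix m n L) (x : σ → L) (a : m) (b : n) :
    partialD c F x a b = pd c (fun x => F x a b) x := rfl

theorem PDiff.hasDerivAt {c : σ} {f : (σ → L) → L} {x : σ → L} (h : PDiff c f x) :
    HasDerivAt (fun s => f (Function.update x c s)) (pd c f x) (x c) :=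
  DifferentiableAt.hasDerivAt h

theorem pd_sub {c : σ} {f g : (σ → L) → L} {x : σ → L} (hf : PDiff c f x) (hg : PDiff c g x) :
    pd c (fun x => f x - g x) x = pd c f x - pd c g x := deriv_fun_sub hf hg

theorem pd_neg {c : σ} {f : (σ → L) → L} {x : σ → L} :
    pd c (fun x => -f x) x = -pd c f x := deriv.fun_neg

theorem pd_mul {c : σ} {f g : (σ → L) → L} {x : σ → L} (hf : PDiff c f x) (hg : PDiff c g x) :
    pd c (fun x => f x * g x) x = pd c f x * g x + f x * pd c g x := by
  have := deriv_fun_mul hf hg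
  simpa [pd, Function.update_eq_self] using this

theorem PDiff.mul {c : σ} {f g : (σ → L) → L} {x : σ → L} (hf : PDiff c f x) (hg : PDiff c g x) :
    PDiff c (fun x => f x * g x) x := DifferentiableAt.fun_mul hf hg

theorem pd_sum {ι : Type*} {c : σ} {f : ι → (σ → L) → L} {x : σ → L} (s : Finset ι)
    (hf : ∀ i ∈ s, PDiff c (f i) x) : pd c (fun x => ∑ i ∈ s, f i x) x = ∑ i ∈ s, pd c (f i) x :=
  deriv_fun_sum hf

/-- Partial derivatives depend only on the germ of the function. -/
theorem pd_congr {c : σ} {f g : (σ → L) → L} {x : σ → L} (h : ∀ᶠ y in 𝓝 x, f y = g y) :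
    pd c f x = pd c g x := by
  refine Filter.EventuallyEq.deriv_eq ?_
  have hcont : Tendsto (fun s => Function.update x c s) (𝓝 (x c)) (𝓝 x) := by
    have : Continuous fun s => Function.update x c s := continuous_const.update c continuous_id
    simpa [Function.update_eq_self] using this.tendsto (x c)
  exact hcont.eventually h

theorem hasDerivAt_aeval_update (c : σ) (p : MvPolynomial σ k) (x : σ → L) (s : L) :
    HasDerivAt (fun s => MvPolynomial.aeval (Function.update x c s) p)
      (MvPolynomial.aeval (Function.update x c s) (MvPolynomial.pderiv c p)) s := by
  induction p using MvPolynomial.induction_on with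
  | C a => simpa [MvPolynomial.algHom_C] using hasDerivAt_const s (algebraMap k L a)
  | add p q hp hq => simpa using hp.fun_add hq
  | mul_X p i hp =>
    have hX : HasDerivAt (fun s => MvPolynomial.aeval (Function.update x c s)
        (MvPolynomial.X i : MvPolynomial σ k))
        (MvPolynomial.aeval (Function.update x c s) (MvPolynomial.pderiv c (MvPolynomial.X i : MvPolynomial σ k))) s := by
      rcases eq_or_ne i c with rfl | h
      · simpa using hasDerivAt_id' s
      · simpa [h, MvPolynomial.pderiv_X_of_ne h.symm] using hasDerivAt_const s (x i)
    have := hp.fun_mul hX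
    simp only [Derivation.leibniz, map_mul, map_add, smul_eq_mul]
    exact this.congr_deriv (by ring)

/-- Numerator of the derivative of a rational function. -/
noncomputable def ratioDeriv (c : σ) (p q : MvPolynomial σ k) : MvPolynomial σ k :=
  MvPolynomial.pderiv c p * q - p * MvPolynomial.pderiv c q

theorem hasDerivAt_ratio (c : σ) (p q : MvPolynomial σ k) (x : σ → L)
    (hq : MvPolynomial.aeval x q ≠ 0) :
    HasDerivAt (fun s => MvPolynomial.aeval (Function.update x c s) p /
        MvPolynomial.aeval (Function.update x c s) q)
      (MvPolynomial.aeval x (ratioDeriv c p q) / MvPolynomial.aeval x (q ^ 2)) (x c) := by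
  have h := (hasDerivAt_aeval_update c p x (x c)).fun_div (hasDerivAt_aeval_update c q x (x c))
    (by rwa [Function.update_eq_self])
  simpa [ratioDeriv, Function.update_eq_self] using h

/-- Differentiation of a limit, with a uniform Lipschitz control of the error. -/
theorem hasDerivAt_of_lipschitz_limit {f : L → L} {h : ℕ → L → L} {h' : ℕ → L} {d s₀ : L} {ε : ℕ → ℝ}
    (hε : Tendsto ε atTop (𝓝 0)) (hd : Tendsto h' atTop (𝓝 d))
    (hh : ∀ m, HasDerivAt (h m) (h' m) s₀)
    (hlip : ∀ m, ∀ᶠ s in 𝓝 s₀, ‖(f s - h m s) - (f s₀ - h m s₀)‖ ≤ ε m * ‖s - s₀‖) :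
    HasDerivAt f d s₀ := by
  rw [hasDerivAt_iff_isLittleO, Asymptotics.isLittleO_iff]
  intro η hη
  have h1 : ∀ᶠ m in atTop, ε m < η / 3 := hε.eventually (gt_mem_nhds (by positivity))
  have h2 : ∀ᶠ m in atTop, ‖h' m - d‖ < η / 3 := by
    have := (tendsto_iff_norm_sub_tendsto_zero.1 hd).eventually
      (gt_mem_nhds (show (0 : ℝ) < η / 3 by positivity))
    exact this
  obtain ⟨m, hm1, hm2⟩ := (h1.and h2).exists
  have h3 := (Asymptotics.isLittleO_iff.1 (hasDerivAt_iff_isLittleO.1 (hh m)))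
    (show (0 : ℝ) < η / 3 by positivity)
  filter_upwards [h3, hlip m] with s hs3 hs4
  have e : f s - f s₀ - (s - s₀) • d = ((f s - h m s) - (f s₀ - h m s₀)) +
      (h m s - h m s₀ - (s - s₀) • h' m) + (s - s₀) • (h' m - d) := by
    simp only [smul_eq_mul]
    ring
  rw [e]
  refine (norm_add₃_le).trans ?_
  rw [norm_smul]
  have h5 : ε m * ‖s - s₀‖ ≤ η / 3 * ‖s - s₀‖ := by gcongr
  have h6 : ‖s - s₀‖ * ‖h' m - d‖ ≤ ‖s - s₀‖ * (η / 3) := by gcongr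
  linarith

section Residue

variable [Finite σ] [Algebra.IsAlgebraic k L] [CompleteSpace k]

/-- A Cauchy net of elements of the field generated by the coordinates of a point converges. -/
theorem exists_tendsto_of_mem_adjoin {ι : Type*} [Preorder ι] (x : σ → L) {u : ι → L}
    (hu : ∀ i, u i ∈ IntermediateField.adjoin k (Set.range x)) (h : CauchySeq u) :
    ∃ d, Tendsto u atTop (𝓝 d) := by
  -- L need not be complete, but k(x) has finite degree over the complete field k and is therefore
  -- complete.
  have : FiniteDimensional k (IntermediateField.adjoin k (Set.range x)) := by
    have := (Set.finite_range x).to_subtype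
    exact IntermediateField.finiteDimensional_adjoin fun y _ =>
      (Algebra.IsAlgebraic.isAlgebraic y).isIntegral
  have hc : IsComplete ((IntermediateField.adjoin k (Set.range x)).toSubalgebra.toSubmodule : Set L) :=
    Submodule.complete_of_finiteDimensional (𝕜 := k) _
  obtain ⟨d, _, hd⟩ := cauchySeq_tendsto_of_isComplete hc hu h
  exact ⟨d, hd⟩

theorem aeval_mem_adjoin (x : σ → L) (p : MvPolynomial σ k) :
    MvPolynomial.aeval x p ∈ IntermediateField.adjoin k (Set.range x) := by
  have h : MvPolynomial.aeval x p ∈ (MvPolynomial.aeval x : MvPolynomial σ k →ₐ[k] L).range := ⟨p, rfl⟩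
  rw [← Algebra.adjoin_range_eq_range_aeval] at h
  exact IntermediateField.algebra_adjoin_le_adjoin k _ h

end Residue

end Derivatives

/-! ### Restriction of polynomials to lines. -/

section Slices

variable {k : Type*} [NontriviallyNormedField k]
variable {L : Type*} [NontriviallyNormedField L] [NormedAlgebra k L]
variable {σ : Type*}

/-- The restriction of a polynomial to the line through `x` with direction `v`. -/
noncomputable def slice (x v : σ → L) : MvPolynomial σ k →ₐ[k] Polynomial L :=
  MvPolynomial.aeval fun i => Polynomial.C (x i) + Polynomial.C (v i) * Polynomial.X

theorem eval_slice (x v : σ → L) (p : MvPolynomial σ k) (s : L) :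
    (slice x v p).eval s = MvPolynomial.aeval (fun i => x i + v i * s) p := by
  induction p using MvPolynomial.induction_on with
  | C a => simp [slice, MvPolynomial.algHom_C]
  | add p q hp hq => rw [map_add, Polynomial.eval_add, hp, hq, map_add]
  | mul_X p i hp => rw [map_mul, Polynomial.eval_mul, hp, map_mul]; simp [slice]

theorem eval_slice_single [DecidableEq σ] (x : σ → L) (c : σ) (p : MvPolynomial σ k) (s : L) :
    (slice x (Pi.single c 1) p).eval s =
      MvPolynomial.aeval (Function.update x c (x c + s)) p := by
  rw [eval_slice]
  congr 2
  funext i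
  rcases eq_or_ne i c with rfl | h
  · simp
  · simp [h]

end Slices

/-! ### Differentiability and Cauchy estimates for uniform limits. -/

section UniformLimits

variable {k : Type*} [NontriviallyNormedField k]
variable {L : Type*} [NontriviallyNormedField L] [NormedAlgebra k L]
variable {σ : Type*} [DecidableEq σ]
variable [IsUltrametricDist L] [NormNatOne L] [IsAlgClosed L]

/-- `R` contains with each of its points a polydisc of radius `‖ρ‖`. -/
def HasMargin (R : Set (σ → L)) (ρ : k) : Prop :=
  ρ ≠ 0 ∧ ∀ x ∈ R, ∀ h ∈ (polydisc k ρ : Set (σ → L)), x + h ∈ R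

theorem HasMargin.update_mem {R : Set (σ → L)} {ρ : k} (hρ : HasMargin R ρ) (c : σ) {x : σ → L}
    (hx : x ∈ R) {s : L} (hs : ‖s‖ ≤ ‖ρ‖) : Function.update x c (x c + s) ∈ R := by
  have := hρ.2 x hx (Pi.single c s) fun i => by
    rcases eq_or_ne i c with rfl | h
    · simpa using hs
    · simp [h]
  convert this using 1
  funext i
  rcases eq_or_ne i c with rfl | h
  · simp
  · simp [h]

/-- Functions in the affinoid algebra are Lipschitz, with a constant that depends only on the
supremum norm. -/
theorem IsUniformLimit.norm_update_sub_le {R : Set (σ → L)} {ρ : k} (hρ : HasMargin R ρ)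
    {f : (σ → L) → L} (hf : IsUniformLimit k R f) {C : ℝ} (hC : 0 < C) (hfC : ∀ x ∈ R, ‖f x‖ ≤ C)
    (c : σ) {x : σ → L} (hx : x ∈ R) {s : L} (hs : ‖s‖ ≤ ‖ρ‖) :
    ‖f (Function.update x c (x c + s)) - f x‖ ≤ C * ‖s‖ / ‖ρ‖ := by
  refine le_of_forall_gt_imp_ge_of_dense fun b hb => ?_
  have hb0 : 0 < b := lt_of_le_of_lt (by positivity) hb
  -- Accuracy C lets the ratio inherit the bound C, so the estimate for rational functions on the
  -- line applies; accuracy b makes passing from f to the ratio cost at most b, which exceeds the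
  -- claimed bound by as little as desired.
  obtain ⟨p, q, hpq⟩ := hf (min b C) (lt_min hb0 hC)
  have hmem : ∀ s : L, ‖s‖ ≤ ‖algebraMap k L ρ‖ → Function.update x c (x c + s) ∈ R := fun s hs =>
    hρ.update_mem c hx (by rwa [norm_algebraMap'] at hs)
  have hle : ∀ y ∈ R, ‖MvPolynomial.aeval y p / MvPolynomial.aeval y q‖ ≤ C := fun y hy => by
    rw [show MvPolynomial.aeval y p / MvPolynomial.aeval y q =
      -(f y - MvPolynomial.aeval y p / MvPolynomial.aeval y q) + f y by ring]
    refine (IsUltrametricDist.norm_add_le_max _ _).trans (max_le ?_ (hfC y hy))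
    rw [norm_neg]
    exact (hpq y hy).2.trans (min_le_right _ _)
  have key := norm_ratio_sub_le (slice x (Pi.single c 1) p) (slice x (Pi.single c 1) q)
    (algebraMap k L ρ) (by simpa using hρ.1) (C := C)
    (fun s hs => by rw [eval_slice_single]; exact (hpq _ (hmem s hs)).1)
    (fun s hs => by rw [eval_slice_single, eval_slice_single]; exact hle _ (hmem s hs))
    (s := s) (by rwa [norm_algebraMap'])
  simp only [eval_slice_single, add_zero, Function.update_eq_self, norm_algebraMap'] at key
  set y := Function.update x c (x c + s)
  have hy : y ∈ R := hρ.update_mem c hx hs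
  rw [show f y - f x = (f y - MvPolynomial.aeval y p / MvPolynomial.aeval y q) +
    (MvPolynomial.aeval y p / MvPolynomial.aeval y q - MvPolynomial.aeval x p / MvPolynomial.aeval x q)
    + -(f x - MvPolynomial.aeval x p / MvPolynomial.aeval x q) by ring]
  refine (IsUltrametricDist.norm_add_le_max _ _).trans (max_le
    ((IsUltrametricDist.norm_add_le_max _ _).trans (max_le ?_ ?_)) ?_)
  · exact (hpq y hy).2.trans (min_le_left _ _)
  · exact key.trans hb.le
  · rw [norm_neg]
    exact (hpq x hx).2.trans (min_le_left _ _)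

theorem IsUniformLimit.eventually_norm_sub_le {R : Set (σ → L)} {ρ : k} (hρ : HasMargin R ρ)
    {f : (σ → L) → L} (hf : IsUniformLimit k R f) {C : ℝ} (hC : 0 < C) (hfC : ∀ x ∈ R, ‖f x‖ ≤ C)
    (c : σ) {x : σ → L} (hx : x ∈ R) :
    ∀ᶠ s in 𝓝 (x c), ‖f (Function.update x c s) - f (Function.update x c (x c))‖ ≤
      C / ‖ρ‖ * ‖s - x c‖ := by
  filter_upwards [Metric.closedBall_mem_nhds (x c) (norm_pos_iff.2 hρ.1)] with s hs
  rw [mem_closedBall_iff_norm] at hs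
  have := hf.norm_update_sub_le hρ hC hfC c hx hs
  rw [add_sub_cancel] at this
  rw [Function.update_eq_self]
  exact this.trans (le_of_eq (by ring))

theorem norm_deriv_le_of_eventually {f : L → L} {f' x₀ : L} (hf : HasDerivAt f f' x₀) {C : ℝ}
    (hC : 0 ≤ C) (h : ∀ᶠ x in 𝓝 x₀, ‖f x - f x₀‖ ≤ C * ‖x - x₀‖) : ‖f'‖ ≤ C := by
  simpa using hf.hasFDerivAt.le_of_lip' hC h

theorem IsUniformLimit.norm_pd_le {R : Set (σ → L)} {ρ : k} (hρ : HasMargin R ρ)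
    {f : (σ → L) → L} (hf : IsUniformLimit k R f) {C : ℝ} (hC : 0 < C) (hfC : ∀ x ∈ R, ‖f x‖ ≤ C)
    (c : σ) {x : σ → L} (hx : x ∈ R) (hd : PDiff c f x) : ‖pd c f x‖ ≤ C / ‖ρ‖ :=
  norm_deriv_le_of_eventually hd.hasDerivAt (by positivity) (hf.eventually_norm_sub_le hρ hC hfC c hx)

theorem isUniformLimit_ratio {R : Set (σ → L)} {p q : MvPolynomial σ k}
    (hq : ∀ x ∈ R, MvPolynomial.aeval x q ≠ 0) :
    IsUniformLimit k R fun x => MvPolynomial.aeval x p / MvPolynomial.aeval x q :=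
  fun _ hε => ⟨p, q, fun x hx => ⟨hq x hx, by simpa using hε.le⟩⟩

theorem pd_ratio (c : σ) (p q : MvPolynomial σ k) {x : σ → L} (hq : MvPolynomial.aeval x q ≠ 0) :
    pd c (fun x => MvPolynomial.aeval x p / MvPolynomial.aeval x q) x =
      MvPolynomial.aeval x (ratioDeriv c p q) / MvPolynomial.aeval x (q ^ 2) :=
  (hasDerivAt_ratio c p q x hq).deriv

theorem pdiff_ratio (c : σ) (p q : MvPolynomial σ k) {x : σ → L} (hq : MvPolynomial.aeval x q ≠ 0) :
    PDiff c (fun x => MvPolynomial.aeval x p / MvPolynomial.aeval x q) x :=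
  (hasDerivAt_ratio c p q x hq).differentiableAt

variable [Finite σ] [Algebra.IsAlgebraic k L] [CompleteSpace k]

/-- By the Lipschitz estimate, uniformly close approximants have close derivatives. These form a
Cauchy sequence in k(x), which converges, and the same estimate identifies its limit as the
derivative of f. -/
theorem HasMargin.pDiff {R : Set (σ → L)} {ρ : k} (hρ : HasMargin R ρ) {f : (σ → L) → L}
    (hf : IsUniformLimit k R f) (c : σ) {x : σ → L} (hx : x ∈ R) : PDiff c f x := by
  choose p q hpq using fun m : ℕ => hf (1 / (m + 1)) Nat.one_div_pos_of_nat
  set h : ℕ → (σ → L) → L := fun m x => MvPolynomial.aeval x (p m) / MvPolynomial.aeval x (q m) with hh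
  have hrat : ∀ m, IsUniformLimit k R (h m) := fun m => isUniformLimit_ratio fun x hx => (hpq m x hx).1
  have hder : ∀ m, HasDerivAt (fun s => h m (Function.update x c s)) (pd c (h m) x) (x c) := fun m =>
    (pdiff_ratio c (p m) (q m) (hpq m x hx).1).hasDerivAt
  have hρ' : 0 < ‖ρ‖ := norm_pos_iff.2 hρ.1
  have hcau : CauchySeq fun m => pd c (h m) x := by
    refine cauchySeq_of_le_tendsto_0 (fun m : ℕ => 1 / ((m : ℝ) + 1) / ‖ρ‖) (fun m l N hm hl => ?_) ?_
    · rw [dist_eq_norm]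
      have hsub : ∀ y ∈ R, ‖h m y - h l y‖ ≤ 1 / ((N : ℝ) + 1) := fun y hy => by
        rw [show h m y - h l y = (f y - h l y) + -(f y - h m y) by ring]
        refine (IsUltrametricDist.norm_add_le_max _ _).trans (max_le ?_ ?_)
        · exact (hpq l y hy).2.trans (Nat.one_div_le_one_div hl)
        · rw [norm_neg]
          exact (hpq m y hy).2.trans (Nat.one_div_le_one_div hm)
      exact norm_deriv_le_of_eventually ((hder m).fun_sub (hder l)) (by positivity)
        (((hrat m).sub (hrat l)).eventually_norm_sub_le hρ Nat.one_div_pos_of_nat hsub c hx)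
    · simpa using (tendsto_one_div_add_atTop_nhds_zero_nat (𝕜 := ℝ)).div_const ‖ρ‖
  obtain ⟨d, hd⟩ := exists_tendsto_of_mem_adjoin x (fun m => by
    rw [pd_ratio c (p m) (q m) (hpq m x hx).1]
    exact div_mem (aeval_mem_adjoin x _) (aeval_mem_adjoin x _)) hcau
  refine (hasDerivAt_of_lipschitz_limit (f := fun s => f (Function.update x c s))
    (h := fun m s => h m (Function.update x c s)) (ε := fun m : ℕ => 1 / ((m : ℝ) + 1) / ‖ρ‖)
    (by simpa using (tendsto_one_div_add_atTop_nhds_zero_nat (𝕜 := ℝ)).div_const ‖ρ‖) hd hder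
    fun m => ?_).differentiableAt
  exact (hf.sub (hrat m)).eventually_norm_sub_le hρ Nat.one_div_pos_of_nat
    (fun y hy => (hpq m y hy).2) c hx

theorem IsUniformLimit.pDiff {R : Set (σ → L)} (hR : IsRational k R) {f : (σ → L) → L}
    (hf : IsUniformLimit k R f) (c : σ) {x : σ → L} (hx : x ∈ R) : PDiff c f x := by
  obtain ⟨ρ, hρ⟩ := hR.exists_add_mem
  exact HasMargin.pDiff hρ hf c hx

theorem HasMargin.norm_pd_le {R : Set (σ → L)} {ρ : k} (hρ : HasMargin R ρ) {f : (σ → L) → L}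
    (hf : IsUniformLimit k R f) {C : ℝ} (hC : 0 < C) (hfC : ∀ x ∈ R, ‖f x‖ ≤ C)
    (c : σ) {x : σ → L} (hx : x ∈ R) : ‖pd c f x‖ ≤ C / ‖ρ‖ :=
  hf.norm_pd_le hρ hC hfC c hx (hρ.pDiff hf c hx)

/-- The Cauchy estimate applied to f - p/q shows that the derivatives of the approximants converge
uniformly, at the price of a factor ‖ρ‖⁻¹. -/
theorem IsUniformLimit.pd {R : Set (σ → L)} (hR : IsRational k R) {f : (σ → L) → L}
    (hf : IsUniformLimit k R f) (c : σ) : IsUniformLimit k R (pd c f) := by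
  obtain ⟨ρ, hρ⟩ := hR.exists_add_mem
  change HasMargin R ρ at hρ
  have hρ' : 0 < ‖ρ‖ := norm_pos_iff.2 hρ.1
  intro ε hε
  obtain ⟨p, q, hpq⟩ := hf (ε * ‖ρ‖) (by positivity)
  refine ⟨ratioDeriv c p q, q ^ 2, fun x hx => ⟨?_, ?_⟩⟩
  · rw [map_pow]
    exact pow_ne_zero _ (hpq x hx).1
  · have hrat : IsUniformLimit k R fun x => MvPolynomial.aeval x p / MvPolynomial.aeval x q :=
      isUniformLimit_ratio fun x hx => (hpq x hx).1
    rw [← pd_ratio c p q (hpq x hx).1, ← pd_sub (hf.pDiff hR c hx) (hrat.pDiff hR c hx)]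
    refine (hρ.norm_pd_le (hf.sub hrat) (by positivity) (fun y hy => (hpq y hy).2) c hx).trans ?_
    rw [mul_div_cancel_right₀ _ hρ'.ne']

/-- The commutator of two derivations is a derivation, and this one kills the variables. -/
theorem pderiv_comm (c d : σ) (p : MvPolynomial σ k) :
    MvPolynomial.pderiv c (MvPolynomial.pderiv d p) = MvPolynomial.pderiv d (MvPolynomial.pderiv c p) := by
  have : ⁅(MvPolynomial.pderiv c : Derivation k (MvPolynomial σ k) (MvPolynomial σ k)),
      (MvPolynomial.pderiv d : Derivation k (MvPolynomial σ k) (MvPolynomial σ k))⁆ = 0 := by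
    refine MvPolynomial.derivation_ext fun i => ?_
    simp only [Derivation.commutator_apply, MvPolynomial.pderiv_X, Derivation.zero_apply, Pi.single_apply]
    split_ifs <;> simp
  have h := DFunLike.congr_fun this p
  rw [Derivation.commutator_apply, Derivation.zero_apply] at h
  exact sub_eq_zero.1 h

/-- Partial derivatives commute. -/
theorem IsUniformLimit.pd_comm {R : Set (σ → L)} (hR : IsRational k R) {f : (σ → L) → L}
    (hf : IsUniformLimit k R f) (c d : σ) {x : σ → L} (hx : x ∈ R) :
    RigidAn.pd c (RigidAn.pd d f) x = RigidAn.pd d (RigidAn.pd c f) x := by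
  obtain ⟨ρ, hρ⟩ := hR.exists_add_mem
  change HasMargin R ρ at hρ
  have hρ' : 0 < ‖ρ‖ := norm_pos_iff.2 hρ.1
  have approx : ∀ ε : ℝ, 0 < ε → ∀ p q : MvPolynomial σ k, (∀ x ∈ R, MvPolynomial.aeval x q ≠ 0 ∧
      ‖f x - MvPolynomial.aeval x p / MvPolynomial.aeval x q‖ ≤ ε) → ∀ c d : σ,
      ‖RigidAn.pd c (RigidAn.pd d f) x - MvPolynomial.aeval x (ratioDeriv c (ratioDeriv d p q) (q ^ 2)) /
        MvPolynomial.aeval x ((q ^ 2) ^ 2)‖ ≤ ε / ‖ρ‖ / ‖ρ‖ := by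
    intro ε hε p q hpq c d
    have hq : ∀ x ∈ R, MvPolynomial.aeval x (q ^ 2) ≠ 0 := fun x hx => by
      rw [map_pow]
      exact pow_ne_zero _ (hpq x hx).1
    have hrat : IsUniformLimit k R fun x => MvPolynomial.aeval x p / MvPolynomial.aeval x q :=
      isUniformLimit_ratio fun x hx => (hpq x hx).1
    have hrat' : IsUniformLimit k R fun x => MvPolynomial.aeval x (ratioDeriv d p q) /
      MvPolynomial.aeval x (q ^ 2) := isUniformLimit_ratio hq
    rw [← pd_ratio c _ _ (hq x hx), ← pd_sub ((hf.pd hR d).pDiff hR c hx) (hrat'.pDiff hR c hx)]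
    refine hρ.norm_pd_le ((hf.pd hR d).sub hrat') (by positivity) (fun y hy => ?_) c hx
    rw [← pd_ratio d p q (hpq y hy).1, ← pd_sub (hf.pDiff hR d hy) (hrat.pDiff hR d hy)]
    exact hρ.norm_pd_le (hf.sub hrat) hε (fun y hy => (hpq y hy).2) d hy
  refine sub_eq_zero.1 (norm_le_zero_iff.1 (le_of_forall_gt_imp_ge_of_dense fun b hb => ?_))
  -- Each of the two differentiations divides the error by ‖ρ‖.
  obtain ⟨p, q, hpq⟩ := hf (b * ‖ρ‖ * ‖ρ‖) (by positivity)
  have h1 := approx _ (by positivity) p q hpq c d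
  have h2 := approx _ (by positivity) p q hpq d c
  have e : ratioDeriv c (ratioDeriv d p q) (q ^ 2) = ratioDeriv d (ratioDeriv c p q) (q ^ 2) := by
    simp only [ratioDeriv, map_sub, Derivation.leibniz, smul_eq_mul, Derivation.leibniz_pow,
      pderiv_comm c d p, pderiv_comm c d q, nsmul_eq_mul]
    ring
  rw [e] at h1
  rw [mul_div_cancel_right₀ _ hρ'.ne', mul_div_cancel_right₀ _ hρ'.ne'] at h1 h2
  rw [← sub_sub_sub_cancel_right _ _ (MvPolynomial.aeval x (ratioDeriv d (ratioDeriv c p q) (q ^ 2)) /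
        MvPolynomial.aeval x ((q ^ 2) ^ 2)), sub_eq_add_neg]
  refine (IsUltrametricDist.norm_add_le_max _ _).trans (max_le h1 ?_)
  rwa [norm_neg]

end UniformLimits

/-! ### Convergent power series and the functions they represent. -/

section Series

variable {k : Type*} [NontriviallyNormedField k]
variable {L : Type*} [NontriviallyNormedField L] [NormedAlgebra k L]
variable {σ : Type*}

/-- The value at `x` of the monomial with exponent `ℓ`. -/
def mon (x : σ → L) (ℓ : σ →₀ ℕ) : L := ℓ.prod fun i e => x i ^ e

theorem mon_zero (x : σ → L) : mon x 0 = 1 := Finsupp.prod_zero_index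

theorem mon_add (x : σ → L) (ℓ ℓ' : σ →₀ ℕ) : mon x (ℓ + ℓ') = mon x ℓ * mon x ℓ' := by
  classical
  exact Finsupp.prod_add_index' (fun _ => pow_zero _) fun _ _ _ => pow_add _ _ _

theorem norm_mon_le {c : k} {x : σ → L} (hx : x ∈ polydisc k c) (ℓ : σ →₀ ℕ) :
    ‖mon x ℓ‖ ≤ ‖c‖ ^ ℓ.degree := by
  rw [mon, Finsupp.prod, norm_prod, Finsupp.degree_apply, ← Finset.prod_pow_eq_pow_sum]
  refine Finset.prod_le_prod (fun _ _ => norm_nonneg _) fun i _ => ?_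
  rw [norm_pow]
  exact pow_le_pow_left₀ (norm_nonneg _) (hx i) _

/-- The coefficients of `f` satisfy the Cauchy estimates with radius `‖c‖` and bound `C`. -/
def CauchyBound (f : MvPowerSeries σ k) (c : k) (C : ℝ) : Prop :=
  ∀ ℓ, ‖MvPowerSeries.coeff ℓ f‖ * ‖c‖ ^ ℓ.degree ≤ C

theorem CauchyBound.mono {f : MvPowerSeries σ k} {c c' : k} {C C' : ℝ} (h : CauchyBound f c C)
    (hc : ‖c'‖ ≤ ‖c‖) (hC : C ≤ C') : CauchyBound f c' C' := fun ℓ =>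
  (by gcongr : _ ≤ _).trans ((h ℓ).trans hC)

theorem CauchyBound.nonneg {f : MvPowerSeries σ k} {c : k} {C : ℝ} (h : CauchyBound f c C) : 0 ≤ C :=
  (by positivity : (0 : ℝ) ≤ _).trans (h 0)

/-- The power series `f` has a positive radius of convergence. -/
def Conv (f : MvPowerSeries σ k) : Prop := ∃ c : k, c ≠ 0 ∧ ∃ C : ℝ, CauchyBound f c C

/-- The terms of the power series `f` at the point `x`. -/
noncomputable def term (f : MvPowerSeries σ k) (x : σ → L) (ℓ : σ →₀ ℕ) : L :=
  algebraMap k L (MvPowerSeries.coeff ℓ f) * mon x ℓ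

/-- The partial sums of a power series. -/
noncomputable def partialPoly (f : MvPowerSeries σ k) (F : Finset (σ →₀ ℕ)) : MvPolynomial σ k :=
  ∑ ℓ ∈ F, MvPolynomial.monomial ℓ (MvPowerSeries.coeff ℓ f)

theorem aeval_partialPoly (f : MvPowerSeries σ k) (F : Finset (σ →₀ ℕ)) (x : σ → L) :
    MvPolynomial.aeval x (partialPoly f F) = ∑ ℓ ∈ F, term f x ℓ := by
  simp only [partialPoly, map_sum, MvPolynomial.aeval_monomial]
  rfl

theorem coeff_partialPoly (f : MvPowerSeries σ k) {F : Finset (σ →₀ ℕ)} {ℓ : σ →₀ ℕ} (h : ℓ ∈ F) :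
    (partialPoly f F).coeff ℓ = MvPowerSeries.coeff ℓ f := by
  classical
  rw [partialPoly, MvPolynomial.coeff_sum, Finset.sum_eq_single ℓ]
  · rw [MvPolynomial.coeff_monomial, if_pos rfl]
  · exact fun m _ hm => by rw [MvPolynomial.coeff_monomial, if_neg hm]
  · exact fun h' => absurd h h'

/-- `f` is the power series expansion at `0` of the function `g`. -/
def HasSer (g : (σ → L) → L) (f : MvPowerSeries σ k) : Prop :=
  Conv f ∧ ∀ᶠ x in 𝓝 0, HasSum (term f x) (g x)

theorem HasSer.congr {g g' : (σ → L) → L} {f : MvPowerSeries σ k} (h : HasSer g f)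
    (hg : ∀ᶠ x in 𝓝 0, g x = g' x) : HasSer g' f :=
  ⟨h.1, (h.2.and hg).mono fun _ hx => hx.2 ▸ hx.1⟩

theorem hasSum_term_coe (p : MvPolynomial σ k) (x : σ → L) :
    HasSum (term (p : MvPowerSeries σ k) x) (MvPolynomial.aeval x p) := by
  have e : MvPolynomial.aeval x p = ∑ ℓ ∈ p.support, term (p : MvPowerSeries σ k) x ℓ := by
    conv_lhs => rw [p.as_sum]
    simp only [map_sum, MvPolynomial.aeval_monomial, term, MvPolynomial.coeff_coe]
    rfl
  rw [e]
  refine hasSum_sum_of_ne_finset_zero fun ℓ hℓ => ?_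
  rw [term, MvPolynomial.coeff_coe, MvPolynomial.notMem_support_iff.1 hℓ, map_zero, zero_mul]

theorem conv_coe (p : MvPolynomial σ k) : Conv (p : MvPowerSeries σ k) := by
  refine ⟨1, one_ne_zero, ∑ ℓ ∈ p.support, ‖p.coeff ℓ‖, fun ℓ => ?_⟩
  rw [norm_one, one_pow, mul_one, MvPolynomial.coeff_coe]
  by_cases h : ℓ ∈ p.support
  · exact Finset.single_le_sum (f := fun ℓ => ‖p.coeff ℓ‖) (fun _ _ => norm_nonneg _) h
  · rw [MvPolynomial.notMem_support_iff.1 h, norm_zero]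
    exact Finset.sum_nonneg fun _ _ => norm_nonneg _

theorem hasSer_coe (p : MvPolynomial σ k) :
    HasSer (fun x : σ → L => MvPolynomial.aeval x p) (p : MvPowerSeries σ k) :=
  ⟨conv_coe p, Eventually.of_forall fun x => hasSum_term_coe p x⟩

theorem hasSer_algebraMap (a : k) :
    HasSer (fun _ : σ → L => algebraMap k L a) (MvPowerSeries.C a) := by
  have := hasSer_coe (L := L) (MvPolynomial.C a : MvPolynomial σ k)
  rw [MvPolynomial.coe_C] at this
  exact this.congr (Eventually.of_forall fun x => MvPolynomial.algHom_C _ _)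

theorem hasSer_zero : HasSer (fun _ : σ → L => 0) (0 : MvPowerSeries σ k) := by
  simpa using hasSer_algebraMap (σ := σ) (L := L) (0 : k)

theorem hasSer_one : HasSer (fun _ : σ → L => 1) (1 : MvPowerSeries σ k) := by
  simpa using hasSer_algebraMap (σ := σ) (L := L) (1 : k)

theorem hasSer_X (i : σ) : HasSer (fun x : σ → L => x i) (MvPowerSeries.X i : MvPowerSeries σ k) := by
  have := hasSer_coe (L := L) (MvPolynomial.X i : MvPolynomial σ k)
  rw [MvPolynomial.coe_X] at this
  exact this.congr (Eventually.of_forall fun x => MvPolynomial.aeval_X _ _)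

theorem exists_norm_le_norm {c c' : k} (hc : c ≠ 0) (hc' : c' ≠ 0) :
    ∃ d : k, d ≠ 0 ∧ ‖d‖ ≤ ‖c‖ ∧ ‖d‖ ≤ ‖c'‖ := by
  rcases le_total ‖c‖ ‖c'‖ with h | h
  · exact ⟨c, hc, le_rfl, h⟩
  · exact ⟨c', hc', h, le_rfl⟩

theorem CauchyBound.neg {f : MvPowerSeries σ k} {c : k} {C : ℝ} (h : CauchyBound f c C) :
    CauchyBound (-f) c C := fun ℓ => by
  rw [map_neg, norm_neg]
  exact h ℓ

theorem Conv.neg {f : MvPowerSeries σ k} (h : Conv f) : Conv (-f) := by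
  obtain ⟨c, hc, C, h⟩ := h
  exact ⟨c, hc, C, h.neg⟩

theorem HasSer.neg {g : (σ → L) → L} {f : MvPowerSeries σ k} (h : HasSer g f) :
    HasSer (fun x => -g x) (-f) :=
  ⟨h.1.neg, h.2.mono fun x hx => by
    have e : term (-f) x = fun ℓ => -term f x ℓ := funext fun ℓ => by
      rw [term, term, map_neg, map_neg, neg_mul]
    exact e ▸ hx.neg⟩

section Ultrametric

variable [IsUltrametricDist k]

theorem CauchyBound.add {f f' : MvPowerSeries σ k} {c : k} {C : ℝ} (h : CauchyBound f c C)
    (h' : CauchyBound f' c C) : CauchyBound (f + f') c C := fun ℓ => by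
  rw [map_add]
  calc _ ≤ max ‖MvPowerSeries.coeff ℓ f‖ ‖MvPowerSeries.coeff ℓ f'‖ * ‖c‖ ^ ℓ.degree := by
        gcongr
        exact IsUltrametricDist.norm_add_le_max _ _
    _ ≤ C := by
        rw [max_mul_of_nonneg _ _ (by positivity)]
        exact max_le (h ℓ) (h' ℓ)

theorem CauchyBound.mul {f f' : MvPowerSeries σ k} {c : k} {C C' : ℝ} (h : CauchyBound f c C)
    (h' : CauchyBound f' c C') : CauchyBound (f * f') c (C * C') := fun ℓ => by
  classical
  have h0 := h.nonneg
  have h0' := h'.nonneg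
  have : ‖c ^ ℓ.degree‖ = ‖c‖ ^ ℓ.degree := norm_pow _ _
  rw [MvPowerSeries.coeff_mul, ← this, ← norm_mul, Finset.sum_mul]
  refine IsUltrametricDist.norm_sum_le_of_forall_le_of_nonneg (by positivity) fun p hp => ?_
  rw [← Finset.HasAntidiagonal.mem_antidiagonal.1 hp, norm_mul, norm_mul, norm_pow, map_add, pow_add,
    mul_mul_mul_comm]
  exact mul_le_mul (h _) (h' _) (by positivity) h0

theorem Conv.add {f f' : MvPowerSeries σ k} (h : Conv f) (h' : Conv f') : Conv (f + f') := by
  obtain ⟨c, hc, C, h⟩ := h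
  obtain ⟨c', hc', C', h'⟩ := h'
  obtain ⟨d, hd, hdc, hdc'⟩ := exists_norm_le_norm hc hc'
  exact ⟨d, hd, _, (h.mono hdc (le_max_left C C')).add (h'.mono hdc' (le_max_right C C'))⟩

theorem Conv.mul {f f' : MvPowerSeries σ k} (h : Conv f) (h' : Conv f') : Conv (f * f') := by
  obtain ⟨c, hc, C, h⟩ := h
  obtain ⟨c', hc', C', h'⟩ := h'
  obtain ⟨d, hd, hdc, hdc'⟩ := exists_norm_le_norm hc hc'
  exact ⟨d, hd, _, (h.mono hdc le_rfl).mul (h'.mono hdc' le_rfl)⟩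

theorem HasSer.add {g g' : (σ → L) → L} {f f' : MvPowerSeries σ k} (h : HasSer g f)
    (h' : HasSer g' f') : HasSer (fun x => g x + g' x) (f + f') :=
  ⟨h.1.add h'.1, (h.2.and h'.2).mono fun x hx => by
    convert hx.1.add hx.2 using 2
    rw [term, term, term, map_add, map_add, add_mul]⟩

theorem HasSer.sub {g g' : (σ → L) → L} {f f' : MvPowerSeries σ k} (h : HasSer g f)
    (h' : HasSer g' f') : HasSer (fun x => g x - g' x) (f - f') := by
  simpa [sub_eq_add_neg] using h.add h'.neg

theorem HasSer.sum {ι : Type*} {g : ι → (σ → L) → L} {f : ι → MvPowerSeries σ k} (s : Finset ι)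
    (h : ∀ i ∈ s, HasSer (g i) (f i)) : HasSer (fun x => ∑ i ∈ s, g i x) (∑ i ∈ s, f i) := by
  classical
  induction s using Finset.induction_on with
  | empty => simpa using hasSer_zero
  | insert i s hi ih =>
    simp only [Finset.sum_insert hi]
    exact (h i (Finset.mem_insert_self _ _)).add (ih fun j hj => h j (Finset.mem_insert_of_mem hj))

variable [IsUltrametricDist L]

instance nonarchimedeanRing_of_isUltrametricDist : NonarchimedeanRing L where
  is_nonarchimedean := NonarchimedeanAddGroup.is_nonarchimedean

/-- In the ultrametric setting the product of two summable families is summable without absolute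
convergence, so it may be summed along antidiagonals. -/
theorem hasSum_term_mul {f f' : MvPowerSeries σ k} {x : σ → L} {a a' : L} (h : HasSum (term f x) a)
    (h' : HasSum (term f' x) a') : HasSum (term (f * f') x) (a * a') := by
  classical
  have hm := h.summable.mul_of_nonarchimedean h'.summable
  have e : term (f * f') x = fun ℓ => ∑ p ∈ Finset.HasAntidiagonal.antidiagonal ℓ,
      term f x p.1 * term f' x p.2 := by
    funext ℓ
    rw [term, MvPowerSeries.coeff_mul, map_sum, Finset.sum_mul]
    refine Finset.sum_congr rfl fun p hp => ?_
    rw [← Finset.HasAntidiagonal.mem_antidiagonal.1 hp, mon_add, map_mul, term, term,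
      mul_mul_mul_comm]
  rw [e, ← h.tsum_eq, ← h'.tsum_eq,
    h.summable.tsum_mul_tsum_eq_tsum_sum_antidiagonal h'.summable hm]
  exact (summable_sum_mul_antidiagonal_of_summable_mul hm).hasSum

theorem HasSer.mul {g g' : (σ → L) → L} {f f' : MvPowerSeries σ k} (h : HasSer g f)
    (h' : HasSer g' f') : HasSer (fun x => g x * g' x) (f * f') :=
  ⟨h.1.mul h'.1, (h.2.and h'.2).mono fun _ hx => hasSum_term_mul hx.1 hx.2⟩

end Ultrametric

end Series

/-! ### Approximation, uniqueness and termwise differentiation of power series. -/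

section Convergence

variable {k : Type*} [NontriviallyNormedField k]
variable {L : Type*} [NontriviallyNormedField L] [NormedAlgebra k L]
variable {σ : Type*} [Finite σ]

theorem norm_term_le {f : MvPowerSeries σ k} {c d : k} {C : ℝ} (h : CauchyBound f c C) (hc : c ≠ 0)
    {x : σ → L} (hx : x ∈ polydisc k d) (ℓ : σ →₀ ℕ) :
    ‖term f x ℓ‖ ≤ C * (‖d‖ / ‖c‖) ^ ℓ.degree := by
  have hc' : 0 < ‖c‖ := norm_pos_iff.2 hc
  rw [term, norm_mul, norm_algebraMap', div_pow, mul_div_assoc', le_div_iff₀ (by positivity)]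
  calc _ ≤ ‖MvPowerSeries.coeff ℓ f‖ * ‖d‖ ^ ℓ.degree * ‖c‖ ^ ℓ.degree := by
        gcongr
        exact norm_mon_le hx ℓ
    _ = ‖MvPowerSeries.coeff ℓ f‖ * ‖c‖ ^ ℓ.degree * ‖d‖ ^ ℓ.degree := by ring
    _ ≤ _ := by gcongr; exact h ℓ

theorem exists_pow_mul_le {C θ ε : ℝ} (hθ : 0 ≤ θ) (hθ1 : θ < 1) (hε : 0 < ε) :
    ∃ N : ℕ, ∀ m, N ≤ m → C * θ ^ m ≤ ε := by
  have := (tendsto_pow_atTop_nhds_zero_of_lt_one hθ hθ1).const_mul C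
  rw [mul_zero] at this
  obtain ⟨N, hN⟩ := eventually_atTop.1 (this.eventually (ge_mem_nhds hε))
  exact ⟨N, hN⟩

variable [IsUltrametricDist L]

/-- The ultrametric inequality bounds the tail by its largest term. -/
theorem norm_sub_partialPoly_le {f : MvPowerSeries σ k} {x : σ → L} {a : L} (h : HasSum (term f x) a)
    {F : Finset (σ →₀ ℕ)} {ε : ℝ} (hε : 0 ≤ ε) (hF : ∀ ℓ, ℓ ∉ F → ‖term f x ℓ‖ ≤ ε) :
    ‖a - MvPolynomial.aeval x (partialPoly f F)‖ ≤ ε := by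
  classical
  rw [aeval_partialPoly]
  have h' : Tendsto (fun s => ‖∑ ℓ ∈ s, term f x ℓ - ∑ ℓ ∈ F, term f x ℓ‖) atTop
      (𝓝 ‖a - ∑ ℓ ∈ F, term f x ℓ‖) :=
    (Tendsto.sub_const (show Tendsto (fun s => ∑ ℓ ∈ s, term f x ℓ) atTop (𝓝 a) from h) _).norm
  refine le_of_tendsto h' ?_
  filter_upwards [eventually_ge_atTop F] with s hs
  rw [← Finset.sum_sdiff hs, add_sub_cancel_right]
  exact IsUltrametricDist.norm_sum_le_of_forall_le_of_nonneg hε fun ℓ hℓ =>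
    hF ℓ (Finset.mem_sdiff.1 hℓ).2

/-- Partial sums approximate the sum uniformly on a small polydisc. -/
theorem CauchyBound.exists_finset {f : MvPowerSeries σ k} {c d : k} {C : ℝ} (h : CauchyBound f c C)
    (hd : ‖d‖ < ‖c‖) {ε : ℝ} (hε : 0 < ε) : ∃ F₀ : Finset (σ →₀ ℕ), ∀ F, F₀ ⊆ F →
      ∀ x ∈ (polydisc k d : Set (σ → L)), ∀ a : L, HasSum (term f x) a →
        ‖a - MvPolynomial.aeval x (partialPoly f F)‖ ≤ ε := by
  have hc : c ≠ 0 := norm_pos_iff.1 ((norm_nonneg d).trans_lt hd)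
  have hc' : 0 < ‖c‖ := norm_pos_iff.2 hc
  obtain ⟨N, hN⟩ := exists_pow_mul_le (by positivity) ((div_lt_one hc').2 hd) hε
  refine ⟨(Finsupp.finite_of_degree_le (σ := σ) N).toFinset, fun F hF x hx a ha =>
    norm_sub_partialPoly_le ha hε.le fun ℓ hℓ => (norm_term_le h hc hx ℓ).trans (hN _ ?_)⟩
  by_contra hlt
  exact hℓ (hF (by simpa using (not_le.1 hlt).le))

theorem exists_lt_norm (k : Type*) [NontriviallyNormedField k] {c : k} (hc : c ≠ 0) {ε : ℝ}
    (hε : 0 < ε) : ∃ d : k, d ≠ 0 ∧ ‖d‖ < ‖c‖ ∧ ‖d‖ ≤ ε := by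
  obtain ⟨d, h, h'⟩ := NormedField.exists_norm_lt k (lt_min (norm_pos_iff.2 hc) hε)
  exact ⟨d, norm_pos_iff.1 h, h'.trans_le (min_le_left _ _), (h'.trans_le (min_le_right _ _)).le⟩

/-- The radius `c₀` is fixed before the accuracy ε, so one polydisc serves for all approximations.
-/
theorem HasSer.exists_approx {g : (σ → L) → L} {f : MvPowerSeries σ k} (h : HasSer g f) :
    ∃ c₀ : k, c₀ ≠ 0 ∧ ∀ d : k, ‖d‖ ≤ ‖c₀‖ → ∀ ε : ℝ, 0 < ε → ∃ F₀ : Finset (σ →₀ ℕ), ∀ F, F₀ ⊆ F →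
      ∀ x ∈ (polydisc k d : Set (σ → L)), ‖g x - MvPolynomial.aeval x (partialPoly f F)‖ ≤ ε := by
  obtain ⟨⟨c, hc, C, hb⟩, hs⟩ := h
  obtain ⟨d₁, hd₁, -, hsub⟩ := exists_polydisc_subset k hs one_pos
  obtain ⟨d, hd, hdc, hdd⟩ := exists_lt_norm k hc (norm_pos_iff.2 hd₁)
  refine ⟨d, hd, fun d' hd' ε hε => ?_⟩
  obtain ⟨F₀, hF₀⟩ := hb.exists_finset (L := L) (hd'.trans_lt hdc) hε
  exact ⟨F₀, fun F hF x hx => hF₀ F hF x hx _ (hsub (polydisc_mono (hd'.trans hdd) hx))⟩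

/-- The sum of a convergent power series belongs to the affinoid algebra of a small polydisc. -/
theorem HasSer.exists_isUniformLimit {g : (σ → L) → L} {f : MvPowerSeries σ k} (h : HasSer g f) :
    ∃ c₀ : k, c₀ ≠ 0 ∧ ∀ d : k, ‖d‖ ≤ ‖c₀‖ → IsUniformLimit k (polydisc k d : Set (σ → L)) g := by
  obtain ⟨c₀, hc₀, happ⟩ := h.exists_approx
  refine ⟨c₀, hc₀, fun d hd ε hε => ?_⟩
  obtain ⟨F, hF⟩ := happ d hd ε hε
  exact ⟨partialPoly f F, 1, fun x hx => by simpa using hF F subset_rfl x hx⟩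

variable [NormNatOne L]

/-- The Gauss norm of a polynomial over `k` is its supremum over the points of the polydisc. -/
theorem norm_coeff_le_of_forall_norm_aeval_le (p : MvPolynomial σ k) (c : k) {C : ℝ}
    (h : ∀ x ∈ (polydisc k c : Set (σ → L)), ‖MvPolynomial.aeval x p‖ ≤ C) (ℓ : σ →₀ ℕ) :
    ‖p.coeff ℓ‖ * ‖c‖ ^ ℓ.degree ≤ C := by
  have := norm_coeff_le_of_forall_norm_eval_le (MvPolynomial.map (algebraMap k L) p)
    (algebraMap k L c) (C := C) (fun x hx => by
      rw [MvPolynomial.eval_map, ← MvPolynomial.aeval_def]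
      exact h x fun i => by simpa [norm_algebraMap'] using hx i) ℓ
  simpa [MvPolynomial.coeff_map, norm_algebraMap'] using this

/-- The power series expansion is unique. -/
theorem HasSer.eq_zero {g : (σ → L) → L} {f : MvPowerSeries σ k} (h : HasSer g f)
    (hg : ∀ᶠ x in 𝓝 0, g x = 0) : f = 0 := by
  classical
  obtain ⟨c₀, hc₀, happ⟩ := h.exists_approx
  obtain ⟨d₁, hd₁, -, hsub⟩ := exists_polydisc_subset k hg one_pos
  obtain ⟨d, hd, hdc, hdd⟩ := exists_norm_le_norm hc₀ hd₁
  ext ℓ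
  rw [map_zero, ← norm_le_zero_iff]
  have hpos : 0 < ‖d‖ ^ ℓ.degree := pow_pos (norm_pos_iff.2 hd) _
  refine le_of_mul_le_mul_right ?_ hpos
  rw [zero_mul]
  refine le_of_forall_gt_imp_ge_of_dense fun ε hε => ?_
  obtain ⟨F, hF⟩ := happ d hdc ε hε
  -- The index ℓ is added to F so that the partial sum surely carries the coefficient to be bounded.
  have := norm_coeff_le_of_forall_norm_aeval_le (L := L) (partialPoly f (insert ℓ F)) d
    (C := ε) (fun x hx => by
      have := hF (insert ℓ F) (Finset.subset_insert _ _) x hx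
      rwa [hsub (polydisc_mono hdd hx), zero_sub, norm_neg] at this) ℓ
  rwa [coeff_partialPoly f (Finset.mem_insert_self _ _)] at this

theorem HasSer.unique [IsUltrametricDist k] {g g' : (σ → L) → L} {f f' : MvPowerSeries σ k} (h : HasSer g f)
    (h' : HasSer g' f') (hg : ∀ᶠ x in 𝓝 0, g x = g' x) : f = f' :=
  sub_eq_zero.1 ((h.sub h').eq_zero (hg.mono fun x hx => by rw [hx, sub_self]))

theorem HasSer.eventually_eq {g g' : (σ → L) → L} {f : MvPowerSeries σ k} (h : HasSer g f)
    (h' : HasSer g' f) : ∀ᶠ x in 𝓝 0, g x = g' x :=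
  (h.2.and h'.2).mono fun _ hx => hx.1.unique hx.2

theorem HasSer.apply_zero {g : (σ → L) → L} {f : MvPowerSeries σ k} (h : HasSer g f) :
    g 0 = algebraMap k L (MvPowerSeries.constantCoeff f) := by
  refine h.2.self_of_nhds.unique ?_
  have : term f (0 : σ → L) 0 = algebraMap k L (MvPowerSeries.constantCoeff f) := by
    rw [term, mon_zero, mul_one, MvPowerSeries.coeff_zero_eq_constantCoeff_apply]
  rw [← this]
  refine hasSum_single 0 fun ℓ hℓ => ?_
  obtain ⟨i, hi⟩ := Finsupp.ne_iff.1 hℓ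
  have : mon (0 : σ → L) ℓ = 0 := by
    rw [mon, Finsupp.prod]
    exact Finset.prod_eq_zero (Finsupp.mem_support_iff.2 hi) (zero_pow hi)
  rw [term, this, mul_zero]

variable [Algebra.IsAlgebraic k L] [CompleteSpace k]

/-- For a null family the ultrametric inequality makes the partial sums Cauchy; they lie in k(x),
and its completeness replaces that of L. -/
theorem summable_of_tendsto_zero {ι : Type*} (x : σ → L) {u : ι → L}
    (hu : ∀ i, u i ∈ IntermediateField.adjoin k (Set.range x)) (h : Tendsto u cofinite (𝓝 0)) :
    Summable u := by
  classical
  obtain ⟨d, hd⟩ := exists_tendsto_of_mem_adjoin x (u := fun s : Finset ι => ∑ i ∈ s, u i)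
    (fun s => sum_mem fun i _ => hu i) (NonarchimedeanAddGroup.cauchySeq_sum_of_tendsto_cofinite_zero h)
  exact ⟨d, hd⟩

theorem term_mem_adjoin (f : MvPowerSeries σ k) (x : σ → L) (ℓ : σ →₀ ℕ) :
    term f x ℓ ∈ IntermediateField.adjoin k (Set.range x) := by
  refine mul_mem (IntermediateField.algebraMap_mem _ _) (prod_mem fun i _ => pow_mem ?_ _)
  exact IntermediateField.subset_adjoin _ _ (Set.mem_range_self i)

theorem CauchyBound.summable {f : MvPowerSeries σ k} {c d : k} {C : ℝ} (h : CauchyBound f c C)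
    (hd : ‖d‖ < ‖c‖) {x : σ → L} (hx : x ∈ polydisc k d) : Summable (term f x) := by
  have hc : c ≠ 0 := norm_pos_iff.1 ((norm_nonneg d).trans_lt hd)
  have hc' : 0 < ‖c‖ := norm_pos_iff.2 hc
  refine summable_of_tendsto_zero x (term_mem_adjoin f x) ?_
  rw [Metric.nhds_basis_closedBall.tendsto_right_iff]
  intro ε hε
  obtain ⟨N, hN⟩ := exists_pow_mul_le (by positivity) ((div_lt_one hc').2 hd) hε
  refine (Finsupp.finite_of_degree_le (σ := σ) N).subset fun ℓ hℓ => ?_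
  by_contra hlt
  refine hℓ ?_
  rw [Set.mem_ofPred_eq, mem_closedBall_zero_iff]
  exact (norm_term_le h hc hx ℓ).trans (hN _ (not_le.1 hlt).le)

theorem Conv.eventually_summable {f : MvPowerSeries σ k} (h : Conv f) :
    ∀ᶠ x : σ → L in 𝓝 0, Summable (term f x) := by
  obtain ⟨c, hc, C, h⟩ := h
  obtain ⟨d, hd, hdc, -⟩ := exists_lt_norm k hc one_pos
  exact mem_of_superset (polydisc_mem_nhds hd) fun x hx => h.summable hdc hx

theorem Conv.hasSer {f : MvPowerSeries σ k} (h : Conv f) :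
    HasSer (fun x : σ → L => ∑' ℓ, term f x ℓ) f :=
  ⟨h, h.eventually_summable.mono fun _ hx => hx.hasSum⟩

variable [IsAlgClosed L] [DecidableEq σ] [NormNatOne k]

theorem Conv.pderiv {f : MvPowerSeries σ k} (h : Conv f) (i : σ) : Conv (MvPowerSeries.pderiv k i f) := by
  obtain ⟨c, hc, C, h⟩ := h
  have hc' : 0 < ‖c‖ := norm_pos_iff.2 hc
  refine ⟨c, hc, C / ‖c‖, fun ℓ => ?_⟩
  rw [MvPowerSeries.coeff_pderiv, le_div_iff₀ hc']
  have h1 := h (ℓ + Finsupp.single i 1)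
  rw [map_add, Finsupp.degree_single, pow_succ, ← mul_assoc] at h1
  refine le_trans ?_ h1
  gcongr
  rw [norm_mul]
  refine mul_le_of_le_one_right (norm_nonneg _) ?_
  exact_mod_cast NormNatOne.norm_natCast_le (K := k) (ℓ i + 1)

/-- Power series are differentiated term by term. -/
theorem HasSer.pd {g : (σ → L) → L} {f : MvPowerSeries σ k} (h : HasSer g f) (i : σ) :
    HasSer (RigidAn.pd i g) (MvPowerSeries.pderiv k i f) := by
  refine ⟨h.1.pderiv i, ?_⟩
  obtain ⟨c, hc, happ⟩ := h.exists_approx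
  obtain ⟨c', hc', hlim⟩ := h.exists_isUniformLimit
  obtain ⟨d, hd, hdc, hdc'⟩ := exists_norm_le_norm hc hc'
  have hR : IsRational k (polydisc k d : Set (σ → L)) := isRational_polydisc hd
  have hg := hlim d hdc'
  obtain ⟨ρ, hρ⟩ := hR.exists_add_mem
  change HasMargin _ ρ at hρ
  have hρ' : 0 < ‖ρ‖ := norm_pos_iff.2 hρ.1
  refine mem_of_superset (polydisc_mem_nhds hd) fun x hx => ?_
  have key : HasSum (fun ℓ => MvPolynomial.aeval x
      (MvPolynomial.pderiv i (MvPolynomial.monomial ℓ (MvPowerSeries.coeff ℓ f)))) (RigidAn.pd i g x) := by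
    have hpoly : ∀ p : MvPolynomial σ k, RigidAn.pd i (fun y => MvPolynomial.aeval y p) x =
        MvPolynomial.aeval x (MvPolynomial.pderiv i p) := fun p => by
      have := (hasDerivAt_aeval_update i p x (x i)).deriv
      rwa [Function.update_eq_self] at this
    have e : ∀ F : Finset (σ →₀ ℕ), ∑ ℓ ∈ F, MvPolynomial.aeval x
      (MvPolynomial.pderiv i (MvPolynomial.monomial ℓ (MvPowerSeries.coeff ℓ f))) =
        MvPolynomial.aeval x (MvPolynomial.pderiv i (partialPoly f F)) := fun F => by
      rw [partialPoly, map_sum, map_sum]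
    change Tendsto _ atTop _
    simp only [e]
    rw [Metric.nhds_basis_closedBall.tendsto_right_iff]
    intro ε hε
    obtain ⟨F₀, hF₀⟩ := happ d hdc (ε * ‖ρ‖) (by positivity)
    filter_upwards [eventually_ge_atTop F₀] with F hF
    rw [mem_closedBall_iff_norm, norm_sub_rev, ← hpoly,
      ← pd_sub (hρ.pDiff hg i hx) (hρ.pDiff (isUniformLimit_aeval _ _) i hx)]
    refine (hρ.norm_pd_le (hg.sub (isUniformLimit_aeval _ _)) (by positivity)
      (fun y hy => hF₀ F hF y hy) i hx).trans ?_
    rw [mul_div_cancel_right₀ _ hρ'.ne']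
  -- Monomials without the i-th variable differentiate to zero; the others are indexed by ℓ ↦ ℓ +
  -- e_i, which gives the terms of the derived series.
  rw [← (add_left_injective (Finsupp.single i 1)).hasSum_iff] at key
  · change HasSum (term (MvPowerSeries.pderiv k i f) x) (RigidAn.pd i g x)
    have e : term (MvPowerSeries.pderiv k i f) x = (fun ℓ => MvPolynomial.aeval x
        (MvPolynomial.pderiv i (MvPolynomial.monomial ℓ (MvPowerSeries.coeff ℓ f)))) ∘
        fun ℓ => ℓ + Finsupp.single i 1 := by
      funext ℓ
      rw [Function.comp_apply, MvPolynomial.pderiv_monomial, MvPolynomial.aeval_monomial, term,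
        MvPowerSeries.coeff_pderiv, add_tsub_cancel_right]
      simp [mon]
    rwa [e]
  · intro ℓ hℓ
    rw [MvPolynomial.pderiv_monomial]
    have : ℓ i = 0 := by
      by_contra h0
      refine hℓ ⟨ℓ - Finsupp.single i 1, tsub_add_cancel_of_le ?_⟩
      simpa [Finsupp.single_le_iff] using Nat.one_le_iff_ne_zero.2 h0
    simp [this]

end Convergence

/-! ### Power series expansions on polydiscs and the identity theorem. -/

section Expansion

variable {k : Type*} [NontriviallyNormedField k]
variable {L : Type*} [NontriviallyNormedField L] [NormedAlgebra k L]
variable {σ : Type*} [Finite σ]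

/-- Cauchy estimates for quotients of power series. -/
theorem cauchyBound_of_mul_eq [IsUltrametricDist k] {h p q : MvPowerSeries σ k} {c : k} {C : ℝ} (e : h * q = p)
    (hq0 : MvPowerSeries.constantCoeff q ≠ 0)
    (hq : CauchyBound q c ‖MvPowerSeries.constantCoeff q‖)
    (hp : CauchyBound p c (C * ‖MvPowerSeries.constantCoeff q‖)) : CauchyBound h c C := by
  classical
  have hq0' : 0 < ‖MvPowerSeries.constantCoeff q‖ := norm_pos_iff.2 hq0
  have hC : 0 ≤ C := nonneg_of_mul_nonneg_left hp.nonneg hq0'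
  suffices ∀ N : ℕ, ∀ ℓ : σ →₀ ℕ, ℓ.degree = N → ‖MvPowerSeries.coeff ℓ h‖ * ‖c‖ ^ ℓ.degree ≤ C from
    fun ℓ => this _ ℓ rfl
  intro N
  induction N using Nat.strong_induction_on with
  | _ N ih =>
    rintro ℓ rfl
    -- Once the term (ℓ, 0) of the convolution is isolated, only coefficients of h of lower degree
    -- remain.
    have hmem : ((ℓ, 0) : (σ →₀ ℕ) × (σ →₀ ℕ)) ∈ Finset.HasAntidiagonal.antidiagonal ℓ := by simp
    have h1 := congrArg (MvPowerSeries.coeff ℓ) e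
    rw [MvPowerSeries.coeff_mul, ← Finset.add_sum_erase _ _ hmem] at h1
    have h2 : MvPowerSeries.coeff ℓ h * MvPowerSeries.constantCoeff q * c ^ ℓ.degree =
        MvPowerSeries.coeff ℓ p * c ^ ℓ.degree - ∑ x ∈ (Finset.HasAntidiagonal.antidiagonal ℓ).erase (ℓ, 0),
          MvPowerSeries.coeff x.1 h * MvPowerSeries.coeff x.2 q * c ^ ℓ.degree := by
      rw [← h1, ← Finset.sum_mul, MvPowerSeries.coeff_zero_eq_constantCoeff_apply]
      ring
    refine le_of_mul_le_mul_right ?_ hq0'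
    calc _ = ‖MvPowerSeries.coeff ℓ h * MvPowerSeries.constantCoeff q * c ^ ℓ.degree‖ := by
          rw [norm_mul, norm_mul, norm_pow]
          ring
      _ ≤ _ := by
          rw [h2, sub_eq_add_neg]
          refine (IsUltrametricDist.norm_add_le_max _ _).trans (max_le ?_ ?_)
          · rw [norm_mul, norm_pow]
            exact hp ℓ
          · rw [norm_neg]
            refine IsUltrametricDist.norm_sum_le_of_forall_le_of_nonneg (by positivity) fun x hx => ?_
            obtain ⟨hne, hx⟩ := Finset.mem_erase.1 hx
            rw [Finset.HasAntidiagonal.mem_antidiagonal] at hx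
            have hx2 : x.2 ≠ 0 := fun h0 => hne (Prod.ext (by rw [← hx, h0, add_zero]) h0)
            have hdeg : x.1.degree < ℓ.degree := by
              rw [← hx, map_add]
              have : x.2.degree ≠ 0 := fun h => hx2 ((Finsupp.degree_eq_zero_iff _).1 h)
              omega
            rw [norm_mul, norm_mul, norm_pow, ← hx, map_add, pow_add, mul_mul_mul_comm]
            exact mul_le_mul (ih _ hdeg _ rfl) (hq _) (by positivity) hC

theorem Conv.inv [IsUltrametricDist k] {f : MvPowerSeries σ k} (h : Conv f) (h0 : MvPowerSeries.constantCoeff f ≠ 0) :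
    Conv f⁻¹ := by
  classical
  obtain ⟨c, hc, C, h⟩ := h
  have hc' : 0 < ‖c‖ := norm_pos_iff.2 hc
  have h0' : 0 < ‖MvPowerSeries.constantCoeff f‖ := norm_pos_iff.2 h0
  have hC : 0 ≤ C := h.nonneg
  -- The radius is small enough for the constant coefficient to dominate: in positive degree one
  -- spare factor ‖d‖/‖c‖ compensates the bound C.
  obtain ⟨d, hd, hdc, hdε⟩ := exists_lt_norm k hc
    (show 0 < ‖MvPowerSeries.constantCoeff f‖ * ‖c‖ / (C + 1) by positivity)
  have hb : CauchyBound f d ‖MvPowerSeries.constantCoeff f‖ := fun ℓ => by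
    rcases eq_or_ne ℓ 0 with rfl | hℓ
    · simp
    · obtain ⟨m, hm⟩ : ∃ m, ℓ.degree = m + 1 :=
        Nat.exists_eq_succ_of_ne_zero fun h => hℓ ((Finsupp.degree_eq_zero_iff _).1 h)
      have h1 := h ℓ
      rw [hm, pow_succ] at h1 ⊢
      rw [le_div_iff₀ (by positivity)] at hdε
      refine le_of_mul_le_mul_right ?_ hc'
      have h2 : ‖MvPowerSeries.coeff ℓ f‖ * ‖d‖ ^ m * ‖c‖ ≤ C := by
        refine le_trans ?_ h1
        rw [mul_assoc]
        gcongr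
      calc _ = ‖MvPowerSeries.coeff ℓ f‖ * ‖d‖ ^ m * ‖c‖ * ‖d‖ := by ring
        _ ≤ (C + 1) * ‖d‖ := by
            gcongr
            linarith
        _ ≤ _ := by linarith
  refine ⟨d, hd, ‖MvPowerSeries.constantCoeff f‖⁻¹,
    cauchyBound_of_mul_eq (MvPowerSeries.inv_mul_cancel f h0) h0 hb fun ℓ => ?_⟩
  rw [inv_mul_cancel₀ h0'.ne', MvPowerSeries.coeff_one]
  split_ifs with hℓ
  · simp [hℓ]
  · simp

variable [IsUltrametricDist L]

theorem norm_le_of_hasSum_term {f : MvPowerSeries σ k} {c : k} {C : ℝ} (h : CauchyBound f c C) {x : σ → L}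
    (hx : x ∈ polydisc k c) {a : L} (ha : HasSum (term f x) a) : ‖a‖ ≤ C := by
  have := norm_sub_partialPoly_le ha (F := ∅) h.nonneg fun ℓ _ => by
    rw [term, norm_mul, norm_algebraMap']
    refine le_trans ?_ (h ℓ)
    gcongr
    exact norm_mon_le hx ℓ
  simpa [partialPoly] using this

variable [IsAlgClosed L]

/-- A polynomial without zeros on a polydisc has constant absolute value. -/
theorem norm_aeval_eq_of_forall_ne_zero (q : MvPolynomial σ k) {c : k}
    (hq : ∀ x ∈ (polydisc k c : Set (σ → L)), MvPolynomial.aeval x q ≠ 0) {x : σ → L}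
    (hx : x ∈ polydisc k c) : ‖MvPolynomial.aeval x q‖ = ‖MvPolynomial.constantCoeff q‖ := by
  -- The one-variable statement is applied on the line s ↦ s·x, which sends the unit disc into the
  -- polydisc.
  have hmem : ∀ s : L, ‖s‖ ≤ 1 → (fun i => (0 : σ → L) i + x i * s) ∈ polydisc k c := fun s hs i => by
    simp only [Pi.zero_apply, zero_add, norm_mul]
    exact (mul_le_of_le_one_right (norm_nonneg _) hs).trans (hx i)
  have := norm_eval_eq_of_forall_ne_zero (slice 0 x q) (r := 1) (fun s hs => by
    rw [eval_slice]
    exact hq _ (hmem s hs)) (s := 1) (by simp)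
  rw [eval_slice, eval_slice] at this
  simp only [Pi.zero_apply, zero_add, mul_one, mul_zero] at this
  rw [this]
  have e : MvPolynomial.aeval (fun _ => 0) q = algebraMap k L (MvPolynomial.constantCoeff q) := by
    have := MvPolynomial.aeval_zero (S₁ := L) q
    exact this
  rw [e, norm_algebraMap']

variable [NormNatOne L]

/-- A denominator without zeros has constant norm ‖q(0)‖ on the polydisc, so p is bounded by C‖q(0)‖
there; comparing Gauss norms and dividing power series gives the bound C at the full radius. -/
theorem cauchyBound_of_mul_coe_eq [IsUltrametricDist k] {h : MvPowerSeries σ k} {p q : MvPolynomial σ k} {c : k} {C : ℝ}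
    (e : h * (q : MvPowerSeries σ k) = p)
    (hpq : ∀ x ∈ (polydisc k c : Set (σ → L)), MvPolynomial.aeval x q ≠ 0 ∧
      ‖MvPolynomial.aeval x p / MvPolynomial.aeval x q‖ ≤ C) : CauchyBound h c C := by
  have hnorm := fun x hx => norm_aeval_eq_of_forall_ne_zero (L := L) q (c := c) (fun x hx => (hpq x hx).1)
    (x := x) hx
  have hqc : MvPowerSeries.constantCoeff (q : MvPowerSeries σ k) = MvPolynomial.constantCoeff q := by
    rw [← MvPowerSeries.coeff_zero_eq_constantCoeff_apply, MvPolynomial.coeff_coe]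
    rfl
  have hpos : 0 < ‖MvPolynomial.constantCoeff q‖ := by
    rw [← hnorm 0 (zero_mem_polydisc c)]
    exact norm_pos_iff.2 (hpq 0 (zero_mem_polydisc c)).1
  refine cauchyBound_of_mul_eq e (by rw [hqc]; exact norm_pos_iff.1 hpos) (fun ℓ => ?_) fun ℓ => ?_
  · rw [hqc, MvPolynomial.coeff_coe]
    exact norm_coeff_le_of_forall_norm_aeval_le (L := L) q c (fun x hx => (hnorm x hx).le) ℓ
  · rw [hqc, MvPolynomial.coeff_coe]
    refine norm_coeff_le_of_forall_norm_aeval_le (L := L) p c (fun x hx => ?_) ℓ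
    have := (hpq x hx).2
    rwa [norm_div, hnorm x hx, div_le_iff₀ hpos] at this

variable [Algebra.IsAlgebraic k L] [CompleteSpace k] [IsUltrametricDist k]

/-- Elements of the affinoid algebra of a polydisc have a power series expansion, and are approximated
by rational functions in the Gauss norm. -/
theorem IsUniformLimit.exists_expansion {c : k} (hc : c ≠ 0) {f : (σ → L) → L}
    (hf : IsUniformLimit k (polydisc k c : Set (σ → L)) f) :
    ∃ g : MvPowerSeries σ k, (∃ C, CauchyBound g c C) ∧
      (∀ d : k, ‖d‖ < ‖c‖ → ∀ x ∈ (polydisc k d : Set (σ → L)), HasSum (term g x) (f x)) ∧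
      ∀ ε : ℝ, 0 < ε → ∃ (p q : MvPolynomial σ k) (h : MvPowerSeries σ k),
        h * (q : MvPowerSeries σ k) = p ∧ CauchyBound (g - h) c ε ∧
        ∀ x ∈ (polydisc k c : Set (σ → L)), MvPolynomial.aeval x q ≠ 0 ∧
          ‖f x - MvPolynomial.aeval x p / MvPolynomial.aeval x q‖ ≤ ε := by
  choose p q hpq using fun m : ℕ => hf (1 / (m + 1)) Nat.one_div_pos_of_nat
  have hq0 : ∀ m, MvPowerSeries.constantCoeff (q m : MvPowerSeries σ k) ≠ 0 := fun m h0 => by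
    refine (hpq m 0 (zero_mem_polydisc c)).1 ?_
    rw [← MvPowerSeries.coeff_zero_eq_constantCoeff_apply, MvPolynomial.coeff_coe] at h0
    rw [MvPolynomial.aeval_zero, MvPolynomial.constantCoeff_eq, h0, map_zero]
  set h : ℕ → MvPowerSeries σ k := fun m => (p m : MvPowerSeries σ k) * (q m : MvPowerSeries σ k)⁻¹ with hh
  have he : ∀ m, h m * (q m : MvPowerSeries σ k) = p m := fun m => by
    rw [hh, mul_assoc, MvPowerSeries.inv_mul_cancel _ (hq0 m), mul_one]
  -- The difference of two approximants is again a rational function without poles, uniformly small,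
  -- so the expansions h m are Cauchy in the Gauss norm. The series g is their coefficientwise
  -- limit.
  have hsub : ∀ N m l, N ≤ m → N ≤ l → CauchyBound (h m - h l) c (1 / ((N : ℝ) + 1)) := by
    intro N m l hm hl
    refine cauchyBound_of_mul_coe_eq (L := L) (p := p m * q l - p l * q m) (q := q m * q l) ?_
      fun x hx => ⟨?_, ?_⟩
    · have hcoe : ((p m * q l - p l * q m : MvPolynomial σ k) : MvPowerSeries σ k) =
          p m * q l - p l * q m := by
        rw [sub_eq_add_neg, ← neg_mul, MvPolynomial.coe_add, MvPolynomial.coe_mul,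
          MvPolynomial.coe_mul, sub_eq_add_neg, ← neg_mul]
        congr 2
      rw [hcoe, MvPolynomial.coe_mul, ← he, ← he]
      ring
    · rw [map_mul]
      exact mul_ne_zero (hpq m x hx).1 (hpq l x hx).1
    · have hm1 := (hpq m x hx).1
      have hl1 := (hpq l x hx).1
      rw [map_sub, map_mul, map_mul, map_mul, show (MvPolynomial.aeval x (p m) * MvPolynomial.aeval x (q l)
        - MvPolynomial.aeval x (p l) * MvPolynomial.aeval x (q m)) /
          (MvPolynomial.aeval x (q m) * MvPolynomial.aeval x (q l)) =
        (f x - MvPolynomial.aeval x (p l) / MvPolynomial.aeval x (q l)) +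
        -(f x - MvPolynomial.aeval x (p m) / MvPolynomial.aeval x (q m)) by field_simp; ring]
      refine (IsUltrametricDist.norm_add_le_max _ _).trans (max_le ?_ ?_)
      · exact (hpq l x hx).2.trans (Nat.one_div_le_one_div hl)
      · rw [norm_neg]
        exact (hpq m x hx).2.trans (Nat.one_div_le_one_div hm)
  have hcpos : ∀ ℓ : σ →₀ ℕ, 0 < ‖c‖ ^ ℓ.degree := fun ℓ => pow_pos (norm_pos_iff.2 hc) _
  have hlim : ∀ ℓ, ∃ a, Tendsto (fun m => MvPowerSeries.coeff ℓ (h m)) atTop (𝓝 a) := fun ℓ => by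
    refine cauchySeq_tendsto_of_complete (cauchySeq_of_le_tendsto_0
      (fun N : ℕ => 1 / ((N : ℝ) + 1) / ‖c‖ ^ ℓ.degree) (fun m l N hm hl => ?_) ?_)
    · rw [dist_eq_norm, le_div_iff₀ (hcpos ℓ), ← map_sub]
      exact hsub N m l hm hl ℓ
    · simpa using (tendsto_one_div_add_atTop_nhds_zero_nat (𝕜 := ℝ)).div_const (‖c‖ ^ ℓ.degree)
  choose a ha using hlim
  set g : MvPowerSeries σ k := fun ℓ => a ℓ with hg
  have hgc : ∀ ℓ, MvPowerSeries.coeff ℓ g = a ℓ := fun ℓ => rfl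
  have hgh : ∀ N, CauchyBound (g - h N) c (1 / ((N : ℝ) + 1)) := fun N ℓ => by
    rw [map_sub, hgc]
    refine le_of_tendsto (((ha ℓ).sub_const _).norm.mul_const _) ?_
    filter_upwards [eventually_ge_atTop N] with m hm
    rw [← map_sub]
    exact hsub N m N hm le_rfl ℓ
  have hN : ∀ ε : ℝ, 0 < ε → ∃ N : ℕ, 1 / ((N : ℝ) + 1) ≤ ε := fun ε hε =>
    (exists_nat_one_div_lt hε).imp fun _ h => h.le
  obtain ⟨C, hC⟩ : ∃ C, CauchyBound g c C := by
    have hb := hgh 0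
    have hb' : ∃ C, CauchyBound (h 0) c C := by
      have hb1 : ∀ x ∈ (polydisc k c : Set (σ → L)), ‖MvPolynomial.aeval x (q 0)‖ = _ := fun x hx =>
        norm_aeval_eq_of_forall_ne_zero (L := L) (q 0) (fun x hx => (hpq 0 x hx).1) hx
      obtain ⟨C, hC, hp⟩ := (isRational_polydisc (L := L) (σ := σ) hc).exists_norm_ratio_le (p 0) (q 0)
        fun x hx => (hpq 0 x hx).1
      exact ⟨C, cauchyBound_of_mul_coe_eq (L := L) (he 0) fun x hx => ⟨(hpq 0 x hx).1, hp x hx⟩⟩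
    obtain ⟨C, hC⟩ := hb'
    have := (hb.mono le_rfl (le_max_left _ C)).add (hC.mono le_rfl (le_max_right _ C))
    rw [sub_add_cancel] at this
    exact ⟨_, this⟩
  refine ⟨g, ⟨C, hC⟩, fun d hd x hx => ?_, fun ε hε => ?_⟩
  · have hxc : x ∈ (polydisc k c : Set (σ → L)) := polydisc_mono hd.le hx
    obtain ⟨s, hs⟩ := hC.summable hd hx
    -- Both s and f x are close to the value of the N-th approximant: f x by choice of the
    -- approximant, s because g - h N is small in the Gauss norm.
    have hsf : s = f x := by
      refine sub_eq_zero.1 (norm_le_zero_iff.1 (le_of_forall_gt_imp_ge_of_dense fun ε hε => ?_))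
      obtain ⟨N, hN⟩ := hN ε hε
      have hsum : HasSum (term (g - h N) x)
          (s - MvPolynomial.aeval x (p N) / MvPolynomial.aeval x (q N)) := by
        have hbN : ∃ C, CauchyBound (h N) c C := by
          have := (hC.mono le_rfl (le_max_left C _)).add
            (((hgh N).mono le_rfl (le_max_right C _)).neg)
          exact ⟨_, by simpa using this⟩
        obtain ⟨C', hC'⟩ := hbN
        obtain ⟨s', hs'⟩ := hC'.summable hd hx
        have h1 := hasSum_term_mul hs' (hasSum_term_coe (q N) x)
        rw [he] at h1
        have h2 := h1.unique (hasSum_term_coe (p N) x)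
        rw [← h2, mul_div_cancel_right₀ _ (hpq N x hxc).1]
        have e : term (g - h N) x = fun ℓ => term g x ℓ - term (h N) x ℓ := funext fun ℓ => by
          rw [term, term, term, map_sub, map_sub, sub_mul]
        exact e ▸ hs.sub hs'
      have h1 := norm_le_of_hasSum_term (hgh N) hxc hsum
      rw [show s - f x = (s - MvPolynomial.aeval x (p N) / MvPolynomial.aeval x (q N)) +
        -(f x - MvPolynomial.aeval x (p N) / MvPolynomial.aeval x (q N)) by ring]
      refine (IsUltrametricDist.norm_add_le_max _ _).trans (max_le (h1.trans hN) ?_)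
      rw [norm_neg]
      exact (hpq N x hxc).2.trans hN
    exact hsf ▸ hs
  · obtain ⟨N, hN⟩ := hN ε hε
    exact ⟨p N, q N, h N, he N, (hgh N).mono le_rfl hN, fun x hx =>
      ⟨(hpq N x hx).1, (hpq N x hx).2.trans hN⟩⟩

theorem IsUniformLimit.exists_hasSer {c : k} (hc : c ≠ 0) {f : (σ → L) → L}
    (hf : IsUniformLimit k (polydisc k c : Set (σ → L)) f) : ∃ g : MvPowerSeries σ k, HasSer f g := by
  obtain ⟨g, ⟨C, hC⟩, hs, -⟩ := hf.exists_expansion hc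
  obtain ⟨d, hd, hdc, -⟩ := exists_lt_norm k hc one_pos
  exact ⟨g, ⟨c, hc, C, hC⟩, mem_of_superset (polydisc_mem_nhds hd) (hs d hdc)⟩

/-- Identity theorem on closed polydiscs. -/
theorem IsUniformLimit.eq_zero_of_eventually {c : k} (hc : c ≠ 0) {f : (σ → L) → L}
    (hf : IsUniformLimit k (polydisc k c : Set (σ → L)) f) (h0 : ∀ᶠ x in 𝓝 0, f x = 0) {x : σ → L}
    (hx : x ∈ polydisc k c) : f x = 0 := by
  obtain ⟨g, ⟨C, hC⟩, hs, happ⟩ := hf.exists_expansion hc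
  obtain ⟨d, hd, hdc, -⟩ := exists_lt_norm k hc one_pos
  -- As g vanishes, the approximants h are small in the Gauss norm of the full radius ‖c‖. This
  -- carries the vanishing to the boundary of the polydisc, where the expansion is not known to
  -- converge to f.
  have hg : g = 0 := HasSer.eq_zero (g := f)
    ⟨⟨c, hc, C, hC⟩, mem_of_superset (polydisc_mem_nhds hd) (hs d hdc)⟩ h0
  refine norm_le_zero_iff.1 (le_of_forall_gt_imp_ge_of_dense fun ε hε => ?_)
  obtain ⟨p, q, h, e, hgh, hpq⟩ := happ ε hε
  have hh : CauchyBound h c ε := fun ℓ => by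
    have := hgh ℓ
    rwa [hg, zero_sub, map_neg, norm_neg] at this
  have hnorm := fun x hx => norm_aeval_eq_of_forall_ne_zero (L := L) q (c := c) (fun x hx => (hpq x hx).1)
    (x := x) hx
  have hq : CauchyBound (q : MvPowerSeries σ k) c ‖MvPolynomial.constantCoeff q‖ := fun ℓ => by
    rw [MvPolynomial.coeff_coe]
    exact norm_coeff_le_of_forall_norm_aeval_le (L := L) q c (fun x hx => (hnorm x hx).le) ℓ
  have hp := hh.mul hq
  rw [e, ← hnorm x hx] at hp
  have h1 := norm_le_of_hasSum_term hp hx (hasSum_term_coe p x)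
  have hqx : 0 < ‖MvPolynomial.aeval x q‖ := norm_pos_iff.2 (hpq x hx).1
  rw [← sub_add_cancel (f x) (MvPolynomial.aeval x p / MvPolynomial.aeval x q)]
  refine (IsUltrametricDist.norm_add_le_max _ _).trans (max_le (hpq x hx).2 ?_)
  rwa [norm_div, div_le_iff₀ hqx]

omit [IsAlgClosed L] in
theorem HasSer.inv {g : (σ → L) → L} {f : MvPowerSeries σ k} (h : HasSer g f)
    (h0 : MvPowerSeries.constantCoeff f ≠ 0) : HasSer (fun x => (g x)⁻¹) f⁻¹ := by
  refine ⟨h.1.inv h0, ?_⟩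
  filter_upwards [h.2, (h.1.inv h0).eventually_summable] with x hx ⟨s, hs⟩
  have h1 := hasSum_term_mul hs hx
  rw [MvPowerSeries.inv_mul_cancel f h0] at h1
  have h2 : HasSum (term (1 : MvPowerSeries σ k) x) 1 := by
    simpa using hasSum_term_coe (1 : MvPolynomial σ k) x
  rwa [← eq_inv_of_mul_eq_one_left (h1.unique h2)]

/-- Elements of the affinoid algebra of a bidisc which vanish near `0` vanish. -/
theorem IsUniformLimit.eq_zero_of_eventually_bidisc {τ : Type*} [Finite τ] {c d : k} (hc : c ≠ 0) (hd : d ≠ 0)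
    {f : (Option τ → L) → L} (hf : IsUniformLimit k (bidisc k c d : Set (Option τ → L)) f)
    (h0 : ∀ᶠ x in 𝓝 0, f x = 0) {x : Option τ → L} (hx : x ∈ bidisc k c d)
    (hdc : ‖d‖ ≤ ‖c‖) : f x = 0 := by
  -- Rescaling each coordinate by its own radius reduces the bidisc to the unit polydisc.
  set a : Option τ → k := fun i => i.elim d fun _ => c with ha
  have ha0 : ∀ i, algebraMap k L (a i) ≠ 0 := fun i => by
    rw [map_ne_zero]
    cases i
    · exact hd
    · exact hc
  have hmem : ∀ y ∈ (polydisc k 1 : Set (Option τ → L)), (fun i => algebraMap k L (a i) * y i) ∈ bidisc k c d := by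
    intro y hy
    have hy' : ∀ i, ‖y i‖ ≤ 1 := fun i => by simpa using hy i
    refine ⟨fun i => ?_, ?_⟩
    · rw [norm_mul, norm_algebraMap']
      refine (mul_le_of_le_one_right (norm_nonneg _) (hy' i)).trans ?_
      cases i
      · exact hdc
      · exact le_rfl
    · rw [norm_mul, norm_algebraMap']
      exact mul_le_of_le_one_right (norm_nonneg _) (hy' none)
  have hcomp := hf.comp_polynomial (fun i => MvPolynomial.C (a i) * MvPolynomial.X i)
    (R' := (polydisc k 1 : Set (Option τ → L))) (fun y hy => by
      simpa [MvPolynomial.algHom_C] using hmem y hy)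
  simp only [map_mul, MvPolynomial.algHom_C, MvPolynomial.aeval_X] at hcomp
  have hcont : Tendsto (fun y : Option τ → L => fun i => algebraMap k L (a i) * y i) (𝓝 0) (𝓝 0) := by
    have : Continuous fun y : Option τ → L => fun i => algebraMap k L (a i) * y i := by fun_prop
    simpa using this.tendsto' 0 0 (by ext; simp)
  have h1 := hcomp.eq_zero_of_eventually one_ne_zero (hcont.eventually h0)
    (x := fun i => (algebraMap k L (a i))⁻¹ * x i) (fun i => by
      have : ‖x i‖ ≤ ‖a i‖ := by
        cases i
        · exact hx.2
        · exact hx.1 _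
      rw [norm_mul, norm_inv, norm_algebraMap', norm_one, ← div_eq_inv_mul]
      exact div_le_one_of_le₀ this (norm_nonneg _))
  simpa only [mul_inv_cancel_left₀ (ha0 _)] using h1

end Expansion

/-! ### Matrices of formal power series. -/

section FormalMatrices

variable {k : Type*} [Field k] {σ : Type*} {l m n : Type*}

/-- The coefficient of a matrix of power series. -/
def mcoeff (ℓ : σ →₀ ℕ) (X : Matrix m n (MvPowerSeries σ k)) : Matrix m n k :=
  X.map (MvPowerSeries.coeff ℓ)

/-- The matrix of power series with given coefficients. -/
def ofCoeff (f : (σ →₀ ℕ) → Matrix m n k) : Matrix m n (MvPowerSeries σ k) :=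
  Matrix.of fun a b ℓ => f ℓ a b

theorem mcoeff_apply (ℓ : σ →₀ ℕ) (X : Matrix m n (MvPowerSeries σ k)) (a : m) (b : n) :
    mcoeff ℓ X a b = MvPowerSeries.coeff ℓ (X a b) := rfl

theorem mcoeff_ext {X Y : Matrix m n (MvPowerSeries σ k)} (h : ∀ ℓ, mcoeff ℓ X = mcoeff ℓ Y) : X = Y := by
  ext a b ℓ
  exact congrFun (congrFun (h ℓ) a) b

theorem mcoeff_add (ℓ : σ →₀ ℕ) (X Y : Matrix m n (MvPowerSeries σ k)) :
    mcoeff ℓ (X + Y) = mcoeff ℓ X + mcoeff ℓ Y := by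
  ext; simp [mcoeff]

theorem mcoeff_sub (ℓ : σ →₀ ℕ) (X Y : Matrix m n (MvPowerSeries σ k)) :
    mcoeff ℓ (X - Y) = mcoeff ℓ X - mcoeff ℓ Y := by
  ext; simp [mcoeff]

theorem mcoeff_zero (ℓ : σ →₀ ℕ) : mcoeff ℓ (0 : Matrix m n (MvPowerSeries σ k)) = 0 := by
  ext; simp [mcoeff]

theorem mcoeff_sum {ι : Type*} (ℓ : σ →₀ ℕ) (s : Finset ι) (X : ι → Matrix m n (MvPowerSeries σ k)) :
    mcoeff ℓ (∑ i ∈ s, X i) = ∑ i ∈ s, mcoeff ℓ (X i) := by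
  ext a b
  simp [mcoeff, Matrix.sum_apply]

theorem mcoeff_mul [Fintype m] [DecidableEq σ] (ℓ : σ →₀ ℕ) (X : Matrix l m (MvPowerSeries σ k))
    (Y : Matrix m n (MvPowerSeries σ k)) : mcoeff ℓ (X * Y) =
      ∑ p ∈ Finset.HasAntidiagonal.antidiagonal ℓ, mcoeff p.1 X * mcoeff p.2 Y := by
  ext a b
  simp only [mcoeff_apply, Matrix.mul_apply, Matrix.sum_apply, map_sum, MvPowerSeries.coeff_mul]
  rw [Finset.sum_comm]

theorem mcoeff_one [DecidableEq m] [DecidableEq σ] (ℓ : σ →₀ ℕ) :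
    mcoeff ℓ (1 : Matrix m m (MvPowerSeries σ k)) = if ℓ = 0 then 1 else 0 := by
  ext a b
  rw [mcoeff_apply, Matrix.one_apply]
  split_ifs with h1 h2 h2 <;> simp [MvPowerSeries.coeff_one, Matrix.one_apply, h1, h2]

/-- Entrywise partial derivative. -/
noncomputable def mD (c : σ) (X : Matrix m n (MvPowerSeries σ k)) : Matrix m n (MvPowerSeries σ k) :=
  X.map (MvPowerSeries.pderiv k c)

theorem mcoeff_mD (c : σ) (X : Matrix m n (MvPowerSeries σ k)) (ℓ : σ →₀ ℕ) :
    mcoeff ℓ (mD c X) = ((ℓ c + 1 : ℕ) : k) • mcoeff (ℓ + Finsupp.single c 1) X := by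
  ext a b
  rw [mcoeff_apply, Matrix.smul_apply, mcoeff_apply, mD, Matrix.map_apply, MvPowerSeries.coeff_pderiv,
    smul_eq_mul, mul_comm]
  push_cast
  rfl

theorem mD_mul [Fintype m] (c : σ) (X : Matrix l m (MvPowerSeries σ k))
    (Y : Matrix m n (MvPowerSeries σ k)) : mD c (X * Y) = mD c X * Y + X * mD c Y := by
  ext1 a b
  simp only [mD, Matrix.map_apply, Matrix.mul_apply, Matrix.add_apply, map_sum, Derivation.leibniz,
    smul_eq_mul, ← Finset.sum_add_distrib]
  exact Finset.sum_congr rfl fun i _ => by ring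

theorem mD_add (c : σ) (X Y : Matrix m n (MvPowerSeries σ k)) : mD c (X + Y) = mD c X + mD c Y := by
  ext1 a b
  simp [mD]

theorem mD_smul (c : σ) (s : MvPowerSeries σ k) (Y : Matrix m n (MvPowerSeries σ k)) :
    mD c (s • Y) = MvPowerSeries.pderiv k c s • Y + s • mD c Y := by
  ext1 a b
  simp only [mD, Matrix.map_apply, Matrix.smul_apply, Matrix.add_apply, smul_eq_mul, Derivation.leibniz]
  ring

theorem mD_sum {ι : Type*} (c : σ) (s : Finset ι) (X : ι → Matrix m n (MvPowerSeries σ k)) :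
    mD c (∑ i ∈ s, X i) = ∑ i ∈ s, mD c (X i) := by
  ext1 a b
  simp [mD, Matrix.sum_apply]

theorem mD_comm (c d : σ) (X : Matrix m n (MvPowerSeries σ k)) : mD c (mD d X) = mD d (mD c X) := by
  classical
  refine mcoeff_ext fun ℓ => ?_
  rw [mcoeff_mD, mcoeff_mD, mcoeff_mD, mcoeff_mD, smul_smul, smul_smul, add_right_comm]
  rcases eq_or_ne c d with rfl | h
  · rfl
  · simp [h, h.symm, mul_comm]

theorem mcoeff_X_smul_add (c : σ) (X : Matrix m n (MvPowerSeries σ k)) (ℓ : σ →₀ ℕ) :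
    mcoeff (ℓ + Finsupp.single c 1) ((MvPowerSeries.X c : MvPowerSeries σ k) • X) = mcoeff ℓ X := by
  ext a b
  rw [mcoeff_apply, mcoeff_apply, Matrix.smul_apply, smul_eq_mul, add_comm ℓ, MvPowerSeries.X,
    MvPowerSeries.coeff_add_monomial_mul, one_mul]

theorem mcoeff_X_smul_of_eq_zero (c : σ) (X : Matrix m n (MvPowerSeries σ k)) {ℓ : σ →₀ ℕ} (h : ℓ c = 0) :
    mcoeff ℓ ((MvPowerSeries.X c : MvPowerSeries σ k) • X) = 0 := by
  classical
  ext a b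
  rw [mcoeff_apply, Matrix.smul_apply, smul_eq_mul, MvPowerSeries.X, MvPowerSeries.coeff_monomial_mul,
    if_neg, Matrix.zero_apply]
  simp [Finsupp.single_le_iff, h]

theorem X_smul_injective (c : σ) {X Y : Matrix m n (MvPowerSeries σ k)}
    (h : (MvPowerSeries.X c : MvPowerSeries σ k) • X = (MvPowerSeries.X c : MvPowerSeries σ k) • Y) :
    X = Y := mcoeff_ext fun ℓ => by
  rw [← mcoeff_X_smul_add c X, h, mcoeff_X_smul_add]

end FormalMatrices

/-! ### Gauge invariance of flatness. -/

section Gauge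

/-- Gauge transformations preserve the flatness of a pair of operators. -/
theorem gauge_flat {𝓜 S : Type*} [Ring 𝓜] [CommRing S] [Algebra S 𝓜] {D D' : 𝓜 → 𝓜} {c : S}
    (hDadd : ∀ X Y, D (X + Y) = D X + D Y) (hD'add : ∀ X Y, D' (X + Y) = D' X + D' Y)
    (hD : ∀ X Y, D (X * Y) = D X * Y + X * D Y) (hD' : ∀ X Y, D' (X * Y) = D' X * Y + X * D' Y)
    (hcomm : ∀ X, D (D' X) = D' (D X) + c • D' X) {A A' P N N' Pi : 𝓜}
    (hflat : D A' - D' A + (A * A' - A' * A) = c • A') (hP : Pi * P = 1)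
    (hN : A * P + D P = P * N) (hN' : A' * P + D' P = P * N') :
    D N' - D' N + (N * N' - N' * N) = c • N' := by
  have e1 : D P * N' + P * D N' = D A' * P + A' * D P + D (D' P) := by
    rw [← hD, ← hN', hDadd, hD]
  have e2 : D' P * N + P * D' N = D' A * P + A * D' P + D' (D P) := by
    rw [← hD', ← hN, hD'add, hD']
  have e3 : P * (N * N') = A * (A' * P + D' P) + D P * N' := by
    rw [← mul_assoc, ← hN, add_mul, mul_assoc, ← hN']
  have e4 : P * (N' * N) = A' * (A * P + D P) + D' P * N := by
    rw [← mul_assoc, ← hN', add_mul, mul_assoc, ← hN]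
  have e1' : P * D N' = D A' * P + A' * D P + D (D' P) - D P * N' := by rw [← e1]; abel
  have e2' : P * D' N = D' A * P + A * D' P + D' (D P) - D' P * N := by rw [← e2]; abel
  -- Expanding by the Leibniz rule, all mixed terms cancel and leave the old curvature times P plus
  -- the commutator of D and D' on P; both are governed by the same c.
  have key : P * (D N' - D' N + (N * N' - N' * N)) = P * (c • N') := by
    calc _ = (D A' - D' A + (A * A' - A' * A)) * P + (D (D' P) - D' (D P)) := by
          rw [mul_add, mul_sub, mul_sub, e1', e2', e3, e4]
          noncomm_ring
      _ = _ := by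
          rw [hflat, hcomm, add_sub_cancel_left, mul_smul_comm, ← hN', smul_add, smul_mul_assoc]
  have := congrArg (Pi * ·) key
  simpa only [← mul_assoc, hP, one_mul] using this

end Gauge

/-- Recursion on a degree. -/
theorem exists_forall_eq_of_local {ι X : Type*} [Zero X] (d : ι → ℕ) (Φ : (ι → X) → ι → X)
    (hΦ : ∀ f g ℓ, (∀ ℓ', d ℓ' < d ℓ → f ℓ' = g ℓ') → Φ f ℓ = Φ g ℓ) : ∃ f, ∀ ℓ, f ℓ = Φ f ℓ := by
  refine ⟨(measure d).wf.fix fun ℓ ih => Φ (fun ℓ' => if h : d ℓ' < d ℓ then ih ℓ' h else 0) ℓ,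
    fun ℓ => ?_⟩
  rw [WellFounded.fix_eq]
  exact hΦ _ _ _ fun ℓ' h => by rw [dif_pos h]

/-! ### The degree in the base variables. -/

section Degree

variable {n : ℕ}

/-- The degree in the variables of the base. -/
def tdeg (ℓ : Option (Fin n) →₀ ℕ) : ℕ := ∑ j, ℓ (some j)

theorem tdeg_add (ℓ ℓ' : Option (Fin n) →₀ ℕ) : tdeg (ℓ + ℓ') = tdeg ℓ + tdeg ℓ' := by
  simp [tdeg, Finset.sum_add_distrib]

theorem tdeg_zero : tdeg (0 : Option (Fin n) →₀ ℕ) = 0 := by simp [tdeg]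

theorem tdeg_single_none (e : ℕ) : tdeg (Finsupp.single (none : Option (Fin n)) e) = 0 := by
  simp [tdeg]

theorem tdeg_single_some (j : Fin n) (e : ℕ) : tdeg (Finsupp.single (some j) e) = e := by
  rw [tdeg, Finset.sum_eq_single j]
  · simp
  · intro i _ h
    simp [h]
  · simp

theorem tdeg_eq_zero_iff {ℓ : Option (Fin n) →₀ ℕ} : tdeg ℓ = 0 ↔ ∀ j, ℓ (some j) = 0 := by
  simp [tdeg]

theorem degree_eq_tdeg_add (ℓ : Option (Fin n) →₀ ℕ) : ℓ.degree = tdeg ℓ + ℓ none := by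
  rw [Finsupp.degree_eq_sum, Fintype.sum_option, add_comm, tdeg]

theorem eq_zero_of_tdeg {ℓ : Option (Fin n) →₀ ℕ} (h : tdeg ℓ = 0) (h' : ℓ none = 0) : ℓ = 0 := by
  ext i
  cases i
  · exact h'
  · exact tdeg_eq_zero_iff.1 h _

end Degree

/-! ### The radial equation and its formal solution. -/

section Recursion

variable {k : Type*} [Field k] [CharZero k] {n : ℕ} {m : Type*} [Fintype m] [DecidableEq m]

/-- `P` and `M` solve the radial equation `u E P = - T P + P M`, where `E` is the Euler field of the
base, with `P = 1` on the axis and `M` independent of `u` and zero at the origin. -/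
structure IsRadialSolution (T P M : Matrix m m (MvPowerSeries (Option (Fin n)) k)) : Prop where
  init : ∀ ℓ, tdeg ℓ = 0 → mcoeff ℓ P = mcoeff ℓ 1
  initM : ∀ ℓ, tdeg ℓ = 0 → mcoeff ℓ M = 0
  indep : ∀ ℓ, ℓ none ≠ 0 → mcoeff ℓ M = 0
  residue : ∀ ℓ, ℓ none = 0 → mcoeff ℓ (T * P) = mcoeff ℓ (P * M)
  -- The factor u in u E P shifts the exponent: the coefficient of the equation at u^{q+1} yields P
  -- at u^q.
  step : ∀ ℓ, (tdeg ℓ : k) • mcoeff ℓ P =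
    -mcoeff (ℓ + Finsupp.single none 1) (T * P) + mcoeff (ℓ + Finsupp.single none 1) (P * M)

/-- In t-degree N > 0 the right-hand side involves P and M in smaller t-degree only: T has no part
of t-degree 0, nor has M, and the remaining product 1·M occurs at u^0 alone, where it is the unknown
being determined. -/
theorem exists_isRadialSolution (T : Matrix m m (MvPowerSeries (Option (Fin n)) k))
    (hT : ∀ ℓ, tdeg ℓ = 0 → mcoeff ℓ T = 0) :
    ∃ P M, IsRadialSolution T P M := by
  classical
  let ad : (Option (Fin n) →₀ ℕ) → Finset ((Option (Fin n) →₀ ℕ) × (Option (Fin n) →₀ ℕ)) :=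
    fun ℓ => Finset.HasAntidiagonal.antidiagonal ℓ
  have had : ∀ {ℓ p}, p ∈ ad ℓ → tdeg ℓ = tdeg p.1 + tdeg p.2 ∧ ℓ none = p.1 none + p.2 none ∧ p.1 + p.2 = ℓ := by
    intro ℓ p hp
    rw [Finset.HasAntidiagonal.mem_antidiagonal] at hp
    rw [← hp, tdeg_add, Finsupp.add_apply]
    exact ⟨rfl, rfl, rfl⟩
  -- The cut-offs make S₁ and S₂ depend on lower t-degrees by definition. The omitted terms vanish
  -- because T and M are zero in t-degree 0 and M is free of u, apart from the term 1·M at u^0.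
  let S₁ : ((Option (Fin n) →₀ ℕ) → Matrix m m k × Matrix m m k) → ℕ → (Option (Fin n) →₀ ℕ) → Matrix m m k :=
    fun f N ℓ => ∑ p ∈ ad ℓ, if tdeg p.2 < N then mcoeff p.1 T * (f p.2).1 else 0
  let S₂ : ((Option (Fin n) →₀ ℕ) → Matrix m m k × Matrix m m k) → ℕ → (Option (Fin n) →₀ ℕ) → Matrix m m k :=
    fun f N ℓ => ∑ p ∈ ad ℓ, if tdeg p.1 < N ∧ tdeg p.2 < N then (f p.1).1 * (f p.2).2 else 0
  obtain ⟨f, hf⟩ := exists_forall_eq_of_local tdeg (fun f ℓ =>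
    ((if tdeg ℓ = 0 then mcoeff ℓ 1 else (tdeg ℓ : k)⁻¹ • (-S₁ f (tdeg ℓ) (ℓ + Finsupp.single none 1) +
      S₂ f (tdeg ℓ) (ℓ + Finsupp.single none 1)) : Matrix m m k),
     (if tdeg ℓ = 0 ∨ ℓ none ≠ 0 then 0 else S₁ f (tdeg ℓ) ℓ - S₂ f (tdeg ℓ) ℓ : Matrix m m k))) (by
    intro f g ℓ h
    have h1 : ∀ ℓ', S₁ f (tdeg ℓ) ℓ' = S₁ g (tdeg ℓ) ℓ' := fun ℓ' =>
      Finset.sum_congr rfl fun p _ => by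
        split_ifs with hp
        · rw [h _ hp]
        · rfl
    have h2 : ∀ ℓ', S₂ f (tdeg ℓ) ℓ' = S₂ g (tdeg ℓ) ℓ' := fun ℓ' =>
      Finset.sum_congr rfl fun p _ => by
        split_ifs with hp
        · rw [h _ hp.1, h _ hp.2]
        · rfl
    simp only [h1, h2])
  set P : Matrix m m (MvPowerSeries (Option (Fin n)) k) := ofCoeff fun ℓ => (f ℓ).1
  set M : Matrix m m (MvPowerSeries (Option (Fin n)) k) := ofCoeff fun ℓ => (f ℓ).2
  have hP : ∀ ℓ, mcoeff ℓ P = (f ℓ).1 := fun ℓ => rfl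
  have hM : ∀ ℓ, mcoeff ℓ M = (f ℓ).2 := fun ℓ => rfl
  have init : ∀ ℓ : Option (Fin n) →₀ ℕ, tdeg ℓ = 0 → mcoeff ℓ P = mcoeff ℓ 1 := fun ℓ h => by
    rw [hP, hf, if_pos h]
  have indep : ∀ ℓ, ℓ none ≠ 0 → mcoeff ℓ M = 0 := fun ℓ h => by
    rw [hM, hf]
    exact if_pos (Or.inr h)
  have initM : ∀ ℓ, tdeg ℓ = 0 → mcoeff ℓ M = 0 := fun ℓ h => by
    rw [hM, hf]
    exact if_pos (Or.inl h)
  -- A term dropped by the cut-off has its first factor in t-degree 0, where T is zero.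
  have hS₁ : ∀ ℓ ℓ' : Option (Fin n) →₀ ℕ, tdeg ℓ' = tdeg ℓ → S₁ f (tdeg ℓ) ℓ' = mcoeff ℓ' (T * P) := fun ℓ ℓ' h => by
    rw [mcoeff_mul]
    refine Finset.sum_congr rfl fun p hp => ?_
    obtain ⟨h1, h2, h3⟩ := had hp
    split_ifs with hlt
    · rfl
    · rw [hT _ (by omega), zero_mul]
  refine ⟨P, M, init, initM, indep, fun ℓ h0 => ?_, fun ℓ => ?_⟩
  · rcases eq_or_ne (tdeg ℓ) 0 with ht | ht
    · rw [mcoeff_mul, mcoeff_mul, Finset.sum_eq_zero, Finset.sum_eq_zero]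
      · intro p hp
        have := had hp
        rw [initM _ (by omega), mul_zero]
      · intro p hp
        have := had hp
        rw [hT _ (by omega), zero_mul]
    · have hmem : ((0, ℓ) : (Option (Fin n) →₀ ℕ) × (Option (Fin n) →₀ ℕ)) ∈
          Finset.HasAntidiagonal.antidiagonal ℓ := by simp
      have h1 : mcoeff ℓ M = S₁ f (tdeg ℓ) ℓ - S₂ f (tdeg ℓ) ℓ := by
        rw [hM, hf]
        exact if_neg (by tauto)
      have h2 : mcoeff ℓ (P * M) = mcoeff ℓ M + S₂ f (tdeg ℓ) ℓ := by
        rw [mcoeff_mul, ← Finset.add_sum_erase _ _ hmem]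
        congr 1
        · rw [init _ tdeg_zero, mcoeff_one, if_pos rfl, one_mul]
        · have e : S₂ f (tdeg ℓ) ℓ = ∑ p ∈ (ad ℓ).erase (0, ℓ),
              if tdeg p.1 < tdeg ℓ ∧ tdeg p.2 < tdeg ℓ then (f p.1).1 * (f p.2).2 else 0 := by
            refine (Finset.add_sum_erase (ad ℓ) _ hmem).symm.trans ?_
            rw [if_neg fun h => lt_irrefl _ h.2, zero_add]
          rw [e]
          refine Finset.sum_congr rfl fun p hp => ?_
          obtain ⟨hne, hp⟩ := Finset.mem_erase.1 hp
          obtain ⟨h1, h2, h3⟩ := had hp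
          split_ifs with hlt
          · rfl
          · rcases eq_or_ne (tdeg p.2) 0 with h4 | h4
            · rw [initM _ h4, mul_zero]
            · have h5 : tdeg p.1 = 0 := by omega
              refine absurd (Prod.ext ?_ ?_) hne
              · exact eq_zero_of_tdeg h5 (by omega)
              · rw [← h3, eq_zero_of_tdeg h5 (by omega), zero_add]
      rw [h2, h1, hS₁ ℓ ℓ rfl, sub_add_cancel]
  · rcases eq_or_ne (tdeg ℓ) 0 with ht | ht
    · rw [ht, Nat.cast_zero, zero_smul, mcoeff_mul, mcoeff_mul, Finset.sum_eq_zero, Finset.sum_eq_zero]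
      · simp
      · intro p hp
        have := had hp
        rw [tdeg_add, tdeg_single_none] at this
        rw [initM _ (by omega), mul_zero]
      · intro p hp
        have := had hp
        rw [tdeg_add, tdeg_single_none] at this
        rw [hT _ (by omega), zero_mul]
    · have h1 : tdeg (ℓ + Finsupp.single none 1) = tdeg ℓ := by rw [tdeg_add, tdeg_single_none, add_zero]
      have h2 : mcoeff (ℓ + Finsupp.single none 1) (P * M) =
          S₂ f (tdeg ℓ) (ℓ + Finsupp.single none 1) := by
        rw [mcoeff_mul]
        refine Finset.sum_congr rfl fun p hp => ?_
        obtain ⟨h3, h4, h5⟩ := had hp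
        rw [h1] at h3
        simp only [Finsupp.add_apply, Finsupp.single_eq_same] at h4
        split_ifs with hlt
        · rfl
        · rcases eq_or_ne (tdeg p.2) 0 with h6 | h6
          · rw [initM _ h6, mul_zero]
          · rcases eq_or_ne (p.2 none) 0 with h7 | h7
            · have h8 : p.1 ≠ 0 := fun h => by
                rw [h] at h4
                simp [h7] at h4
              rw [init _ (by omega), mcoeff_one, if_neg h8, zero_mul]
            · rw [indep _ h7, mul_zero]
      rw [h2, ← hS₁ ℓ _ h1, hP, hf]
      dsimp only
      rw [if_neg ht, smul_smul, mul_inv_cancel₀ (Nat.cast_ne_zero.2 ht), one_smul]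

end Recursion

/-! ### Convergence of the radial solution. -/

section Bounds

variable {k : Type*} [NontriviallyNormedField k] [IsUltrametricDist k] {n : ℕ}
  {m : Type*} [Fintype m] [DecidableEq m]

theorem norm_mul_apply_le {l n : Type*} {X : Matrix l m k} {Y : Matrix m n k} {C C' : ℝ} (hC : 0 ≤ C)
    (hC' : 0 ≤ C') (hX : ∀ a b, ‖X a b‖ ≤ C) (hY : ∀ a b, ‖Y a b‖ ≤ C') (a : l) (b : n) :
    ‖(X * Y) a b‖ ≤ C * C' := by
  rw [Matrix.mul_apply]
  refine IsUltrametricDist.norm_sum_le_of_forall_le_of_nonneg (by positivity) fun i _ => ?_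
  rw [norm_mul]
  exact mul_le_mul (hX _ _) (hY _ _) (norm_nonneg _) hC

/-- A radial solution of a convergent equation converges. -/
theorem IsRadialSolution.cauchyBound [NormNatOne k] {T P M : Matrix m m (MvPowerSeries (Option (Fin n)) k)}
    (h : IsRadialSolution T P M) (hT0 : ∀ ℓ, tdeg ℓ = 0 → mcoeff ℓ T = 0) {c d : ℝ} (hc : 0 < c)
    (hd : 0 < d) (hT : ∀ ℓ a b, ‖mcoeff ℓ T a b‖ * (d ^ tdeg ℓ * c ^ ℓ none) ≤ c) :
    ∀ ℓ, (∀ a b, ‖mcoeff ℓ P a b‖ * (d ^ tdeg ℓ * c ^ ℓ none) ≤ 1) ∧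
      ∀ a b, ‖mcoeff ℓ M a b‖ * (d ^ tdeg ℓ * c ^ ℓ none) ≤ c := by
  classical
  -- In this weight u has size c. Thus T and M of size at most c and P of size at most 1 reproduce
  -- themselves: T P and P M have size at most c, and division by u brings this back to 1.
  set w : (Option (Fin n) →₀ ℕ) → ℝ := fun ℓ => d ^ tdeg ℓ * c ^ ℓ none with hw
  have hwpos : ∀ ℓ, 0 < w ℓ := fun ℓ => by positivity
  have hwadd : ∀ ℓ ℓ', w (ℓ + ℓ') = w ℓ * w ℓ' := fun ℓ ℓ' => by
    simp only [hw, tdeg_add, Finsupp.add_apply, pow_add]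
    ring
  have had : ∀ {ℓ : Option (Fin n) →₀ ℕ} {p}, p ∈ Finset.HasAntidiagonal.antidiagonal ℓ →
      tdeg ℓ = tdeg p.1 + tdeg p.2 ∧ ℓ none = p.1 none + p.2 none ∧ p.1 + p.2 = ℓ := by
    intro ℓ p hp
    rw [Finset.HasAntidiagonal.mem_antidiagonal] at hp
    rw [← hp, tdeg_add, Finsupp.add_apply]
    exact ⟨rfl, rfl, rfl⟩
  have hmul : ∀ {X Y : Matrix m m k} {ℓ ℓ' ℓ'' : Option (Fin n) →₀ ℕ} {C C' : ℝ}, ℓ + ℓ' = ℓ'' →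
      0 ≤ C → 0 ≤ C' → (∀ a b, ‖X a b‖ * w ℓ ≤ C) → (∀ a b, ‖Y a b‖ * w ℓ' ≤ C') →
      ∀ a b, ‖(X * Y) a b‖ ≤ C * C' / w ℓ'' := by
    intro X Y ℓ ℓ' ℓ'' C C' e h0 h0' hX hY a b
    have h1 := hwpos ℓ
    have h2 := hwpos ℓ'
    rw [← e, hwadd, ← div_mul_div_comm]
    exact norm_mul_apply_le (by positivity) (by positivity)
      (fun a b => (le_div_iff₀ (hwpos _)).2 (hX a b)) (fun a b => (le_div_iff₀ (hwpos _)).2 (hY a b)) a b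
  suffices ∀ N ℓ, tdeg ℓ = N → (∀ a b, ‖mcoeff ℓ P a b‖ * w ℓ ≤ 1) ∧ ∀ a b, ‖mcoeff ℓ M a b‖ * w ℓ ≤ c from
    fun ℓ => this _ ℓ rfl
  intro N
  induction N using Nat.strong_induction_on with
  | _ N ih =>
    rintro ℓ rfl
    rcases eq_or_ne (tdeg ℓ) 0 with ht | ht
    · rw [h.init ℓ ht, h.initM ℓ ht, mcoeff_one]
      constructor
      · intro a b
        split_ifs with h0
        · rw [Matrix.one_apply, h0]
          split_ifs <;> simp [hw, tdeg_zero]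
        · simp
      · intro a b
        simpa using hc.le
    have hTP : ∀ ℓ', tdeg ℓ' = tdeg ℓ → ∀ a b, ‖mcoeff ℓ' (T * P) a b‖ ≤ c / w ℓ' := by
      intro ℓ' hℓ' a b
      have h1 := hwpos ℓ'
      rw [mcoeff_mul, Matrix.sum_apply]
      refine IsUltrametricDist.norm_sum_le_of_forall_le_of_nonneg (by positivity) fun p hp => ?_
      obtain ⟨h3, h4, h5⟩ := had hp
      rcases eq_or_ne (tdeg p.1) 0 with h6 | h6
      · rw [hT0 _ h6, zero_mul, Matrix.zero_apply, norm_zero]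
        positivity
      · have := hmul h5 hc.le zero_le_one (hT p.1) (ih (tdeg p.2) (by omega) p.2 rfl).1 a b
        rwa [mul_one] at this
    constructor
    · intro a b
      have h1 := congrFun (congrFun (h.step ℓ) a) b
      have h2 : tdeg (ℓ + Finsupp.single none 1) = tdeg ℓ := by rw [tdeg_add, tdeg_single_none, add_zero]
      have h3 : w (ℓ + Finsupp.single none 1) = w ℓ * c := by
        rw [hwadd]
        simp [hw, tdeg_single_none]
      -- The integer `tdeg ℓ` is nonzero and has norm one, so solving for P involves no loss.
      have h4 := congrArg norm h1
      rw [Matrix.smul_apply, smul_eq_mul, norm_mul, NormNatOne.norm_natCast _ ht, one_mul] at h4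
      rw [h4, ← le_div_iff₀ (hwpos _)]
      have h5 : c / w (ℓ + Finsupp.single none 1) = 1 / w ℓ := by
        rw [h3]
        have := hwpos ℓ
        field_simp
      rw [← h5, Matrix.add_apply, Matrix.neg_apply]
      refine (IsUltrametricDist.norm_add_le_max _ _).trans (max_le ?_ ?_)
      · rw [norm_neg]
        exact hTP _ h2 a b
      · have h1 := hwpos (ℓ + Finsupp.single none 1)
        rw [mcoeff_mul, Matrix.sum_apply]
        refine IsUltrametricDist.norm_sum_le_of_forall_le_of_nonneg (by positivity) fun p hp => ?_
        obtain ⟨h3, h4, h5⟩ := had hp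
        rw [h2] at h3
        simp only [Finsupp.add_apply, Finsupp.single_eq_same] at h4
        by_cases hz : mcoeff p.1 P * mcoeff p.2 M = 0
        · rw [hz, Matrix.zero_apply, norm_zero]
          positivity
        have h6 : tdeg p.2 ≠ 0 := fun h6 => hz (by rw [h.initM _ h6, mul_zero])
        have h7 : p.2 none = 0 := by
          by_contra h7
          exact hz (by rw [h.indep _ h7, mul_zero])
        have h8 : tdeg p.1 ≠ 0 := fun h8 => hz (by
          have h9 : p.1 ≠ 0 := fun h => by
            rw [h] at h4
            simp [h7] at h4
          rw [h.init _ h8, mcoeff_one, if_neg h9, zero_mul])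
        have := hmul h5 zero_le_one hc.le (ih (tdeg p.1) (by omega) p.1 rfl).1
          (ih (tdeg p.2) (by omega) p.2 rfl).2 a b
        rwa [one_mul] at this
    · intro a b
      by_cases h0 : ℓ none = 0
      swap
      · rw [h.indep _ h0, Matrix.zero_apply, norm_zero, zero_mul]
        exact hc.le
      have hmem : ((0, ℓ) : (Option (Fin n) →₀ ℕ) × (Option (Fin n) →₀ ℕ)) ∈
          Finset.HasAntidiagonal.antidiagonal ℓ := by simp
      have h1 := h.residue ℓ h0
      have hwl := hwpos ℓ
      -- In the equation at u^0 the term (0, ℓ) is the coefficient of M in question; the other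
      -- products only contain coefficients of smaller t-degree or zero.
      rw [mcoeff_mul ℓ P M, ← Finset.add_sum_erase _ _ hmem, h.init _ tdeg_zero, mcoeff_one, if_pos rfl,
        one_mul] at h1
      rw [← le_div_iff₀ (hwpos _), eq_sub_of_add_eq h1.symm, Matrix.sub_apply, sub_eq_add_neg]
      refine (IsUltrametricDist.norm_add_le_max _ _).trans (max_le (hTP ℓ rfl a b) ?_)
      rw [norm_neg, Matrix.sum_apply]
      refine IsUltrametricDist.norm_sum_le_of_forall_le_of_nonneg (by positivity) fun p hp => ?_
      obtain ⟨hne, hp⟩ := Finset.mem_erase.1 hp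
      obtain ⟨h3, h4, h5⟩ := had hp
      by_cases hz : mcoeff p.1 P * mcoeff p.2 M = 0
      · rw [hz, Matrix.zero_apply, norm_zero]
        positivity
      have h6 : tdeg p.2 ≠ 0 := fun h6 => hz (by rw [h.initM _ h6, mul_zero])
      have h8 : tdeg p.1 ≠ 0 := fun h8 => by
        have h9 := eq_zero_of_tdeg h8 (by omega)
        exact hne (Prod.ext h9 (by rw [← h5, h9, zero_add]))
      have := hmul h5 zero_le_one hc.le (ih (tdeg p.1) (by omega) p.1 rfl).1
        (ih (tdeg p.2) (by omega) p.2 rfl).2 a b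
      rwa [one_mul] at this

end Bounds

/-! ### Consequences of flatness along the Euler field. -/

section FormalFlatness

variable {k : Type*} [Field k] {n : ℕ} {m l : Type*}

/-- The coordinate `u` as a formal power series. -/
noncomputable def uVar (k : Type*) [Field k] (n : ℕ) : MvPowerSeries (Option (Fin n)) k := MvPowerSeries.X none

/-- The series `u²` for the direction `∂_u` and `u` for the direction `∂_{t_j}`. -/
noncomputable def fweight (c : Option (Fin n)) : MvPowerSeries (Option (Fin n)) k :=
  c.elim (uVar k n ^ 2) fun _ => uVar k n

/-- The operators `u² ∂_u` and `u ∂_{t_j}` on matrices of formal power series. -/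
noncomputable def dop (c : Option (Fin n)) (X : Matrix m l (MvPowerSeries (Option (Fin n)) k)) :
    Matrix m l (MvPowerSeries (Option (Fin n)) k) :=
  (fweight c : MvPowerSeries (Option (Fin n)) k) • mD c X

theorem dop_add (c : Option (Fin n)) (X Y : Matrix m l (MvPowerSeries (Option (Fin n)) k)) :
    dop c (X + Y) = dop c X + dop c Y := by rw [dop, mD_add, smul_add]; rfl

theorem dop_some_comm (i j : Fin n) (X : Matrix m l (MvPowerSeries (Option (Fin n)) k)) :
    dop (some i) (dop (some j) X) = dop (some j) (dop (some i) X) := by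
  have h : ∀ i : Fin n, MvPowerSeries.pderiv k (some i) (uVar k n) = 0 := fun i =>
    MvPowerSeries.pderiv_X_of_ne (by simp)
  simp only [dop, mD_smul, fweight, Option.elim_some, h, zero_smul, zero_add]
  rw [mD_comm]

/-- The commutator of u²∂_u and u∂_{t_j} is u·(u∂_{t_j}); this is the source of the right-hand side
of `IsFormallyFlat.none_some`. -/
theorem dop_none_comm (j : Fin n) (X : Matrix m l (MvPowerSeries (Option (Fin n)) k)) :
    dop none (dop (some j) X) = dop (some j) (dop none X) + uVar k n • dop (some j) X := by
  have h : MvPowerSeries.pderiv k (some j) (uVar k n) = 0 :=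
    MvPowerSeries.pderiv_X_of_ne (by simp)
  have h' : MvPowerSeries.pderiv k none (uVar k n) = 1 := MvPowerSeries.pderiv_X_self
  simp only [dop, mD_smul, fweight, Option.elim_some, Option.elim_none, h, h', one_smul,
    MvPowerSeries.pderiv_pow, mul_zero, zero_smul, zero_add, smul_add, smul_smul]
  rw [mD_comm none, add_comm]
  congr 2 <;> ring

variable [Fintype m]

theorem dop_mul {l' : Type*} (c : Option (Fin n)) (X : Matrix l m (MvPowerSeries (Option (Fin n)) k))
    (Y : Matrix m l' (MvPowerSeries (Option (Fin n)) k)) :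
    dop c (X * Y) = dop c X * Y + X * dop c Y := by
  rw [dop, mD_mul, smul_add, dop, dop, Matrix.smul_mul, Matrix.mul_smul]

omit [Fintype m] in
theorem sum_smul_mul {ι S l' : Type*} [CommRing S] [Fintype m] (s : Finset ι) (c : ι → S) (X : ι → Matrix l m S)
    (Y : Matrix m l' S) : ∑ i ∈ s, c i • (X i * Y) = (∑ i ∈ s, c i • X i) * Y := by
  rw [Matrix.sum_mul]
  exact Finset.sum_congr rfl fun i _ => (Matrix.smul_mul _ _ _).symm

omit [Fintype m] in
theorem sum_smul_mul' {ι S l' : Type*} [CommRing S] [Fintype m] (s : Finset ι) (c : ι → S) (X : ι → Matrix m l S)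
    (Y : Matrix l' m S) : ∑ i ∈ s, c i • (Y * X i) = Y * ∑ i ∈ s, c i • X i := by
  rw [Matrix.mul_sum]
  exact Finset.sum_congr rfl fun i _ => (Matrix.mul_smul _ _ _).symm

/-- Flatness of the operators `u² ∂_u + A_u` and `u ∂_{t_j} + A_j`. -/
structure IsFormallyFlat (A : Option (Fin n) → Matrix m m (MvPowerSeries (Option (Fin n)) k)) : Prop where
  some_some : ∀ i j, dop (some i) (A (some j)) - dop (some j) (A (some i)) +
    (A (some i) * A (some j) - A (some j) * A (some i)) = 0
  none_some : ∀ j, dop none (A (some j)) - dop (some j) (A none) +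
    (A none * A (some j) - A (some j) * A none) = uVar k n • A (some j)

variable [DecidableEq m]

theorem IsFormallyFlat.gauge {A N : Option (Fin n) → Matrix m m (MvPowerSeries (Option (Fin n)) k)}
    (hA : IsFormallyFlat A) {P Pi : Matrix m m (MvPowerSeries (Option (Fin n)) k)} (hP : Pi * P = 1)
    (hN : ∀ c, A c * P + dop c P = P * N c) : IsFormallyFlat N where
  some_some i j := by
    rw [← zero_smul (MvPowerSeries (Option (Fin n)) k) (N (some j))]
    exact gauge_flat (S := MvPowerSeries (Option (Fin n)) k) (dop_add _) (dop_add _) (dop_mul _) (dop_mul _)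
      (fun X => by rw [zero_smul, add_zero]; exact dop_some_comm i j X)
      (by rw [zero_smul]; exact hA.some_some i j) hP (hN _) (hN _)
  none_some j := gauge_flat (dop_add _) (dop_add _) (dop_mul _) (dop_mul _) (dop_none_comm j)
    (hA.none_some j) hP (hN _) (hN _)

omit [Fintype m] [DecidableEq m] in
theorem mcoeff_X_smul_mD (c : Option (Fin n)) (X : Matrix l m (MvPowerSeries (Option (Fin n)) k))
    (ℓ : Option (Fin n) →₀ ℕ) :
    mcoeff ℓ ((MvPowerSeries.X c : MvPowerSeries (Option (Fin n)) k) • mD c X) = (ℓ c : k) • mcoeff ℓ X := by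
  rcases eq_or_ne (ℓ c) 0 with h | h
  · rw [mcoeff_X_smul_of_eq_zero c _ h, h, Nat.cast_zero, zero_smul]
  · obtain ⟨ℓ', rfl⟩ : ∃ ℓ', ℓ = ℓ' + Finsupp.single c 1 := by
      refine ⟨ℓ - Finsupp.single c 1, (tsub_add_cancel_of_le ?_).symm⟩
      simpa [Finsupp.single_le_iff] using Nat.one_le_iff_ne_zero.2 h
    rw [mcoeff_X_smul_add, mcoeff_mD]
    simp

/-- The Euler field of the base. -/
noncomputable def euler (X : Matrix l m (MvPowerSeries (Option (Fin n)) k)) :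
    Matrix l m (MvPowerSeries (Option (Fin n)) k) :=
  ∑ j, (MvPowerSeries.X (some j) : MvPowerSeries (Option (Fin n)) k) • mD (some j) X

omit [Fintype m] [DecidableEq m] in
theorem mcoeff_euler (X : Matrix l m (MvPowerSeries (Option (Fin n)) k)) (ℓ : Option (Fin n) →₀ ℕ) :
    mcoeff ℓ (euler X) = (tdeg ℓ : k) • mcoeff ℓ X := by
  rw [euler, mcoeff_sum, tdeg, Nat.cast_sum, Finset.sum_smul]
  exact Finset.sum_congr rfl fun j _ => mcoeff_X_smul_mD _ _ _

/-- The contraction of a connection with the Euler field. -/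
noncomputable def radial (N : Option (Fin n) → Matrix l m (MvPowerSeries (Option (Fin n)) k)) :
    Matrix l m (MvPowerSeries (Option (Fin n)) k) :=
  ∑ j, (MvPowerSeries.X (some j) : MvPowerSeries (Option (Fin n)) k) • N (some j)

omit [Fintype m] [DecidableEq m] in
theorem mcoeff_radial_eq_zero (N : Option (Fin n) → Matrix l m (MvPowerSeries (Option (Fin n)) k))
    {ℓ : Option (Fin n) →₀ ℕ} (h : tdeg ℓ = 0) : mcoeff ℓ (radial N) = 0 := by
  rw [radial, mcoeff_sum]
  exact Finset.sum_eq_zero fun j _ => mcoeff_X_smul_of_eq_zero _ _ (tdeg_eq_zero_iff.1 h j)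

omit [Fintype m] [DecidableEq m] in
theorem mD_radial (N : Option (Fin n) → Matrix l m (MvPowerSeries (Option (Fin n)) k)) (i : Fin n) :
    mD (some i) (radial N) = N (some i) +
      ∑ j, (MvPowerSeries.X (some j) : MvPowerSeries (Option (Fin n)) k) • mD (some i) (N (some j)) := by
  simp only [radial, mD_sum, mD_smul, Finset.sum_add_distrib]
  congr 1
  rw [Finset.sum_eq_single i]
  · rw [MvPowerSeries.pderiv_X_self, one_smul]
  · intro j _ h
    rw [MvPowerSeries.pderiv_X_of_ne (by simpa using h), zero_smul]
  · simp

-- Obtained by contracting the flatness in two base directions with the Euler field in one of them;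
-- the extra N_i comes from differentiating the coordinates in `radial N`.
omit [DecidableEq m] in
theorem IsFormallyFlat.euler_some {N : Option (Fin n) → Matrix m m (MvPowerSeries (Option (Fin n)) k)}
    (hN : IsFormallyFlat N) (i : Fin n) :
    uVar k n • (euler (N (some i)) + N (some i) - mD (some i) (radial N)) =
      N (some i) * radial N - radial N * N (some i) := by
  have h := Finset.sum_congr rfl fun j (_ : j ∈ Finset.univ) =>
    congrArg (fun Y => (MvPowerSeries.X (some j) : MvPowerSeries (Option (Fin n)) k) • Y) (hN.some_some j i)
  simp only [smul_add, smul_sub, smul_zero, Finset.sum_const_zero, Finset.sum_add_distrib,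
    Finset.sum_sub_distrib, sum_smul_mul, sum_smul_mul'] at h
  simp only [dop, fweight, Option.elim_some, smul_comm _ (uVar k n), ← Finset.smul_sum, ← smul_sub] at h
  rw [mD_radial]
  have e : euler (N (some i)) + N (some i) - (N (some i) +
      ∑ j, (MvPowerSeries.X (some j) : MvPowerSeries (Option (Fin n)) k) • mD (some i) (N (some j))) =
      euler (N (some i)) - ∑ j, (MvPowerSeries.X (some j) : MvPowerSeries (Option (Fin n)) k) • mD (some i) (N (some j)) := by
    abel
  rw [e, euler, eq_neg_of_add_eq_zero_left h, radial, neg_sub]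

-- Induction on the t-degree d. Taking the coefficient at one higher power of u in
-- `IsFormallyFlat.euler_some`, the left side is (d + 1) times the wanted coefficient. In the
-- commutator the radial part has positive t-degree and sits at u^0, so N_i enters with smaller
-- t-degree and positive power of u, where it vanishes by induction.
omit [DecidableEq m] in
theorem IsFormallyFlat.indep {N : Option (Fin n) → Matrix m m (MvPowerSeries (Option (Fin n)) k)}
    (hN : IsFormallyFlat N) [CharZero k] (hM : ∀ ℓ, ℓ none ≠ 0 → mcoeff ℓ (radial N) = 0) (i : Fin n)
    (ℓ : Option (Fin n) →₀ ℕ) (hℓ : ℓ none ≠ 0) : mcoeff ℓ (N (some i)) = 0 := by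
  classical
  suffices ∀ d ℓ, tdeg ℓ = d → ℓ none ≠ 0 → mcoeff ℓ (N (some i)) = 0 from this _ ℓ rfl hℓ
  clear hℓ ℓ
  intro d
  induction d using Nat.strong_induction_on with
  | _ d ih =>
    rintro ℓ rfl hℓ
    have h := congrArg (mcoeff (ℓ + Finsupp.single none 1)) (hN.euler_some i)
    rw [uVar, mcoeff_X_smul_add, mcoeff_sub, mcoeff_add, mcoeff_euler, mcoeff_mD, hM (ℓ + _) (by simp [hℓ]),
      smul_zero, sub_zero, mcoeff_sub, mcoeff_mul, mcoeff_mul, Finset.sum_eq_zero, Finset.sum_eq_zero,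
      sub_zero] at h
    · have h2 : ((tdeg ℓ + 1 : ℕ) : k) • mcoeff ℓ (N (some i)) = 0 := by
        rw [← h, Nat.cast_add, Nat.cast_one, add_smul, one_smul]
      exact (smul_eq_zero.1 h2).resolve_left (Nat.cast_ne_zero.2 (Nat.succ_ne_zero _))
    all_goals
      intro p hp
      rw [Finset.HasAntidiagonal.mem_antidiagonal] at hp
      have h1 := congrArg tdeg hp
      have h2 := DFunLike.congr_fun hp none
      rw [tdeg_add, tdeg_add, tdeg_single_none] at h1
      simp only [Finsupp.add_apply, Finsupp.single_eq_same] at h2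
    · rcases eq_or_ne (p.1 none) 0 with h3 | h3
      · rcases eq_or_ne (tdeg p.1) 0 with h4 | h4
        · rw [mcoeff_radial_eq_zero N h4, zero_mul]
        · rw [ih (tdeg p.2) (by omega) p.2 rfl (by omega), mul_zero]
      · rw [hM _ h3, zero_mul]
    · rcases eq_or_ne (p.2 none) 0 with h3 | h3
      · rcases eq_or_ne (tdeg p.2) 0 with h4 | h4
        · rw [mcoeff_radial_eq_zero N h4, mul_zero]
        · rw [ih (tdeg p.1) (by omega) p.1 rfl (by omega), zero_mul]
      · rw [hM _ h3, mul_zero]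

-- This is the Euler contraction of flatness in the directions u and t_j; the term with ∂_u N_j
-- drops out since N_j is free of u.
omit [DecidableEq m] in
theorem IsFormallyFlat.euler_none {N : Option (Fin n) → Matrix m m (MvPowerSeries (Option (Fin n)) k)}
    (hN : IsFormallyFlat N) (hi : ∀ i ℓ, ℓ none ≠ 0 → mcoeff ℓ (N (some i)) = 0) :
    uVar k n • (euler (N none) + radial N) = N none * radial N - radial N * N none := by
  have h0 : ∀ j, mD none (N (some j)) = 0 := fun j => mcoeff_ext fun ℓ => by
    rw [mcoeff_mD, hi _ _ (by simp), smul_zero, mcoeff_zero]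
  have h := Finset.sum_congr rfl fun j (_ : j ∈ Finset.univ) =>
    congrArg (fun Y => (MvPowerSeries.X (some j) : MvPowerSeries (Option (Fin n)) k) • Y) (hN.none_some j)
  simp only [smul_add, smul_sub, Finset.sum_add_distrib,
    Finset.sum_sub_distrib, sum_smul_mul, sum_smul_mul'] at h
  simp only [dop, fweight, Option.elim_some, smul_comm _ (uVar k n), ← Finset.smul_sum, h0,
    smul_zero, Finset.sum_const_zero, zero_sub] at h
  rw [euler, smul_add, radial, ← h]
  abel

-- The same induction as in `IsFormallyFlat.indep`, now based on `IsFormallyFlat.euler_none`. The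
-- Euler factor is d instead of d + 1, so t-degree 0 is not covered and has to be supplied by `h0`.
omit [DecidableEq m] in
theorem IsFormallyFlat.none_eq_zero {N : Option (Fin n) → Matrix m m (MvPowerSeries (Option (Fin n)) k)}
    (hN : IsFormallyFlat N) [CharZero k] (hi : ∀ i ℓ, ℓ none ≠ 0 → mcoeff ℓ (N (some i)) = 0)
    (h0 : ∀ ℓ, tdeg ℓ = 0 → 2 ≤ ℓ none → mcoeff ℓ (N none) = 0) (ℓ : Option (Fin n) →₀ ℕ)
    (hℓ : 2 ≤ ℓ none) : mcoeff ℓ (N none) = 0 := by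
  classical
  have hM : ∀ ℓ, ℓ none ≠ 0 → mcoeff ℓ (radial N) = 0 := fun ℓ hℓ => by
    rw [radial, mcoeff_sum]
    refine Finset.sum_eq_zero fun j _ => ?_
    rcases eq_or_ne (ℓ (some j)) 0 with h | h
    · exact mcoeff_X_smul_of_eq_zero _ _ h
    · obtain ⟨ℓ', rfl⟩ : ∃ ℓ', ℓ = ℓ' + Finsupp.single (some j) 1 := by
        refine ⟨ℓ - Finsupp.single (some j) 1, (tsub_add_cancel_of_le ?_).symm⟩
        simpa [Finsupp.single_le_iff] using Nat.one_le_iff_ne_zero.2 h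
      rw [mcoeff_X_smul_add]
      exact hi _ _ (by simpa using hℓ)
  suffices ∀ d ℓ, tdeg ℓ = d → 2 ≤ ℓ none → mcoeff ℓ (N none) = 0 from this _ ℓ rfl hℓ
  clear hℓ ℓ
  intro d
  induction d using Nat.strong_induction_on with
  | _ d ih =>
    rintro ℓ rfl hℓ
    rcases eq_or_ne (tdeg ℓ) 0 with ht | ht
    · exact h0 ℓ ht hℓ
    have h := congrArg (mcoeff (ℓ + Finsupp.single none 1)) (hN.euler_none hi)
    rw [uVar, mcoeff_X_smul_add, mcoeff_add, mcoeff_euler, hM ℓ (by omega),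
      add_zero, mcoeff_sub, mcoeff_mul, mcoeff_mul, Finset.sum_eq_zero, Finset.sum_eq_zero,
      sub_zero] at h
    · exact (smul_eq_zero.1 h).resolve_left (Nat.cast_ne_zero.2 ht)
    all_goals
      intro p hp
      rw [Finset.HasAntidiagonal.mem_antidiagonal] at hp
      have h1 := congrArg tdeg hp
      have h2 := DFunLike.congr_fun hp none
      rw [tdeg_add, tdeg_add, tdeg_single_none] at h1
      simp only [Finsupp.add_apply, Finsupp.single_eq_same] at h2
    · rcases eq_or_ne (p.1 none) 0 with h3 | h3
      · rcases eq_or_ne (tdeg p.1) 0 with h4 | h4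
        · rw [mcoeff_radial_eq_zero N h4, zero_mul]
        · rw [ih (tdeg p.2) (by omega) p.2 rfl (by omega), mul_zero]
      · rw [hM _ h3, zero_mul]
    · rcases eq_or_ne (p.2 none) 0 with h3 | h3
      · rcases eq_or_ne (tdeg p.2) 0 with h4 | h4
        · rw [mcoeff_radial_eq_zero N h4, mul_zero]
        · rw [ih (tdeg p.1) (by omega) p.1 rfl (by omega), zero_mul]
      · rw [hM _ h3, mul_zero]

/-- Frames in which the connection has the framed form and which agree on the axis differ by a
constant matrix. -/
theorem eq_const_of_compare {l : Type*} [Fintype l] [CharZero k]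
    {W : Matrix m l (MvPowerSeries (Option (Fin n)) k)}
    {N : Fin n → Matrix m m (MvPowerSeries (Option (Fin n)) k)}
    {a : Fin n → Matrix l l (MvPowerSeries (Option (Fin n)) k)}
    (hN : ∀ i ℓ, ℓ none ≠ 0 → mcoeff ℓ (N i) = 0) (ha : ∀ i ℓ, ℓ none ≠ 0 → mcoeff ℓ (a i) = 0)
    (h : ∀ j, dop (some j) W + N j * W = W * a j)
    (hW : ∀ ℓ, tdeg ℓ = 0 → ℓ none ≠ 0 → mcoeff ℓ W = 0) (ℓ : Option (Fin n) →₀ ℕ) (hℓ : ℓ ≠ 0) :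
    mcoeff ℓ W = 0 := by
  classical
  suffices ∀ d ℓ, tdeg ℓ = d → ℓ ≠ 0 → mcoeff ℓ W = 0 from this _ ℓ rfl hℓ
  clear hℓ ℓ
  intro d
  induction d using Nat.strong_induction_on with
  | _ d ih =>
    rintro ℓ rfl hℓ
    rcases eq_or_ne (tdeg ℓ) 0 with ht | ht
    · exact hW ℓ ht fun h => hℓ (eq_zero_of_tdeg ht h)
    obtain ⟨j, hj⟩ : ∃ j, ℓ (some j) ≠ 0 := by
      by_contra hcon
      push Not at hcon
      exact ht (tdeg_eq_zero_iff.2 hcon)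
    obtain ⟨ℓ', rfl⟩ : ∃ ℓ', ℓ = ℓ' + Finsupp.single (some j) 1 := by
      refine ⟨ℓ - Finsupp.single (some j) 1, (tsub_add_cancel_of_le ?_).symm⟩
      simpa [Finsupp.single_le_iff] using Nat.one_le_iff_ne_zero.2 hj
    -- One power of u higher, only the u^0 parts of N and a contribute; they meet coefficients of W
    -- with positive power of u and smaller t-degree, which vanish by induction.
    have h1 := congrArg (mcoeff (ℓ' + Finsupp.single none 1)) (h j)
    rw [dop, mcoeff_add, fweight, Option.elim_some, uVar, mcoeff_X_smul_add, mcoeff_mD, mcoeff_mul, mcoeff_mul,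
      Finset.sum_eq_zero, Finset.sum_eq_zero, add_zero] at h1
    · exact (smul_eq_zero.1 h1).resolve_left (Nat.cast_ne_zero.2 (Nat.succ_ne_zero _))
    all_goals
      intro p hp
      rw [Finset.HasAntidiagonal.mem_antidiagonal] at hp
      have h1 := congrArg tdeg hp
      have h2 := DFunLike.congr_fun hp none
      rw [tdeg_add, tdeg_add, tdeg_single_none] at h1
      rw [tdeg_add, tdeg_single_some] at ih
      simp only [Finsupp.add_apply, Finsupp.single_eq_same] at h2
    · rcases eq_or_ne (p.2 none) 0 with h3 | h3
      · rw [ih (tdeg p.1) (by omega) p.1 rfl (fun h => by simp [h, h3] at h2), Matrix.zero_mul]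
      · rw [ha _ _ h3, Matrix.mul_zero]
    · rcases eq_or_ne (p.1 none) 0 with h3 | h3
      · rw [ih (tdeg p.2) (by omega) p.2 rfl (fun h => by simp [h, h3] at h2), Matrix.mul_zero]
      · rw [hN _ _ h3, Matrix.zero_mul]

theorem isUnit_det_of_mcoeff_zero {σ : Type*} {X : Matrix m m (MvPowerSeries σ k)}
    (h : (mcoeff 0 X).det ≠ 0) : IsUnit X.det := by
  rw [MvPowerSeries.isUnit_iff_constantCoeff, RingHom.map_det, isUnit_iff_ne_zero]
  exact h

end FormalFlatness

/-! ### Existence of a convergent gauge transformation. -/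

section FormalTheorem

variable {k : Type*} [NontriviallyNormedField k] [IsUltrametricDist k] [NormNatOne k] {n : ℕ}
  {m : Type*} [Fintype m] [DecidableEq m]

/-- The entries of `X` are convergent power series. -/
def MConv {σ l m : Type*} (X : Matrix l m (MvPowerSeries σ k)) : Prop := ∀ a b, Conv (X a b)

/-- A flat connection whose `u`-component has the framed form on the axis is gauge equivalent to one
of the framed form, by a unique convergent gauge transformation which is trivial on the axis. -/
theorem exists_formal_framing {A : Option (Fin n) → Matrix m m (MvPowerSeries (Option (Fin n)) k)}
    (hA : IsFormallyFlat A) (hconv : ∀ j, MConv (A (some j)))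
    (h0 : ∀ ℓ, tdeg ℓ = 0 → 2 ≤ ℓ none → mcoeff ℓ (A none) = 0) :
    ∃ (P : Matrix m m (MvPowerSeries (Option (Fin n)) k))
      (N : Option (Fin n) → Matrix m m (MvPowerSeries (Option (Fin n)) k)),
      MConv P ∧ (∀ ℓ, tdeg ℓ = 0 → mcoeff ℓ P = mcoeff ℓ 1) ∧
      (∀ c, A c * P + dop c P = P * N c) ∧
      (∀ j ℓ, ℓ none ≠ 0 → mcoeff ℓ (N (some j)) = 0) ∧
      ∀ ℓ, 2 ≤ ℓ none → mcoeff ℓ (N none) = 0 := by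
  classical
  have := NormNatOne.charZero (K := k)
  have hT0 : ∀ ℓ, tdeg ℓ = 0 → mcoeff ℓ (radial A) = 0 := fun ℓ h => mcoeff_radial_eq_zero A h
  obtain ⟨P, M, hPM⟩ := exists_isRadialSolution (radial A) hT0
  have hP0 : mcoeff 0 P = 1 := by rw [hPM.init 0 tdeg_zero, mcoeff_one, if_pos rfl]
  have hdet : IsUnit P.det := isUnit_det_of_mcoeff_zero (by rw [hP0, Matrix.det_one]; exact one_ne_zero)
  have hPi : P⁻¹ * P = 1 := Matrix.nonsing_inv_mul P hdet
  set N : Option (Fin n) → Matrix m m (MvPowerSeries (Option (Fin n)) k) :=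
    fun c => P⁻¹ * (A c * P + dop c P) with hNdef
  have hN : ∀ c, A c * P + dop c P = P * N c := fun c => by
    rw [hNdef, ← mul_assoc, Matrix.mul_nonsing_inv P hdet, one_mul]
  have hflat := hA.gauge hPi hN
  -- The conditions `residue` and `step` are the coefficients of this one equation at u^0 and at
  -- positive powers of u.
  have hrad : radial A * P + uVar k n • euler P = P * M := by
    refine mcoeff_ext fun ℓ => ?_
    rcases eq_or_ne (ℓ none) 0 with h | h
    · rw [mcoeff_add, uVar, mcoeff_X_smul_of_eq_zero _ _ h, add_zero, hPM.residue ℓ h]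
    · obtain ⟨ℓ', rfl⟩ : ∃ ℓ', ℓ = ℓ' + Finsupp.single none 1 := by
        refine ⟨ℓ - Finsupp.single none 1, (tsub_add_cancel_of_le ?_).symm⟩
        simpa [Finsupp.single_le_iff] using Nat.one_le_iff_ne_zero.2 h
      rw [mcoeff_add, uVar, mcoeff_X_smul_add, mcoeff_euler, hPM.step]
      abel
  -- The Euler contraction of the transformed connection is M, which is free of u by construction;
  -- this is the hypothesis that `IsFormallyFlat.indep` needs.
  have hM : radial N = M := by
    have : radial A * P + uVar k n • euler P = P * radial N := by
      have e : ∀ j, (MvPowerSeries.X (some j) : MvPowerSeries (Option (Fin n)) k) • (P * N (some j)) =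
          P * ((MvPowerSeries.X (some j) : MvPowerSeries (Option (Fin n)) k) • N (some j)) := fun j =>
        (Matrix.mul_smul _ _ _).symm
      rw [radial, radial, euler, Finset.sum_mul, Finset.smul_sum, ← Finset.sum_add_distrib, Finset.mul_sum]
      refine Finset.sum_congr rfl fun j _ => ?_
      rw [← e, ← hN, smul_add, Matrix.smul_mul, dop, fweight, Option.elim_some, smul_comm]
    rw [hrad] at this
    have := congrArg (P⁻¹ * ·) this
    simpa only [← mul_assoc, hPi, one_mul] using this.symm
  have hindep := hflat.indep (by rw [hM]; exact hPM.indep)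
  refine ⟨P, N, fun a b => ?_, hPM.init, hN, hindep, hflat.none_eq_zero hindep fun ℓ ht h2 => ?_⟩
  · have hT : ∃ c : k, c ≠ 0 ∧ ∃ C : ℝ, ∀ a b, CauchyBound (radial A a b) c C := by
      have hTconv : ∀ a b, Conv (radial A a b) := fun a b => by
        rw [radial, Matrix.sum_apply]
        refine Finset.sum_induction _ Conv (fun _ _ => Conv.add) (by simpa using conv_coe (0 : MvPolynomial (Option (Fin n)) k)) fun j _ => ?_
        rw [Matrix.smul_apply, smul_eq_mul]
        refine Conv.mul ?_ (hconv j a b)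
        rw [← MvPolynomial.coe_X]
        exact conv_coe _
      have key : ∀ s : Finset (m × m), ∃ c : k, c ≠ 0 ∧ ∃ C : ℝ, ∀ p ∈ s, CauchyBound (radial A p.1 p.2) c C := by
        intro s
        induction s using Finset.induction_on with
        | empty => exact ⟨1, one_ne_zero, 0, by simp⟩
        | insert p s _ ih =>
          obtain ⟨c, hc, C, h⟩ := ih
          obtain ⟨c', hc', C', h'⟩ := hTconv p.1 p.2
          obtain ⟨d, hd, hdc, hdc'⟩ := exists_norm_le_norm hc hc'
          refine ⟨d, hd, max C C', fun q hq => ?_⟩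
          rcases Finset.mem_insert.1 hq with rfl | hq
          · exact h'.mono hdc' (le_max_right _ _)
          · exact (h q hq).mono hdc (le_max_left _ _)
      obtain ⟨c, hc, C, h⟩ := key Finset.univ
      exact ⟨c, hc, C, fun a b => h (a, b) (Finset.mem_univ _)⟩
    obtain ⟨c, hc, C, hT⟩ := hT
    have hC : 0 ≤ C := (hT a b).nonneg
    have hc' : 0 < ‖c‖ := norm_pos_iff.2 hc
    -- The series `radial A` has only terms of positive t-degree, so a smaller radius ‖d‖ in the
    -- t-directions brings its bound C down to the ‖c‖ required by the weighted estimate.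
    obtain ⟨d, hd, hdc, hdε⟩ := exists_lt_norm k hc (show 0 < ‖c‖ * ‖c‖ / (C + 1) by positivity)
    have hd' : 0 < ‖d‖ := norm_pos_iff.2 hd
    have hb := hPM.cauchyBound hT0 hc' hd' (fun ℓ a b => by
      rcases eq_or_ne (tdeg ℓ) 0 with ht | ht
      · rw [hT0 ℓ ht, Matrix.zero_apply, norm_zero, zero_mul]
        exact hc'.le
      · obtain ⟨e, he⟩ := Nat.exists_eq_succ_of_ne_zero ht
        have h1 := hT a b ℓ
        rw [degree_eq_tdeg_add, he, pow_add, Nat.succ_eq_add_one, pow_succ] at h1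
        rw [le_div_iff₀ (by positivity)] at hdε
        rw [he, Nat.succ_eq_add_one, pow_succ, mcoeff_apply]
        refine le_of_mul_le_mul_right ?_ hc'
        have h3 : ‖MvPowerSeries.coeff ℓ (radial A a b)‖ * (‖d‖ ^ e * ‖c‖ * ‖c‖ ^ ℓ none) ≤ C := by
          refine le_trans ?_ h1
          gcongr
        calc _ = ‖MvPowerSeries.coeff ℓ (radial A a b)‖ * (‖d‖ ^ e * ‖c‖ * ‖c‖ ^ ℓ none) * ‖d‖ := by ring
          _ ≤ (C + 1) * ‖d‖ := by
            gcongr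
            linarith
          _ ≤ _ := by linarith)
    refine ⟨d, hd, 1, fun ℓ => ?_⟩
    refine le_trans ?_ ((hb ℓ).1 a b)
    rw [degree_eq_tdeg_add, pow_add, mcoeff_apply]
    gcongr
  · have h1 := congrArg (mcoeff ℓ) (hN none)
    have hne : ℓ ≠ 0 := fun h => by simp [h] at h2
    have hdop : mcoeff ℓ (dop none P) = 0 := by
      obtain ⟨ℓ', rfl⟩ : ∃ ℓ', ℓ = ℓ' + Finsupp.single none 1 := by
        refine ⟨ℓ - Finsupp.single none 1, (tsub_add_cancel_of_le ?_).symm⟩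
        simpa [Finsupp.single_le_iff] using (by omega : 1 ≤ ℓ none)
      rw [dop, fweight, Option.elim_none, uVar, pow_two, mul_smul, mcoeff_X_smul_add, mcoeff_X_smul_mD]
      have h3 : tdeg ℓ' = 0 := by rwa [tdeg_add, tdeg_single_none, add_zero] at ht
      have h4 : ℓ' ≠ 0 := fun h => by simp [h] at h2
      rw [hPM.init _ h3, mcoeff_one, if_neg h4, smul_zero]
    have hadd : ∀ p : (Option (Fin n) →₀ ℕ) × (Option (Fin n) →₀ ℕ),
        p ∈ Finset.HasAntidiagonal.antidiagonal ℓ → tdeg p.1 = 0 ∧ tdeg p.2 = 0 ∧ p.1 + p.2 = ℓ := fun p hp => by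
      rw [Finset.HasAntidiagonal.mem_antidiagonal] at hp
      have := congrArg tdeg hp
      rw [tdeg_add, ht] at this
      exact ⟨by omega, by omega, hp⟩
    rw [mcoeff_add, hdop, add_zero, mcoeff_mul, mcoeff_mul, Finset.sum_eq_single (ℓ, 0),
      Finset.sum_eq_single (0, ℓ), hP0, mul_one, one_mul, h0 ℓ ht h2] at h1
    · exact h1.symm
    · rintro p hp hne
      obtain ⟨h3, h4, h5⟩ := hadd p hp
      have : p.1 ≠ 0 := fun h => hne (Prod.ext h (by rw [← h5, h, zero_add]))
      rw [hPM.init _ h3, mcoeff_one, if_neg this, zero_mul]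
    · simp
    · rintro p hp hne
      obtain ⟨h3, h4, h5⟩ := hadd p hp
      have : p.2 ≠ 0 := fun h => hne (Prod.ext (by rw [← h5, h, add_zero]) h)
      rw [hPM.init _ h4, mcoeff_one, if_neg this, mul_zero]
    · simp

end FormalTheorem

/-! ### Restriction of power series to coordinate subspaces. -/

section Restriction

variable {k : Type*} [NontriviallyNormedField k]
variable {L : Type*} [NontriviallyNormedField L] [NormedAlgebra k L]
variable {σ : Type*}

open Classical in
/-- The restriction of a power series to the coordinate subspace where the variables in `Z` vanish. -/
noncomputable def kill (Z : σ → Prop) (f : MvPowerSeries σ k) : MvPowerSeries σ k :=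
  fun ℓ => if ∀ i, Z i → ℓ i = 0 then MvPowerSeries.coeff ℓ f else 0

theorem coeff_kill_of_forall {Z : σ → Prop} {f : MvPowerSeries σ k} {ℓ : σ →₀ ℕ} (h : ∀ i, Z i → ℓ i = 0) :
    MvPowerSeries.coeff ℓ (kill Z f) = MvPowerSeries.coeff ℓ f := if_pos h

theorem coeff_kill_of_not_forall {Z : σ → Prop} {f : MvPowerSeries σ k} {ℓ : σ →₀ ℕ} (h : ¬∀ i, Z i → ℓ i = 0) :
    MvPowerSeries.coeff ℓ (kill Z f) = 0 := if_neg h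

theorem Conv.kill {f : MvPowerSeries σ k} (h : Conv f) (Z : σ → Prop) : Conv (kill Z f) := by
  obtain ⟨c, hc, C, h⟩ := h
  refine ⟨c, hc, C, fun ℓ => ?_⟩
  by_cases hZ : ∀ i, Z i → ℓ i = 0
  · rw [coeff_kill_of_forall hZ]
    exact h ℓ
  · rw [coeff_kill_of_not_forall hZ, norm_zero, zero_mul]
    exact h.nonneg

theorem HasSer.kill {g : (σ → L) → L} {f : MvPowerSeries σ k} (h : HasSer g f) (Z : σ → Prop)
    {π : (σ → L) → (σ → L)} (h0 : ∀ x i, Z i → π x i = 0) (h1 : ∀ x i, ¬Z i → π x i = x i) :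
    HasSer (fun x => g (π x)) (RigidAn.kill Z f) := by
  have hcont : Tendsto π (𝓝 0) (𝓝 0) := by
    rw [tendsto_pi_nhds]
    intro i
    by_cases hi : Z i
    · simp only [h0 _ i hi]
      exact tendsto_const_nhds
    · simp only [h1 _ i hi]
      exact (continuous_apply i).tendsto 0
  refine ⟨h.1.kill Z, (hcont.eventually h.2).mono fun x hx => ?_⟩
  convert hx using 1
  funext ℓ
  by_cases hZ : ∀ i, Z i → ℓ i = 0
  · rw [term, term, coeff_kill_of_forall hZ, mon, mon]
    congr 1
    refine Finset.prod_congr rfl fun i hi => ?_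
    dsimp only
    rw [h1 x i fun hz => Finsupp.mem_support_iff.1 hi (hZ i hz)]
  · rw [term, term, coeff_kill_of_not_forall hZ, map_zero, zero_mul]
    push Not at hZ
    obtain ⟨i, hi, hne⟩ := hZ
    have : mon (π x) ℓ = 0 := by
      rw [mon, Finsupp.prod]
      exact Finset.prod_eq_zero (Finsupp.mem_support_iff.2 hne) (by rw [h0 x i hi, zero_pow hne])
    rw [this, mul_zero]

end Restriction

/-! ### Power series expansions of matrices of functions. -/

section MatrixSeries

variable {k : Type*} [NontriviallyNormedField k]
variable {L : Type*} [NontriviallyNormedField L] [NormedAlgebra k L]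
variable {σ : Type*} {l m n : Type*}

/-- Power series expansions of matrices of functions. -/
def HasSerMat (F : (σ → L) → Matrix m n L) (X : Matrix m n (MvPowerSeries σ k)) : Prop :=
  ∀ a b, HasSer (fun x => F x a b) (X a b)

theorem HasSerMat.mconv {F : (σ → L) → Matrix m n L} {X : Matrix m n (MvPowerSeries σ k)}
    (h : HasSerMat F X) : MConv X := fun a b => (h a b).1

theorem hasSerMat_const (X : Matrix m n k) :
    HasSerMat (fun _ : σ → L => X.map (algebraMap k L)) (X.map (MvPowerSeries.C (σ := σ))) :=
  fun a b => hasSer_algebraMap (X a b)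

theorem hasSerMat_one [DecidableEq m] : HasSerMat (fun _ : σ → L => (1 : Matrix m m L))
    (1 : Matrix m m (MvPowerSeries σ k)) := fun a b => by
  rcases eq_or_ne a b with rfl | h
  · simpa using hasSer_one
  · simpa [h] using hasSer_zero

theorem hasSerMat_zero : HasSerMat (fun _ : σ → L => (0 : Matrix m n L))
    (0 : Matrix m n (MvPowerSeries σ k)) := fun _ _ => hasSer_zero

theorem HasSerMat.kill {F : (σ → L) → Matrix m n L} {X : Matrix m n (MvPowerSeries σ k)}
    (h : HasSerMat F X) (Z : σ → Prop) {π : (σ → L) → (σ → L)} (h0 : ∀ x i, Z i → π x i = 0)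
    (h1 : ∀ x i, ¬Z i → π x i = x i) : HasSerMat (fun x => F (π x)) (X.map (RigidAn.kill Z)) :=
  fun a b => (h a b).kill Z h0 h1

variable [IsUltrametricDist k]

theorem HasSerMat.add {F F' : (σ → L) → Matrix m n L} {X X' : Matrix m n (MvPowerSeries σ k)}
    (h : HasSerMat F X) (h' : HasSerMat F' X') : HasSerMat (fun x => F x + F' x) (X + X') :=
  fun a b => (h a b).add (h' a b)

theorem HasSerMat.sub {F F' : (σ → L) → Matrix m n L} {X X' : Matrix m n (MvPowerSeries σ k)}
    (h : HasSerMat F X) (h' : HasSerMat F' X') : HasSerMat (fun x => F x - F' x) (X - X') :=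
  fun a b => (h a b).sub (h' a b)

variable [IsUltrametricDist L]

theorem HasSerMat.mul [Fintype m] {F : (σ → L) → Matrix l m L} {F' : (σ → L) → Matrix m n L}
    {X : Matrix l m (MvPowerSeries σ k)} {X' : Matrix m n (MvPowerSeries σ k)}
    (h : HasSerMat F X) (h' : HasSerMat F' X') : HasSerMat (fun x => F x * F' x) (X * X') :=
  fun a b => by
    simp only [Matrix.mul_apply]
    exact HasSer.sum _ fun i _ => (h a i).mul (h' i b)

theorem HasSerMat.smul {s : (σ → L) → L} {f : MvPowerSeries σ k} {F : (σ → L) → Matrix m n L}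
    {X : Matrix m n (MvPowerSeries σ k)} (hs : HasSer s f) (h : HasSerMat F X) :
    HasSerMat (fun x => s x • F x) (f • X) := fun a b => hs.mul (h a b)

theorem HasSer.prod {ι : Type*} {g : ι → (σ → L) → L} {f : ι → MvPowerSeries σ k} (s : Finset ι)
    (h : ∀ i ∈ s, HasSer (g i) (f i)) : HasSer (fun x => ∏ i ∈ s, g i x) (∏ i ∈ s, f i) := by
  classical
  induction s using Finset.induction_on with
  | empty => simpa using hasSer_one
  | insert i s hi ih =>
    simp only [Finset.prod_insert hi]
    exact (h i (Finset.mem_insert_self _ _)).mul (ih fun j hj => h j (Finset.mem_insert_of_mem hj))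

variable [Fintype m] [DecidableEq m]

theorem HasSerMat.det {F : (σ → L) → Matrix m m L} {X : Matrix m m (MvPowerSeries σ k)}
    (h : HasSerMat F X) : HasSer (fun x => (F x).det) X.det := by
  simp only [Matrix.det_apply]
  refine HasSer.sum _ fun τ _ => ?_
  have := HasSer.prod Finset.univ fun i _ => h (τ i) i
  rcases Int.units_eq_one_or (Equiv.Perm.sign τ) with hs | hs
  · simpa [hs] using this
  · simpa [hs] using this.neg

theorem HasSerMat.adjugate {F : (σ → L) → Matrix m m L} {X : Matrix m m (MvPowerSeries σ k)}
    (h : HasSerMat F X) : HasSerMat (fun x => (F x).adjugate) X.adjugate := fun a b => by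
  simp only [Matrix.adjugate_apply]
  refine HasSerMat.det fun i j => ?_
  rcases eq_or_ne i b with rfl | hi
  · simp only [Matrix.updateRow_self]
    rcases eq_or_ne j a with rfl | hj
    · simpa using hasSer_one
    · simpa [hj] using hasSer_zero
  · simp only [Matrix.updateRow_ne hi]
    exact h i j

variable [Finite σ] [NormNatOne L]

theorem HasSerMat.apply_zero {n : Type*} {F : (σ → L) → Matrix l n L} {X : Matrix l n (MvPowerSeries σ k)}
    (h : HasSerMat F X) : F 0 = (mcoeff 0 X).map (algebraMap k L) := by
  ext a b
  exact (h a b).apply_zero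

theorem HasSerMat.unique {n : Type*} {F F' : (σ → L) → Matrix l n L} {X X' : Matrix l n (MvPowerSeries σ k)}
    (h : HasSerMat F X) (h' : HasSerMat F' X') (hF : ∀ᶠ x in 𝓝 0, F x = F' x) : X = X' := by
  ext1 a b
  exact (h a b).unique (h' a b) (hF.mono fun x hx => by rw [hx])

theorem HasSerMat.eventually_eq {n l : Type*} [Finite n] [Finite l] {F F' : (σ → L) → Matrix l n L}
    {X : Matrix l n (MvPowerSeries σ k)}
    (h : HasSerMat F X) (h' : HasSerMat F' X) : ∀ᶠ x in 𝓝 0, F x = F' x := by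
  have : ∀ᶠ x in 𝓝 0, ∀ a b, F x a b = F' x a b :=
    eventually_all.2 fun a => eventually_all.2 fun b => (h a b).eventually_eq (h' a b)
  exact this.mono fun x hx => Matrix.ext hx

theorem HasSerMat.det_mcoeff_ne_zero {F : (σ → L) → Matrix m m L} {X : Matrix m m (MvPowerSeries σ k)}
    (h : HasSerMat F X) (h0 : (F 0).det ≠ 0) : (mcoeff 0 X).det ≠ 0 := fun h1 => by
  rw [h.apply_zero] at h0
  refine h0 ?_
  have : ((mcoeff 0 X).map (algebraMap k L)).det = algebraMap k L (mcoeff 0 X).det :=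
    (RingHom.map_det _ _).symm
  rw [this, h1, map_zero]

theorem HasSerMat.exists_isUniformLimitMat {n l : Type*} [Fintype n] [Fintype l]
    {F : (σ → L) → Matrix l n L} {X : Matrix l n (MvPowerSeries σ k)} (h : HasSerMat F X) :
    ∃ c₀ : k, c₀ ≠ 0 ∧ ∀ d : k, ‖d‖ ≤ ‖c₀‖ → IsUniformLimitMat k (polydisc k d : Set (σ → L)) F := by
  classical
  have key : ∀ s : Finset (l × n), ∃ c₀ : k, c₀ ≠ 0 ∧ ∀ d : k, ‖d‖ ≤ ‖c₀‖ → ∀ p ∈ s,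
      IsUniformLimit k (polydisc k d : Set (σ → L)) fun x => F x p.1 p.2 := by
    intro s
    induction s using Finset.induction_on with
    | empty => exact ⟨1, one_ne_zero, by simp⟩
    | insert p s _ ih =>
      obtain ⟨c, hc, h1⟩ := ih
      obtain ⟨c', hc', h2⟩ := (h p.1 p.2).exists_isUniformLimit
      obtain ⟨d, hd, hdc, hdc'⟩ := exists_norm_le_norm hc hc'
      refine ⟨d, hd, fun e he q hq => ?_⟩
      rcases Finset.mem_insert.1 hq with rfl | hq
      · exact h2 e (he.trans hdc')
      · exact h1 e (he.trans hdc) q hq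
  obtain ⟨c, hc, h1⟩ := key Finset.univ
  exact ⟨c, hc, fun d hd a b => h1 d hd (a, b) (Finset.mem_univ _)⟩

variable [Algebra.IsAlgebraic k L] [CompleteSpace k]

/-- Writing the inverse as adjugate over determinant reduces the claim to inverting one scalar
series. -/
theorem HasSerMat.inv {F : (σ → L) → Matrix m m L} {X : Matrix m m (MvPowerSeries σ k)}
    (h : HasSerMat F X) (h0 : (mcoeff 0 X).det ≠ 0) : HasSerMat (fun x => (F x)⁻¹) X⁻¹ := by
  have hc : MvPowerSeries.constantCoeff X.det ≠ 0 := by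
    rw [RingHom.map_det]
    exact h0
  have hdet := h.det.inv hc
  have hX : X⁻¹ = X.det⁻¹ • X.adjugate := Matrix.inv_eq_left_inv (by
    rw [Matrix.smul_mul, Matrix.adjugate_mul, smul_smul, MvPowerSeries.inv_mul_cancel _ hc, one_smul])
  have hF : ∀ x, (F x)⁻¹ = (F x).det⁻¹ • (F x).adjugate := fun x => by
    rw [Matrix.inv_def, Ring.inverse_eq_inv']
  rw [hX]
  simp only [hF]
  exact HasSerMat.smul hdet h.adjugate

theorem MConv.exists_hasSerMat {n l : Type*} {X : Matrix l n (MvPowerSeries σ k)} (h : MConv X) :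
    ∃ F : (σ → L) → Matrix l n L, HasSerMat F X :=
  ⟨fun x => Matrix.of fun a b => ∑' ℓ, term (X a b) x ℓ, fun a b => (h a b).hasSer⟩

/-- Invertibility at the origin persists nearby. -/
theorem HasSerMat.eventually_det_ne_zero {F : (σ → L) → Matrix m m L} {X : Matrix m m (MvPowerSeries σ k)}
    (h : HasSerMat F X) (h0 : (mcoeff 0 X).det ≠ 0) : ∀ᶠ x in 𝓝 0, (F x).det ≠ 0 := by
  have hc : MvPowerSeries.constantCoeff X.det ≠ 0 := by
    rw [RingHom.map_det]
    exact h0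
  have h1 := h.det.mul (h.det.inv hc)
  rw [MvPowerSeries.mul_inv_cancel _ hc] at h1
  refine (h1.eventually_eq hasSer_one).mono fun x hx h0 => ?_
  rw [h0, zero_mul] at hx
  exact zero_ne_one hx

variable [IsAlgClosed L]

theorem IsUniformLimitMat.exists_hasSerMat {n l : Type*} {c : k} (hc : c ≠ 0) {F : (σ → L) → Matrix l n L}
    (hF : IsUniformLimitMat k (polydisc k c : Set (σ → L)) F) :
    ∃ X : Matrix l n (MvPowerSeries σ k), HasSerMat F X := by
  choose X hX using fun a b => (hF a b).exists_hasSer hc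
  exact ⟨Matrix.of X, hX⟩

theorem IsAnalyticMat.exists_hasSerMat {n l : Type*} {S : Set (σ → L)} {F : (σ → L) → Matrix l n L}
    (hF : IsAnalyticMat k S F) (hS : S ∈ 𝓝 0) : ∃ X : Matrix l n (MvPowerSeries σ k), HasSerMat F X := by
  obtain ⟨c, hc, -, hcS⟩ := exists_polydisc_subset k hS one_pos
  exact (hF.isUniformLimitMat (isRational_polydisc hc) hcS).exists_hasSerMat hc

variable [DecidableEq σ] [NormNatOne k]

theorem HasSerMat.partialD {n l : Type*} {F : (σ → L) → Matrix l n L} {X : Matrix l n (MvPowerSeries σ k)}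
    (h : HasSerMat F X) (c : σ) : HasSerMat (RigidAn.partialD c F) (mD c X) := fun a b => (h a b).pd c

end MatrixSeries

/-! ### Differential calculus of matrices of functions. -/

section MatrixCalculus

variable {k : Type*} [NontriviallyNormedField k]
variable {L : Type*} [NontriviallyNormedField L] [NormedAlgebra k L]
variable {σ : Type*} [DecidableEq σ] {l m n : Type*}

/-- The entries of `F` have a partial derivative in the direction `c` at the point `x`. -/
def MPDiff (c : σ) (F : (σ → L) → Matrix m n L) (x : σ → L) : Prop :=
  ∀ a b, PDiff c (fun y => F y a b) x

theorem partialD_congr {c : σ} {F G : (σ → L) → Matrix m n L} {x : σ → L} (h : ∀ᶠ y in 𝓝 x, F y = G y) :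
    partialD c F x = partialD c G x := by
  ext a b
  exact pd_congr (f := fun y => F y a b) (g := fun y => G y a b) (h.mono fun y hy => by rw [hy])

theorem partialD_neg (c : σ) (F : (σ → L) → Matrix m n L) (x : σ → L) :
    partialD c (fun y => -F y) x = -partialD c F x := by
  ext a b
  exact pd_neg (f := fun y => F y a b)

theorem partialD_const (c : σ) (X : Matrix m n L) (x : σ → L) : partialD c (fun _ => X) x = 0 :=
  Matrix.ext fun _ _ => deriv_const _ _

theorem partialD_mul [Fintype m] {c : σ} {F : (σ → L) → Matrix l m L} {G : (σ → L) → Matrix m n L} {x : σ → L}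
    (hF : MPDiff c F x) (hG : MPDiff c G x) :
    partialD c (fun y => F y * G y) x = partialD c F x * G x + F x * partialD c G x := by
  ext a b
  simp only [partialD_apply, Matrix.mul_apply, Matrix.add_apply]
  rw [pd_sum _ fun i _ => (hF a i).mul (hG i b), ← Finset.sum_add_distrib]
  exact Finset.sum_congr rfl fun i _ => pd_mul (hF a i) (hG i b)

theorem partialD_smul {c : σ} {s : (σ → L) → L} {G : (σ → L) → Matrix m n L} {x : σ → L}
    (hs : PDiff c s x) (hG : MPDiff c G x) :
    partialD c (fun y => s y • G y) x = pd c s x • G x + s x • partialD c G x :=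
  Matrix.ext fun a b => pd_mul hs (hG a b)

theorem mPDiff_const (c : σ) (X : Matrix m n L) (x : σ → L) : MPDiff c (fun _ => X) x :=
  fun _ _ => differentiableAt_const _

variable [NormNatOne L] [IsUltrametricDist L] [Finite σ] [Algebra.IsAlgebraic k L] [CompleteSpace k]
  [NormNatOne k] [IsUltrametricDist k] [IsAlgClosed L]

theorem IsUniformLimitMat.mPDiff {R : Set (σ → L)} {F : (σ → L) → Matrix m n L} (hF : IsUniformLimitMat k R F)
    (hR : IsRational k R) (c : σ) {x : σ → L} (hx : x ∈ R) : MPDiff c F x :=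
  fun a b => (hF a b).pDiff hR c hx

theorem IsUniformLimitMat.partialD {R : Set (σ → L)} {F : (σ → L) → Matrix m n L}
    (hF : IsUniformLimitMat k R F) (hR : IsRational k R) (c : σ) :
    IsUniformLimitMat k R (RigidAn.partialD c F) := fun a b => (hF a b).pd hR c

theorem IsUniformLimitMat.partialD_comm {R : Set (σ → L)} {F : (σ → L) → Matrix m n L}
    (hF : IsUniformLimitMat k R F) (hR : IsRational k R) (c d : σ) {x : σ → L} (hx : x ∈ R) :
    RigidAn.partialD c (RigidAn.partialD d F) x = RigidAn.partialD d (RigidAn.partialD c F) x :=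
  Matrix.ext fun a b => (hF a b).pd_comm hR c d hx

variable [Fintype l] [Fintype m] [DecidableEq l] [DecidableEq m]

/-- The derivative of an inverse matrix. -/
theorem IsUniformLimitMat.partialD_inverse {R : Set (σ → L)} {h : (σ → L) → Matrix m l L}
    {h' : (σ → L) → Matrix l m L} (hh : IsUniformLimitMat k R h) (hh' : IsUniformLimitMat k R h')
    (hR : IsRational k R) (e : ∀ x ∈ R, h x * h' x = 1) (e' : ∀ x ∈ R, h' x * h x = 1) (c : σ)
    {x : σ → L} (hx : x ∈ R) :
    RigidAn.partialD c h' x = -(h' x * RigidAn.partialD c h x * h' x) := by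
  have h1 : RigidAn.partialD c (fun y => h' y * h y) x = 0 := by
    rw [partialD_congr (G := fun _ => 1), partialD_const]
    filter_upwards [hR.mem_nhds hx] with y hy using e' y hy
  rw [partialD_mul (hh'.mPDiff hR c hx) (hh.mPDiff hR c hx)] at h1
  have h2 := congrArg (· * h' x) h1
  simp only [Matrix.add_mul, Matrix.zero_mul, Matrix.mul_assoc, e x hx, Matrix.mul_one] at h2
  rw [eq_neg_of_add_eq_zero_left h2, Matrix.mul_assoc]

/-- The connection which has a flat frame `h` is flat. -/
theorem curvature_frame {R : Set (σ → L)} {h : (σ → L) → Matrix m l L}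
    {h' : (σ → L) → Matrix l m L} (hh : IsUniformLimitMat k R h) (hh' : IsUniformLimitMat k R h')
    (hR : IsRational k R) (e : ∀ x ∈ R, h x * h' x = 1) (e' : ∀ x ∈ R, h' x * h x = 1)
    (Γ : σ → (σ → L) → Matrix m m L) (hΓ : ∀ c, ∀ x ∈ R, Γ c x = -(RigidAn.partialD c h x * h' x))
    (c d : σ) {x : σ → L} (hx : x ∈ R) : curvature Γ c d x = 0 := by
  -- With Γ = -∂h·h⁻¹, the derivative of Γ consists of a second derivative of h, symmetric in c and
  -- d, and a product of components of Γ which cancels against the commutator in the curvature.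
  have key : ∀ c d, RigidAn.partialD c (Γ d) x = -(RigidAn.partialD c (RigidAn.partialD d h) x * h' x) +
      Γ d x * Γ c x := fun c d => by
    rw [partialD_congr (G := fun y => -(RigidAn.partialD d h y * h' y)), partialD_neg,
      partialD_mul ((hh.partialD hR d).mPDiff hR c hx) (hh'.mPDiff hR c hx),
      hh.partialD_inverse hh' hR e e' c hx, hΓ d x hx, hΓ c x hx]
    · simp only [Matrix.mul_assoc, neg_add, Matrix.mul_neg, Matrix.neg_mul, neg_neg]
    · filter_upwards [hR.mem_nhds hx] with y hy using hΓ d y hy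
  rw [curvature, key, key, hh.partialD_comm hR c d hx]
  abel

end MatrixCalculus

/-! ### Flatness of an F-bundle in terms of power series. -/

section FormalFlatness

variable {k : Type*} [NontriviallyNormedField k] [IsUltrametricDist k]
variable {L : Type*} [NontriviallyNormedField L] [NormedAlgebra k L] [IsUltrametricDist L]
variable {n : ℕ} {l m : Type*}

theorem hasSer_weight (c : Option (Fin n)) : HasSer (weight (L := L) c) (fweight (k := k) c) := by
  cases c with
  | none =>
    have := (hasSer_X (k := k) (L := L) (none : Option (Fin n))).mul (hasSer_X (none : Option (Fin n)))
    rw [← pow_two] at this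
    exact this.congr (Eventually.of_forall fun x => (pow_two _).symm)
  | some j => exact hasSer_X none

variable [NormNatOne L] [Algebra.IsAlgebraic k L] [CompleteSpace k] [NormNatOne k] [IsAlgClosed L]

theorem HasSerMat.dop {F : (Option (Fin n) → L) → Matrix l m L}
    {X : Matrix l m (MvPowerSeries (Option (Fin n)) k)} (h : HasSerMat F X) (c : Option (Fin n)) :
    HasSerMat (fun y => weight c y • RigidAn.partialD c F y) (dop c X) := (h.partialD c).smul (hasSer_weight c)

/-- The coordinate `u` is not a zero divisor. -/
theorem HasSerMat.eq_of_u_ne_zero {F : (Option (Fin n) → L) → Matrix l m L}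
    {X : Matrix l m (MvPowerSeries (Option (Fin n)) k)} (h : HasSerMat F X)
    (h0 : ∀ᶠ y in 𝓝 0, y none ≠ 0 → F y = 0) : X = 0 := by
  refine X_smul_injective none ?_
  rw [smul_zero]
  refine (h.smul (hasSer_X none)).unique hasSerMat_zero (h0.mono fun y hy => ?_)
  rcases eq_or_ne (y none) 0 with h | h
  · rw [h, zero_smul]
  · rw [hy h, smul_zero]

theorem pd_some_weight_inv (j : Fin n) (c : Option (Fin n)) (y : Option (Fin n) → L) :
    pd (some j) (fun z => (weight c z)⁻¹) y = 0 := by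
  cases c <;> simp [pd, weight]

theorem pDiff_some_weight_inv (j : Fin n) (c : Option (Fin n)) (y : Option (Fin n) → L) :
    PDiff (some j) (fun z => (weight c z)⁻¹) y := by
  cases c <;> simp [PDiff, weight]

theorem hasDerivAt_weight_inv (j : Fin n) {y : Option (Fin n) → L} (hy : y none ≠ 0) :
    HasDerivAt (fun s => (weight (some j) (Function.update y none s))⁻¹) (-(y none ^ 2)⁻¹) (y none) := by
  simpa [weight] using hasDerivAt_inv hy

/-- Flatness is given off u = 0 for the matrices divided by their weights. Multiplying by u²,
respectively u³, clears the poles, and as u is not a zero divisor the identity holds for the series.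
The derivative of u⁻¹ accounts for the term u A_j of the mixed equation. -/
theorem FBundle.isFormallyFlat {B : Set (Fin n → L)} (E : FBundle k B) (i : E.bundle.ι)
    (h0 : 0 ∈ E.bundle.chart i)
    {X : Option (Fin n) → Matrix (Fin (E.bundle.rank i)) (Fin (E.bundle.rank i))
      (MvPowerSeries (Option (Fin n)) k)} (hX : ∀ c, HasSerMat (E.A i c) (X c)) : IsFormallyFlat X where
  some_some a b := by
    have hR := E.bundle.cover.rational i
    refine HasSerMat.eq_of_u_ne_zero ((((hX (some b)).dop (some a)).sub ((hX (some a)).dop (some b))).add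
      (((hX (some a)).mul (hX (some b))).sub ((hX (some b)).mul (hX (some a))))) ?_
    filter_upwards [hR.mem_nhds h0] with y hy hu
    have hd : ∀ c d, MPDiff d (E.A i c) y := fun c d =>
      ((E.analytic_A i c).isUniformLimitMat hR subset_rfl).mPDiff hR d hy
    have h := E.flat i (some a) (some b) y hy hu
    rw [curvature, partialD_smul (pDiff_some_weight_inv _ _ _) (hd _ _),
      partialD_smul (pDiff_some_weight_inv _ _ _) (hd _ _), pd_some_weight_inv, pd_some_weight_inv] at h
    have h2 := congrArg (y none ^ 2 • ·) h
    simp only [weight, Option.elim_some, zero_smul, zero_add, Matrix.smul_mul, Matrix.mul_smul, smul_add,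
      smul_sub, smul_smul, smul_zero] at h2 ⊢
    have e1 : y none ^ 2 * (y none)⁻¹ = y none := by field_simp
    have e2 : y none ^ 2 * ((y none)⁻¹ * (y none)⁻¹) = 1 := by field_simp
    rw [e1, e2, one_smul, one_smul] at h2
    exact h2
  none_some b := by
    have hR := E.bundle.cover.rational i
    rw [← sub_eq_zero]
    refine HasSerMat.eq_of_u_ne_zero (((((hX (some b)).dop none).sub ((hX none).dop (some b))).add
      (((hX none).mul (hX (some b))).sub ((hX (some b)).mul (hX none)))).sub
        ((hX (some b)).smul (hasSer_X none))) ?_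
    filter_upwards [hR.mem_nhds h0] with y hy hu
    have hd : ∀ c d, MPDiff d (E.A i c) y := fun c d =>
      ((E.analytic_A i c).isUniformLimitMat hR subset_rfl).mPDiff hR d hy
    have h := E.flat i none (some b) y hy hu
    have hw := hasDerivAt_weight_inv b hu
    have hw1 : PDiff none (fun z => (weight (some b) z)⁻¹) y := hw.differentiableAt
    have hw2 : pd none (fun z => (weight (some b) z)⁻¹) y = -(y none ^ 2)⁻¹ := hw.deriv
    rw [curvature, partialD_smul hw1 (hd _ _), partialD_smul (pDiff_some_weight_inv _ _ _) (hd _ _),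
      pd_some_weight_inv, hw2] at h
    have h2 := congrArg (y none ^ 3 • ·) h
    simp only [weight, Option.elim_some, Option.elim_none, zero_smul, zero_add, Matrix.smul_mul, Matrix.mul_smul,
      smul_add, smul_sub, smul_smul, smul_zero, smul_neg, neg_smul] at h2 ⊢
    have e1 : y none ^ 3 * (y none ^ 2)⁻¹ = y none := by field_simp
    have e2 : y none ^ 3 * (y none)⁻¹ = y none ^ 2 := by field_simp
    have e3 : y none ^ 3 * ((y none)⁻¹ * (y none ^ 2)⁻¹) = 1 := by field_simp
    have e4 : y none ^ 3 * ((y none ^ 2)⁻¹ * (y none)⁻¹) = 1 := by field_simp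
    rw [e1, e2] at h2
    rw [e3] at h2
    rw [e4] at h2
    rw [one_smul, one_smul] at h2
    rw [← h2]
    abel

end FormalFlatness

/-! ### Restriction of germs to the axis and to u = 0. -/

section AxisGeometry

variable {k : Type*} [NontriviallyNormedField k]
variable {L : Type*} [NontriviallyNormedField L] [NormedAlgebra k L]
variable {σ : Type*} {m n : Type*}

theorem eventually_partialD_congr [DecidableEq σ] (c : σ) {F G : (σ → L) → Matrix m n L} {x : σ → L}
    (h : ∀ᶠ y in 𝓝 x, F y = G y) : ∀ᶠ y in 𝓝 x, partialD c F y = partialD c G y :=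
  (eventually_eventually_nhds.2 h).mono fun _ hy => partialD_congr hy

theorem point_zero_zero : point (0 : σ → L) 0 = 0 := by
  funext c
  cases c <;> rfl

theorem axis_zero : axis σ (0 : Option (Fin 0) → L) = 0 := point_zero_zero

theorem tendsto_axis : Tendsto (axis σ : (Option (Fin 0) → L) → Option σ → L) (𝓝 0) (𝓝 0) := by
  rw [tendsto_pi_nhds]
  rintro (_ | i)
  · exact (continuous_apply none).tendsto 0
  · exact tendsto_const_nhds

theorem axis_const (y : Option σ → L) : axis σ (fun _ => y none) = point 0 (y none) := rfl

theorem const_axis (z : Option (Fin 0) → L) : (fun _ => axis σ z none) = z := by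
  funext c
  rcases c with _ | i
  · rfl
  · exact i.elim0

theorem tendsto_const_none : Tendsto (fun (y : Option σ → L) (_ : Option (Fin 0)) => y none) (𝓝 0) (𝓝 0) := by
  rw [tendsto_pi_nhds]
  exact fun _ => (continuous_apply none).tendsto 0

theorem mcoeff_map_kill_of_forall {Z : σ → Prop} {X : Matrix m n (MvPowerSeries σ k)} {ℓ : σ →₀ ℕ}
    (h : ∀ i, Z i → ℓ i = 0) : mcoeff ℓ (X.map (kill Z)) = mcoeff ℓ X :=
  Matrix.ext fun _ _ => coeff_kill_of_forall h

theorem mcoeff_map_kill_of_not_forall {Z : σ → Prop} {X : Matrix m n (MvPowerSeries σ k)} {ℓ : σ →₀ ℕ}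
    (h : ¬∀ i, Z i → ℓ i = 0) : mcoeff ℓ (X.map (kill Z)) = 0 :=
  Matrix.ext fun _ _ => coeff_kill_of_not_forall h

theorem HasSerMat.kill_base {F : (Option σ → L) → Matrix m n L} {X : Matrix m n (MvPowerSeries (Option σ) k)}
    (h : HasSerMat F X) : HasSerMat (fun y => F (point 0 (y none))) (X.map (RigidAn.kill (· ≠ none))) :=
  h.kill _ (π := fun y => point 0 (y none))
    (fun x i hi => by cases i with | none => exact absurd rfl hi | some i => rfl)
    fun x i hi => by rw [not_not.1 hi]; rfl

theorem HasSerMat.kill_u {F : (Option σ → L) → Matrix m n L} {X : Matrix m n (MvPowerSeries (Option σ) k)}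
    (h : HasSerMat F X) : HasSerMat (fun y => F (point (base y) 0)) (X.map (RigidAn.kill (· = none))) :=
  h.kill _ (π := fun y => point (base y) 0) (fun x i hi => by rw [hi]; rfl)
    fun x i hi => by cases i with | none => exact absurd rfl hi | some i => rfl

theorem forall_ne_none_iff {n : ℕ} {ℓ : Option (Fin n) →₀ ℕ} : (∀ i, i ≠ none → ℓ i = 0) ↔ tdeg ℓ = 0 := by
  rw [tdeg_eq_zero_iff]
  exact ⟨fun h j => h _ (by simp), fun h i hi => by cases i with | none => exact absurd rfl hi | some i => exact h i⟩

end AxisGeometry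

/-! ### The germ of the extended frame. -/

section FlatFrames

variable {k : Type*} [NontriviallyNormedField k] [IsUltrametricDist k] [CompleteSpace k] [NormNatOne k]
variable {L : Type*} [NontriviallyNormedField L] [NormedAlgebra k L] [IsUltrametricDist L] [NormNatOne L]
  [Algebra.IsAlgebraic k L] [IsAlgClosed L]
variable {n : ℕ} {B : Set (Fin n → L)}

/-- The matrices of `∇_{u²∂_u}` and `∇_{u∂_{t_j}}` in the frame with coordinates `F` in the `i`-th frame. -/
noncomputable def FBundle.conn (E : FBundle k B) (i : E.bundle.ι)
    (F : (Option (Fin n) → L) → Matrix (Fin (E.bundle.rank i)) (Fin (E.bundle.rank i)) L) (c : Option (Fin n))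
    (y : Option (Fin n) → L) : Matrix (Fin (E.bundle.rank i)) (Fin (E.bundle.rank i)) L :=
  (F y)⁻¹ * (E.A i c y * F y + weight c y • partialD c F y)

theorem FBundle.mul_conn {E : FBundle k B} {i : E.bundle.ι}
    {F : (Option (Fin n) → L) → Matrix (Fin (E.bundle.rank i)) (Fin (E.bundle.rank i)) L} {c : Option (Fin n)}
    {y : Option (Fin n) → L} (h : (F y).det ≠ 0) :
    F y * E.conn i F c y = E.A i c y * F y + weight c y • partialD c F y := by
  rw [FBundle.conn, ← Matrix.mul_assoc, Matrix.mul_nonsing_inv _ (isUnit_iff_ne_zero.2 h), Matrix.one_mul]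

theorem FBundle.exists_hasSerMat_A (E : FBundle k B) {i : E.bundle.ι} (h0 : 0 ∈ E.bundle.chart i) :
    ∃ X : Option (Fin n) → Matrix (Fin (E.bundle.rank i)) (Fin (E.bundle.rank i))
      (MvPowerSeries (Option (Fin n)) k), ∀ c, HasSerMat (E.A i c) (X c) := by
  choose X hX using fun c => (E.analytic_A i c).exists_hasSerMat ((E.bundle.cover.rational i).mem_nhds h0)
  exact ⟨X, hX⟩

/-- The germ at the origin of the frame extending the frame of the framing `φ`. -/
structure IsFormalFrame {hB : (0 : Fin n → L) ∈ B} {E : FBundle k B}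
    (φ : Framing k (E.restrictZero hB) Set.univ) (i : E.bundle.ι)
    (H : (Option (Fin n) → L) → Matrix (Fin (E.bundle.rank i)) (Fin (E.bundle.rank i)) L)
    (X : Matrix (Fin (E.bundle.rank i)) (Fin (E.bundle.rank i)) (MvPowerSeries (Option (Fin n)) k))
    (N : Option (Fin n) → Matrix (Fin (E.bundle.rank i)) (Fin (E.bundle.rank i))
      (MvPowerSeries (Option (Fin n)) k)) : Prop where
  zero_mem : 0 ∈ E.bundle.chart i
  hasSer : HasSerMat H X
  det_ne_zero : (mcoeff 0 X).det ≠ 0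
  hasSer_conn : ∀ c, HasSerMat (E.conn i H c) (N c)
  some_indep : ∀ j ℓ, ℓ none ≠ 0 → mcoeff ℓ (N (some j)) = 0
  none_linear : ∀ ℓ, 2 ≤ ℓ none → mcoeff ℓ (N none) = 0
  axis_flat : ∀ᶠ z in 𝓝 0, partialD none (fun z => H (axis (Fin n) z)) z +
    φ.matrixAtZero i z * H (axis (Fin n) z) = 0

/-- The second u-derivative of the restriction to the axis vanishes near 0, and in characteristic
zero this kills the coefficients of u^q with q ≥ 2. -/
theorem mcoeff_eq_zero_of_linear_on_axis {m : Type*} [Finite m] {F : (Option (Fin n) → L) → Matrix m m L}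
    {X : Matrix m m (MvPowerSeries (Option (Fin n)) k)} (h : HasSerMat F X) {K G : Matrix m m L}
    (hF : ∀ᶠ y in 𝓝 (0 : Option (Fin n) → L), F (point 0 (y none)) = K + y none • G) {ℓ : Option (Fin n) →₀ ℕ}
    (hℓ : tdeg ℓ = 0) (hℓ' : 2 ≤ ℓ none) : mcoeff ℓ X = 0 := by
  have := NormNatOne.charZero (K := k)
  have h1 : ∀ᶠ y in 𝓝 (0 : Option (Fin n) → L),
      partialD none (fun y => F (point 0 (y none))) y = G := by
    refine (eventually_partialD_congr none hF).mono fun y hy => ?_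
    rw [hy]
    ext a b
    simp [partialD]
  have h2 := (h.kill_base.partialD none).partialD none |>.unique hasSerMat_zero
    ((eventually_partialD_congr none h1).mono fun y hy => by rw [hy, partialD_const])
  obtain ⟨ℓ', rfl⟩ : ∃ ℓ', ℓ = ℓ' + Finsupp.single none 1 + Finsupp.single none 1 := by
    refine ⟨ℓ - Finsupp.single none 2, ?_⟩
    rw [add_assoc, ← Finsupp.single_add]
    exact (tsub_add_cancel_of_le (by simpa [Finsupp.single_le_iff] using hℓ')).symm
  have h3 := congrArg (mcoeff ℓ') h2
  rw [mcoeff_mD, mcoeff_mD, smul_smul, mcoeff_zero, mcoeff_map_kill_of_forall (forall_ne_none_iff.2 hℓ)] at h3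
  refine (smul_eq_zero.1 h3).resolve_left ?_
  rw [← Nat.cast_mul]
  exact Nat.cast_ne_zero.2 (Nat.mul_ne_zero (Nat.succ_ne_zero _) (Nat.succ_ne_zero _))

/-- The frames of a framing at the origin. -/
theorem Framing.exists_frame_atZero {hB : (0 : Fin n → L) ∈ B} {E : FBundle k B}
    (φ : Framing k (E.restrictZero hB) Set.univ) : ∃ (i : E.bundle.ι) (S : Set (Option (Fin 0) → L))
      (P : (Option (Fin 0) → L) → Matrix (Fin (E.bundle.rank i)) (Fin (E.bundle.rank i)) L)
      (K G : Matrix (Fin (E.bundle.rank i)) (Fin (E.bundle.rank i)) L),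
      0 ∈ E.bundle.chart i ∧ 0 ∈ S ∧ S ∈ 𝓝 0 ∧ IsAnalyticMat k S P ∧ ∀ z ∈ S, (P z).det ≠ 0 ∧
        partialD none P z + φ.matrixAtZero i z * P z = 0 ∧
        E.A i none (axis (Fin n) z) * P z + z none ^ 2 • partialD none P z = P z * (K + z none • G) := by
  obtain ⟨i, V, S, P, K, G, a, -, h0V, -, hS, hSd, hP, -, -, -, hfr⟩ := φ.framed 0 (Set.mem_univ _)
  have h0S : 0 ∈ S := by
    have := hS.zero_mem 0 h0V
    rwa [point_zero_zero] at this
  refine ⟨i, S, P, K 0, G 0, ?_, h0S, hS.admissible.mem_nhds h0S, hP, fun z hz => ?_⟩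
  · have : axis (Fin n) 0 ∈ E.bundle.chart i := (hSd h0S).1
    rwa [axis_zero] at this
  · obtain ⟨h1, h2, h3, -⟩ := hfr z hz
    have hb : base z = 0 := funext fun j => j.elim0
    rw [hb] at h3
    exact ⟨h1, h2 none, h3⟩

/-- The flat frame of `φ` is extended constantly in t and then corrected by the gauge transformation
of `exists_formal_framing`. That transformation is trivial on the axis, so the restriction to b is
not disturbed. -/
theorem exists_isFormalFrame {hB : (0 : Fin n → L) ∈ B} {E : FBundle k B}
    (φ : Framing k (E.restrictZero hB) Set.univ) : ∃ i H X N, IsFormalFrame φ i H X N := by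
  obtain ⟨i, S, P, K, G, h0i, h0S, hSn, hP, hfr⟩ := φ.exists_frame_atZero
  obtain ⟨c, hc, -, hcS⟩ := exists_polydisc_subset k hSn one_pos
  set F : (Option (Fin n) → L) → Matrix (Fin (E.bundle.rank i)) (Fin (E.bundle.rank i)) L :=
    fun y => P fun _ => y none with hFdef
  have hFP : ∀ z, F (axis (Fin n) z) = P z := fun z => by rw [hFdef]; dsimp only; rw [const_axis]
  have hF : IsUniformLimitMat k (polydisc k c) F := fun a b => by
    have := (hP.isUniformLimitMat (isRational_polydisc hc) hcS a b).comp_polynomial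
      (τ := Option (Fin n)) (fun _ => MvPolynomial.X none) (R' := polydisc k c) fun x hx j => by
        simpa using hx none
    simpa using this
  obtain ⟨Y, hY⟩ := hF.exists_hasSerMat hc
  have hY0 : (mcoeff 0 Y).det ≠ 0 := hY.det_mcoeff_ne_zero (by
    rw [← axis_zero, hFP]
    exact (hfr 0 h0S).1)
  have hYu := isUnit_det_of_mcoeff_zero hY0
  obtain ⟨A, hA⟩ := E.exists_hasSerMat_A h0i
  have hN : ∀ c, HasSerMat (E.conn i F c) (Y⁻¹ * (A c * Y + dop c Y)) := fun c =>
    (hY.inv hY0).mul (((hA c).mul hY).add (hY.dop c))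
  have hYN : ∀ c, A c * Y + dop c Y = Y * (Y⁻¹ * (A c * Y + dop c Y)) := fun c => by
    rw [← Matrix.mul_assoc, Matrix.mul_nonsing_inv _ hYu, Matrix.one_mul]
  -- In the constant extension the u-component on the axis is that of `φ`, linear in u; this
  -- provides the initial condition in t-degree 0.
  have haxis : ∀ᶠ y in 𝓝 (0 : Option (Fin n) → L), E.conn i F none (point 0 (y none)) =
      K + y none • G := by
    filter_upwards [tendsto_const_none hSn] with y hy
    obtain ⟨h1, -, h2⟩ := hfr _ hy
    have hd : partialD none P (fun _ => y none) = partialD none F (point 0 (y none)) := by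
      rw [← axis_const, ← partialD_axis]
      simp only [hFP]
    rw [hd, axis_const] at h2
    have h3 : F (point 0 (y none)) = P fun _ => y none := rfl
    rw [FBundle.conn, h3]
    change _ * (_ + y none ^ 2 • _) = _
    rw [h2, ← Matrix.mul_assoc, Matrix.nonsing_inv_mul _ (isUnit_iff_ne_zero.2 h1), Matrix.one_mul]
  obtain ⟨Q, N, hQ, hQ1, hQN, hN1, hN2⟩ := exists_formal_framing
    ((E.isFormallyFlat i h0i hA).gauge (Matrix.nonsing_inv_mul _ hYu) hYN) (fun j => (hN _).mconv)
    (fun ℓ h1 h2 => mcoeff_eq_zero_of_linear_on_axis (hN none) haxis h1 h2)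
  obtain ⟨q, hq⟩ := hQ.exists_hasSerMat (L := L)
  have hYQ0 : (mcoeff 0 (Y * Q)).det ≠ 0 := by
    have : mcoeff 0 (Y * Q) = mcoeff 0 Y * mcoeff 0 Q :=
      Matrix.map_mul (f := MvPowerSeries.constantCoeff)
    rw [this, hQ1 0 tdeg_zero, mcoeff_one, if_pos rfl, Matrix.mul_one]
    exact hY0
  have hconn : ∀ c, A c * (Y * Q) + dop c (Y * Q) = Y * Q * N c := fun c => by
    rw [Matrix.mul_assoc Y, ← hQN, Matrix.mul_add, ← Matrix.mul_assoc Y _ Q, ← hYN, Matrix.add_mul, dop_mul,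
      ← Matrix.mul_assoc (A c), add_assoc]
  have hH := hY.mul hq
  refine ⟨i, fun y => F y * q y, Y * Q, N, h0i, hH, hYQ0, fun c => ?_, hN1, hN2, ?_⟩
  · have h1 := (hH.inv hYQ0).mul (((hA c).mul hH).add (hH.dop c))
    rw [hconn c, ← Matrix.mul_assoc, Matrix.nonsing_inv_mul _ (isUnit_det_of_mcoeff_zero hYQ0), Matrix.one_mul] at h1
    exact h1
  · have hQk : Q.map (kill (· ≠ none)) = 1 := mcoeff_ext fun ℓ => by
      by_cases h : ∀ i, i ≠ none → ℓ i = 0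
      · rw [mcoeff_map_kill_of_forall h, hQ1 ℓ (forall_ne_none_iff.1 h)]
      · rw [mcoeff_map_kill_of_not_forall h, mcoeff_one, if_neg]
        rintro rfl
        exact h fun _ _ => rfl
    have h1 := hq.kill_base
    rw [hQk] at h1
    have h2 : ∀ᶠ z in 𝓝 (0 : Option (Fin 0) → L), F (axis (Fin n) z) * q (axis (Fin n) z) = P z := by
      filter_upwards [tendsto_axis (h1.eventually_eq hasSerMat_one)] with z hz
      have hz' : q (axis (Fin n) z) = 1 := hz
      rw [hz', hFP, Matrix.mul_one]
    filter_upwards [h2, eventually_partialD_congr none h2, hSn] with z hz hz' hzS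
    rw [hz, hz']
    exact (hfr z hzS).2.1

end FlatFrames

/-! ### From a frame on a polydisc to a framing. -/

section FramingConstruction

variable {k : Type*} [NontriviallyNormedField k] [IsUltrametricDist k] [CompleteSpace k] [NormNatOne k]
variable {L : Type*} [NontriviallyNormedField L] [NormedAlgebra k L] [IsUltrametricDist L] [NormNatOne L]
  [Algebra.IsAlgebraic k L] [IsAlgClosed L]
variable {n : ℕ} {B : Set (Fin n → L)}

/-- `H` is a frame of the F-bundle over a polydisc inside the `i`-th chart, in which the connection has
the shape required of framings. -/
structure IsFrameOn (E : FBundle k B) (i : E.bundle.ι)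
    (H : (Option (Fin n) → L) → Matrix (Fin (E.bundle.rank i)) (Fin (E.bundle.rank i)) L) (c : k) : Prop where
  ne_zero : c ≠ 0
  norm_le_one : ‖c‖ ≤ 1
  subset : polydisc k c ⊆ E.bundle.chart i
  unif : IsUniformLimitMat k (polydisc k c) H
  unif_inv : IsUniformLimitMat k (polydisc k c) fun y => (H y)⁻¹
  det_ne_zero : ∀ y ∈ polydisc k c, (H y).det ≠ 0
  conn_some : ∀ j, ∀ y ∈ polydisc k c, E.conn i H (some j) y = E.conn i H (some j) (point (base y) 0)
  conn_none : ∀ y ∈ polydisc k c, E.conn i H none y = E.conn i H none (point (base y) 0) +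
    y none • partialD none (E.conn i H none) (point (base y) 0)

theorem map_kill_u_eq {m l : Type*} {X : Matrix m l (MvPowerSeries (Option (Fin n)) k)}
    (h : ∀ ℓ, ℓ none ≠ 0 → mcoeff ℓ X = 0) : X.map (kill (· = none)) = X := mcoeff_ext fun ℓ => by
  by_cases h1 : ∀ i, i = none → ℓ i = 0
  · exact mcoeff_map_kill_of_forall h1
  · rw [mcoeff_map_kill_of_not_forall h1, h ℓ (by simpa using h1)]

/-- A series of degree at most one in u equals its first Taylor polynomial at u = 0; this produces
the shape K(t) + u G(t). -/
theorem map_kill_u_add_eq {m l : Type*} {X : Matrix m l (MvPowerSeries (Option (Fin n)) k)}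
    (h : ∀ ℓ, 2 ≤ ℓ none → mcoeff ℓ X = 0) :
    X.map (kill (· = none)) + (MvPowerSeries.X none : MvPowerSeries (Option (Fin n)) k) •
      (mD none X).map (kill (· = none)) = X := mcoeff_ext fun ℓ => by
  rw [mcoeff_add]
  rcases eq_or_ne (ℓ none) 0 with h0 | h0
  · rw [mcoeff_X_smul_of_eq_zero _ _ h0, add_zero, mcoeff_map_kill_of_forall (by simpa using h0)]
  · obtain ⟨ℓ, rfl⟩ : ∃ ℓ', ℓ = ℓ' + Finsupp.single none 1 := by
      refine ⟨ℓ - Finsupp.single none 1, (tsub_add_cancel_of_le ?_).symm⟩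
      simpa [Finsupp.single_le_iff] using Nat.one_le_iff_ne_zero.2 h0
    rw [mcoeff_X_smul_add, mcoeff_map_kill_of_not_forall (by simp), zero_add]
    rcases eq_or_ne (ℓ none) 0 with h1 | h1
    · rw [mcoeff_map_kill_of_forall (by simpa using h1), mcoeff_mD, h1, zero_add, Nat.cast_one, one_smul]
    · rw [mcoeff_map_kill_of_not_forall (by simpa using h1), h]
      simpa using Nat.one_le_iff_ne_zero.2 h1

/-- Vanishing of coefficients becomes equality of germs by uniqueness of the represented function;
all required properties then hold on one small polydisc. -/
theorem IsFormalFrame.exists_isFrameOn {hB : (0 : Fin n → L) ∈ B} {E : FBundle k B}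
    {φ : Framing k (E.restrictZero hB) Set.univ} {i : E.bundle.ι}
    {H : (Option (Fin n) → L) → Matrix (Fin (E.bundle.rank i)) (Fin (E.bundle.rank i)) L}
    {X : Matrix (Fin (E.bundle.rank i)) (Fin (E.bundle.rank i)) (MvPowerSeries (Option (Fin n)) k)}
    {N : Option (Fin n) → Matrix (Fin (E.bundle.rank i)) (Fin (E.bundle.rank i))
      (MvPowerSeries (Option (Fin n)) k)} (h : IsFormalFrame φ i H X N) : ∃ c, IsFrameOn E i H c := by
  have h1 : ∀ᶠ y in 𝓝 0, ∀ j, E.conn i H (some j) y = E.conn i H (some j) (point (base y) 0) :=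
    eventually_all.2 fun j => by
      have := (h.hasSer_conn (some j)).kill_u
      rw [map_kill_u_eq (h.some_indep j)] at this
      exact (h.hasSer_conn (some j)).eventually_eq this
  have h2 : ∀ᶠ y in 𝓝 0, E.conn i H none y = E.conn i H none (point (base y) 0) +
      y none • partialD none (E.conn i H none) (point (base y) 0) := by
    have := (h.hasSer_conn none).kill_u.add (((h.hasSer_conn none).partialD none).kill_u.smul (hasSer_X none))
    rw [map_kill_u_add_eq h.none_linear] at this
    exact (h.hasSer_conn none).eventually_eq this
  have h3 := h.hasSer.eventually_det_ne_zero h.det_ne_zero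
  have h4 : E.bundle.chart i ∈ 𝓝 0 := (E.bundle.cover.rational i).mem_nhds h.zero_mem
  obtain ⟨c, hc, hc1, hcs⟩ := exists_polydisc_subset k (inter_mem (inter_mem h1 h2) (inter_mem h3 h4)) one_pos
  obtain ⟨c', hc', hu⟩ := h.hasSer.exists_isUniformLimitMat
  obtain ⟨c'', hc'', hu'⟩ := (h.hasSer.inv h.det_ne_zero).exists_isUniformLimitMat
  obtain ⟨d, hd, hdc, hdc'⟩ := exists_norm_le_norm hc hc'
  obtain ⟨e, he, hed, hec⟩ := exists_norm_le_norm hd hc''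
  have hes := (polydisc_mono (σ := Option (Fin n)) (L := L) (hed.trans hdc)).trans hcs
  exact ⟨e, he, (hed.trans hdc).trans hc1, fun y hy => (hes hy).2.2, hu e (hed.trans hdc'), hu' e hec,
    fun y hy => (hes hy).2.1, fun j y hy => (hes hy).1.1 j, fun y hy => (hes hy).1.2⟩

theorem isUniformLimit_weight (c : Option (Fin n)) (R : Set (Option (Fin n) → L)) :
    IsUniformLimit k R (weight c) := by
  cases c with
  | none =>
    exact (isUniformLimit_aeval R (MvPolynomial.X none ^ 2 : MvPolynomial (Option (Fin n)) k)).congr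
      fun y _ => by simp [weight]
  | some j => exact isUniformLimit_coord R none

/-- The frame `H` of the `i`-th chart, in the coordinates of the `j`-th chart. -/
noncomputable def FBundle.frameIn (E : FBundle k B) (i : E.bundle.ι)
    (H : (Option (Fin n) → L) → Matrix (Fin (E.bundle.rank i)) (Fin (E.bundle.rank i)) L) (j : E.bundle.ι)
    (y : Option (Fin n) → L) : Matrix (Fin (E.bundle.rank j)) (Fin (E.bundle.rank i)) L :=
  E.bundle.g j i y * H y

/-- The inverse of `FBundle.frameIn`. -/
noncomputable def FBundle.coframeIn (E : FBundle k B) (i : E.bundle.ι)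
    (H : (Option (Fin n) → L) → Matrix (Fin (E.bundle.rank i)) (Fin (E.bundle.rank i)) L) (j : E.bundle.ι)
    (y : Option (Fin n) → L) : Matrix (Fin (E.bundle.rank i)) (Fin (E.bundle.rank j)) L :=
  (H y)⁻¹ * E.bundle.g i j y

theorem VectorBundle.g_mul_symm {W : Set (Option (Fin n) → L)} (E : VectorBundle k W) {i j : E.ι}
    {y : Option (Fin n) → L} (hi : y ∈ E.chart i) (hj : y ∈ E.chart j) : E.g i j y * E.g j i y = 1 := by
  rw [E.g_mul i j i y ⟨⟨hi, hj⟩, hi⟩, E.g_self i y hi]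

namespace IsFrameOn

variable {E : FBundle k B} {i : E.bundle.ι}
  {H : (Option (Fin n) → L) → Matrix (Fin (E.bundle.rank i)) (Fin (E.bundle.rank i)) L} {c : k}

theorem unif_conn (h : IsFrameOn E i H c) (e : Option (Fin n)) :
    IsUniformLimitMat k (polydisc k c) (E.conn i H e) := by
  have hR := isRational_polydisc (σ := Option (Fin n)) (L := L) h.ne_zero
  exact h.unif_inv.mul hR ((((E.analytic_A i e).isUniformLimitMat hR h.subset).mul hR h.unif).add
    (IsUniformLimitMat.smul hR (isUniformLimit_weight e _) (h.unif.partialD hR e)))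

theorem inv_mul (h : IsFrameOn E i H c) {y : Option (Fin n) → L} (hy : y ∈ polydisc k c) :
    (H y)⁻¹ * H y = 1 := Matrix.nonsing_inv_mul _ (isUnit_iff_ne_zero.2 (h.det_ne_zero y hy))

theorem mul_inv (h : IsFrameOn E i H c) {y : Option (Fin n) → L} (hy : y ∈ polydisc k c) :
    H y * (H y)⁻¹ = 1 := Matrix.mul_nonsing_inv _ (isUnit_iff_ne_zero.2 (h.det_ne_zero y hy))

theorem isRational_inter (h : IsFrameOn E i H c) (j : E.bundle.ι) :
    IsRational k (E.bundle.chart j ∩ polydisc k c) :=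
  (E.bundle.cover.rational j).inter (isRational_polydisc h.ne_zero)

theorem unif_g_left (h : IsFrameOn E i H c) (j : E.bundle.ι) :
    IsUniformLimitMat k (E.bundle.chart j ∩ polydisc k c) (E.bundle.g i j) :=
  (E.bundle.analytic_g i j).isUniformLimitMat (h.isRational_inter j) fun _ hy => ⟨h.subset hy.2, hy.1⟩

theorem unif_g_right (h : IsFrameOn E i H c) (j : E.bundle.ι) :
    IsUniformLimitMat k (E.bundle.chart j ∩ polydisc k c) (E.bundle.g j i) :=
  (E.bundle.analytic_g j i).isUniformLimitMat (h.isRational_inter j) fun _ hy => ⟨hy.1, h.subset hy.2⟩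

theorem unif_frameIn (h : IsFrameOn E i H c) (j : E.bundle.ι) :
    IsUniformLimitMat k (E.bundle.chart j ∩ polydisc k c) (E.frameIn i H j) :=
  (h.unif_g_right j).mul (h.isRational_inter j) (h.unif.mono Set.inter_subset_right)

theorem unif_coframeIn (h : IsFrameOn E i H c) (j : E.bundle.ι) :
    IsUniformLimitMat k (E.bundle.chart j ∩ polydisc k c) (E.coframeIn i H j) :=
  IsUniformLimitMat.mul (h.isRational_inter j) (h.unif_inv.mono Set.inter_subset_right) (h.unif_g_left j)

theorem coframeIn_mul (h : IsFrameOn E i H c) {j : E.bundle.ι} {y : Option (Fin n) → L}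
    (hy : y ∈ E.bundle.chart j ∩ polydisc k c) : E.coframeIn i H j y * E.frameIn i H j y = 1 := by
  rw [FBundle.coframeIn, FBundle.frameIn, Matrix.mul_assoc, ← Matrix.mul_assoc (E.bundle.g i j y),
    E.bundle.g_mul_symm (h.subset hy.2) hy.1, Matrix.one_mul, h.inv_mul hy.2]

theorem frameIn_mul (h : IsFrameOn E i H c) {j : E.bundle.ι} {y : Option (Fin n) → L}
    (hy : y ∈ E.bundle.chart j ∩ polydisc k c) : E.frameIn i H j y * E.coframeIn i H j y = 1 := by
  rw [FBundle.coframeIn, FBundle.frameIn, Matrix.mul_assoc, ← Matrix.mul_assoc (H y),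
    h.mul_inv hy.2, Matrix.one_mul, E.bundle.g_mul_symm hy.1 (h.subset hy.2)]

theorem partialD_frameIn (h : IsFrameOn E i H c) {j : E.bundle.ι} {y : Option (Fin n) → L}
    (hy : y ∈ E.bundle.chart j ∩ polydisc k c) (e : Option (Fin n)) :
    partialD e (E.frameIn i H j) y = partialD e (E.bundle.g j i) y * H y + E.bundle.g j i y * partialD e H y :=
  partialD_mul ((h.unif_g_right j).mPDiff (h.isRational_inter j) e hy)
    (h.unif.mPDiff (isRational_polydisc h.ne_zero) e hy.2)

theorem frameIn_conn (h : IsFrameOn E i H c) {j : E.bundle.ι} {y : Option (Fin n) → L}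
    (hy : y ∈ E.bundle.chart j ∩ polydisc k c) (e : Option (Fin n)) :
    E.A j e y * E.frameIn i H j y + weight e y • partialD e (E.frameIn i H j) y =
      E.frameIn i H j y * E.conn i H e y := by
  rw [h.partialD_frameIn hy, FBundle.frameIn, Matrix.mul_assoc, FBundle.mul_conn (h.det_ne_zero y hy.2),
    Matrix.mul_add, ← Matrix.mul_assoc _ (E.A i e y), E.gauge j i e y ⟨hy.1, h.subset hy.2⟩,
    Matrix.add_mul, Matrix.smul_mul, Matrix.mul_smul, smul_add]
  simp only [Matrix.mul_assoc, add_assoc]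

/-- The connection with the flat frame `H`. -/
noncomputable def connection (E : FBundle k B) (i : E.bundle.ι)
    (H : (Option (Fin n) → L) → Matrix (Fin (E.bundle.rank i)) (Fin (E.bundle.rank i)) L) (j : E.bundle.ι)
    (e : Option (Fin n)) (y : Option (Fin n) → L) : Matrix (Fin (E.bundle.rank j)) (Fin (E.bundle.rank j)) L :=
  -(partialD e (E.frameIn i H j) y * E.coframeIn i H j y)

theorem flat_frameIn (h : IsFrameOn E i H c) {j : E.bundle.ι} {y : Option (Fin n) → L}
    (hy : y ∈ E.bundle.chart j ∩ polydisc k c) (e : Option (Fin n)) :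
    partialD e (E.frameIn i H j) y + connection E i H j e y * E.frameIn i H j y = 0 := by
  rw [connection, Matrix.neg_mul, Matrix.mul_assoc, h.coframeIn_mul hy, Matrix.mul_one, add_neg_cancel]

theorem polydisc_subset (h : IsFrameOn E i H c) : (polydisc k c : Set (Fin n → L)) ⊆ B := fun t ht => by
  have h1 : point t 0 ∈ polydisc k c := (isGermNhd_polydisc h.ne_zero h.norm_le_one).zero_mem t ht
  have h2 : point t 0 ∈ E.dom := E.bundle.cover.iUnion_eq ▸ Set.mem_iUnion_of_mem i (h.subset h1)
  exact (E.isGermNhd.subset _ h2).1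

theorem unif_point {m l : Type*} {F : (Option (Fin n) → L) → Matrix m l L}
    (hF : IsUniformLimitMat k (polydisc k c) F) :
    IsUniformLimitMat k (polydisc k c : Set (Fin n → L)) fun t => F (point t 0) := fun a b => by
  have := (hF a b).comp_polynomial (τ := Fin n) (fun e => e.elim 0 MvPolynomial.X) (R' := polydisc k c)
    fun x hx e => by cases e <;> simp [hx _]
  refine this.congr fun t _ => ?_
  congr 1
  funext e
  cases e <;> simp [point]

/-- The framing with the flat frame `H`. -/
noncomputable def toFraming (h : IsFrameOn E i H c) : Framing k E (polydisc k c) where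
  dom := polydisc k c
  isGermNhd := isGermNhd_polydisc h.ne_zero h.norm_le_one
  subset := h.subset.trans ((Set.subset_iUnion E.bundle.chart i).trans E.bundle.cover.iUnion_eq.subset)
  Γ := connection E i H
  analytic_Γ j e := by
    have hR := h.isRational_inter j
    exact (((h.unif_frameIn j).partialD hR e).mul hR (h.unif_coframeIn j)).neg.isAnalyticMat
  gauge j l e y hy := by
    obtain ⟨⟨hj, hl⟩, hc⟩ := hy
    have hjl : IsRational k (E.bundle.chart j ∩ E.bundle.chart l) :=
      (E.bundle.cover.rational j).inter (E.bundle.cover.rational l)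
    have hd : partialD e (E.frameIn i H j) y = partialD e (E.bundle.g j l) y * E.frameIn i H l y +
        E.bundle.g j l y * partialD e (E.frameIn i H l) y := by
      rw [← partialD_mul (((E.bundle.analytic_g j l).isUniformLimitMat hjl subset_rfl).mPDiff hjl e ⟨hj, hl⟩)
        ((h.unif_frameIn l).mPDiff (h.isRational_inter l) e ⟨hl, hc⟩)]
      refine partialD_congr ?_
      filter_upwards [hjl.mem_nhds ⟨hj, hl⟩, (isRational_polydisc h.ne_zero).mem_nhds hc] with z hz hzc
      rw [FBundle.frameIn, FBundle.frameIn, ← Matrix.mul_assoc, E.bundle.g_mul j l i z ⟨hz, h.subset hzc⟩]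
    have hco : E.coframeIn i H j y * E.bundle.g j l y = E.coframeIn i H l y := by
      rw [FBundle.coframeIn, FBundle.coframeIn, Matrix.mul_assoc, E.bundle.g_mul i j l y ⟨⟨h.subset hc, hj⟩, hl⟩]
    rw [connection, connection, hd, Matrix.neg_mul, Matrix.mul_assoc _ (E.coframeIn i H j y), hco, Matrix.add_mul,
      Matrix.mul_assoc, h.frameIn_mul ⟨hl, hc⟩, Matrix.mul_one, Matrix.mul_neg, Matrix.mul_assoc]
    abel
  flat j e e' y hy := curvature_frame (h.unif_frameIn j) (h.unif_coframeIn j) (h.isRational_inter j)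
    (fun _ hx => h.frameIn_mul hx) (fun _ hx => h.coframeIn_mul hx) _ (fun _ _ _ => rfl) e e' hy
  framed x hx := by
    have hR := isRational_polydisc (σ := Option (Fin n)) (L := L) h.ne_zero
    -- K and G are the value and the u-derivative at u = 0 of the u-component, and a_j is the value
    -- at u = 0 of the t_j-component.
    refine ⟨i, polydisc k c, polydisc k c, H, fun t => E.conn i H none (point t 0),
      fun t => partialD none (E.conn i H none) (point t 0), fun j t => E.conn i H (some j) (point t 0),
      (isRational_polydisc h.ne_zero).isAdmissibleOpen, hx, subset_rfl, isGermNhd_polydisc h.ne_zero h.norm_le_one,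
      fun y hy => ⟨h.subset hy, hy⟩, h.unif.isAnalyticMat, (unif_point (h.unif_conn none)).isAnalyticMat,
      (unif_point ((h.unif_conn none).partialD hR none)).isAnalyticMat,
      fun j => (unif_point (h.unif_conn (some j))).isAnalyticMat, fun y hy => ⟨h.det_ne_zero y hy, fun e => ?_, ?_, ?_⟩⟩
    · have hg : ∀ᶠ z in 𝓝 y, E.frameIn i H i z = H z := by
        filter_upwards [(E.bundle.cover.rational i).mem_nhds (h.subset hy)] with z hz
        rw [FBundle.frameIn, E.bundle.g_self i z hz, Matrix.one_mul]
      have := h.flat_frameIn ⟨h.subset hy, hy⟩ e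
      rwa [partialD_congr hg, hg.self_of_nhds] at this
    · rw [← h.conn_none y hy, FBundle.mul_conn (h.det_ne_zero y hy)]
    · intro j
      change _ = H y * E.conn i H (some j) (point (base y) 0)
      rw [← h.conn_some j y hy, FBundle.mul_conn (h.det_ne_zero y hy)]

end IsFrameOn

theorem isGermNhd_univ_polydisc {d : k} (hd : d ≠ 0) (hd1 : ‖d‖ ≤ 1) :
    IsGermNhd k (Set.univ : Set (Fin 0 → L)) (polydisc k d) := by
  have : (Set.univ : Set (Fin 0 → L)) = polydisc k d := (Set.eq_univ_of_forall fun t j => j.elim0).symm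
  rw [this]
  exact isGermNhd_polydisc hd hd1

/-- Flatness of H for `φ` on the axis is given in the chart i only; the gauge law of `φ` and that of
the transition matrices carry it to every other chart. -/
theorem IsFrameOn.extends {hB : (0 : Fin n → L) ∈ B} {E : FBundle k B}
    {φ : Framing k (E.restrictZero hB) Set.univ} {i : E.bundle.ι}
    {H : (Option (Fin n) → L) → Matrix (Fin (E.bundle.rank i)) (Fin (E.bundle.rank i)) L} {c : k}
    (h : IsFrameOn E i H c) (hφ : ∀ᶠ z in 𝓝 0, partialD none (fun z => H (axis (Fin n) z)) z +
      φ.matrixAtZero i z * H (axis (Fin n) z) = 0) : h.toFraming.Extends φ := by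
  have h0 : φ.dom ∈ 𝓝 0 := by
    refine φ.isGermNhd.admissible.mem_nhds ?_
    have := φ.isGermNhd.zero_mem 0 (Set.mem_univ _)
    rwa [point_zero_zero] at this
  obtain ⟨d, hd, hd1, hds⟩ := exists_polydisc_subset k
    (inter_mem (inter_mem hφ h0) (tendsto_axis (σ := Fin n) (polydisc_mem_nhds h.ne_zero))) one_pos
  refine ⟨polydisc k d, isGermNhd_univ_polydisc hd hd1, fun z hz => ⟨(hds hz).1.2, (hds hz).2⟩, ?_⟩
  rintro j z ⟨hz, hzj⟩
  obtain ⟨⟨h1, h2⟩, h3⟩ := hds hz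
  have hg : E.bundle.g j i (axis (Fin n) z) * φ.matrixAtZero i z =
      φ.matrixAtZero j z * E.bundle.g j i (axis (Fin n) z) + partialD none (E.bundle.g j i) (axis (Fin n) z) := by
    rw [← partialD_axis]
    exact φ.gauge j i none z ⟨⟨hzj, h.subset h3⟩, h2⟩
  have h1' : partialD none H (axis (Fin n) z) = -(φ.matrixAtZero i z * H (axis (Fin n) z)) := by
    rw [← partialD_axis]
    exact eq_neg_of_add_eq_zero_left h1
  change IsFrameOn.connection E i H j none _ = _
  rw [IsFrameOn.connection, h.partialD_frameIn ⟨hzj, h3⟩, h1', Matrix.mul_neg, ← Matrix.mul_assoc, hg,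
    Matrix.add_mul (φ.matrixAtZero j z * _)]
  rw [show ∀ X Y : Matrix (Fin (E.bundle.rank j)) (Fin (E.bundle.rank i)) L, Y + -(X + Y) = -X by
    intros; abel, Matrix.neg_mul, neg_neg, Matrix.mul_assoc, Matrix.mul_assoc]
  have := h.frameIn_mul ⟨hzj, h3⟩
  rw [FBundle.frameIn, Matrix.mul_assoc] at this
  rw [this, Matrix.mul_one]

end FramingConstruction

/-! ### Separating the exponents of t and u; the recursion for coefficients. -/

section SplitIndices

variable {n : ℕ}

theorem optionElim_add_single_none (ℓ : Fin n →₀ ℕ) (q : ℕ) :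
    Finsupp.optionElim q ℓ + Finsupp.single none 1 = Finsupp.optionElim (q + 1) ℓ := by
  ext i
  cases i <;> simp [Finsupp.optionElim_apply_eq_elim]

theorem optionElim_add_single_some (ℓ : Fin n →₀ ℕ) (q : ℕ) (j : Fin n) :
    Finsupp.optionElim q ℓ + Finsupp.single (some j) 1 = Finsupp.optionElim q (ℓ + Finsupp.single j 1) := by
  classical
  ext i
  cases i <;> simp [Finsupp.optionElim_apply_eq_elim, Finsupp.single_apply]

theorem sum_antidiagonal_optionElim {M : Type*} [AddCommMonoid M] (ℓ : Fin n →₀ ℕ) (q : ℕ)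
    (f : (Option (Fin n) →₀ ℕ) × (Option (Fin n) →₀ ℕ) → M) :
    ∑ p ∈ Finset.HasAntidiagonal.antidiagonal (Finsupp.optionElim q ℓ), f p =
      ∑ p ∈ Finset.HasAntidiagonal.antidiagonal ℓ, ∑ s ∈ Finset.HasAntidiagonal.antidiagonal q,
        f (Finsupp.optionElim s.1 p.1, Finsupp.optionElim s.2 p.2) := by
  rw [← Finset.sum_product']
  refine Finset.sum_nbij' (fun p => ((p.1.some, p.2.some), (p.1 none, p.2 none)))
    (fun r => (Finsupp.optionElim r.2.1 r.1.1, Finsupp.optionElim r.2.2 r.1.2)) ?_ ?_ ?_ ?_ ?_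
  · rintro ⟨a, b⟩ h
    have h' : a + b = Finsupp.optionElim q ℓ := Finset.HasAntidiagonal.mem_antidiagonal.1 h
    simp only [Finset.mem_product, Finset.HasAntidiagonal.mem_antidiagonal]
    refine ⟨Finsupp.ext fun j => ?_, ?_⟩
    · simpa [Finsupp.optionElim_apply_eq_elim] using DFunLike.congr_fun h' (some j)
    · simpa [Finsupp.optionElim_apply_eq_elim] using DFunLike.congr_fun h' none
  · rintro ⟨⟨a, b⟩, s, t⟩ h
    simp only [Finset.mem_product, Finset.HasAntidiagonal.mem_antidiagonal] at h ⊢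
    obtain ⟨rfl, rfl⟩ := h
    ext i
    cases i <;> simp [Finsupp.optionElim_apply_eq_elim]
  · rintro ⟨a, b⟩ -
    simp [Finsupp.optionElim_some]
  · rintro ⟨⟨a, b⟩, s, t⟩ -
    simp [Finsupp.some_optionElim]
  · rintro ⟨a, b⟩ -
    simp [Finsupp.optionElim_some]

theorem tdeg_optionElim_zero (q : ℕ) : tdeg (Finsupp.optionElim q (0 : Fin n →₀ ℕ)) = 0 := by
  rw [tdeg_eq_zero_iff]
  intro j
  simp

theorem optionElim_zero_eq_zero_iff (q : ℕ) : Finsupp.optionElim q (0 : Fin n →₀ ℕ) = 0 ↔ q = 0 := by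
  rw [Finsupp.optionElim_zero, Finsupp.single_eq_zero]

variable {k : Type*} [NontriviallyNormedField k]
variable {L : Type*} [NontriviallyNormedField L] [NormedAlgebra k L] {r : ℕ}

theorem mon_optionElim (y : Option (Fin n) → L) (ℓ : Fin n →₀ ℕ) (q : ℕ) :
    mon y (Finsupp.optionElim q ℓ) = (ℓ.prod fun j e => y (some j) ^ e) * y none ^ q := by
  rw [mon, Finsupp.prod_fintype _ _ fun _ => pow_zero _, Finsupp.prod_fintype _ _ fun _ => pow_zero _,
    Fintype.prod_option, mul_comm]
  simp [Finsupp.optionElim_apply_eq_elim]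

theorem HasSerMat.eventually_seriesHasSum {F : (Option (Fin n) → L) → Matrix (Fin r) (Fin r) L}
    {X : Matrix (Fin r) (Fin r) (MvPowerSeries (Option (Fin n)) k)} (h : HasSerMat F X) :
    ∀ᶠ y in 𝓝 0, SeriesHasSum (fun ℓ q => mcoeff (Finsupp.optionElim q ℓ) X) y (F y) := by
  have h1 : ∀ᶠ y in 𝓝 0, ∀ a b, HasSum (term (X a b) y) (F y a b) :=
    eventually_all.2 fun a => eventually_all.2 fun b => (h a b).2
  refine h1.mono fun y hy a b => ?_
  have h2 := (((Equiv.prodComm _ _).trans (Finsupp.optionEquiv (α := Fin n) (M := ℕ)).symm).hasSum_iff).2 (hy a b)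
  convert h2 using 1
  funext p
  rw [← mon_optionElim]
  rfl

/-- In u ∂_{t_j} Q = -T_j Q + Q N_j the coefficient at u^0 is `residue` and the one at u^{q+1} is
`step`; as N_j is free of u, its convolution reduces to a single sum. -/
theorem isGaugeRecursion_of_series {T N : Fin n → Matrix (Fin r) (Fin r) (MvPowerSeries (Option (Fin n)) k)}
    {Q : Matrix (Fin r) (Fin r) (MvPowerSeries (Option (Fin n)) k)}
    (hQ : ∀ ℓ, tdeg ℓ = 0 → mcoeff ℓ Q = mcoeff ℓ 1) (hN : ∀ j ℓ, ℓ none ≠ 0 → mcoeff ℓ (N j) = 0)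
    (h : ∀ j, T j * Q + dop (some j) Q = Q * N j) :
    IsGaugeRecursion (fun j ℓ q => mcoeff (Finsupp.optionElim q ℓ) (T j))
      (fun ℓ q => mcoeff (Finsupp.optionElim q ℓ) Q) fun j ℓ => mcoeff (Finsupp.optionElim 0 ℓ) (N j) where
  init q := by
    classical
    rw [hQ _ (tdeg_optionElim_zero q), mcoeff_one]
    simp only [optionElim_zero_eq_zero_iff]
  residue j ℓ := by
    have h1 := congrArg (mcoeff (Finsupp.optionElim 0 ℓ)) (h j)
    rw [mcoeff_add, dop, fweight, Option.elim_some, uVar,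
      mcoeff_X_smul_of_eq_zero _ _ (Finsupp.optionElim_apply_none _ _), add_zero, mcoeff_mul, mcoeff_mul,
      sum_antidiagonal_optionElim, sum_antidiagonal_optionElim] at h1
    simpa using h1.symm
  step j ℓ q := by
    have h1 := congrArg (mcoeff (Finsupp.optionElim (q + 1) ℓ)) (h j)
    have h2 : mcoeff (Finsupp.optionElim (q + 1) ℓ) (Q * N j) =
        ∑ p ∈ Finset.HasAntidiagonal.antidiagonal ℓ, mcoeff (Finsupp.optionElim (q + 1) p.1) Q *
          mcoeff (Finsupp.optionElim 0 p.2) (N j) := by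
      rw [mcoeff_mul, sum_antidiagonal_optionElim]
      refine Finset.sum_congr rfl fun p _ => ?_
      rw [Finset.sum_eq_single (q + 1, 0)]
      · rintro ⟨s, t⟩ hs hne
        rw [hN, Matrix.mul_zero]
        rw [Finsupp.optionElim_apply_none]
        rintro rfl
        simp at hs
        exact hne (by rw [hs])
      · simp
    have h3 : mcoeff (Finsupp.optionElim (q + 1) ℓ) (dop (some j) Q) =
        ((ℓ j + 1 : ℕ) : k) • mcoeff (Finsupp.optionElim q (ℓ + Finsupp.single j 1)) Q := by
      rw [dop, fweight, Option.elim_some, uVar, ← optionElim_add_single_none, mcoeff_X_smul_add, mcoeff_mD,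
        optionElim_add_single_some, Finsupp.optionElim_apply_some]
    rw [mcoeff_add, h2, h3, mcoeff_mul, sum_antidiagonal_optionElim] at h1
    exact eq_neg_add_of_add_eq h1

end SplitIndices

/-! ### Comparing two frames. -/

section Comparison

variable {k : Type*} [NontriviallyNormedField k] [IsUltrametricDist k] [CompleteSpace k] [NormNatOne k]
variable {L : Type*} [NontriviallyNormedField L] [NormedAlgebra k L] [IsUltrametricDist L] [NormNatOne L]
  [Algebra.IsAlgebraic k L] [IsAlgClosed L]
variable {n : ℕ} {B : Set (Fin n → L)} {m l l' : Type*} [Fintype m] [Fintype l] [Fintype l']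

theorem HasSerMat.eventually_mPDiff {F : (Option (Fin n) → L) → Matrix m l L}
    {X : Matrix m l (MvPowerSeries (Option (Fin n)) k)} (h : HasSerMat F X) :
    ∀ᶠ y in 𝓝 0, ∀ e, MPDiff e F y := by
  obtain ⟨c, hc, h⟩ := h.exists_isUniformLimitMat
  filter_upwards [polydisc_mem_nhds hc] with y hy e
  exact (h c le_rfl).mPDiff (isRational_polydisc hc) e hy

theorem HasSerMat.eventually_eq_const {F : (Option (Fin n) → L) → Matrix m l L}
    {X : Matrix m l (MvPowerSeries (Option (Fin n)) k)} (h : HasSerMat F X) (hX : ∀ ℓ, ℓ ≠ 0 → mcoeff ℓ X = 0) :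
    ∀ᶠ y in 𝓝 0, F y = F 0 := by
  have h1 := hasSerMat_const (σ := Option (Fin n)) (L := L) (mcoeff 0 X)
  have h2 : X = (mcoeff 0 X).map (MvPowerSeries.C (σ := Option (Fin n))) := by
    classical
    ext a b ℓ
    rw [Matrix.map_apply, MvPowerSeries.coeff_C]
    split_ifs with hℓ
    · rw [hℓ]
      rfl
    · exact congrFun (congrFun (hX ℓ hℓ) a) b
  rw [← h2, ← h.apply_zero] at h1
  exact h.eventually_eq h1

variable [DecidableEq m] [DecidableEq l]

theorem eventually_partialD_inverse {P : (Option (Fin n) → L) → Matrix m l L} {Pi : (Option (Fin n) → L) → Matrix l m L}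
    {X : Matrix m l (MvPowerSeries (Option (Fin n)) k)} {Y : Matrix l m (MvPowerSeries (Option (Fin n)) k)}
    (hP : HasSerMat P X) (hPi : HasSerMat Pi Y) (h1 : ∀ᶠ y in 𝓝 0, P y * Pi y = 1)
    (h2 : ∀ᶠ y in 𝓝 0, Pi y * P y = 1) :
    ∀ᶠ y in 𝓝 0, ∀ e, partialD e Pi y = -(Pi y * partialD e P y * Pi y) := by
  obtain ⟨c, hc, hu⟩ := hP.exists_isUniformLimitMat
  obtain ⟨c', hc', hu'⟩ := hPi.exists_isUniformLimitMat
  obtain ⟨d, hd, -, hds⟩ := exists_polydisc_subset k (inter_mem h1 h2) one_pos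
  obtain ⟨a, ha, hac, hac'⟩ := exists_norm_le_norm hc hc'
  obtain ⟨b, hb, hba, hbd⟩ := exists_norm_le_norm ha hd
  have hbs := (polydisc_mono hbd).trans hds
  filter_upwards [polydisc_mem_nhds hb] with y hy e
  exact (hu b (hba.trans hac)).partialD_inverse (hu' b (hba.trans hac')) (isRational_polydisc hb)
    (fun x hx => (hbs hx).1) (fun x hx => (hbs hx).2) e hy

/-- The equation satisfied by the matrix comparing two frames. -/
theorem eventually_compare {P : (Option (Fin n) → L) → Matrix m l L} {Pi : (Option (Fin n) → L) → Matrix l m L}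
    {F : (Option (Fin n) → L) → Matrix m l' L}
    {X : Matrix m l (MvPowerSeries (Option (Fin n)) k)} {Y : Matrix l m (MvPowerSeries (Option (Fin n)) k)}
    {Z : Matrix m l' (MvPowerSeries (Option (Fin n)) k)}
    (hP : HasSerMat P X) (hPi : HasSerMat Pi Y) (hF : HasSerMat F Z) (h1 : ∀ᶠ y in 𝓝 0, P y * Pi y = 1)
    (h2 : ∀ᶠ y in 𝓝 0, Pi y * P y = 1) {e : Option (Fin n)} {A : (Option (Fin n) → L) → Matrix m m L}
    {N : (Option (Fin n) → L) → Matrix l l L} {a : (Option (Fin n) → L) → Matrix l' l' L}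
    (hPN : ∀ᶠ y in 𝓝 0, A y * P y + weight e y • partialD e P y = P y * N y)
    (hFa : ∀ᶠ y in 𝓝 0, A y * F y + weight e y • partialD e F y = F y * a y) :
    ∀ᶠ y in 𝓝 0, weight e y • partialD e (fun y => Pi y * F y) y + N y * (Pi y * F y) = Pi y * F y * a y := by
  filter_upwards [h1, h2, hPN, hFa, eventually_partialD_inverse hP hPi h1 h2, hPi.eventually_mPDiff,
    hF.eventually_mPDiff] with y h1 h2 hPN hFa hd hPi hF
  have e1 : weight e y • partialD e P y = P y * N y - A y * P y := by rw [← hPN, add_sub_cancel_left]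
  have e2 : weight e y • partialD e F y = F y * a y - A y * F y := by rw [← hFa, add_sub_cancel_left]
  have e3 : weight e y • partialD e Pi y = -(N y * Pi y) + Pi y * A y := by
    rw [hd, smul_neg, ← Matrix.smul_mul, ← Matrix.mul_smul, e1, Matrix.mul_sub, Matrix.sub_mul, ← Matrix.mul_assoc,
      h2, Matrix.one_mul, Matrix.mul_assoc, Matrix.mul_assoc, h1, Matrix.mul_one]
    abel
  rw [partialD_mul (hPi e) (hF e), smul_add, ← Matrix.smul_mul, ← Matrix.mul_smul, e2, e3, Matrix.add_mul,
    Matrix.mul_sub, Matrix.neg_mul]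
  simp only [Matrix.mul_assoc]
  abel

theorem tendsto_point_zero : Tendsto (fun y : Option (Fin n) → L => point (0 : Fin n → L) (y none)) (𝓝 0) (𝓝 0) :=
  tendsto_axis.comp tendsto_const_none

theorem FBundle.exists_hasSerMat_conn (E : FBundle k B) {i : E.bundle.ι} (h0 : 0 ∈ E.bundle.chart i)
    {F : (Option (Fin n) → L) → Matrix (Fin (E.bundle.rank i)) (Fin (E.bundle.rank i)) L}
    {X : Matrix (Fin (E.bundle.rank i)) (Fin (E.bundle.rank i)) (MvPowerSeries (Option (Fin n)) k)}
    (hF : HasSerMat F X) (hX : (mcoeff 0 X).det ≠ 0) :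
    ∃ T : Option (Fin n) → Matrix (Fin (E.bundle.rank i)) (Fin (E.bundle.rank i))
      (MvPowerSeries (Option (Fin n)) k), ∀ c, HasSerMat (E.conn i F c) (T c) := by
  obtain ⟨A, hA⟩ := E.exists_hasSerMat_A h0
  exact ⟨_, fun c => (hF.inv hX).mul (((hA c).mul hF).add (hF.dop c))⟩

theorem Framing.Extends.eventually_eq {hB : (0 : Fin n → L) ∈ B} {E : FBundle k B}
    {φ : Framing k (E.restrictZero hB) Set.univ} {U : Set (Fin n → L)} {Φ : Framing k E U} (h : Φ.Extends φ)
    {i : E.bundle.ι} (h0 : 0 ∈ E.bundle.chart i) :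
    ∀ᶠ z in 𝓝 0, Φ.Γ i none (axis (Fin n) z) = φ.matrixAtZero i z := by
  obtain ⟨N, hN, -, h⟩ := h
  have h0N : (0 : Option (Fin 0) → L) ∈ N := by
    have := hN.zero_mem 0 (Set.mem_univ _)
    rwa [point_zero_zero] at this
  have h0' := tendsto_axis (σ := Fin n) ((E.bundle.cover.rational i).mem_nhds h0)
  filter_upwards [hN.admissible.mem_nhds h0N, h0'] with z hz hz'
  exact h i z ⟨hz, hz'⟩

namespace IsFrameOn

variable {hB : (0 : Fin n → L) ∈ B} {E : FBundle k B} {φ : Framing k (E.restrictZero hB) Set.univ} {i : E.bundle.ι}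
  {H : (Option (Fin n) → L) → Matrix (Fin (E.bundle.rank i)) (Fin (E.bundle.rank i)) L} {c : k}

theorem inter_mem_nhds (h : IsFrameOn E i H c) {j : E.bundle.ι} (h0 : 0 ∈ E.bundle.chart j) :
    E.bundle.chart j ∩ polydisc k c ∈ 𝓝 0 := (h.isRational_inter j).mem_nhds ⟨h0, zero_mem_polydisc c⟩

theorem exists_hasSerMat_frameIn (h : IsFrameOn E i H c) {j : E.bundle.ι} (h0 : 0 ∈ E.bundle.chart j) :
    ∃ X : Matrix (Fin (E.bundle.rank j)) (Fin (E.bundle.rank i)) (MvPowerSeries (Option (Fin n)) k),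
      HasSerMat (E.frameIn i H j) X :=
  (h.unif_frameIn j).isAnalyticMat.exists_hasSerMat (h.inter_mem_nhds h0)

theorem exists_hasSerMat_coframeIn (h : IsFrameOn E i H c) {j : E.bundle.ι} (h0 : 0 ∈ E.bundle.chart j) :
    ∃ X : Matrix (Fin (E.bundle.rank i)) (Fin (E.bundle.rank j)) (MvPowerSeries (Option (Fin n)) k),
      HasSerMat (E.coframeIn i H j) X :=
  (h.unif_coframeIn j).isAnalyticMat.exists_hasSerMat (h.inter_mem_nhds h0)

theorem eventually_frameIn_mul (h : IsFrameOn E i H c) {j : E.bundle.ι} (h0 : 0 ∈ E.bundle.chart j) :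
    ∀ᶠ y in 𝓝 0, E.frameIn i H j y * E.coframeIn i H j y = 1 :=
  mem_of_superset (h.inter_mem_nhds h0) fun _ hy => h.frameIn_mul hy

theorem eventually_coframeIn_mul (h : IsFrameOn E i H c) {j : E.bundle.ι} (h0 : 0 ∈ E.bundle.chart j) :
    ∀ᶠ y in 𝓝 0, E.coframeIn i H j y * E.frameIn i H j y = 1 :=
  mem_of_superset (h.inter_mem_nhds h0) fun _ hy => h.coframeIn_mul hy

/-- A second frame which is flat along the axis differs from `H` by a constant matrix along the axis. -/
theorem mcoeff_compare_axis (h : IsFrameOn E i H c) (hφ : h.toFraming.Extends φ)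
    {j : E.bundle.ι} (h0 : 0 ∈ E.bundle.chart j)
    {F : (Option (Fin n) → L) → Matrix (Fin (E.bundle.rank j)) l L}
    {Y : Matrix (Fin (E.bundle.rank j)) l (MvPowerSeries (Option (Fin n)) k)} (hF : HasSerMat F Y)
    (hflat : ∀ᶠ z in 𝓝 0, partialD none F (axis (Fin n) z) + φ.matrixAtZero j z * F (axis (Fin n) z) = 0)
    {W : Matrix (Fin (E.bundle.rank i)) l (MvPowerSeries (Option (Fin n)) k)}
    (hW : HasSerMat (fun y => E.coframeIn i H j y * F y) W) {ℓ : Option (Fin n) →₀ ℕ} (hℓ : tdeg ℓ = 0)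
    (hℓ' : ℓ none ≠ 0) : mcoeff ℓ W = 0 := by
  have := NormNatOne.charZero (K := k)
  obtain ⟨X, hX⟩ := h.exists_hasSerMat_frameIn h0
  obtain ⟨X', hX'⟩ := h.exists_hasSerMat_coframeIn h0
  have h1 := eventually_partialD_inverse hX hX' (h.eventually_frameIn_mul h0) (h.eventually_coframeIn_mul h0)
  -- Along the axis both frames solve the same linear differential equation in u, because the
  -- framing restricts to `φ`; the product of one with the inverse of the other has zero derivative.
  have h2 : ∀ᶠ z in 𝓝 0, partialD none (fun y => E.coframeIn i H j y * F y) (axis (Fin n) z) = 0 := by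
    filter_upwards [hφ.eventually_eq h0, hflat, tendsto_axis h1, tendsto_axis hX'.eventually_mPDiff,
      tendsto_axis hF.eventually_mPDiff] with z hz hzf h1 hd hd'
    change connection E i H j none _ = _ at hz
    have h3 : partialD none (E.coframeIn i H j) (axis (Fin n) z) = _ := h1 none
    rw [partialD_mul (hd none) (hd' none), eq_neg_of_add_eq_zero_left hzf, h3, ← hz, connection]
    simp only [Matrix.neg_mul, neg_neg, Matrix.mul_assoc]
    exact neg_add_cancel _
  have h3 := (hW.partialD none).kill_base.unique hasSerMat_zero (tendsto_const_none h2)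
  obtain ⟨ℓ, rfl⟩ : ∃ ℓ', ℓ = ℓ' + Finsupp.single none 1 := by
    refine ⟨ℓ - Finsupp.single none 1, (tsub_add_cancel_of_le ?_).symm⟩
    simpa [Finsupp.single_le_iff] using Nat.one_le_iff_ne_zero.2 hℓ'
  rw [tdeg_add, tdeg_single_none, add_zero] at hℓ
  have h4 := congrArg (mcoeff ℓ) h3
  rw [mcoeff_map_kill_of_forall (forall_ne_none_iff.2 hℓ), mcoeff_mD, mcoeff_zero] at h4
  exact (smul_eq_zero.1 h4).resolve_left (Nat.cast_ne_zero.2 (Nat.succ_ne_zero _))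

end IsFrameOn

end Comparison

/-! ### The explicit form of the framing. -/

section ExplicitForm

variable {k : Type*} [NontriviallyNormedField k] [IsUltrametricDist k] [CompleteSpace k] [NormNatOne k]
variable {L : Type*} [NontriviallyNormedField L] [NormedAlgebra k L] [IsUltrametricDist L] [NormNatOne L]
  [Algebra.IsAlgebraic k L] [IsAlgClosed L]
variable {n : ℕ} {B : Set (Fin n → L)} {hB : (0 : Fin n → L) ∈ B} {E : FBundle k B}
  {φ : Framing k (E.restrictZero hB) Set.univ} {i : E.bundle.ι}
  {H : (Option (Fin n) → L) → Matrix (Fin (E.bundle.rank i)) (Fin (E.bundle.rank i)) L} {c : k}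

/-- The wanted frame F·Q is the flat frame H, moved to the chart j, times a constant matrix W₀.
Along the axis F and H differ by a constant, and W₀ is chosen to be this constant, so that Q = 1
there. -/
theorem IsFrameOn.exists_gaugeRecursion (h : IsFrameOn E i H c) (hφ : h.toFraming.Extends φ)
    {j : E.bundle.ι} (h0 : 0 ∈ E.bundle.chart j)
    {F : (Option (Fin n) → L) → Matrix (Fin (E.bundle.rank j)) (Fin (E.bundle.rank j)) L}
    {Y : Matrix (Fin (E.bundle.rank j)) (Fin (E.bundle.rank j)) (MvPowerSeries (Option (Fin n)) k)}
    (hF : HasSerMat F Y) (hY : (mcoeff 0 Y).det ≠ 0)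
    (hflat : ∀ᶠ z in 𝓝 0, partialD none F (axis (Fin n) z) + φ.matrixAtZero j z * F (axis (Fin n) z) = 0) :
    ∃ (T : Option (Fin n) → Matrix (Fin (E.bundle.rank j)) (Fin (E.bundle.rank j)) (MvPowerSeries (Option (Fin n)) k))
      (X : Matrix (Fin (E.bundle.rank j)) (Fin (E.bundle.rank j)) (MvPowerSeries (Option (Fin n)) k))
      (M : Fin n → (Fin n →₀ ℕ) → Matrix (Fin (E.bundle.rank j)) (Fin (E.bundle.rank j)) k)
      (Q : (Option (Fin n) → L) → Matrix (Fin (E.bundle.rank j)) (Fin (E.bundle.rank j)) L)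
      (W₀ : Matrix (Fin (E.bundle.rank i)) (Fin (E.bundle.rank j)) L),
      (∀ e, HasSerMat (E.conn j F e) (T e)) ∧ HasSerMat Q X ∧ (mcoeff 0 X).det ≠ 0 ∧
      IsGaugeRecursion (fun a ℓ q => mcoeff (Finsupp.optionElim q ℓ) (T (some a)))
        (fun ℓ q => mcoeff (Finsupp.optionElim q ℓ) X) M ∧
      ∀ᶠ y in 𝓝 0, F y * Q y = E.frameIn i H j y * W₀ := by
  classical
  obtain ⟨X, hX⟩ := h.exists_hasSerMat_frameIn h0
  obtain ⟨X', hX'⟩ := h.exists_hasSerMat_coframeIn h0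
  obtain ⟨T, hT⟩ := E.exists_hasSerMat_conn h0 hF hY
  have hW := hX'.mul hF
  have hFi := hF.inv hY
  have hV := hFi.mul hX
  -- The charts i and j have ranks of different form, so W₀ and its inverse V₀ are rectangular in
  -- type and are carried separately.
  set W₀ := E.coframeIn i H j 0 * F 0 with hW₀
  set V₀ := (F 0)⁻¹ * E.frameIn i H j 0 with hV₀
  obtain ⟨Ws, hWs⟩ : ∃ Z : Matrix _ _ (MvPowerSeries (Option (Fin n)) k), HasSerMat (fun _ => W₀) Z := by
    rw [hW₀, hW.apply_zero]
    exact ⟨_, hasSerMat_const _⟩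
  obtain ⟨Vs, hVs⟩ : ∃ Z : Matrix _ _ (MvPowerSeries (Option (Fin n)) k), HasSerMat (fun _ => V₀) Z := by
    rw [hV₀, hV.apply_zero]
    exact ⟨_, hasSerMat_const _⟩
  have hdet := hF.eventually_det_ne_zero hY
  have hF1 : ∀ᶠ y in 𝓝 0, F y * (F y)⁻¹ = 1 :=
    hdet.mono fun y hy => Matrix.mul_nonsing_inv _ (isUnit_iff_ne_zero.2 hy)
  have hF2 : ∀ᶠ y in 𝓝 0, (F y)⁻¹ * F y = 1 :=
    hdet.mono fun y hy => Matrix.nonsing_inv_mul _ (isUnit_iff_ne_zero.2 hy)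
  have hVW : ∀ᶠ y in 𝓝 0, (F y)⁻¹ * E.frameIn i H j y * (E.coframeIn i H j y * F y) = 1 := by
    filter_upwards [hF2, h.eventually_frameIn_mul h0] with y h2 h3
    rw [Matrix.mul_assoc, ← Matrix.mul_assoc _ _ (F y), h3, Matrix.one_mul, h2]
  have hWV : W₀ * V₀ = 1 := by
    have h1 := hF1.self_of_nhds
    have h3 := (h.eventually_coframeIn_mul h0).self_of_nhds
    rw [hW₀, hV₀, Matrix.mul_assoc, ← Matrix.mul_assoc (F 0), h1, Matrix.one_mul, h3]
  set Q := fun y => (F y)⁻¹ * E.frameIn i H j y * W₀ with hQdef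
  have hQ := hV.mul hWs
  have hQ0 : Q 0 = 1 := hVW.self_of_nhds
  -- along the axis the comparison matrix is constant
  have hWax : ∀ᶠ y in 𝓝 (0 : Option (Fin n) → L), E.coframeIn i H j (point 0 (y none)) * F (point 0 (y none)) = W₀ := by
    have h1 := hW.kill_base.eventually_eq_const fun ℓ hℓ => by
      by_cases h2 : ∀ i, i ≠ none → ℓ i = 0
      · rw [mcoeff_map_kill_of_forall h2]
        refine h.mcoeff_compare_axis hφ h0 hF hflat hW (forall_ne_none_iff.1 h2) fun h3 => hℓ ?_
        ext a
        cases a with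
        | none => exact h3
        | some a => exact h2 _ (by simp)
      · exact mcoeff_map_kill_of_not_forall h2
    refine h1.mono fun y hy => hy.trans ?_
    rw [Pi.zero_apply, point_zero_zero]
  have hQax : ∀ ℓ, tdeg ℓ = 0 → mcoeff ℓ (Y⁻¹ * X * Ws) = mcoeff ℓ 1 := by
    have h1 := hQ.kill_base.unique hasSerMat_one (by
      filter_upwards [hWax, tendsto_point_zero hVW] with y hy1 hy2
      have hy3 : (F (point 0 (y none)))⁻¹ * E.frameIn i H j (point 0 (y none)) *
        (E.coframeIn i H j (point 0 (y none)) * F (point 0 (y none))) = 1 := hy2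
      rw [← hy1, hy3])
    intro ℓ hℓ
    rw [← h1, mcoeff_map_kill_of_forall (forall_ne_none_iff.2 hℓ)]
  -- the connection in the frame `F * Q`
  obtain ⟨N, hN⟩ : ∃ N : Fin n → Matrix (Fin (E.bundle.rank i)) (Fin (E.bundle.rank i))
      (MvPowerSeries (Option (Fin n)) k), ∀ a, HasSerMat (E.conn i H (some a)) (N a) := by
    choose N hN using fun a => (h.unif_conn (some a)).exists_hasSerMat h.ne_zero
    exact ⟨N, hN⟩
  -- Passing to the frame multiplied by W₀ conjugates the connection matrices by a constant, and
  -- they stay free of u.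
  have hN' := fun a => (hVs.mul (hN a)).mul hWs
  have hind : ∀ a ℓ, ℓ none ≠ 0 → mcoeff ℓ (Vs * N a * Ws) = 0 := fun a ℓ hℓ => by
    have h1 := (hN' a).unique (hN' a).kill_u (by
      filter_upwards [polydisc_mem_nhds h.ne_zero] with y hy
      rw [h.conn_some a y hy])
    rw [h1, mcoeff_map_kill_of_not_forall (by simpa using hℓ)]
  refine ⟨T, _, _, Q, W₀, hT, hQ, ?_, isGaugeRecursion_of_series (T := fun a => T (some a)) hQax hind fun a => ?_, ?_⟩
  · refine hQ.det_mcoeff_ne_zero ?_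
    change (Q 0).det ≠ 0
    rw [hQ0, Matrix.det_one]
    exact one_ne_zero
  · have h1 := eventually_compare hF hFi hX hF1 hF2 (e := some a) (A := E.A j (some a)) (N := E.conn j F (some a))
      (a := E.conn i H (some a)) (hdet.mono fun y hy => (FBundle.mul_conn hy).symm)
      (mem_of_superset (h.inter_mem_nhds h0) fun y hy => h.frameIn_conn hy (some a))
    refine (((hT (some a)).mul hQ).add (hQ.dop (some a))).unique (hQ.mul (hN' a)) ?_
    filter_upwards [h1, hV.eventually_mPDiff] with y hy hd
    rw [partialD_mul (hd _) (mPDiff_const _ _ _), partialD_const, Matrix.mul_zero, add_zero, ← Matrix.smul_mul,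
      ← Matrix.mul_assoc, ← Matrix.add_mul, add_comm, hy]
    simp only [Matrix.mul_assoc]
    rw [← Matrix.mul_assoc W₀ V₀, hWV, Matrix.one_mul]
  · filter_upwards [hF1] with y hy
    rw [hQdef]
    simp only [← Matrix.mul_assoc]
    rw [hy, Matrix.one_mul]

/-- The germ identities of `IsFrameOn.exists_gaugeRecursion` are realised on one polydisc. F·Q is
flat because it is a flat frame times a constant matrix. -/
theorem IsFrameOn.isExplicit (h : IsFrameOn E i H c) (hφ : h.toFraming.Extends φ) : h.toFraming.IsExplicit φ := by
  intro j S F hS h0S hSj hF hFdet hflat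
  have h0 : 0 ∈ E.bundle.chart j := hSj h0S
  have hSn := hS.mem_nhds h0S
  obtain ⟨Y, hY⟩ := hF.exists_hasSerMat hSn
  have hY0 := hY.det_mcoeff_ne_zero (hFdet 0 h0S)
  have hφ0 : φ.dom ∈ 𝓝 0 := by
    refine φ.isGermNhd.admissible.mem_nhds ?_
    have := φ.isGermNhd.zero_mem 0 (Set.mem_univ _)
    rwa [point_zero_zero] at this
  have hflat' : ∀ᶠ z in 𝓝 0, partialD none F (axis (Fin n) z) + φ.matrixAtZero j z * F (axis (Fin n) z) = 0 := by
    filter_upwards [hφ0, tendsto_axis (σ := Fin n) hSn] with z hz hzS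
    rw [← partialD_axis]
    exact hflat z ⟨hz, hzS⟩
  obtain ⟨T, X, M, Q, W₀, hT, hQ, hX0, hrec, hFQ⟩ := h.exists_gaugeRecursion hφ h0 hY hY0 hflat'
  have h1 : ∀ᶠ y in 𝓝 0, ∀ a, SeriesHasSum (fun ℓ q => mcoeff (Finsupp.optionElim q ℓ) (T (some a))) y
      (E.conn j F (some a) y) := eventually_all.2 fun a => (hT (some a)).eventually_seriesHasSum
  have h2 : ∀ᶠ y in 𝓝 0, ∀ e, partialD e (fun z => F z * Q z) y + connection E i H j e y * (F y * Q y) = 0 := by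
    filter_upwards [eventually_eventually_nhds.2 hFQ, h.inter_mem_nhds h0] with y hy hyj e
    rw [partialD_congr hy, hy.self_of_nhds, partialD_mul ((h.unif_frameIn j).mPDiff (h.isRational_inter j) e hyj)
      (mPDiff_const _ _ _), partialD_const, Matrix.mul_zero, add_zero, ← Matrix.mul_assoc, ← Matrix.add_mul,
      h.flat_frameIn hyj, Matrix.zero_mul]
  obtain ⟨d, hd, -, hds⟩ := exists_polydisc_subset k (inter_mem (inter_mem (inter_mem h1 h2)
    (inter_mem hQ.eventually_seriesHasSum (hQ.eventually_det_ne_zero hX0)))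
    (inter_mem hSn (polydisc_mem_nhds (L := L) h.ne_zero))) one_pos
  exact ⟨d, _, _, M, Q, hd, fun y hy => (hds hy).2, hrec, fun y hy => ⟨(hds hy).1.1.1, (hds hy).1.2.1,
    (hds hy).1.2.2, (hds hy).1.1.2⟩⟩

end ExplicitForm

/-! ### Uniqueness near the origin and over the whole polydisc. -/

section Uniqueness

variable {k : Type*} [NontriviallyNormedField k] [IsUltrametricDist k] [CompleteSpace k] [NormNatOne k]
variable {L : Type*} [NontriviallyNormedField L] [NormedAlgebra k L] [IsUltrametricDist L] [NormNatOne L]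
  [Algebra.IsAlgebraic k L] [IsAlgClosed L]
variable {n : ℕ} {B : Set (Fin n → L)} {hB : (0 : Fin n → L) ∈ B} {E : FBundle k B}
  {φ : Framing k (E.restrictZero hB) Set.univ} {i : E.bundle.ι}
  {H : (Option (Fin n) → L) → Matrix (Fin (E.bundle.rank i)) (Fin (E.bundle.rank i)) L} {c : k}

/-- Finitely many rational sets have a common margin. -/
theorem exists_common_margin {ι : Type*} {R : ι → Set (Option (Fin n) → L)} (hR : ∀ i, IsRational k (R i)) (hc : c ≠ 0)
    (s : Finset ι) : ∃ ρ : k, ρ ≠ 0 ∧ ‖ρ‖ ≤ ‖c‖ ∧ ‖ρ‖ ≤ 1 ∧ ∀ i ∈ s, ∀ x ∈ R i,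
      ∀ v ∈ (polydisc k ρ : Set (Option (Fin n) → L)), x + v ∈ R i := by
  classical
  induction s using Finset.induction_on with
  | empty =>
    obtain ⟨d, hd, h1, h2⟩ := exists_norm_le_norm hc (one_ne_zero (α := k))
    exact ⟨d, hd, h1, by simpa using h2, by simp⟩
  | insert i s _ ih =>
    obtain ⟨ρ, hρ, h1, h2, h3⟩ := ih
    obtain ⟨ρ', hρ', h4⟩ := (hR i).exists_add_mem
    obtain ⟨d, hd, hdρ, hdρ'⟩ := exists_norm_le_norm hρ hρ'
    refine ⟨d, hd, hdρ.trans h1, hdρ.trans h2, fun j hj x hx v hv => ?_⟩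
    rcases Finset.mem_insert.1 hj with rfl | hj
    · exact h4 x hx v (polydisc_mono hdρ' hv)
    · exact h3 j hj x hx v (polydisc_mono hdρ hv)

theorem exists_aeval_eq_point (n : ℕ) (L : Type*) [NontriviallyNormedField L] [NormedAlgebra k L] (c : k) :
    ∃ μ : Option (Fin n) → MvPolynomial (Fin n) k, ∀ z : Fin n → L,
      (fun e => MvPolynomial.aeval z (μ e)) = point (fun j => algebraMap k L c * z j) 0 := by
  refine ⟨fun e => e.elim 0 fun j => MvPolynomial.C c * MvPolynomial.X j, fun z => ?_⟩
  funext e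
  cases e <;> simp [point, MvPolynomial.algHom_C]

/-- An admissible open neighbourhood of a closed polydisc in `u = 0` contains a product with a disc. -/
theorem IsAdmissibleOpen.exists_bidisc_subset {W : Set (Option (Fin n) → L)} (hW : IsAdmissibleOpen k W)
    (hc : c ≠ 0) (h : ∀ t ∈ (polydisc k c : Set (Fin n → L)), point t 0 ∈ W) :
    ∃ ρ : k, ρ ≠ 0 ∧ ‖ρ‖ ≤ ‖c‖ ∧ ‖ρ‖ ≤ 1 ∧ bidisc k c ρ ⊆ W := by
  obtain ⟨𝒞, h𝒞⟩ := hW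
  have hcL : algebraMap k L c ≠ 0 := (map_ne_zero _).2 hc
  obtain ⟨μ, hμ⟩ := exists_aeval_eq_point n L c
  -- Admissibility is tested on the closed unit polydisc, with no equations, mapped by z ↦ (c z, 0).
  -- Finitely many rational members of the covering suffice, and their common margin is the
  -- thickness in the u-direction.
  obtain ⟨s, hs⟩ := h𝒞.finite n ∅ (fun e z => MvPolynomial.aeval z (μ e)) (fun _ hg => hg.elim)
    (fun e => (isUniformLimit_aeval _ _).isAnalytic) fun z hz _ => by
      rw [hμ]
      refine h _ fun j => ?_
      rw [norm_mul, norm_algebraMap']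
      simpa using mul_le_mul_of_nonneg_left (hz j) (norm_nonneg c)
  obtain ⟨ρ, hρ, h1, h2, h3⟩ := exists_common_margin h𝒞.rational hc s
  refine ⟨ρ, hρ, h1, h2, fun y hy => ?_⟩
  obtain ⟨R, hR, hyR⟩ := hs (fun j => (algebraMap k L c)⁻¹ * y (some j)) (fun j => by
    rw [norm_mul, norm_inv, norm_algebraMap', norm_one, inv_mul_le_iff₀ (norm_pos_iff.2 hc), mul_one]
    exact hy.1 (some j)) (fun _ hg => hg.elim)
  rw [hμ] at hyR
  rw [← h𝒞.iUnion_eq]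
  refine Set.mem_iUnion_of_mem R ?_
  have hv : Pi.single none (y none) ∈ (polydisc k ρ : Set (Option (Fin n) → L)) := fun e => by
    cases e with
    | none => simpa using hy.2
    | some j => simp
  have hy' : y = point (fun j => algebraMap k L c * ((algebraMap k L c)⁻¹ * y (some j))) 0 +
      Pi.single none (y none) := by
    funext e
    cases e <;> simp [point, mul_inv_cancel_left₀ hcL]
  rw [hy']
  exact h3 R hR _ hyR _ hv

/-- The agreement of two framings at a point does not depend on the chart. -/
theorem Framing.eq_of_eq {U₁ U₂ : Set (Fin n → L)} (Φ : Framing k E U₁) (Ψ : Framing k E U₂) {j l : E.bundle.ι}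
    {y : Option (Fin n) → L} (hj : y ∈ E.bundle.chart j) (hl : y ∈ E.bundle.chart l) (hΦ : y ∈ Φ.dom)
    (hΨ : y ∈ Ψ.dom) {e : Option (Fin n)} (h : Φ.Γ j e y = Ψ.Γ j e y) : Φ.Γ l e y = Ψ.Γ l e y := by
  have h1 : E.bundle.g j l y * Φ.Γ l e y = E.bundle.g j l y * Ψ.Γ l e y := by
    rw [Φ.gauge j l e y ⟨⟨hj, hl⟩, hΦ⟩, Ψ.gauge j l e y ⟨⟨hj, hl⟩, hΨ⟩, h]
  have h2 := congrArg (E.bundle.g l j y * ·) h1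
  simpa only [← Matrix.mul_assoc, E.bundle.g_mul_symm hl hj, Matrix.one_mul] using h2

/-- Two framings which agree along `b × 𝔻_u` agree near the origin. -/
theorem IsFrameOn.eventually_eq_of_extends {X : Matrix (Fin (E.bundle.rank i)) (Fin (E.bundle.rank i)) (MvPowerSeries (Option (Fin n)) k)}
    {N : Option (Fin n) → Matrix (Fin (E.bundle.rank i)) (Fin (E.bundle.rank i)) (MvPowerSeries (Option (Fin n)) k)}
    (h : IsFrameOn E i H c) (hf : IsFormalFrame φ i H X N) (hφ : h.toFraming.Extends φ) {V : Set (Fin n → L)}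
    (h0V : 0 ∈ V) {Ψ : Framing k E V} (hΨ : Ψ.Extends φ) :
    ∀ᶠ y in 𝓝 0, y ∈ Ψ.dom ∧ ∀ e, h.toFraming.Γ i e y = Ψ.Γ i e y := by
  have := NormNatOne.charZero (K := k)
  obtain ⟨j, V', S, P, K, G, a, hV', h0V', -, hS, hSj, hP, -, -, ha, hfr⟩ := Ψ.framed 0 h0V
  have h0S : 0 ∈ S := by
    have := hS.zero_mem 0 h0V'
    rwa [point_zero_zero] at this
  have h0 := (hSj h0S).1
  have hSn := hS.admissible.mem_nhds h0S
  obtain ⟨Y, hY⟩ := hP.exists_hasSerMat hSn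
  have hflat : ∀ᶠ z in 𝓝 0, partialD none P (axis (Fin n) z) + φ.matrixAtZero j z * P (axis (Fin n) z) = 0 := by
    filter_upwards [tendsto_axis (σ := Fin n) hSn, hΨ.eventually_eq h0] with z hz hz'
    rw [← hz']
    exact (hfr _ hz).2.1 none
  obtain ⟨Z, hZ⟩ := h.exists_hasSerMat_frameIn h0
  obtain ⟨Z', hZ'⟩ := h.exists_hasSerMat_coframeIn h0
  have hW := hZ'.mul hY
  have hab : ∀ j, ∃ A : Matrix _ _ (MvPowerSeries (Option (Fin n)) k), HasSerMat (fun y => a j (base y)) A := fun e => by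
    obtain ⟨d, hd, -, hds⟩ := exists_polydisc_subset k (hV'.mem_nhds h0V') one_pos
    refine IsUniformLimitMat.exists_hasSerMat hd fun p q => ?_
    have := ((ha e).isUniformLimitMat (isRational_polydisc hd) hds p q).comp_polynomial (τ := Option (Fin n))
      (fun j => MvPolynomial.X (some j)) (R' := polydisc k d) fun x hx j => by simpa using hx (some j)
    simp only [MvPolynomial.aeval_X] at this
    exact this
  choose A hA using hab
  have hAind : ∀ j ℓ, ℓ none ≠ 0 → mcoeff ℓ (A j) = 0 := fun e ℓ hℓ => by
    have h1 := (hA e).unique (hA e).kill_u (Eventually.of_forall fun y => rfl)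
    rw [h1, mcoeff_map_kill_of_not_forall (by simpa using hℓ)]
  have hcomp : ∀ e, dop (some e) (Z' * Y) + N (some e) * (Z' * Y) = Z' * Y * A e := fun e => by
    refine ((hW.dop (some e)).add ((hf.hasSer_conn (some e)).mul hW)).unique (hW.mul (hA e)) ?_
    refine eventually_compare hZ hZ' hY (h.eventually_frameIn_mul h0) (h.eventually_coframeIn_mul h0)
      (A := E.A j (some e)) ?_ ?_
    · filter_upwards [h.inter_mem_nhds h0] with y hy using h.frameIn_conn hy (some e)
    · filter_upwards [hSn] with y hy using (hfr y hy).2.2.2 e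
  -- A flat frame P of Ψ thus differs from H by a constant matrix, so it is also flat for the
  -- connection defined by H. As P is invertible, the two connection matrices coincide.
  have hconst := hW.eventually_eq_const (eq_const_of_compare (fun e => hf.some_indep e) hAind hcomp
    fun ℓ => h.mcoeff_compare_axis hφ h0 hY hflat hW)
  generalize E.coframeIn i H j 0 * P 0 = W₀ at hconst
  have hPW : ∀ᶠ y in 𝓝 0, P y = E.frameIn i H j y * W₀ := by
    filter_upwards [hconst, h.eventually_frameIn_mul h0] with y h1 h2
    rw [← h1, ← Matrix.mul_assoc, h2, Matrix.one_mul]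
  filter_upwards [eventually_eventually_nhds.2 hPW, hSn, h.inter_mem_nhds h0, h.inter_mem_nhds hf.zero_mem]
    with y hy hyS hyj hyi
  refine ⟨(hSj hyS).2, fun e => Framing.eq_of_eq _ _ hyj.1 hyi.1 hyj.2 (hSj hyS).2 ?_⟩
  have h1 := (hfr y hyS).2.1 e
  have h2 : partialD e P y + connection E i H j e y * P y = 0 := by
    rw [partialD_congr hy, hy.self_of_nhds, partialD_mul ((h.unif_frameIn j).mPDiff (h.isRational_inter j) e hyj)
      (mPDiff_const _ _ _), partialD_const, Matrix.mul_zero, add_zero, ← Matrix.mul_assoc, ← Matrix.add_mul,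
      h.flat_frameIn hyj, Matrix.zero_mul]
  have h3 : connection E i H j e y * P y = Ψ.Γ j e y * P y := add_left_cancel (h2.trans h1.symm)
  have h4 := congrArg (· * (P y)⁻¹) h3
  have h5 := Matrix.mul_nonsing_inv _ (isUnit_iff_ne_zero.2 (hfr y hyS).1)
  simp only [Matrix.mul_assoc, h5, Matrix.mul_one] at h4
  exact h4

/-- Near the origin the two framings agree. Both are defined on a bidisc over the whole polydisc,
however thin in u, which lies in the single chart i; the identity theorem there extends the
agreement to the bidisc, and `Framing.eq_of_eq` transfers it to the other charts. -/
theorem IsFrameOn.agreeOn_of_extends {X : Matrix (Fin (E.bundle.rank i)) (Fin (E.bundle.rank i)) (MvPowerSeries (Option (Fin n)) k)}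
    {N : Option (Fin n) → Matrix (Fin (E.bundle.rank i)) (Fin (E.bundle.rank i)) (MvPowerSeries (Option (Fin n)) k)}
    (h : IsFrameOn E i H c) (hf : IsFormalFrame φ i H X N) (hφ : h.toFraming.Extends φ)
    {Ψ : Framing k E (polydisc k c)} (hΨ : Ψ.Extends φ) : h.toFraming.AgreeOn Ψ (polydisc k c) := by
  have h1 := h.eventually_eq_of_extends hf hφ (zero_mem_polydisc c) hΨ
  obtain ⟨ρ, hρ, hρc, hρ1, hρΨ⟩ := Ψ.isGermNhd.admissible.exists_bidisc_subset h.ne_zero Ψ.isGermNhd.zero_mem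
  have hsub : bidisc k c ρ ⊆ h.toFraming.dom := fun y hy => hy.1
  have hR := isRational_bidisc (σ := Fin n) (L := L) h.ne_zero hρ
  have hu : ∀ {V : Set (Fin n → L)} (Φ : Framing k E V), bidisc k c ρ ⊆ Φ.dom → ∀ e,
      IsUniformLimitMat k (bidisc k c ρ) (Φ.Γ i e) := fun Φ hΦ e =>
    (Φ.analytic_Γ i e).isUniformLimitMat hR fun y hy => ⟨h.subset hy.1, hΦ hy⟩
  refine ⟨bidisc k c ρ, isGermNhd_bidisc h.ne_zero hρ hρ1, fun y hy => ⟨hy.1, hρΨ hy⟩, ?_⟩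
  rintro j e y ⟨hy, hyj⟩
  refine Framing.eq_of_eq _ _ (h.subset hy.1) hyj hy.1 (hρΨ hy) (Matrix.ext fun p q => sub_eq_zero.1 ?_)
  refine IsUniformLimit.eq_zero_of_eventually_bidisc h.ne_zero hρ ((hu _ hsub e p q).sub (hu Ψ hρΨ e p q)) ?_ hy hρc
  filter_upwards [h1] with z hz
  rw [hz.2 e, sub_self]

/-- Over an arbitrary V only agreement of germs is needed, so a small polydisc suffices. -/
theorem IsFrameOn.exists_agreeOn_of_extends {X : Matrix (Fin (E.bundle.rank i)) (Fin (E.bundle.rank i)) (MvPowerSeries (Option (Fin n)) k)}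
    {N : Option (Fin n) → Matrix (Fin (E.bundle.rank i)) (Fin (E.bundle.rank i)) (MvPowerSeries (Option (Fin n)) k)}
    (h : IsFrameOn E i H c) (hf : IsFormalFrame φ i H X N) (hφ : h.toFraming.Extends φ) {V : Set (Fin n → L)}
    (h0V : 0 ∈ V) {Ψ : Framing k E V} (hΨ : Ψ.Extends φ) :
    ∃ V' : Set (Fin n → L), IsAdmissibleOpen k V' ∧ 0 ∈ V' ∧ V' ⊆ polydisc k c ∩ V ∧ h.toFraming.AgreeOn Ψ V' := by
  obtain ⟨d, hd, hd1, hds⟩ := exists_polydisc_subset k (inter_mem (h.eventually_eq_of_extends hf hφ h0V hΨ)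
    (h.inter_mem_nhds hf.zero_mem)) one_pos
  have hN := isGermNhd_polydisc (σ := Fin n) (L := L) hd hd1
  refine ⟨polydisc k d, (isRational_polydisc hd).isAdmissibleOpen, zero_mem_polydisc d, fun t ht => ?_,
    polydisc k d, hN, fun y hy => ⟨(hds hy).2.2, (hds hy).1.1⟩, ?_⟩
  · obtain ⟨⟨h1, -⟩, -, h2⟩ := hds (hN.zero_mem t ht)
    exact ⟨fun j => h2 (some j), (Ψ.isGermNhd.subset _ h1).1⟩
  · rintro j e y ⟨hy, hyj⟩
    obtain ⟨⟨h1, h2⟩, h3, h4⟩ := hds hy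
    exact Framing.eq_of_eq _ _ h3 hyj h4 h1 (h2 e)

end Uniqueness

end RigidAn

theorem mainTheorem4 {k : Type*} [NontriviallyNormedField k] [IsUltrametricDist k]
    [CompleteSpace k] [CharZero k] (hk : ∀ q : ℚ, q ≠ 0 → ‖(q : k)‖ = 1)
    {L : Type*} [NontriviallyNormedField L] [NormedAlgebra k L] [IsAlgClosure k L]
    (n : ℕ) (B : Set (Fin n → L)) (hB : RigidAn.IsAdmissibleOpen k B) (h0 : (0 : Fin n → L) ∈ B)
    (E : RigidAn.FBundle k B)
    (φ : RigidAn.Framing k (E.restrictZero h0) Set.univ) :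
    ∃ U : Set (Fin n → L), RigidAn.IsAdmissibleOpen k U ∧ 0 ∈ U ∧ U ⊆ B ∧
      ∃ Φ : RigidAn.Framing k E U, Φ.Extends φ ∧ Φ.IsExplicit φ ∧
        (∀ Ψ : RigidAn.Framing k E U, Ψ.Extends φ → Φ.AgreeOn Ψ U) ∧
        ∀ V : Set (Fin n → L), RigidAn.IsAdmissibleOpen k V → 0 ∈ V → V ⊆ B →
          ∀ Ψ : RigidAn.Framing k E V, Ψ.Extends φ →
            ∃ V' : Set (Fin n → L), RigidAn.IsAdmissibleOpen k V' ∧ 0 ∈ V' ∧ V' ⊆ U ∩ V ∧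
              Φ.AgreeOn Ψ V' := by
  have hL : IsAlgClosed L := IsAlgClosure.isAlgClosed k
  have halg : Algebra.IsAlgebraic k L := IsAlgClosure.isAlgebraic
  have hk1 : RigidAn.NormNatOne k := ⟨fun m hm => by
    simpa using hk m (Nat.cast_ne_zero.2 hm)⟩
  have hL1 : RigidAn.NormNatOne L := ⟨fun m hm => by
    rw [← map_natCast (algebraMap k L), norm_algebraMap']
    simpa using hk m (Nat.cast_ne_zero.2 hm)⟩
  -- The ultrametric inequality on L is not assumed: it follows from the boundedness of the natural
  -- numbers in L, inherited from k.
  have hLu : IsUltrametricDist L := RigidAn.NormNatOne.isUltrametricDist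
  obtain ⟨i, H, X, N, hf⟩ := RigidAn.exists_isFormalFrame φ
  obtain ⟨c, h⟩ := hf.exists_isFrameOn
  have hφ : h.toFraming.Extends φ := h.extends hf.axis_flat
  exact ⟨RigidAn.polydisc k c, (RigidAn.isRational_polydisc h.ne_zero).isAdmissibleOpen,
    RigidAn.zero_mem_polydisc c, h.polydisc_subset, h.toFraming, hφ, h.isExplicit hφ,
    fun Ψ hΨ => h.agreeOn_of_extends hf hφ hΨ, fun V _ h0V _ Ψ hΨ => h.exists_agreeOn_of_extends hf hφ h0V hΨ⟩
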